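/- **Games.** A Conway game $A$ is a rooted oriented graph: a set $P_A$ of positions with a root $\star_A$, a set $M_A\subseteq P_A\times P_A$ of moves, and a polarity $\lambda_A:M_A\to\{-1,+1\}$ ($-1$ = Opponent, $+1$ = Player); no move $x\to x$ is a loop and no move goes into the root. A multi-bracketed game is a Conway game with, for each position $x$, a finite set $Q_A(x)$ of queries, each with a polarity in $\{-1,+1\}$, and, for each move $m:x\to y$, a residual relation $[m]\subseteq Q_A(x)\times Q_A(y)$ which is functional, injective and polarity-preserving, and which is extended to paths by composition, such that: $Q_A(\star_A)=\emptyset$; parallel paths have equal residual relations; every query at $y$ with no ancestor along $m$ has the polarity of $m$; every query at $x$ with no residual along $m$ has the opposite polarity. For a path $s:x\twoheadrightarrow y$, $\kappa_A^{\pm}(s)$ is the number of queries of polarity $\pm1$ at $y$ which have no ancestor along $s$. A strategy is a set of alternating plays (paths from the root) of even length, each starting with an Opponent move if non-empty, which contains the empty play, is closed under even-length prefixes and is deterministic ($s\cdot m\cdot n,\ s\cdot m\cdot n'\in\sigma$ imply $n=n'$). It is well-bracketed if, for each of its plays $s\cdot m\cdot t\cdot n$ with $m$ an Opponent and $n$ a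 Player move, $\kappa^+(m\cdot t\cdot n)=0$ implies $\kappa^-(m\cdot t\cdot n)=0$. The dual $A^*$ reverses the polarities of moves and queries. The tensor product $A\otimes B$ has positions $P_A\times P_B$ and root $(\star_A,\star_B)$; a move is a move in one component; the queries at $(x,y)$ are the disjoint union of $Q_A(x)$ and $Q_B(y)$; polarities and residuals are componentwise. The game $1$ has one position, no move and no query. The exponential $!A$ has as positions the finite words $w=x_1\cdots x_k$ of positions $x_i\neq\star_A$ of $A$, and the empty word as root; its moves are $w_1\,x\,w_2\to w_1\,y\,w_2$ for a move $x\to y$ of $A$, and $w\to w\,x$ for an Opponent move $\star_A\to x$ of $A$ (Opponent opens a new copy); its queries at $x_1\cdots x_k$ are the pairs $(i,q)$ with $1\le i\le k$ and $q\in Q_A(x_i)$; polarities are inherited from $A$, and a move acts by the residual relation of $A$ on the queries of the copy in which it is played and as the identity on the queries of the other copies. **The category $\mathcal B$.** Its objects are the multi-bracketed games, and its morphisms $A\to B$ are the well-bracketed strategies of $A^*\otimes B$. The identity is the copycat strategy. The composite of $\sigma:A\to B$ and $\tau:B\to C$ is the set of alternating plays $u_{|A^*\otimes C}$ where $u$ is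 an interaction sequence with $u_{|A^*\otimes B}\in\sigma$ and $u_{|B^*\otimes C}\in\tau$. The tensor product of $\sigma:A\to A'$ and $\tau:B\to B'$ is the set of alternating plays of $(A\otimes B)^*\otimes(A'\otimes B')$ whose restrictions to $A^*\otimes A'$ and $B^*\otimes B'$ belong to $\sigma$ and $\tau$; the structural isomorphisms are the evident copycat strategies. **Statement.** These data make $\mathcal B$ a symmetric monoidal category with unit $1$, and: 1. For every multi-bracketed game $A$, the game $!A$ carries a structure of commutative comonoid in $\mathcal B$ and a morphism $\varepsilon_A:{!A}\to A$ which make it the free commutative comonoid on $A$: for every commutative comonoid $K$ in $\mathcal B$ and every morphism $f:K\to A$ there is exactly one comonoid morphism $g:K\to{!A}$ such that $\varepsilon_A\circ g=f$. 2. Hence $\mathcal B$ is a model of multiplicative exponential linear logic: it is $*$-autonomous, with negation $A\mapsto A^*$ (that is, $(-)^*$ extends to an equivalence $\mathcal B^{op}\to\mathcal B$ with natural bijections $\mathcal B(A\otimes B,D^*)\cong\mathcal B(A,(B\otimes D)^*)$); the category of commutative comonoids of $\mathcal B$ is cartesian, its forgetful functor to $\mathcal B$ is strong symmetric monoidal and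 has a right adjoint, and the value of this right adjoint at $A$ is, up to isomorphism compatible with the counit, the comonoid $!A$ with $\varepsilon_A$. 3. The model is degenerate (self-dual): $\mathcal B$ is compact closed, $A^*$ being a monoidal dual of $A$, with $A^{**}=A$ and $(A\otimes B)^*=A^*\otimes B^*$. -/

import Mathlib

open CategoryTheory MonoidalCategory

universe u

/-! ## Conway games, paths, plays and strategies -/

/-- A Conway game: a rooted oriented graph whose edges (the moves) carry a polarity `+1` (Proponent)
or `-1` (Opponent).  `Move p x y` says that there is a move `x → y` and that its polarity is `p`,
so `Move` is the set of moves together with the graph of the polarity function.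
No move is a self-loop and no move returns to the root. -/
structure ConwayGame where
  Pos : Type u
  root : Pos
  Move : ℤˣ → Pos → Pos → Prop
  pol_unique : ∀ {p q : ℤˣ} {x y : Pos}, Move p x y → Move q x y → p = q
  no_loop : ∀ {p : ℤˣ} {x : Pos}, ¬ Move p x x
  no_return : ∀ {p : ℤˣ} {x : Pos}, ¬ Move p x root

namespace ConwayGame

/-- There is a move `x → y`, of either polarity. -/
def Edge (G : ConwayGame.{u}) (x y : G.Pos) : Prop := ∃ p, G.Move p x y

/-- A path is given by its initial position `x` and the list of the positions that it visits after
`x`; its final position is `s.getLastD x`. -/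
def IsPath (G : ConwayGame.{u}) : G.Pos → List G.Pos → Prop
  | _, [] => True
  | x, y :: s => G.Edge x y ∧ G.IsPath y s

/-- `s` is an alternating path from `x` whose first move (if there is one) has polarity `p`. -/
def IsAlternating (G : ConwayGame.{u}) : ℤˣ → G.Pos → List G.Pos → Prop
  | _, _, [] => True
  | p, x, y :: s => G.Move p x y ∧ G.IsAlternating (-p) y s

/-- Alternating plays (paths from the root) that are empty or start with an Opponent move. -/
def IsPlay (G : ConwayGame.{u}) (s : List G.Pos) : Prop := G.IsAlternating (-1) G.root s

/-- The dual Conway game: the polarities of moves are reversed. -/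
def dual (G : ConwayGame.{u}) : ConwayGame.{u} where
  Pos := G.Pos
  root := G.root
  Move p x y := G.Move (-p) x y
  pol_unique h h' := neg_injective (G.pol_unique h h')
  no_loop := G.no_loop
  no_return := G.no_return

end ConwayGame

/-- A strategy: a set of alternating plays of even length, starting with Opponent moves, that
contains the empty play, is closed under even-length prefixes and is deterministic. -/
@[ext] structure Strategy (G : ConwayGame.{u}) where
  plays : Set (List G.Pos)
  isPlay : ∀ s ∈ plays, G.IsPlay s
  even_length : ∀ s ∈ plays, Even s.length
  nil_mem : [] ∈ plays
  prefix_closed : ∀ (s : List G.Pos) (y z : G.Pos), s ++ [y, z] ∈ plays → s ∈ plays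
  deterministic : ∀ (s : List G.Pos) (y z z' : G.Pos),
    s ++ [y, z] ∈ plays → s ++ [y, z'] ∈ plays → z = z'

/-! ## Multi-bracketed games -/

/-- Extension of a residual relation from moves to paths, by composition of relations; the empty
path at `x` acts as the identity relation on the queries at `x`. -/
def pathResidual {X Q : Type u} (IsQuery : ℤˣ → X → Q → Prop) (Res : X → X → Q → Q → Prop) :
    X → List X → Q → Q → Prop
  | x, [], r, r' => r = r' ∧ ∃ p, IsQuery p x r
  | x, y :: s, r, r' => ∃ r₁, Res x y r r₁ ∧ pathResidual IsQuery Res y s r₁ r'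

/-- A multi-bracketed game.  `IsQuery p x r` says that `r` belongs to the set of queries at the
position `x` and has polarity `p`; `Res x y` is the residual relation of the move `x → y`
(it is empty when there is no such move). -/
structure MBGame extends ConwayGame.{u} where
  Query : Type u
  IsQuery : ℤˣ → Pos → Query → Prop
  query_pol_unique : ∀ {p q : ℤˣ} {x : Pos} {r : Query}, IsQuery p x r → IsQuery q x r → p = q
  query_finite : ∀ x : Pos, {r | ∃ p, IsQuery p x r}.Finite
  Res : Pos → Pos → Query → Query → Prop
  res_edge : ∀ {x y : Pos} {r r' : Query}, Res x y r r' → ∃ p, Move p x y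
  /-- The residual relation of `x → y` relates queries at `x` to queries at `y`, and a residual
  of a query has the polarity of that query. -/
  res_query : ∀ {x y : Pos} {r r' : Query}, Res x y r r' → ∃ p, IsQuery p x r ∧ IsQuery p y r'
  res_functional : ∀ {x y : Pos} {r r₁ r₂ : Query}, Res x y r r₁ → Res x y r r₂ → r₁ = r₂
  res_injective : ∀ {x y : Pos} {r₁ r₂ r : Query}, Res x y r₁ r → Res x y r₂ r → r₁ = r₂
  /-- A move only initiates queries of its own polarity. -/
  initiates : ∀ {p q : ℤˣ} {x y : Pos} {r : Query}, Move p x y → IsQuery q y r →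
    (¬ ∃ r₀, Res x y r₀ r) → q = p
  /-- A move only complies with queries of the opposite polarity. -/
  complies : ∀ {p q : ℤˣ} {x y : Pos} {r : Query}, Move p x y → IsQuery q x r →
    (¬ ∃ r', Res x y r r') → q = -p
  /-- Parallel paths induce the same residual relation. -/
  parallel : ∀ (x : Pos) (s t : List Pos), toConwayGame.IsPath x s → toConwayGame.IsPath x t →
    s.getLastD x = t.getLastD x → pathResidual IsQuery Res x s = pathResidual IsQuery Res x t
  no_root_query : ∀ {p : ℤˣ} {r : Query}, ¬ IsQuery p root r

namespace MBGame

/-- The residual relation of a path. -/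
def pathRes (A : MBGame.{u}) : A.Pos → List A.Pos → A.Query → A.Query → Prop :=
  pathResidual A.IsQuery A.Res

/-- The resource function: `A.kappa p x s` is the number of queries of polarity `p` at the final
position of the path `s` from `x` that are initiated by `s`. -/
noncomputable def kappa (A : MBGame.{u}) (p : ℤˣ) (x : A.Pos) (s : List A.Pos) : ℕ :=
  {r | A.IsQuery p (s.getLastD x) r ∧ ¬ ∃ r₀, A.pathRes x s r₀ r}.ncard

/-- A strategy is well-bracketed when `κ⁺(m·t·n) = 0` implies `κ⁻(m·t·n) = 0` for each of its plays
`s·m·t·n` with `m` an Opponent move and `n` (necessarily) a Proponent move.  Here `m` leads to `y`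
and `n` leads to `z`. -/
def WellBracketed (A : MBGame.{u}) (σ : Strategy A.toConwayGame) : Prop :=
  ∀ (s : List A.Pos) (y : A.Pos) (t : List A.Pos) (z : A.Pos),
    s ++ y :: (t ++ [z]) ∈ σ.plays → A.Move (-1) (s.getLastD A.root) y →
    A.kappa 1 (s.getLastD A.root) (y :: (t ++ [z])) = 0 →
    A.kappa (-1) (s.getLastD A.root) (y :: (t ++ [z])) = 0

end MBGame

/-! ## Projections of paths -/

open scoped Classical in
/-- The projection of a path (from `x`, visiting `s`) along a map `π` of positions: the list of the
images, where the steps that do not change the image are erased. -/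
noncomputable def project {X Y : Type*} (π : X → Y) : X → List X → List Y
  | _, [] => []
  | x, y :: s => if π y = π x then project π y s else π y :: project π y s

theorem getLastD_project {X Y : Type*} (π : X → Y) (x : X) (s : List X) :
    (project π x s).getLastD (π x) = π (s.getLastD x) := by
  induction s generalizing x with
  | nil => simp [project]
  | cons y s ih =>
    rw [List.getLastD_cons, project]
    split_ifs with h
    · rw [← h, ih]
    · rw [List.getLastD_cons, ih]

namespace MBGame

/-- The residual relation of a step that is either a move `x → y` or no move at all (`x = y`). -/
def StepRes (A : MBGame.{u}) (x y : A.Pos) (r r' : A.Query) : Prop :=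
  (x = y ∧ r = r' ∧ ∃ p, A.IsQuery p x r) ∨ A.Res x y r r'

theorem StepRes.query {A : MBGame.{u}} {x y : A.Pos} {r r' : A.Query} (h : A.StepRes x y r r') :
    ∃ p, A.IsQuery p x r ∧ A.IsQuery p y r' := by
  rcases h with ⟨rfl, rfl, p, hp⟩ | h
  · exact ⟨p, hp, hp⟩
  · exact A.res_query h

theorem stepRes_self {A : MBGame.{u}} {x : A.Pos} {r r' : A.Query} :
    A.StepRes x x r r' ↔ r = r' ∧ ∃ p, A.IsQuery p x r := by
  refine ⟨?_, fun h => Or.inl ⟨rfl, h⟩⟩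
  rintro (⟨-, h⟩ | h)
  · exact h
  · obtain ⟨p, hp⟩ := A.res_edge h
    exact (A.no_loop hp).elim

theorem stepRes_of_ne {A : MBGame.{u}} {x y : A.Pos} (hxy : y ≠ x) {r r' : A.Query} :
    A.StepRes x y r r' ↔ A.Res x y r r' :=
  ⟨fun h => h.elim (fun h => (hxy h.1.symm).elim) id, Or.inr⟩

theorem StepRes.functional {A : MBGame.{u}} {x y : A.Pos} {r r₁ r₂ : A.Query}
    (h₁ : A.StepRes x y r r₁) (h₂ : A.StepRes x y r r₂) : r₁ = r₂ := by
  by_cases hxy : y = x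
  · subst hxy
    rw [stepRes_self] at h₁ h₂
    exact h₁.1.symm.trans h₂.1
  · rw [stepRes_of_ne hxy] at h₁ h₂
    exact A.res_functional h₁ h₂

theorem StepRes.injective {A : MBGame.{u}} {x y : A.Pos} {r r₁ r₂ : A.Query}
    (h₁ : A.StepRes x y r₁ r) (h₂ : A.StepRes x y r₂ r) : r₁ = r₂ := by
  by_cases hxy : y = x
  · subst hxy
    rw [stepRes_self] at h₁ h₂
    exact h₁.1.trans h₂.1.symm
  · rw [stepRes_of_ne hxy] at h₁ h₂
    exact A.res_injective h₁ h₂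

/-- If the steps of `E` project along `π` to moves of `A` or to nothing, then paths of `E` project
to paths of `A`. -/
theorem isPath_project (A : MBGame.{u}) (E : ConwayGame.{u})
    (π : E.Pos → A.Pos) (hπ : ∀ x y, E.Edge x y → π y = π x ∨ A.Edge (π x) (π y))
    (x : E.Pos) (s : List E.Pos) (hs : E.IsPath x s) : A.IsPath (π x) (project π x s) := by
  induction s generalizing x with
  | nil => simp [project, ConwayGame.IsPath]
  | cons y s ih =>
    rw [project]
    split_ifs with h
    · rw [← h]; exact ih y hs.2
    · exact ⟨(hπ x y hs.1).resolve_left h, ih y hs.2⟩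

/-- Residuals of the queries that come from `A` are computed on the projected path. -/
theorem pathResidual_project (A : MBGame.{u}) (E : ConwayGame.{u}) {Q : Type u}
    (IsQ : ℤˣ → E.Pos → Q → Prop) (R : E.Pos → E.Pos → Q → Q → Prop)
    (π : E.Pos → A.Pos) (ι : A.Query → Q)
    (hq : ∀ p x r, IsQ p x (ι r) ↔ A.IsQuery p (π x) r)
    (hR : ∀ x y, E.Edge x y → ∀ r r',
      R x y (ι r) r' ↔ ∃ r₁, r' = ι r₁ ∧ A.StepRes (π x) (π y) r r₁)
    (x : E.Pos) (s : List E.Pos) (hs : E.IsPath x s) (r : A.Query) (r' : Q) :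
    pathResidual IsQ R x s (ι r) r' ↔
      ∃ r₁, r' = ι r₁ ∧ A.pathRes (π x) (project π x s) r r₁ := by
  induction s generalizing x r with
  | nil =>
    simp only [pathResidual, project, pathRes, hq]
    constructor
    · rintro ⟨rfl, h⟩; exact ⟨r, rfl, rfl, h⟩
    · rintro ⟨_, rfl, rfl, h⟩; exact ⟨rfl, h⟩
  | cons y s ih =>
    have key : pathResidual IsQ R x (y :: s) (ι r) r' ↔ ∃ r₂, A.StepRes (π x) (π y) r r₂ ∧
        ∃ r₁, r' = ι r₁ ∧ A.pathRes (π y) (project π y s) r₂ r₁ := by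
      simp only [pathResidual]
      constructor
      · rintro ⟨r₀, h, h'⟩
        obtain ⟨r₂, rfl, h₂⟩ := (hR x y hs.1 _ _).1 h
        exact ⟨r₂, h₂, (ih y hs.2 r₂).1 h'⟩
      · rintro ⟨r₂, h, h'⟩
        exact ⟨ι r₂, (hR x y hs.1 _ _).2 ⟨r₂, rfl, h⟩, (ih y hs.2 r₂).2 h'⟩
    rw [key, project]
    split_ifs with h
    · rw [h]
      constructor
      · rintro ⟨r₂, h₂, h'⟩
        rw [stepRes_self] at h₂
        rw [h₂.1]; exact h'
      · rintro ⟨r₁, e, h'⟩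
        refine ⟨r, stepRes_self.2 ⟨rfl, ?_⟩, r₁, e, h'⟩
        revert h'
        generalize project π y s = l
        cases l with
        | nil => exact fun h' => h'.2
        | cons z l =>
          rintro ⟨r₃, h₃, -⟩
          obtain ⟨p, hp, -⟩ := A.res_query h₃
          exact ⟨p, hp⟩
    · simp only [stepRes_of_ne h]
      constructor
      · rintro ⟨r₂, h₂, r₁, e, h'⟩; exact ⟨r₁, e, r₂, h₂, h'⟩
      · rintro ⟨r₁, e, r₂, h₂, h'⟩; exact ⟨r₂, h₂, r₁, e, h'⟩

theorem parallel_project (A : MBGame.{u}) (E : ConwayGame.{u}) {Q : Type u}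
    (IsQ : ℤˣ → E.Pos → Q → Prop) (R : E.Pos → E.Pos → Q → Q → Prop)
    (π : E.Pos → A.Pos) (ι : A.Query → Q)
    (hq : ∀ p x r, IsQ p x (ι r) ↔ A.IsQuery p (π x) r)
    (hπ : ∀ x y, E.Edge x y → π y = π x ∨ A.Edge (π x) (π y))
    (hR : ∀ x y, E.Edge x y → ∀ r r',
      R x y (ι r) r' ↔ ∃ r₁, r' = ι r₁ ∧ A.StepRes (π x) (π y) r r₁)
    (x : E.Pos) (s t : List E.Pos) (hs : E.IsPath x s) (ht : E.IsPath x t)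
    (hst : s.getLastD x = t.getLastD x) (r : A.Query) (r' : Q) :
    pathResidual IsQ R x s (ι r) r' ↔ pathResidual IsQ R x t (ι r) r' := by
  rw [pathResidual_project A E IsQ R π ι hq hR x s hs,
    pathResidual_project A E IsQ R π ι hq hR x t ht]
  have := A.parallel (π x) _ _ (isPath_project A E π hπ x s hs)
    (isPath_project A E π hπ x t ht)
    (by rw [getLastD_project, getLastD_project, hst])
  change A.pathRes _ _ = A.pathRes _ _ at this
  rw [this]

/-! ## Dual, unit, tensor product, exponential -/

/-- The dual game: the polarities of moves and queries are reversed. -/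
def dual (A : MBGame.{u}) : MBGame.{u} where
  toConwayGame := A.toConwayGame.dual
  Query := A.Query
  IsQuery p x r := A.IsQuery (-p) x r
  query_pol_unique h h' := neg_injective (A.query_pol_unique h h')
  query_finite x := (A.query_finite x).subset fun _ ⟨p, hp⟩ => ⟨-p, hp⟩
  Res := A.Res
  res_edge h := by
    obtain ⟨p, hp⟩ := A.res_edge h
    exact ⟨-p, by rwa [← neg_neg p] at hp⟩
  res_query h := by
    obtain ⟨p, hp⟩ := A.res_query h
    exact ⟨-p, by rwa [neg_neg]⟩
  res_functional := A.res_functional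
  res_injective := A.res_injective
  initiates h hq hr := neg_injective (A.initiates h hq hr)
  complies h hq hr := neg_injective (A.complies h hq hr)
  parallel x s t hs ht hst := by
    have key : ∀ (y : A.Pos) (l : List A.Pos),
        pathResidual (fun p x r => A.IsQuery (-p) x r) A.Res y l =
          pathResidual A.IsQuery A.Res y l := by
      intro y l
      induction l generalizing y with
      | nil =>
        funext r r'
        simp only [pathResidual, eq_iff_iff, and_congr_right_iff]
        exact fun _ => ⟨fun ⟨p, hp⟩ => ⟨-p, hp⟩, fun ⟨p, hp⟩ => ⟨-p, by rwa [neg_neg]⟩⟩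
      | cons z l ih =>
        funext r r'
        simp only [pathResidual, ih]
    have key' : ∀ (y : A.Pos) (l : List A.Pos),
        A.toConwayGame.dual.IsPath y l → A.IsPath y l := by
      intro y l
      induction l generalizing y with
      | nil => exact fun h => h
      | cons z l ih => exact fun h => ⟨h.1.imp' _ fun _ h => h, ih z h.2⟩
    exact (key x s).trans ((A.parallel x s t (key' x s hs) (key' x t ht) hst).trans
      (key x t).symm)
  no_root_query := A.no_root_query

/-- The game `1` with a single position, no move and no query. -/
def one : MBGame.{u} where
  Pos := PUnit
  root := PUnit.unit
  Move _ _ _ := False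
  pol_unique h := h.elim
  no_loop h := h
  no_return h := h
  Query := PEmpty
  IsQuery _ _ _ := False
  query_pol_unique h := h.elim
  query_finite _ := Set.toFinite _
  Res _ _ _ _ := False
  res_edge h := h.elim
  res_query h := h.elim
  res_functional h := h.elim
  res_injective h := h.elim
  initiates h := h.elim
  complies h := h.elim
  parallel _ _ _ _ _ _ := by funext r; exact r.elim
  no_root_query h := h

/-- The Conway game underlying the tensor product: a move is a move in one of the components. -/
def tensorConway (A B : MBGame.{u}) : ConwayGame.{u} where
  Pos := A.Pos × B.Pos
  root := (A.root, B.root)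
  Move p x y := (A.Move p x.1 y.1 ∧ x.2 = y.2) ∨ (x.1 = y.1 ∧ B.Move p x.2 y.2)
  pol_unique := by
    rintro p q ⟨a, b⟩ ⟨a', b'⟩ (⟨h, e⟩ | ⟨e, h⟩) (⟨h', e'⟩ | ⟨e', h'⟩)
    · exact A.pol_unique h h'
    · dsimp only at e'; subst e'; exact (A.no_loop h).elim
    · dsimp only at e; subst e; exact (A.no_loop h').elim
    · exact B.pol_unique h h'
  no_loop := by
    rintro p x (⟨h, -⟩ | ⟨-, h⟩)
    · exact A.no_loop h
    · exact B.no_loop h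
  no_return := by
    rintro p x (⟨h, -⟩ | ⟨-, h⟩)
    · exact A.no_return h
    · exact B.no_return h

/-- The queries of the tensor product: the disjoint union of the queries of the components. -/
def TensorIsQuery (A B : MBGame.{u}) (p : ℤˣ) (x : A.Pos × B.Pos) : A.Query ⊕ B.Query → Prop
  | .inl r => A.IsQuery p x.1 r
  | .inr r => B.IsQuery p x.2 r

/-- The residual relation of the tensor product: a move acts on the queries of the component in
which it is played, and as the identity on the queries of the other component. -/
def TensorRes (A B : MBGame.{u}) (x y : A.Pos × B.Pos) :
    A.Query ⊕ B.Query → A.Query ⊕ B.Query → Prop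
  | .inl r, .inl r' => (tensorConway A B).Edge x y ∧ A.StepRes x.1 y.1 r r'
  | .inr r, .inr r' => (tensorConway A B).Edge x y ∧ B.StepRes x.2 y.2 r r'
  | _, _ => False

/-- The tensor product of two multi-bracketed games. -/
def tensor (A B : MBGame.{u}) : MBGame.{u} where
  toConwayGame := tensorConway A B
  Query := A.Query ⊕ B.Query
  IsQuery := TensorIsQuery A B
  query_pol_unique := by
    rintro p q x (r | r) h h'
    · exact A.query_pol_unique h h'
    · exact B.query_pol_unique h h'
  query_finite x := by
    refine (((A.query_finite x.1).image Sum.inl).union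
      ((B.query_finite x.2).image Sum.inr)).subset ?_
    rintro (r | r) ⟨p, hp⟩
    · exact Or.inl ⟨r, ⟨p, hp⟩, rfl⟩
    · exact Or.inr ⟨r, ⟨p, hp⟩, rfl⟩
  Res := TensorRes A B
  res_edge := by
    rintro x y (r | r) (r' | r') h
    · exact h.1
    · exact h.elim
    · exact h.elim
    · exact h.1
  res_query := by
    rintro x y (r | r) (r' | r') h
    · exact h.2.query
    · exact h.elim
    · exact h.elim
    · exact h.2.query
  res_functional := by
    rintro x y (r | r) (r₁ | r₁) (r₂ | r₂) h h'
    any_goals exact h.elim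
    any_goals exact h'.elim
    · rw [h.2.functional h'.2]
    · rw [h.2.functional h'.2]
  res_injective := by
    rintro x y (r₁ | r₁) (r₂ | r₂) (r | r) h h'
    any_goals exact h.elim
    any_goals exact h'.elim
    · rw [h.2.injective h'.2]
    · rw [h.2.injective h'.2]
  initiates := by
    rintro p q ⟨a, b⟩ ⟨a', b'⟩ (r | r) (⟨h, e⟩ | ⟨e, h⟩) hq hr
    · exact A.initiates h hq fun ⟨r₀, h₀⟩ => hr ⟨.inl r₀, ⟨p, Or.inl ⟨h, e⟩⟩, Or.inr h₀⟩
    · dsimp only at e; subst e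
      exact (hr ⟨.inl r, ⟨p, Or.inr ⟨rfl, h⟩⟩, Or.inl ⟨rfl, rfl, q, hq⟩⟩).elim
    · dsimp only at e; subst e
      exact (hr ⟨.inr r, ⟨p, Or.inl ⟨h, rfl⟩⟩, Or.inl ⟨rfl, rfl, q, hq⟩⟩).elim
    · exact B.initiates h hq fun ⟨r₀, h₀⟩ => hr ⟨.inr r₀, ⟨p, Or.inr ⟨e, h⟩⟩, Or.inr h₀⟩
  complies := by
    rintro p q ⟨a, b⟩ ⟨a', b'⟩ (r | r) (⟨h, e⟩ | ⟨e, h⟩) hq hr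
    · exact A.complies h hq fun ⟨r₀, h₀⟩ => hr ⟨.inl r₀, ⟨p, Or.inl ⟨h, e⟩⟩, Or.inr h₀⟩
    · dsimp only at e; subst e
      exact (hr ⟨.inl r, ⟨p, Or.inr ⟨rfl, h⟩⟩, Or.inl ⟨rfl, rfl, q, hq⟩⟩).elim
    · dsimp only at e; subst e
      exact (hr ⟨.inr r, ⟨p, Or.inl ⟨h, rfl⟩⟩, Or.inl ⟨rfl, rfl, q, hq⟩⟩).elim
    · exact B.complies h hq fun ⟨r₀, h₀⟩ => hr ⟨.inr r₀, ⟨p, Or.inr ⟨e, h⟩⟩, Or.inr h₀⟩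
  parallel x s t hs ht hst := by
    funext r r'
    apply propext
    cases r with
    | inl r =>
      refine parallel_project A (tensorConway A B) _ _ Prod.fst Sum.inl
        (fun _ _ _ => Iff.rfl) ?_ ?_ x s t hs ht hst r r'
      · rintro x y ⟨p, h | h⟩
        · exact Or.inr ⟨p, h.1⟩
        · exact Or.inl h.1.symm
      · rintro x y h r (r' | r')
        · exact ⟨fun h => ⟨r', rfl, h.2⟩, fun ⟨_, e, h'⟩ => by cases e; exact ⟨h, h'⟩⟩
        · exact ⟨fun h => h.elim, fun ⟨_, e, _⟩ => by cases e⟩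
    | inr r =>
      refine parallel_project B (tensorConway A B) _ _ Prod.snd Sum.inr
        (fun _ _ _ => Iff.rfl) ?_ ?_ x s t hs ht hst r r'
      · rintro x y ⟨p, h | h⟩
        · exact Or.inl h.2.symm
        · exact Or.inr ⟨p, h.2⟩
      · rintro x y h r (r' | r')
        · exact ⟨fun h => h.elim, fun ⟨_, e, _⟩ => by cases e⟩
        · exact ⟨fun h => ⟨r', rfl, h.2⟩, fun ⟨_, e, h'⟩ => by cases e; exact ⟨h, h'⟩⟩
  no_root_query := by
    rintro p (r | r) h
    · exact A.no_root_query h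
    · exact B.no_root_query h

/-- Positions of the exponential game: words of positions of `A` different from the root. -/
abbrev BangPos (A : MBGame.{u}) : Type u := List {x : A.Pos // x ≠ A.root}

/-- The current position of the copy number `i` (counted from `0`): the letter number `i`, or the
root of `A` if the copy has not been opened. -/
def letter (A : MBGame.{u}) (i : ℕ) (w : A.BangPos) : A.Pos :=
  (w[i]?).elim A.root Subtype.val

theorem letter_append_left {A : MBGame.{u}} {i : ℕ} {w v : A.BangPos} (h : i < w.length) :
    A.letter i (w ++ v) = A.letter i w := by
  simp [letter, List.getElem?_append_left h]

theorem letter_of_le {A : MBGame.{u}} {i : ℕ} {w : A.BangPos} (h : w.length ≤ i) :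
    A.letter i w = A.root := by
  simp [letter, List.getElem?_eq_none h]

theorem letter_middle {A : MBGame.{u}} (w v : A.BangPos) (x : {x : A.Pos // x ≠ A.root}) :
    A.letter w.length (w ++ x :: v) = x.1 := by
  simp [letter]

theorem letter_middle_ne {A : MBGame.{u}} {i : ℕ} {w v : A.BangPos}
    {x y : {x : A.Pos // x ≠ A.root}} (h : i ≠ w.length) :
    A.letter i (w ++ x :: v) = A.letter i (w ++ y :: v) := by
  rcases lt_or_gt_of_ne h with h | h
  · rw [letter_append_left h, letter_append_left h]
  · obtain ⟨k, rfl⟩ := Nat.exists_eq_add_of_lt h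
    simp only [letter]
    rw [List.getElem?_append_right (by omega), List.getElem?_append_right (by omega)]
    have : w.length + k + 1 - w.length = k + 1 := by omega
    rw [this]; simp

/-- The moves of the exponential game: either a move of `A` in one of the copies, or an initial
Opponent move of `A` in a new copy, which is opened at the end of the word. -/
inductive BangMove (A : MBGame.{u}) : ℤˣ → A.BangPos → A.BangPos → Prop
  | play {p : ℤˣ} (w₁ w₂ : A.BangPos) (x y : {x : A.Pos // x ≠ A.root}) (h : A.Move p x.1 y.1) :
      BangMove A p (w₁ ++ x :: w₂) (w₁ ++ y :: w₂)
  | openCopy (w : A.BangPos) (x : {x : A.Pos // x ≠ A.root}) (h : A.Move (-1) A.root x.1) :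
      BangMove A (-1) w (w ++ [x])

/-- Every move of the exponential game is a move of `A` in one copy, and leaves the other copies
unchanged. -/
theorem BangMove.exists_copy {A : MBGame.{u}} {p : ℤˣ} {w w' : A.BangPos} (h : A.BangMove p w w') :
    ∃ i, i < w'.length ∧ w.length ≤ w'.length ∧ A.Move p (A.letter i w) (A.letter i w') ∧
      ∀ j, j ≠ i → A.letter j w = A.letter j w' := by
  cases h with
  | play w₁ w₂ x y h =>
    refine ⟨w₁.length, by simp, by simp, ?_, fun j hj => letter_middle_ne hj⟩
    rwa [letter_middle, letter_middle]
  | openCopy _ x h =>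
    refine ⟨w.length, by simp, by simp, ?_, fun j hj => ?_⟩
    · rwa [letter_middle, letter_of_le le_rfl]
    · rcases lt_or_gt_of_ne hj with hj | hj
      · rw [letter_append_left hj]
      · rw [letter_of_le hj.le, letter_of_le (by simpa using hj)]

/-- The Conway game underlying the exponential game; its root is the empty word. -/
def bangConway (A : MBGame.{u}) : ConwayGame.{u} where
  Pos := A.BangPos
  root := []
  Move := A.BangMove
  pol_unique := by
    intro p q w w' h h'
    obtain ⟨i, -, -, hi, hi'⟩ := h.exists_copy
    obtain ⟨j, -, -, hj, -⟩ := h'.exists_copy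
    by_cases e : j = i
    · subst e; exact A.pol_unique hi hj
    · rw [hi' j e] at hj; exact (A.no_loop hj).elim
  no_loop := by
    intro p w h
    obtain ⟨i, -, -, hi, -⟩ := h.exists_copy
    exact A.no_loop hi
  no_return := by
    intro p w h
    obtain ⟨i, hi, -⟩ := h.exists_copy
    simp at hi

/-- The queries of the exponential game at a word `w`: pairs of the index of a letter of `w` and a
query of `A` at that letter. -/
def BangIsQuery (A : MBGame.{u}) (p : ℤˣ) (w : A.BangPos) (r : ℕ × A.Query) : Prop :=
  r.1 < w.length ∧ A.IsQuery p (A.letter r.1 w) r.2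

/-- The residual relation of the exponential game: a move acts on the queries of the copy in which
it is played, and as the identity on the queries of the other copies. -/
def BangRes (A : MBGame.{u}) (w w' : A.BangPos) (r r' : ℕ × A.Query) : Prop :=
  A.bangConway.Edge w w' ∧ r.1 = r'.1 ∧
    A.StepRes (A.letter r.1 w) (A.letter r.1 w') r.2 r'.2

theorem bangIsQuery_iff {A : MBGame.{u}} {p : ℤˣ} {w : A.BangPos} {r : ℕ × A.Query} :
    A.BangIsQuery p w r ↔ A.IsQuery p (A.letter r.1 w) r.2 := by
  refine ⟨And.right, fun h => ⟨?_, h⟩⟩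
  by_contra h'
  rw [letter_of_le (not_lt.1 h')] at h
  exact A.no_root_query h

/-- The exponential game `!A`. -/
def bang (A : MBGame.{u}) : MBGame.{u} where
  toConwayGame := A.bangConway
  Query := ℕ × A.Query
  IsQuery := A.BangIsQuery
  query_pol_unique h h' := A.query_pol_unique h.2 h'.2
  query_finite w := by
    refine ((Set.finite_lt_nat w.length).biUnion
      fun i _ => (A.query_finite (A.letter i w)).image (Prod.mk i)).subset ?_
    rintro ⟨i, r⟩ ⟨p, hi, hp⟩
    exact Set.mem_biUnion (x := i) hi ⟨r, ⟨p, hp⟩, rfl⟩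
  Res := A.BangRes
  res_edge h := h.1
  res_query := by
    rintro w w' ⟨i, r⟩ ⟨j, r'⟩ ⟨-, e, h⟩
    dsimp only at e; subst e
    obtain ⟨p, hp, hp'⟩ := h.query
    exact ⟨p, bangIsQuery_iff.2 hp, bangIsQuery_iff.2 hp'⟩
  res_functional := by
    rintro w w' ⟨i, r⟩ ⟨j, r'⟩ ⟨k, r''⟩ ⟨-, e, h⟩ ⟨-, e', h'⟩
    dsimp only at e e'; subst e; subst e'
    exact congrArg _ (h.functional h')
  res_injective := by
    rintro w w' ⟨i, r⟩ ⟨j, r'⟩ ⟨k, r''⟩ ⟨-, e, h⟩ ⟨-, e', h'⟩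
    dsimp only at e e'; subst e; subst e'
    exact congrArg _ (h.injective h')
  initiates := by
    rintro p q w w' ⟨i, r⟩ h hq hr
    obtain ⟨j, -, -, hj, hj'⟩ := BangMove.exists_copy h
    by_cases e : i = j
    · subst e
      exact A.initiates hj hq.2 fun ⟨r₀, h₀⟩ => hr ⟨(i, r₀), ⟨p, h⟩, rfl, Or.inr h₀⟩
    · refine (hr ⟨(i, r), ⟨p, h⟩, rfl, Or.inl ⟨hj' i e, rfl, q, ?_⟩⟩).elim
      have := hq.2
      rwa [← hj' i e] at this
  complies := by
    rintro p q w w' ⟨i, r⟩ h hq hr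
    obtain ⟨j, -, -, hj, hj'⟩ := BangMove.exists_copy h
    by_cases e : i = j
    · subst e
      exact A.complies hj hq.2 fun ⟨r₀, h₀⟩ => hr ⟨(i, r₀), ⟨p, h⟩, rfl, Or.inr h₀⟩
    · exact (hr ⟨(i, r), ⟨p, h⟩, rfl, Or.inl ⟨hj' i e, rfl, q, hq.2⟩⟩).elim
  parallel w s t hs ht hst := by
    funext r r'
    apply propext
    obtain ⟨i, r⟩ := r
    refine parallel_project A A.bangConway _ _ (A.letter i) (Prod.mk i)
      (fun _ _ _ => bangIsQuery_iff) ?_ ?_ w s t hs ht hst r r'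
    · rintro x y ⟨p, h⟩
      obtain ⟨j, -, -, hj, hj'⟩ := BangMove.exists_copy h
      by_cases e : i = j
      · subst e; exact Or.inr ⟨p, hj⟩
      · exact Or.inl (hj' i e).symm
    · rintro x y h r ⟨j, r'⟩
      constructor
      · rintro ⟨-, e, h'⟩
        dsimp only at e; subst e
        exact ⟨r', rfl, h'⟩
      · rintro ⟨r₁, e, h'⟩
        cases e
        exact ⟨h, rfl, h'⟩
  no_root_query h := absurd h.1 (by simp [bangConway])

/-! ## The category of multi-bracketed games -/

/-- Morphisms `A → B`: well-bracketed strategies of the game `A* ⊗ B`. -/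
@[ext] structure Hom (A B : MBGame.{u}) extends Strategy (A.dual.tensor B).toConwayGame where
  wellBracketed : (A.dual.tensor B).WellBracketed toStrategy

/-- The copycat plays on `A* ⊗ B`, along a map `φ` from the positions of `A` to those of `B`
(a renaming of positions, or the identity map): after every even number of moves, the play in `B`
is the renaming of the play in `A`. -/
def copycat (A B : MBGame.{u}) (φ : A.Pos → B.Pos) : Set (List (A.Pos × B.Pos)) :=
  {s | (A.dual.tensor B).IsPlay s ∧ Even s.length ∧ ∀ t, t <+: s → Even t.length →
    (project Prod.fst (A.root, B.root) t).map φ = project Prod.snd (A.root, B.root) t}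

/-- The plays of the composite of two strategies: restrictions to `A* ⊗ C` of the interactions `u`
on `A`, `B`, `C` whose restrictions to `A* ⊗ B` and to `B* ⊗ C` belong to the given strategies and
whose restriction to `A* ⊗ C` is an alternating play. -/
def compPlays (A B C : MBGame.{u}) (σ : Set (List (A.Pos × B.Pos)))
    (τ : Set (List (B.Pos × C.Pos))) : Set (List (A.Pos × C.Pos)) :=
  {s | ∃ u : List (A.Pos × B.Pos × C.Pos),
    project (fun x => (x.1, x.2.1)) (A.root, B.root, C.root) u ∈ σ ∧
    project (fun x => (x.2.1, x.2.2)) (A.root, B.root, C.root) u ∈ τ ∧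
    project (fun x => (x.1, x.2.2)) (A.root, B.root, C.root) u = s ∧
    (A.dual.tensor C).IsPlay s}

/-- The plays of the tensor product of two strategies: the alternating plays whose restrictions to
`A* ⊗ A'` and to `B* ⊗ B'` belong to the given strategies. -/
def tensorPlays (A A' B B' : MBGame.{u}) (σ : Set (List (A.Pos × A'.Pos)))
    (τ : Set (List (B.Pos × B'.Pos))) : Set (List ((A.Pos × B.Pos) × (A'.Pos × B'.Pos))) :=
  {s | ((A.tensor B).dual.tensor (A'.tensor B')).IsPlay s ∧
    project (fun x => (x.1.1, x.2.1)) ((A.root, B.root), (A'.root, B'.root)) s ∈ σ ∧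
    project (fun x => (x.1.2, x.2.2)) ((A.root, B.root), (A'.root, B'.root)) s ∈ τ}

end MBGame

open MBGame in
/-- The category of multi-bracketed games and well-bracketed strategies: identities are the
copycat strategies, composition is parallel composition plus hiding.  All the data are determined
by their plays, so that this structure has at most one element; to exhibit one is to show that the
sets of plays in question are well-bracketed strategies and obey the laws of a category. -/
structure GameCat where
  id : ∀ A : MBGame.{u}, Hom A A
  id_plays : ∀ A, (id A).plays = copycat A A (fun x => x)
  comp : ∀ {A B C : MBGame.{u}}, Hom A B → Hom B C → Hom A C
  comp_plays : ∀ {A B C} (σ : Hom A B) (τ : Hom B C),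
    (comp σ τ).plays = compPlays A B C σ.plays τ.plays
  id_comp : ∀ {A B} (σ : Hom A B), comp (id A) σ = σ
  comp_id : ∀ {A B} (σ : Hom A B), comp σ (id B) = σ
  assoc : ∀ {A B C D} (σ : Hom A B) (τ : Hom B C) (υ : Hom C D),
    comp (comp σ τ) υ = comp σ (comp τ υ)

/-- The objects of the category: all multi-bracketed games. -/
def GameCat.Obj (_ : GameCat.{u}) : Type (u + 1) := MBGame.{u}

instance GameCat.category (S : GameCat.{u}) : Category.{u} S.Obj where
  Hom A B := MBGame.Hom A B
  id A := S.id A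
  comp σ τ := S.comp σ τ
  id_comp σ := S.id_comp σ
  comp_id σ := S.comp_id σ
  assoc σ τ υ := S.assoc σ τ υ

namespace GameCat

variable (S : GameCat.{u})

variable {S} in
/-- An object of the category is a multi-bracketed game. -/
def game (A : S.Obj) : MBGame.{u} := A

variable {S} in
/-- The set of plays of a morphism. -/
def plays {A B : S.Obj} (f : A ⟶ B) : Set (List ((game A).Pos × (game B).Pos)) :=
  Strategy.plays (MBGame.Hom.toStrategy f)

/-- The tensor product of objects. -/
def tens (A B : S.Obj) : S.Obj := MBGame.tensor A B

/-- The unit object. -/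
def unit : S.Obj := MBGame.one

/-- The dual of an object. -/
def dual (A : S.Obj) : S.Obj := MBGame.dual A

/-- The exponential of an object. -/
def bang (A : S.Obj) : S.Obj := MBGame.bang A

end GameCat

/-- The symmetric monoidal structure of the category of multi-bracketed games: the tensor product
is the tensor product of games and the tensor product of strategies, the unit is the game `1`, and
the structural isomorphisms are the evident copycat strategies.  Again, all the data are determined
by their plays, and this structure has at most one element. -/
structure GameTensor (S : GameCat.{u}) where
  tensorHom : ∀ {A A' B B' : S.Obj}, (A ⟶ A') → (B ⟶ B') → (S.tens A B ⟶ S.tens A' B')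
  tensorHom_plays : ∀ {A A' B B' : S.Obj} (f : A ⟶ A') (g : B ⟶ B'),
    GameCat.plays (tensorHom f g) =
      MBGame.tensorPlays A A' B B' (GameCat.plays f) (GameCat.plays g)
  associator : ∀ A B C : S.Obj, S.tens (S.tens A B) C ≅ S.tens A (S.tens B C)
  associator_plays : ∀ A B C : S.Obj, GameCat.plays (associator A B C).hom =
    MBGame.copycat (S.tens (S.tens A B) C) (S.tens A (S.tens B C))
      (fun x => (x.1.1, (x.1.2, x.2)))
  leftUnitor : ∀ A : S.Obj, S.tens S.unit A ≅ A
  leftUnitor_plays : ∀ A : S.Obj, GameCat.plays (leftUnitor A).hom =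
    MBGame.copycat (S.tens S.unit A) A (fun x => x.2)
  rightUnitor : ∀ A : S.Obj, S.tens A S.unit ≅ A
  rightUnitor_plays : ∀ A : S.Obj, GameCat.plays (rightUnitor A).hom =
    MBGame.copycat (S.tens A S.unit) A (fun x => x.1)
  braiding : ∀ A B : S.Obj, S.tens A B ≅ S.tens B A
  braiding_plays : ∀ A B : S.Obj, GameCat.plays (braiding A B).hom =
    MBGame.copycat (S.tens A B) (S.tens B A) (fun x => (x.2, x.1))
  tensor_id : ∀ A B : S.Obj, tensorHom (𝟙 A) (𝟙 B) = 𝟙 (S.tens A B)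
  tensor_comp : ∀ {A A' A'' B B' B'' : S.Obj} (f : A ⟶ A') (g : B ⟶ B') (f' : A' ⟶ A'')
    (g' : B' ⟶ B''), tensorHom f g ≫ tensorHom f' g' = tensorHom (f ≫ f') (g ≫ g')
  associator_naturality : ∀ {A A' B B' C C' : S.Obj} (f : A ⟶ A') (g : B ⟶ B') (h : C ⟶ C'),
    tensorHom (tensorHom f g) h ≫ (associator A' B' C').hom =
      (associator A B C).hom ≫ tensorHom f (tensorHom g h)
  leftUnitor_naturality : ∀ {A A' : S.Obj} (f : A ⟶ A'),
    tensorHom (𝟙 S.unit) f ≫ (leftUnitor A').hom = (leftUnitor A).hom ≫ f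
  rightUnitor_naturality : ∀ {A A' : S.Obj} (f : A ⟶ A'),
    tensorHom f (𝟙 S.unit) ≫ (rightUnitor A').hom = (rightUnitor A).hom ≫ f
  pentagon : ∀ A B C D : S.Obj,
    tensorHom (associator A B C).hom (𝟙 D) ≫ (associator A (S.tens B C) D).hom ≫
        tensorHom (𝟙 A) (associator B C D).hom =
      (associator (S.tens A B) C D).hom ≫ (associator A B (S.tens C D)).hom
  triangle : ∀ A B : S.Obj,
    (associator A S.unit B).hom ≫ tensorHom (𝟙 A) (leftUnitor B).hom =
      tensorHom (rightUnitor A).hom (𝟙 B)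
  braiding_naturality : ∀ {A A' B B' : S.Obj} (f : A ⟶ A') (g : B ⟶ B'),
    tensorHom f g ≫ (braiding A' B').hom = (braiding A B).hom ≫ tensorHom g f
  hexagon : ∀ A B C : S.Obj,
    (associator A B C).hom ≫ (braiding A (S.tens B C)).hom ≫ (associator B C A).hom =
      tensorHom (braiding A B).hom (𝟙 C) ≫ (associator B A C).hom ≫
        tensorHom (𝟙 B) (braiding A C).hom
  symmetry : ∀ A B : S.Obj, (braiding A B).hom ≫ (braiding B A).hom = 𝟙 (S.tens A B)

namespace GameTensor

variable {S : GameCat.{u}}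

/-- The symmetric monoidal category of multi-bracketed games, as a category that carries its
monoidal structure. -/
def Obj (_ : GameTensor S) : Type (u + 1) := S.Obj

instance category (T : GameTensor S) : Category.{u} T.Obj := S.category

instance monoidalStruct (T : GameTensor S) : MonoidalCategoryStruct T.Obj where
  tensorObj A B := S.tens A B
  tensorUnit := S.unit
  tensorHom f g := T.tensorHom f g
  whiskerLeft A _ _ f := T.tensorHom (𝟙 A) f
  whiskerRight f B := T.tensorHom f (𝟙 B)
  associator A B C := T.associator A B C
  leftUnitor A := T.leftUnitor A
  rightUnitor A := T.rightUnitor A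

instance monoidal (T : GameTensor S) : MonoidalCategory T.Obj :=
  MonoidalCategory.ofTensorHom
    (id_tensorHom_id := fun A B => T.tensor_id A B)
    (id_tensorHom := fun _ _ _ _ => rfl)
    (tensorHom_id := fun _ _ => rfl)
    (tensorHom_comp_tensorHom := fun f g f' g' => T.tensor_comp f g f' g')
    (associator_naturality := fun f g h => T.associator_naturality f g h)
    (leftUnitor_naturality := fun f => T.leftUnitor_naturality f)
    (rightUnitor_naturality := fun f => T.rightUnitor_naturality f)
    (pentagon := fun A B C D => T.pentagon A B C D)
    (triangle := fun A B => T.triangle A B)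

instance symmetric (T : GameTensor S) : SymmetricCategory T.Obj where
  braiding A B := T.braiding A B
  braiding_naturality_right A _ _ f := T.braiding_naturality (𝟙 A) f
  braiding_naturality_left f B := T.braiding_naturality f (𝟙 B)
  hexagon_forward A B C := T.hexagon A B C
  hexagon_reverse A B C := by
    have key : ∀ b : (∀ X Y : T.Obj, X ⊗ Y ≅ Y ⊗ X),
        (∀ X Y : T.Obj, (b X Y).hom ≫ (b Y X).hom = 𝟙 _) →
        ((α_ C A B).hom ≫ (b C (A ⊗ B)).hom ≫ (α_ A B C).hom =
          (b C A).hom ▷ B ≫ (α_ A C B).hom ≫ A ◁ (b C B).hom) →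
        (α_ A B C).inv ≫ (b (A ⊗ B) C).hom ≫ (α_ C A B).inv =
          (A ◁ (b B C).hom) ≫ (α_ A C B).inv ≫ ((b A C).hom ▷ B) := by
      intro b hb h
      have e : ∀ X Y : T.Obj, (b X Y).hom = (b Y X).inv := fun X Y =>
        (Iso.comp_hom_eq_id (b Y X)).1 (hb X Y)
      have h' : whiskerRightIso (b C A) B ≪≫ α_ A C B ≪≫ whiskerLeftIso A (b C B) =
          α_ C A B ≪≫ b C (A ⊗ B) ≪≫ α_ A B C := Iso.ext h.symm
      have h'' := congrArg Iso.inv h'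
      simp only [Iso.trans_inv, whiskerRightIso_inv, whiskerLeftIso_inv, Category.assoc] at h''
      rw [e A C, e B C, e (A ⊗ B) C]
      exact h''.symm
    exact key (fun X Y => T.braiding X Y) T.symmetry (T.hexagon C A B)
  symmetry A B := T.symmetry A B

/-- The dual game `A*`, as an object of the category. -/
def dual (T : GameTensor S) (A : T.Obj) : T.Obj := S.dual A

/-- The exponential game `!A`, as an object of the category. -/
def bang (T : GameTensor S) (A : T.Obj) : T.Obj := S.bang A

end GameTensor

/-! ## Free commutative comonoids and models of linear logic -/

section Models

universe v₁ v₂ u₁ u₂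

variable {C : Type u₁} [Category.{v₁} C] [MonoidalCategory C] [SymmetricCategory C]

/-- The commutative comonoid `X`, with the morphism `ε : X ⟶ A`, is the free commutative comonoid
on the object `A`: every morphism from a commutative comonoid `K` to `A` factors through `ε` by
exactly one morphism of comonoids `K ⟶ X`. -/
def IsFreeCommComonoid (X : CommComon C) {A : C} (ε : X.X ⟶ A) : Prop :=
  ∀ (K : CommComon C) (f : K.X ⟶ A), ∃! g : K ⟶ X, g.hom.hom ≫ ε = f

variable (C) in
/-- The forgetful functor from commutative comonoids to the underlying category. -/
def forgetCommComon : CommComon C ⥤ C := CommComon.forget₂Comon C ⋙ Comon.forget C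

variable (C) in
/-- A *-autonomous structure on a symmetric monoidal category: a contravariant functor `star` that
is an equivalence, and bijections `Hom(A ⊗ B, D*) ≃ Hom(A, (B ⊗ D)*)` natural in `A`, `B`, `D`. -/
structure StarAutonomous where
  star : Cᵒᵖ ⥤ C
  isEquivalence : star.IsEquivalence
  curry : ∀ A B D : C, (A ⊗ B ⟶ star.obj (.op D)) ≃ (A ⟶ star.obj (.op (B ⊗ D)))
  curry_natural : ∀ {A A' B B' D D' : C} (f : A' ⟶ A) (g : B' ⟶ B) (h : D' ⟶ D)
    (k : A ⊗ B ⟶ star.obj (.op D)),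
    curry A' B' D' ((f ⊗ₘ g) ≫ k ≫ star.map h.op) = f ≫ curry A B D k ≫ star.map (g ⊗ₘ h).op

/-- The functor `U : M ⥤ C` underlies an exponential resource modality on `C`: the category `M` is
cartesian, `U` is a (strong) symmetric monoidal functor, and `U` has a right adjoint `F`.
The modality of linear logic is the comonad `F ⋙ U` on `C`. -/
structure ExponentialModality {M : Type u₂} [Category.{v₂} M] (U : M ⥤ C) where
  cartesian : CartesianMonoidalCategory M
  braided : BraidedCategory M
  symmetricMonoidal : U.Braided
  F : C ⥤ M
  adj : U ⊣ F

/-- A model of multiplicative exponential linear logic (in linear-non-linear form): a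
*-autonomous category with an exponential resource modality. -/
structure MELLModel {M : Type u₂} [Category.{v₂} M] (U : M ⥤ C) extends
  StarAutonomous C, ExponentialModality U

end Models

/-- The game `!A` with a structure of commutative comonoid, as a commutative comonoid. -/
def GameTensor.bangComonoid {S : GameCat.{u}} (T : GameTensor S) (A : T.Obj)
    (c : ComonObj (T.bang A)) (hc : IsCommComonObj (T.bang A)) : CommComon T.Obj :=
  CommComon.mk (T.bang A)

-- Everything is computed on interactions: lists of positions of several games played together,
-- whose projections (`project`) erase the steps that do not concern the games kept. The key to
-- alternation is that it is arithmetic: a path from the root is an alternating play exactly when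
-- the excess of Opponent moves over Player moves is 0 or 1 after every prefix
-- (`isAlternating_iff`). On `A* ⊗ B` this excess is that of `B` minus that of `A`, so it telescopes
-- along an interaction, and alternation of the various projections follows by linear arithmetic.
-- Associativity of composition and functoriality of the tensor product then come down to
-- amalgamating two lists over a common projection (`exists_amalgam`). Determinism is recast as a
-- relation `Coh` between two plays, and well-bracketing as an implication between the existence of
-- fresh queries (`wellBracketed_iff`); both pass to composites by induction along interactions
-- (`Inter.coh`, `fresh_inter`).
--
-- Structural morphisms come from synchronous relations, that is, sets of paths of simultaneous
-- moves in two games. Such a relation acts on plays without disturbing alternation, and composing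
-- with the morphism that it defines is plain composition of relations (`compPlays_transl`). For an
-- isomorphism of games the action is a renaming of positions, so the coherence laws are equalities
-- of bijections. Copycat answers every Opponent move, hence it is maximal among strategies
-- (`IsStrat.eq_id`). The snake equations therefore need one inclusion only, which is obtained by
-- expanding a copycat play to a chain of five copies of the game (`exists_chain`).
--
-- The games `1`, `A`, `!A` and their tensor products are families of copies of `A`. A canonical
-- relation between two families matches their members by a partial bijection. Since `!A` opens its
-- copies in a fixed order, there is exactly one canonical relation from `!A` to a given family
-- (`Canonical.eq_canRel`). Comultiplication, counit and dereliction are the canonical morphisms,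
-- and the comonoid laws hold because both sides are canonical (`IsCan.eq`).
--
-- For the universal property, let `K` be a commutative comonoid and `f : K → A`. No Player move is
-- initial in `K` (`negative_of_comul`): the comultiplication would have to answer it in one of two
-- factors, against commutativity and determinism. Let `r : A ⊗ !A → !A` put a copy in front of a
-- word (`uncons`). Because `r ∘ (ε ⊗ 1) ∘ Δ = 1` on `!A`, every comonoid morphism `g` with `ε ∘ g =
-- f` satisfies `g = r ∘ (f ⊗ g) ∘ Δ`. This equation has exactly one solution: a union of finite
-- approximations exists (`lift_eq`), and it is unique since each unfolding consumes one letter of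
-- the final word while a play that ends at the empty word is empty (`Negative.unfold_ext`). The
-- solution is a morphism of comonoids: `Δ ∘ g` and `(g ⊗ g) ∘ Δ` are both symmetric and, restricted
-- to the plays that open the left exponential first, satisfy the same unfolding equation, which
-- together with symmetry determines them (`Negative.openLeft_ext`).
--
-- The rest is general: commutative comonoids form a cartesian category, a choice of free ones is a
-- right adjoint, and a compact closed category whose duality is involutive on objects is
-- *-autonomous.

attribute [reducible] MBGame.dual ConwayGame.dual MBGame.tensor MBGame.tensorConway
  MBGame.one MBGame.bang MBGame.bangConway

/-! ## Lists of positions and their projections -/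

section Lists

variable {X Y Z : Type*}

/-- Consecutive elements of the list `x :: s` are related by `R`. -/
def Along (R : X → X → Prop) : X → List X → Prop
  | _, [] => True
  | x, y :: s => R x y ∧ Along R y s

theorem getLastD_append (x : X) (s t : List X) :
    (s ++ t).getLastD x = t.getLastD (s.getLastD x) := by
  induction s generalizing x with
  | nil => simp
  | cons y s ih => rw [List.cons_append, List.getLastD_cons, List.getLastD_cons, ih]

theorem along_append {R : X → X → Prop} (x : X) (s t : List X) :
    Along R x (s ++ t) ↔ Along R x s ∧ Along R (s.getLastD x) t := by
  induction s generalizing x with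
  | nil => simp [Along]
  | cons y s ih => rw [List.cons_append, List.getLastD_cons, Along, Along, ih, and_assoc]

theorem Along.mono {R R' : X → X → Prop} (h : ∀ x y, R x y → R' x y) {x : X} {s : List X}
    (hs : Along R x s) : Along R' x s := by
  induction s generalizing x with
  | nil => trivial
  | cons y s ih => exact ⟨h _ _ hs.1, ih hs.2⟩

theorem Along.and {R R' : X → X → Prop} {x : X} {s : List X} (h : Along R x s)
    (h' : Along R' x s) : Along (fun p q => R p q ∧ R' p q) x s := by
  induction s generalizing x with
  | nil => trivial
  | cons y s ih => exact ⟨⟨h.1, h'.1⟩, ih h.2 h'.2⟩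

theorem along_map {R : Y → Y → Prop} (f : X → Y) (x : X) (s : List X) :
    Along R (f x) (s.map f) ↔ Along (fun p q => R (f p) (f q)) x s := by
  induction s generalizing x with
  | nil => simp [Along]
  | cons y s ih => simp only [List.map_cons, Along, ih]

theorem project_nil (π : X → Y) (x : X) : project π x [] = [] := rfl

theorem project_cons_of_eq {π : X → Y} {x y : X} (h : π y = π x) (s : List X) :
    project π x (y :: s) = project π y s := by
  rw [project, if_pos h]

theorem project_cons_of_ne {π : X → Y} {x y : X} (h : π y ≠ π x) (s : List X) :
    project π x (y :: s) = π y :: project π y s := by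
  rw [project, if_neg h]

theorem project_append (π : X → Y) (x : X) (s t : List X) :
    project π x (s ++ t) = project π x s ++ project π (s.getLastD x) t := by
  induction s generalizing x with
  | nil => simp [project]
  | cons y s ih =>
    rw [List.cons_append, List.getLastD_cons]
    by_cases h : π y = π x
    · rw [project_cons_of_eq h, project_cons_of_eq h, ih]
    · rw [project_cons_of_ne h, project_cons_of_ne h, ih, List.cons_append]

theorem project_project (π : X → Y) (f : Y → Z) (x : X) (s : List X) :
    project f (π x) (project π x s) = project (fun w => f (π w)) x s := by
  induction s generalizing x with
  | nil => rfl
  | cons y s ih =>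
    by_cases h : π y = π x
    · rw [project_cons_of_eq h, ← h, ih, project_cons_of_eq (π := fun w => f (π w)) (by rw [h])]
    · rw [project_cons_of_ne h]
      by_cases h' : f (π y) = f (π x)
      · rw [project_cons_of_eq h', ih, project_cons_of_eq (π := fun w => f (π w)) h']
      · rw [project_cons_of_ne h', ih, project_cons_of_ne (π := fun w => f (π w)) h']

theorem project_map (θ : X → Y) (π : Y → Z) (x : X) (s : List X) :
    project π (θ x) (s.map θ) = project (fun w => π (θ w)) x s := by
  induction s generalizing x with
  | nil => rfl
  | cons y s ih =>
    rw [List.map_cons]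
    by_cases h : π (θ y) = π (θ x)
    · rw [project_cons_of_eq h, ih, project_cons_of_eq (π := fun w => π (θ w)) h]
    · rw [project_cons_of_ne h, ih, project_cons_of_ne (π := fun w => π (θ w)) h]

theorem map_project (π : X → Y) (θ : Y → Z) (hθ : Function.Injective θ) (x : X) (s : List X) :
    (project π x s).map θ = project (fun w => θ (π w)) x s := by
  induction s generalizing x with
  | nil => rfl
  | cons y s ih =>
    by_cases h : π y = π x
    · rw [project_cons_of_eq h, ih,
        project_cons_of_eq (π := fun w => θ (π w)) (congrArg θ h)]
    · rw [project_cons_of_ne h, List.map_cons, ih,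
        project_cons_of_ne (π := fun w => θ (π w)) (fun e => h (hθ e))]

theorem project_congr {π π' : X → Y} {x : X} {s : List X} (hx : π x = π' x)
    (h : ∀ y ∈ s, π y = π' y) : project π x s = project π' x s := by
  induction s generalizing x with
  | nil => rfl
  | cons y s ih =>
    have hy := h y (by simp)
    have := ih hy fun z hz => h z (by simp [hz])
    by_cases e : π y = π x
    · rw [project_cons_of_eq e, project_cons_of_eq (by rw [← hy, ← hx, e]), this]
    · rw [project_cons_of_ne e, project_cons_of_ne (by rwa [← hy, ← hx]), this, hy]

theorem project_const {π : X → Y} {x : X} {s : List X} {c : Y} (hx : π x = c)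
    (h : ∀ y ∈ s, π y = c) : project π x s = [] := by
  induction s generalizing x with
  | nil => rfl
  | cons y s ih =>
    have hy := h y (by simp)
    rw [project_cons_of_eq (hy.trans hx.symm), ih hy fun z hz => h z (by simp [hz])]

/-- No two consecutive elements of the list `x :: s` are equal. -/
abbrev NoStutter (x : X) (s : List X) : Prop := Along (fun p q => q ≠ p) x s

/-- A step that does not change the image leaves no trace in the projection, so the relation
constrains the other steps only. Conditions on several projections of one interaction become in this
way conditions on the steps of that interaction, where they can be conjoined. -/
theorem along_project {R : Y → Y → Prop} (π : X → Y) (x : X) (s : List X) :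
    Along R (π x) (project π x s) ↔ Along (fun p q => π q = π p ∨ R (π p) (π q)) x s := by
  induction s generalizing x with
  | nil => simp [project, Along]
  | cons y s ih =>
    by_cases h : π y = π x
    · rw [project_cons_of_eq h, ← h, ih]
      simp [Along, h]
    · rw [project_cons_of_ne h]
      simp [Along, h, ih]

theorem noStutter_project (π : X → Y) (x : X) (s : List X) :
    NoStutter (π x) (project π x s) := by
  rw [NoStutter, along_project]
  induction s generalizing x with
  | nil => trivial
  | cons y s ih => exact ⟨em _, ih y⟩

theorem project_of_noStutter {π : X → Y} {x : X} {s : List X}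
    (h : Along (fun p q => π q ≠ π p) x s) : project π x s = s.map π := by
  induction s generalizing x with
  | nil => rfl
  | cons y s ih => rw [project_cons_of_ne h.1, ih h.2, List.map_cons]

theorem project_id_of_noStutter {x : X} {s : List X} (h : NoStutter x s) :
    project (fun w => w) x s = s := by
  rw [project_of_noStutter h, List.map_id'']
  exact fun _ => rfl

theorem prefix_project {π : X → Y} {x : X} {s : List X} {t : List Y}
    (h : t <+: project π x s) : ∃ u, u <+: s ∧ project π x u = t := by
  induction s generalizing x t with
  | nil => exact ⟨[], List.prefix_rfl, (List.prefix_nil.1 h).symm⟩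
  | cons y s ih =>
    by_cases e : π y = π x
    · rw [project_cons_of_eq e] at h
      obtain ⟨u, hu, hu'⟩ := ih h
      exact ⟨y :: u, by simpa using hu, (project_cons_of_eq e u).trans hu'⟩
    · rw [project_cons_of_ne e] at h
      cases t with
      | nil => exact ⟨[], List.nil_prefix, rfl⟩
      | cons z t =>
        obtain ⟨e', h⟩ := List.cons_prefix_cons.1 h
        obtain ⟨u, hu, hu'⟩ := ih h
        exact ⟨y :: u, by simpa using hu, by rw [project_cons_of_ne e, hu', e']⟩

theorem project_prefix (π : X → Y) (x : X) {u s : List X} (h : u <+: s) :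
    project π x u <+: project π x s := by
  obtain ⟨v, rfl⟩ := h
  rw [project_append]
  exact List.prefix_append _ _

theorem Along.prefix {R : X → X → Prop} {x : X} {u s : List X} (h : Along R x s) (hu : u <+: s) :
    Along R x u := by
  obtain ⟨v, rfl⟩ := hu
  exact ((along_append x u v).1 h).1

/-- Two lists with the same projection are the projections of an interleaving, which does not
move simultaneously in both of them unless their common projection moves. -/
theorem exists_amalgam {U V : Type*} (f : U → X) (g : V → X) (u₀ : U) (v₀ : V)
    (h₀ : f u₀ = g v₀) (u : List U) (v : List V) (h : project f u₀ u = project g v₀ v) :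
    ∃ w : List (U × V), project Prod.fst (u₀, v₀) w = project (fun x => x) u₀ u ∧
      project Prod.snd (u₀, v₀) w = project (fun x => x) v₀ v ∧
      Along (fun p q => q.1 = p.1 ∨ q.2 = p.2 ∨ f q.1 ≠ f p.1) (u₀, v₀) w ∧
      ∀ p ∈ w, f p.1 = g p.2 := by
  induction u generalizing u₀ v₀ v with
  | nil =>
    induction v generalizing v₀ with
    | nil => exact ⟨[], rfl, rfl, trivial, by simp⟩
    | cons b v ih =>
      by_cases e : g b = g v₀
      · rw [project_cons_of_eq e] at h
        obtain ⟨w, h₁, h₂, h₃, h₄⟩ := ih b (h₀.trans e.symm) h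
        refine ⟨(u₀, b) :: w, ?_, ?_, ⟨Or.inl rfl, h₃⟩, ?_⟩
        · rw [project_cons_of_eq (by rfl), h₁]
        · by_cases e' : b = v₀
          · rw [project_cons_of_eq (π := Prod.snd) e', project_cons_of_eq (π := fun x => x) e', h₂]
          · rw [project_cons_of_ne (π := Prod.snd) e', project_cons_of_ne (π := fun x => x) e', h₂]
        · rintro p (_ | ⟨_, hp⟩)
          · exact h₀.trans e.symm
          · exact h₄ p hp
      · rw [project_cons_of_ne e] at h
        cases h
  | cons a u ih =>
    by_cases e : f a = f u₀
    · rw [project_cons_of_eq e] at h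
      obtain ⟨w, h₁, h₂, h₃, h₄⟩ := ih a v₀ (e.trans h₀) v h
      refine ⟨(a, v₀) :: w, ?_, ?_, ⟨Or.inr (Or.inl rfl), h₃⟩, ?_⟩
      · by_cases e' : a = u₀
        · rw [project_cons_of_eq (π := Prod.fst) e', project_cons_of_eq (π := fun x => x) e', h₁]
        · rw [project_cons_of_ne (π := Prod.fst) e', project_cons_of_ne (π := fun x => x) e', h₁]
      · rw [project_cons_of_eq (by rfl), h₂]
      · rintro p (_ | ⟨_, hp⟩)
        · exact e.trans h₀
        · exact h₄ p hp
    · rw [project_cons_of_ne e] at h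
      -- The first list is about to make a visible step and waits while the second list makes its
      -- invisible ones; the two visible steps are then taken together.
      induction v generalizing v₀ with
      | nil => cases h
      | cons b v ihv =>
        by_cases e₂ : g b = g v₀
        · rw [project_cons_of_eq e₂] at h
          obtain ⟨w, h₁, h₂, h₃, h₄⟩ := ihv b (h₀.trans e₂.symm) h
          refine ⟨(u₀, b) :: w, ?_, ?_, ⟨Or.inl rfl, h₃⟩, ?_⟩
          · rw [project_cons_of_eq (by rfl), h₁]
          · by_cases e' : b = v₀
            · rw [project_cons_of_eq (π := Prod.snd) e', project_cons_of_eq (π := fun x => x) e',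
                h₂]
            · rw [project_cons_of_ne (π := Prod.snd) e', project_cons_of_ne (π := fun x => x) e',
                h₂]
          · rintro p (_ | ⟨_, hp⟩)
            · exact h₀.trans e₂.symm
            · exact h₄ p hp
        · rw [project_cons_of_ne e₂] at h
          obtain ⟨e₃, h⟩ := List.cons.inj h
          obtain ⟨w, h₁, h₂, h₃, h₄⟩ := ih a b e₃ v h
          have hu : a ≠ u₀ := fun h => e (by rw [h])
          have hv : b ≠ v₀ := fun h => e₂ (by rw [h])
          refine ⟨(a, b) :: w, ?_, ?_, ⟨Or.inr (Or.inr e), h₃⟩, ?_⟩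
          · rw [project_cons_of_ne (π := Prod.fst) hu, project_cons_of_ne (π := fun x => x) hu, h₁]
          · rw [project_cons_of_ne (π := Prod.snd) hv, project_cons_of_ne (π := fun x => x) hv, h₂]
          · rintro p (_ | ⟨_, hp⟩)
            · exact e₃
            · exact h₄ p hp

/-- An amalgam is known only up to stuttering, through equations like `h`. This is enough, since
every further projection erases repetitions anyway. -/
theorem project_comp_of_eq {W : Type*} {π : W → X} {x : W} {w : List W} {u : List X}
    (h : project π x w = project (fun y => y) (π x) u) (f : X → Y) :
    project (fun y => f (π y)) x w = project f (π x) u := by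
  rw [← project_project π f, h, project_project (fun y => y) f]

theorem along_of_project_eq {W : Type*} {π : W → X} {x : W} {w : List W} {u : List X}
    {R : X → X → Prop} (h : project π x w = project (fun y => y) (π x) u)
    (hR : Along (fun p q => q = p ∨ R p q) (π x) u) :
    Along (fun p q => π q = π p ∨ R (π p) (π q)) x w := by
  rw [← along_project, h, along_project (fun y => y)]
  exact hR

end Lists

/-! ## Balances -/

namespace ConwayGame

/-- Either no move or a move `x → y`. -/
def OK (G : ConwayGame.{u}) (x y : G.Pos) : Prop := y = x ∨ G.Edge x y

open scoped Classical in
/-- The variation along a step `x → y` of the number of Opponent moves that have not been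
answered. -/
noncomputable def inc (G : ConwayGame.{u}) (x y : G.Pos) : ℤ :=
  if G.Move (-1) x y then 1 else if G.Move 1 x y then -1 else 0

variable {G : ConwayGame.{u}}

theorem Move.ne {p : ℤˣ} {x y : G.Pos} (h : G.Move p x y) : y ≠ x := by
  rintro rfl
  exact G.no_loop h

theorem Edge.ne {x y : G.Pos} (h : G.Edge x y) : y ≠ x := h.elim fun _ => Move.ne

theorem inc_self (x : G.Pos) : G.inc x x = 0 := by
  rw [inc, if_neg G.no_loop, if_neg G.no_loop]

theorem inc_of_opp {x y : G.Pos} (h : G.Move (-1) x y) : G.inc x y = 1 := if_pos h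

theorem inc_of_prop {x y : G.Pos} (h : G.Move 1 x y) : G.inc x y = -1 := by
  rw [inc, if_neg fun h' => absurd (G.pol_unique h h') (by decide), if_pos h]

theorem inc_of_move {p : ℤˣ} {x y : G.Pos} (h : G.Move p x y) : G.inc x y = -(p : ℤ) := by
  rcases Int.units_eq_one_or p with rfl | rfl
  · rw [inc_of_prop h]; rfl
  · rw [inc_of_opp h]; rfl

theorem inc_of_not_edge {x y : G.Pos} (h : ¬ G.Edge x y) : G.inc x y = 0 := by
  rw [inc, if_neg fun e => h ⟨_, e⟩, if_neg fun e => h ⟨_, e⟩]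

theorem Edge.cases {x y : G.Pos} (h : G.Edge x y) : G.Move (-1) x y ∨ G.Move 1 x y := by
  obtain ⟨p, h⟩ := h
  rcases Int.units_eq_one_or p with rfl | rfl
  · exact Or.inr h
  · exact Or.inl h

/-- The sum of the variations along a list of steps. -/
noncomputable def bal (G : ConwayGame.{u}) {W : Type*} (π : W → G.Pos) : W → List W → ℤ
  | _, [] => 0
  | x, y :: s => G.inc (π x) (π y) + bal G π y s

variable {W V : Type*}

@[simp] theorem bal_nil (π : W → G.Pos) (x : W) : G.bal π x [] = 0 := rfl

theorem bal_cons (π : W → G.Pos) (x y : W) (s : List W) :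
    G.bal π x (y :: s) = G.inc (π x) (π y) + G.bal π y s := rfl

theorem bal_project (π : W → V) (f : V → G.Pos) (x : W) (s : List W) :
    G.bal f (π x) (project π x s) = G.bal (fun w => f (π w)) x s := by
  induction s generalizing x with
  | nil => rfl
  | cons y s ih =>
    by_cases h : π y = π x
    · rw [project_cons_of_eq h, ← h, ih, bal_cons, h, inc_self, zero_add]
    · rw [project_cons_of_ne h, bal_cons, bal_cons, ih]

theorem isPath_iff {x : G.Pos} {s : List G.Pos} : G.IsPath x s ↔ Along G.Edge x s := by
  induction s generalizing x with
  | nil => simp [IsPath, Along]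
  | cons y s ih => rw [IsPath, Along, ih]

/-- The number of unanswered Opponent moves at the beginning of a path whose first move has
polarity `p`. -/
def turn (p : ℤˣ) : ℤ := if p = -1 then 0 else 1

/-- If the excess of Opponent over Player moves is confined to two consecutive values, every move
has to lead from one to the other, so the polarities alternate. Unlike alternation, the bounds are
linear and additive over components, so the conditions for different pairs of games can be combined
by arithmetic. -/
theorem isAlternating_iff (p : ℤˣ) {x : G.Pos} {s : List G.Pos} :
    G.IsAlternating p x s ↔ Along G.Edge x s ∧ ∀ t, t <+: s →
      0 ≤ turn p + G.bal (fun w => w) x t ∧ turn p + G.bal (fun w => w) x t ≤ 1 := by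
  have hp : ∀ p : ℤˣ, 0 ≤ turn p ∧ turn p ≤ 1 := by
    intro p
    rcases Int.units_eq_one_or p with rfl | rfl <;> decide
  have hp' : ∀ p : ℤˣ, turn p - p = turn (-p) := by
    intro p
    rcases Int.units_eq_one_or p with rfl | rfl <;> decide
  have hpq : ∀ p q : ℤˣ, 0 ≤ turn p - q → turn p - q ≤ 1 → q = p := by
    intro p q
    rcases Int.units_eq_one_or p with rfl | rfl <;>
      rcases Int.units_eq_one_or q with rfl | rfl <;> decide
  induction s generalizing p x with
  | nil =>
    simp only [IsAlternating, Along, List.prefix_nil, forall_eq, bal_nil, add_zero, hp, and_self]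
  | cons y s ih =>
    refine (and_congr Iff.rfl (ih (-p) (x := y))).trans ?_
    constructor
    · rintro ⟨h, h₁, h₂⟩
      refine ⟨⟨⟨p, h⟩, h₁⟩, fun t ht => ?_⟩
      cases t with
      | nil => simpa using hp p
      | cons z t =>
        obtain ⟨e, ht'⟩ := List.cons_prefix_cons.1 ht
        rw [bal_cons, e, inc_of_move h, ← add_assoc, ← sub_eq_add_neg, hp']
        exact h₂ t ht'
    · rintro ⟨⟨⟨q, h⟩, h₁⟩, h₂⟩
      -- The bounds for the prefix of length one fix the polarity of the first move.
      have h₃ := h₂ [y] (by simp)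
      rw [bal_cons, inc_of_move h, bal_nil, add_zero, ← sub_eq_add_neg] at h₃
      obtain rfl := hpq p q h₃.1 h₃.2
      refine ⟨h, h₁, fun t ht => ?_⟩
      have := h₂ (y :: t) (by simpa using ht)
      rwa [bal_cons, inc_of_move h, ← add_assoc, ← sub_eq_add_neg, hp'] at this

/-- Prefixes of a projection are projections of prefixes, and erased steps do not contribute to the
balance. The criterion can thus be read on the interaction itself, without computing the projected
list. -/
theorem isPlay_project_iff {π : W → G.Pos} {x : W} {u : List W} (hx : π x = G.root) :
    G.IsPlay (project π x u) ↔ Along (fun p q => G.OK (π p) (π q)) x u ∧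
      ∀ t, t <+: u → 0 ≤ G.bal π x t ∧ G.bal π x t ≤ 1 := by
  rw [IsPlay, ← hx, isAlternating_iff, along_project]
  refine and_congr Iff.rfl ⟨fun h t ht => ?_, fun h t ht => ?_⟩
  · have := h _ (project_prefix π x ht)
    rw [bal_project] at this
    simpa [turn] using this
  · obtain ⟨v, hv, rfl⟩ := prefix_project ht
    rw [bal_project]
    simpa [turn] using h v hv

theorem even_bal_add_length {x : G.Pos} {s : List G.Pos} (h : Along G.Edge x s) :
    Even (G.bal (fun w => w) x s + s.length) := by
  induction s generalizing x with
  | nil => simp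
  | cons y s ih =>
    obtain ⟨k, hk⟩ := ih h.2
    rw [bal_cons, List.length_cons]
    push_cast
    rcases h.1.cases with h | h
    · rw [inc_of_opp h]; exact ⟨k + 1, by omega⟩
    · rw [inc_of_prop h]; exact ⟨k, by omega⟩

/-- Each move changes the balance by one, so balance and length have the same parity; a balance that
is 0 or 1 is even only if it vanishes. Completed exchanges are recognised in this way by a linear
equation. -/
theorem even_length_iff {s : List G.Pos} (h : G.IsPlay s) :
    Even s.length ↔ G.bal (fun w => w) G.root s = 0 := by
  obtain ⟨h₁, h₂⟩ := (isAlternating_iff _).1 h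
  have h₃ := h₂ s List.prefix_rfl
  obtain ⟨k, hk⟩ := even_bal_add_length h₁
  simp only [turn, if_true, zero_add] at h₃
  rw [Nat.even_iff]
  omega

theorem even_length_project_iff {π : W → G.Pos} {x : W} {u : List W} (hx : π x = G.root)
    (h : G.IsPlay (project π x u)) : Even (project π x u).length ↔ G.bal π x u = 0 := by
  rw [even_length_iff h, ← hx, bal_project]

theorem IsPlay.noStutter {s : List G.Pos} (h : G.IsPlay s) : NoStutter G.root s :=
  ((isAlternating_iff _).1 h).1.mono fun _ _ => Edge.ne

theorem IsPlay.prefix {s t : List G.Pos} (h : G.IsPlay s) (ht : t <+: s) : G.IsPlay t := by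
  rw [IsPlay, isAlternating_iff] at h ⊢
  exact ⟨h.1.prefix ht, fun v hv => h.2 v (hv.trans ht)⟩

end ConwayGame

namespace MBGame

open ConwayGame

/-- No move, or a move in one of the components. -/
def Step (A B : MBGame.{u}) (x y : A.Pos × B.Pos) : Prop :=
  (A.OK x.1 y.1 ∧ y.2 = x.2) ∨ (y.1 = x.1 ∧ B.OK x.2 y.2)

variable {A B : MBGame.{u}}

theorem edge_dual {x y : A.Pos} : A.dual.Edge x y ↔ A.Edge x y := by
  refine ⟨fun ⟨p, h⟩ => ⟨-p, h⟩, fun ⟨p, h⟩ => ⟨-p, ?_⟩⟩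
  change A.Move (- -p) x y
  rwa [neg_neg]

theorem move_dual {p : ℤˣ} {x y : A.Pos} : A.dual.Move p x y ↔ A.Move (-p) x y := Iff.rfl

theorem ok_dual {x y : A.Pos} : A.dual.OK x y ↔ A.OK x y := or_congr Iff.rfl edge_dual

theorem inc_dual (x y : A.Pos) : A.dual.inc x y = - A.inc x y := by
  by_cases h : A.Edge x y
  · obtain ⟨p, h⟩ := h
    have : A.dual.Move (-p) x y := by rwa [move_dual, neg_neg]
    rw [inc_of_move h, inc_of_move this]
    simp
  · have h' : ¬ A.dual.Edge x y := fun h' => h (edge_dual.1 h')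
    rw [inc_of_not_edge h, inc_of_not_edge h', neg_zero]

theorem bal_dual {W : Type*} (π : W → A.Pos) (x : W) (s : List W) :
    A.dual.bal π x s = - A.bal π x s := by
  induction s generalizing x with
  | nil => simp
  | cons y s ih => rw [bal_cons, bal_cons, ih, inc_dual, neg_add]

theorem edge_tensor {x y : A.Pos × B.Pos} : (A.tensor B).Edge x y ↔
    (A.Edge x.1 y.1 ∧ x.2 = y.2) ∨ (x.1 = y.1 ∧ B.Edge x.2 y.2) := by
  constructor
  · rintro ⟨p, ⟨h, e⟩ | ⟨e, h⟩⟩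
    · exact Or.inl ⟨⟨p, h⟩, e⟩
    · exact Or.inr ⟨e, ⟨p, h⟩⟩
  · rintro (⟨⟨p, h⟩, e⟩ | ⟨e, ⟨p, h⟩⟩)
    · exact ⟨p, Or.inl ⟨h, e⟩⟩
    · exact ⟨p, Or.inr ⟨e, h⟩⟩

theorem ok_tensor {x y : A.Pos × B.Pos} : (A.tensor B).OK x y ↔ Step A B x y := by
  rw [OK, edge_tensor, Step, OK, OK]
  constructor
  · rintro (rfl | ⟨h, e⟩ | ⟨e, h⟩)
    · exact Or.inl ⟨Or.inl rfl, rfl⟩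
    · exact Or.inl ⟨Or.inr h, e.symm⟩
    · exact Or.inr ⟨e.symm, Or.inr h⟩
  · rintro (⟨h | h, e⟩ | ⟨e, h | h⟩)
    · exact Or.inl (Prod.ext h e)
    · exact Or.inr (Or.inl ⟨h, e.symm⟩)
    · exact Or.inl (Prod.ext e h)
    · exact Or.inr (Or.inr ⟨e.symm, h⟩)

theorem inc_tensor {x y : A.Pos × B.Pos} (h : Step A B x y) :
    (A.tensor B).inc x y = A.inc x.1 y.1 + B.inc x.2 y.2 := by
  rcases x with ⟨a, b⟩
  rcases y with ⟨a', b'⟩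
  rcases h with ⟨h, e⟩ | ⟨e, h⟩
  · dsimp only at h e; subst e
    rcases h with rfl | ⟨p, h⟩
    · exact (inc_self (G := (A.tensor B).toConwayGame) (a', b')).trans (by simp [inc_self])
    · rw [inc_self, add_zero, inc_of_move h]
      exact inc_of_move (G := (A.tensor B).toConwayGame) (Or.inl ⟨h, rfl⟩)
  · dsimp only at h e; subst e
    rcases h with rfl | ⟨p, h⟩
    · exact (inc_self (G := (A.tensor B).toConwayGame) (a', b')).trans (by simp [inc_self])
    · rw [inc_self, zero_add, inc_of_move h]
      exact inc_of_move (G := (A.tensor B).toConwayGame) (Or.inr ⟨rfl, h⟩)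

/-- The hypothesis excludes steps in which both components move: the tensor product has no such
move, and `inc` would take its default value 0 there, whatever happens in the components. -/
theorem bal_tensor {W : Type*} {a : W → A.Pos} {b : W → B.Pos} {x : W} {s : List W}
    (h : Along (fun p q => Step A B (a p, b p) (a q, b q)) x s) :
    (A.tensor B).bal (fun w => (a w, b w)) x s = A.bal a x s + B.bal b x s := by
  induction s generalizing x with
  | nil => simp
  | cons y s ih =>
    rw [bal_cons, bal_cons, bal_cons, ih h.2, inc_tensor h.1]
    ring

theorem step_dual {x y : A.Pos × B.Pos} : Step A.dual B x y ↔ Step A B x y := by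
  rw [Step, Step, ok_dual]

/-- Plays of `A* ⊗ B`, in terms of the balances of the components. -/
theorem isPlay_iff {W : Type*} {a : W → A.Pos} {b : W → B.Pos} {x : W} {u : List W}
    (ha : a x = A.root) (hb : b x = B.root) :
    (A.dual.tensor B).IsPlay (project (fun w => (a w, b w)) x u) ↔
      Along (fun p q => Step A B (a p, b p) (a q, b q)) x u ∧
      ∀ t, t <+: u → 0 ≤ B.bal b x t - A.bal a x t ∧ B.bal b x t - A.bal a x t ≤ 1 := by
  rw [isPlay_project_iff (G := (A.dual.tensor B).toConwayGame) (Prod.ext ha hb)]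
  have key : Along (fun p q => (A.dual.tensor B).OK (a p, b p) (a q, b q)) x u ↔
      Along (fun p q => Step A B (a p, b p) (a q, b q)) x u := by
    refine ⟨Along.mono fun p q h => ?_, Along.mono fun p q h => ?_⟩
    · exact step_dual.1 (ok_tensor.1 h)
    · exact ok_tensor.2 (step_dual.2 h)
  have e : ∀ t, Along (fun p q => Step A B (a p, b p) (a q, b q)) x t →
      (A.dual.tensor B).bal (fun w => (a w, b w)) x t = B.bal b x t - A.bal a x t := by
    intro t ht
    have := bal_tensor (A := A.dual) (ht.mono fun p q h => step_dual.2 h)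
    rw [bal_dual] at this
    refine this.trans ?_
    ring
  constructor
  · rintro ⟨h₁, h₂⟩
    refine ⟨key.1 h₁, fun t ht => ?_⟩
    rw [← e t ((key.1 h₁).prefix ht)]
    exact h₂ t ht
  · rintro ⟨h₁, h₂⟩
    refine ⟨key.2 h₁, fun t ht => ?_⟩
    exact (e t (h₁.prefix ht)).symm ▸ h₂ t ht

/-- The balance of `A* ⊗ B` is a difference, so a play is complete when the balances of the two
sides are equal. Parity of a composite follows by transitivity, and parity of a tensor product by
addition. -/
theorem even_iff {W : Type*} {a : W → A.Pos} {b : W → B.Pos} {x : W} {u : List W}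
    (ha : a x = A.root) (hb : b x = B.root)
    (h : (A.dual.tensor B).IsPlay (project (fun w => (a w, b w)) x u)) :
    Even (project (fun w => (a w, b w)) x u).length ↔ B.bal b x u = A.bal a x u := by
  have h₁ := ((isPlay_iff ha hb).1 h).1
  have e := even_length_project_iff (G := (A.dual.tensor B).toConwayGame) (Prod.ext ha hb) h
  refine e.trans ?_
  have := bal_tensor (A := A.dual) (h₁.mono fun p q h => step_dual.2 h)
  rw [bal_dual] at this
  rw [this]
  constructor <;> intro h <;> omega

end MBGame

/-! ## Queries initiated by a path -/

namespace MBGame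

open ConwayGame

/-- The path `s` from `x` initiates a query of polarity `p` that is pending at its end. -/
def Fresh (A : MBGame.{u}) (p : ℤˣ) (x : A.Pos) (s : List A.Pos) : Prop :=
  ∃ r, A.IsQuery p (s.getLastD x) r ∧ ¬ ∃ r₀, A.pathRes x s r₀ r

variable {A B C : MBGame.{u}}

theorem kappa_eq_zero_iff {p : ℤˣ} {x : A.Pos} {s : List A.Pos} :
    A.kappa p x s = 0 ↔ ¬ A.Fresh p x s := by
  -- `ncard` of an infinite set is 0 by convention; finiteness of the set of queries at a position
  -- excludes that reading.
  rw [kappa, Set.ncard_eq_zero ((A.query_finite (s.getLastD x)).subset fun r hr => ⟨p, hr.1⟩),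
    Set.eq_empty_iff_forall_notMem, Fresh, not_exists]
  exact Iff.rfl

theorem pathRes_query {x : A.Pos} {s : List A.Pos} {r r' : A.Query} (h : A.pathRes x s r r') :
    ∃ p, A.IsQuery p x r ∧ A.IsQuery p (s.getLastD x) r' := by
  induction s generalizing x r with
  | nil =>
    obtain ⟨rfl, p, hp⟩ := h
    exact ⟨p, hp, hp⟩
  | cons y s ih =>
    obtain ⟨r₁, h₁, h₂⟩ := h
    obtain ⟨p, hp, hp'⟩ := A.res_query h₁
    obtain ⟨q, hq, hq'⟩ := ih h₂
    rw [List.getLastD_cons]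
    obtain rfl := A.query_pol_unique hp' hq
    exact ⟨p, hp, hq'⟩

theorem not_fresh_nil {p : ℤˣ} {x : A.Pos} : ¬ A.Fresh p x [] := by
  rintro ⟨r, h, h'⟩
  exact h' ⟨r, rfl, p, h⟩

theorem Fresh.of_tail {p : ℤˣ} {x y : A.Pos} {s : List A.Pos} (h : A.Fresh p y s) :
    A.Fresh p x (y :: s) := by
  obtain ⟨r, h₁, h₂⟩ := h
  refine ⟨r, by rwa [List.getLastD_cons], ?_⟩
  rintro ⟨r₀, r₁, -, h⟩
  exact h₂ ⟨r₁, h⟩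

/-- A query that is fresh for the whole path but has an ancestor at `y` descends from a query at `y`
without ancestor at `x`. Residuals keep their polarity and a move initiates queries of its own
polarity only, so this move has polarity `p`. -/
theorem Fresh.tail_or {p : ℤˣ} {x y : A.Pos} {s : List A.Pos} (h : A.Fresh p x (y :: s))
    (hxy : A.Edge x y) : A.Fresh p y s ∨ A.Move p x y := by
  obtain ⟨r, h₁, h₂⟩ := h
  rw [List.getLastD_cons] at h₁
  by_cases e : ∃ r₀, A.pathRes y s r₀ r
  · obtain ⟨r₀, h₀⟩ := e
    obtain ⟨q, hq, hq'⟩ := pathRes_query h₀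
    obtain rfl := A.query_pol_unique h₁ hq'
    obtain ⟨q, hxy⟩ := hxy
    have := A.initiates hxy hq fun ⟨r₁, h₁⟩ => h₂ ⟨r₁, r₀, h₁, h₀⟩
    exact Or.inr (this ▸ hxy)
  · exact Or.inl ⟨r, h₁, e⟩

theorem fresh_dual {p : ℤˣ} {x : A.Pos} {s : List A.Pos} :
    A.dual.Fresh p x s ↔ A.Fresh (-p) x s := by
  have key : ∀ r r', A.dual.pathRes x s r r' ↔ A.pathRes x s r r' := by
    intro r r'
    induction s generalizing x r with
    | nil =>
      refine and_congr Iff.rfl ⟨fun ⟨p, hp⟩ => ⟨-p, hp⟩, fun ⟨p, hp⟩ => ⟨-p, ?_⟩⟩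
      change A.IsQuery (- -p) x r
      rwa [neg_neg]
    | cons y s ih => exact exists_congr fun r₁ => and_congr Iff.rfl (ih r₁)
  exact exists_congr fun r => and_congr Iff.rfl (not_congr (exists_congr fun r₀ => key r₀ r))

theorem pathRes_tensor_inl {x : A.Pos × B.Pos} {s : List (A.Pos × B.Pos)}
    (hs : (A.tensor B).IsPath x s) (r : A.Query) (r' : A.Query ⊕ B.Query) :
    (A.tensor B).pathRes x s (.inl r) r' ↔
      ∃ r₁, r' = .inl r₁ ∧ A.pathRes x.1 (project Prod.fst x s) r r₁ := by
  refine pathResidual_project A (tensorConway A B) _ _ Prod.fst Sum.inl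
    (fun _ _ _ => Iff.rfl) ?_ x s hs r r'
  rintro x y h r (r' | r')
  · exact ⟨fun h => ⟨r', rfl, h.2⟩, fun ⟨_, e, h'⟩ => by cases e; exact ⟨h, h'⟩⟩
  · exact ⟨fun h => h.elim, fun ⟨_, e, _⟩ => by cases e⟩

theorem pathRes_tensor_inr {x : A.Pos × B.Pos} {s : List (A.Pos × B.Pos)}
    (hs : (A.tensor B).IsPath x s) (r : B.Query) (r' : A.Query ⊕ B.Query) :
    (A.tensor B).pathRes x s (.inr r) r' ↔
      ∃ r₁, r' = .inr r₁ ∧ B.pathRes x.2 (project Prod.snd x s) r r₁ := by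
  refine pathResidual_project B (tensorConway A B) _ _ Prod.snd Sum.inr
    (fun _ _ _ => Iff.rfl) ?_ x s hs r r'
  rintro x y h r (r' | r')
  · exact ⟨fun h => h.elim, fun ⟨_, e, _⟩ => by cases e⟩
  · exact ⟨fun h => ⟨r', rfl, h.2⟩, fun ⟨_, e, h'⟩ => by cases e; exact ⟨h, h'⟩⟩

/-- Residuals never pass from one component to the other, and the ancestors of a query are computed
on the projection to its own component. -/
theorem fresh_tensor {p : ℤˣ} {x : A.Pos × B.Pos} {s : List (A.Pos × B.Pos)}
    (hs : (A.tensor B).IsPath x s) : (A.tensor B).Fresh p x s ↔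
      A.Fresh p x.1 (project Prod.fst x s) ∨ B.Fresh p x.2 (project Prod.snd x s) := by
  have e₁ : (project Prod.fst x s).getLastD x.1 = (s.getLastD x).1 :=
    getLastD_project Prod.fst x s
  have e₂ : (project Prod.snd x s).getLastD x.2 = (s.getLastD x).2 :=
    getLastD_project Prod.snd x s
  constructor
  · rintro ⟨r | r, h, h'⟩
    · refine Or.inl ⟨r, e₁.symm ▸ h, fun ⟨r₀, h₀⟩ => h' ⟨.inl r₀, ?_⟩⟩
      exact (pathRes_tensor_inl hs _ _).2 ⟨r, rfl, h₀⟩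
    · refine Or.inr ⟨r, e₂.symm ▸ h, fun ⟨r₀, h₀⟩ => h' ⟨.inr r₀, ?_⟩⟩
      exact (pathRes_tensor_inr hs _ _).2 ⟨r, rfl, h₀⟩
  · rintro (⟨r, h, h'⟩ | ⟨r, h, h'⟩)
    · refine ⟨.inl r, (congrArg (A.IsQuery p · r) e₁).mp h, ?_⟩
      rintro ⟨r₀ | r₀, h₀⟩
      · obtain ⟨r₁, e, h₁⟩ := (pathRes_tensor_inl hs _ _).1 h₀
        cases e
        exact h' ⟨r₀, h₁⟩
      · obtain ⟨r₁, e, h₁⟩ := (pathRes_tensor_inr hs _ _).1 h₀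
        cases e
    · refine ⟨.inr r, (congrArg (B.IsQuery p · r) e₂).mp h, ?_⟩
      rintro ⟨r₀ | r₀, h₀⟩
      · obtain ⟨r₁, e, h₁⟩ := (pathRes_tensor_inl hs _ _).1 h₀
        cases e
      · obtain ⟨r₁, e, h₁⟩ := (pathRes_tensor_inr hs _ _).1 h₀
        cases e
        exact h' ⟨r₀, h₁⟩

theorem fresh_tensor_project {W : Type*} {a : W → A.Pos} {b : W → B.Pos} {x : W} {u : List W}
    (h : Along (fun p q => Step A B (a p, b p) (a q, b q)) x u) (p : ℤˣ) :
    (A.tensor B).Fresh p (a x, b x) (project (fun w => (a w, b w)) x u) ↔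
      A.Fresh p (a x) (project a x u) ∨ B.Fresh p (b x) (project b x u) := by
  have hs : (A.tensor B).IsPath (a x, b x) (project (fun w => (a w, b w)) x u) := by
    rw [isPath_iff, along_project (fun w => (a w, b w))]
    exact h.mono fun p q h => ok_tensor.2 h
  rw [fresh_tensor hs]
  have e₁ := project_project (fun w => (a w, b w)) Prod.fst x u
  have e₂ := project_project (fun w => (a w, b w)) Prod.snd x u
  dsimp only at e₁ e₂
  rw [e₁, e₂]

theorem fresh_arrow {W : Type*} {a : W → A.Pos} {b : W → B.Pos} {x : W} {u : List W}
    (h : Along (fun p q => Step A B (a p, b p) (a q, b q)) x u) (p : ℤˣ) :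
    (A.dual.tensor B).Fresh p (a x, b x) (project (fun w => (a w, b w)) x u) ↔
      A.Fresh (-p) (a x) (project a x u) ∨ B.Fresh p (b x) (project b x u) := by
  rw [fresh_tensor_project (A := A.dual) (h.mono fun p q h => step_dual.2 h), fresh_dual]

/-- Fresh queries of a projected path, and the first step of the path. -/
theorem Fresh.project_cons {W : Type*} {a : W → A.Pos} {x y : W} {u : List W} {p : ℤˣ}
    (hxy : A.OK (a x) (a y)) (h : A.Fresh p (a x) (project a x (y :: u))) :
    A.Fresh p (a y) (project a y u) ∨ A.Move p (a x) (a y) := by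
  rcases hxy with e | e
  · rw [project_cons_of_eq e, ← e] at h
    exact Or.inl h
  · rw [project_cons_of_ne e.ne] at h
    exact h.tail_or e

theorem Fresh.project_of_tail {W : Type*} {a : W → A.Pos} {x y : W} {u : List W} {p : ℤˣ}
    (h : A.Fresh p (a y) (project a y u)) : A.Fresh p (a x) (project a x (y :: u)) := by
  by_cases e : a y = a x
  · rw [project_cons_of_eq e, ← e]
    exact h
  · rw [project_cons_of_ne e]
    exact h.of_tail

theorem IsAlternating.move_of_append {G : ConwayGame.{u}} {p : ℤˣ} {x y : G.Pos}
    {s t : List G.Pos} (h : G.IsAlternating p x (s ++ y :: t)) :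
    G.Move (if Even s.length then p else -p) (s.getLastD x) y := by
  induction s generalizing x p with
  | nil => simpa using h.1
  | cons z s ih =>
    have := ih h.2
    rw [List.getLastD_cons, List.length_cons]
    by_cases e : Even s.length
    · rw [if_pos e] at this
      rwa [if_neg (by simpa [Nat.even_add_one] using e)]
    · rw [if_neg e, neg_neg] at this
      rwa [if_pos (by simpa [Nat.even_add_one] using e)]

/-- The definition tests suffixes that begin with an Opponent move. It extends to all suffixes: an
Opponent query that is fresh for a suffix beginning with a Player move is not initiated by that
move, hence is fresh for the shorter suffix, to which the definition applies. Only the existence of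
fresh queries matters, not their number. -/
theorem wellBracketed_iff (σ : Strategy A.toConwayGame) : A.WellBracketed σ ↔
    ∀ s t, s ++ t ∈ σ.plays → A.Fresh (-1) (s.getLastD A.root) t →
      A.Fresh 1 (s.getLastD A.root) t := by
  constructor
  · intro h s t hst ht
    induction t generalizing s with
    | nil => exact (not_fresh_nil ht).elim
    | cons y t ih =>
      have hm := IsAlternating.move_of_append (σ.isPlay _ hst)
      have he := σ.even_length _ hst
      by_cases e : Even s.length
      · rw [if_pos e] at hm
        rcases List.eq_nil_or_concat t with rfl | ⟨t, z, rfl⟩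
        · simp [Nat.even_add_one, e] at he
        · rw [List.concat_eq_append] at hst ht ⊢
          by_contra hc
          have := h s y t z hst hm (kappa_eq_zero_iff.2 hc)
          exact kappa_eq_zero_iff.1 this ht
      · rw [if_neg e, neg_neg] at hm
        rcases ht.tail_or ⟨_, hm⟩ with h' | h'
        · have := ih (s ++ [y]) (by simpa using hst)
          rw [getLastD_append] at this
          exact (this h').of_tail
        · exact absurd (A.pol_unique hm h') (by decide)
  · intro h s y t z hst _ h1
    rw [kappa_eq_zero_iff] at h1 ⊢
    exact fun h2 => h1 (h s _ hst h2)

end MBGame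

/-! ## Coherence of lists: an equational form of determinism -/

/-- Two lists of alternating moves of which the first elements that differ, if there are any, are
Opponent moves; the first moves are Proponent moves if `k = 1`, and Opponent moves if `k = 0`. -/
def Coh {X : Type*} : ℤ → List X → List X → Prop
  | k, y :: s, y' :: s' => (k = 1 → y = y') ∧ (y = y' → Coh (1 - k) s s')
  | _, _, _ => True

section

variable {X : Type*}

@[simp] theorem coh_nil_left (k : ℤ) (s : List X) : Coh k [] s := by
  cases s <;> trivial

@[simp] theorem coh_nil_right (k : ℤ) (s : List X) : Coh k s [] := by
  cases s <;> trivial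

@[simp] theorem coh_cons_cons (k : ℤ) (y y' : X) (s s' : List X) :
    Coh k (y :: s) (y' :: s') ↔ (k = 1 → y = y') ∧ (y = y' → Coh (1 - k) s s') := Iff.rfl

theorem Coh.of_append {k : ℤ} {s t t' : List X} (h : Coh k (s ++ t) (s ++ t')) :
    Coh (if Even s.length then k else 1 - k) t t' := by
  induction s generalizing k with
  | nil => simpa using h
  | cons y s ih =>
    have := ih (h.2 rfl)
    rw [List.length_cons]
    by_cases e : Even s.length
    · rw [if_pos e] at this
      rwa [if_neg (by simpa [Nat.even_add_one] using e)]
    · rw [if_neg e, sub_sub_cancel] at this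
      rwa [if_pos (by simpa [Nat.even_add_one] using e)]

end

namespace Strategy

variable {G : ConwayGame.{u}} (σ : Strategy G)

theorem prefix_mem {s : List G.Pos} (hs : Even s.length) (t : List G.Pos)
    (h : s ++ t ∈ σ.plays) : s ∈ σ.plays := by
  have ht : Even t.length := by
    have := σ.even_length _ h
    rw [List.length_append, Nat.even_add] at this
    exact this.1 hs
  obtain ⟨n, hn⟩ := ht
  induction n generalizing t with
  | zero =>
    obtain rfl : t = [] := List.length_eq_zero_iff.1 (by omega)
    simpa using h
  | succ n ih =>
    obtain ⟨t', y, z, rfl⟩ : ∃ t' y z, t = t' ++ [y, z] := by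
      rcases List.eq_nil_or_concat t with rfl | ⟨t, z, rfl⟩
      · simp at hn
      · rw [List.length_concat] at hn
        rcases List.eq_nil_or_concat t with rfl | ⟨t, y, rfl⟩
        · simp at hn; omega
        · exact ⟨t, y, z, by simp⟩
    refine ih t' (σ.prefix_closed _ y z (by simpa using h)) ?_
    simp at hn
    omega

/-- Two plays of a deterministic strategy can part only at an Opponent move. Stated for two whole
lists, determinism can be propagated by induction along two interactions at once. -/
theorem coh {s s' : List G.Pos} (hs : s ∈ σ.plays) (hs' : s' ∈ σ.plays) : Coh 0 s s' := by
  -- The common past `h` is kept, so that prefix closure and determinism of `σ` can be applied to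
  -- the next exchange.
  suffices key : ∀ (n : ℕ) (h s s' : List G.Pos), s.length ≤ n → Even h.length →
      h ++ s ∈ σ.plays → h ++ s' ∈ σ.plays → Coh 0 s s' from
    key _ [] s s' le_rfl (by simp) hs hs'
  intro n
  induction n using Nat.strong_induction_on with
  | _ n ih =>
    intro h s s' hn hh hs hs'
    match s, s' with
    | [], _ => simp
    | _ :: _, [] => simp
    | [y], y' :: s' => simp
    | y :: z :: s, [y'] => simp
    | y :: z :: s, y' :: z' :: s' =>
      rw [coh_cons_cons]
      refine ⟨by simp, ?_⟩
      rintro rfl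
      have h₁ : h ++ [y, z] ∈ σ.plays :=
        σ.prefix_mem (by simpa [Nat.even_add] using hh) s (by simpa using hs)
      have h₂ : h ++ [y, z'] ∈ σ.plays :=
        σ.prefix_mem (by simpa [Nat.even_add] using hh) s' (by simpa using hs')
      obtain rfl := σ.deterministic _ _ _ _ h₁ h₂
      rw [coh_cons_cons]
      refine ⟨fun _ => rfl, fun _ => ?_⟩
      have := ih s.length (by simp at hn; omega) (h ++ [y, z]) s s' le_rfl
        (by simpa [Nat.even_add] using hh) (by simpa using hs) (by simpa using hs')
      simpa using this

end Strategy

/-! ## Strategies as sets of plays -/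

namespace MBGame

open ConwayGame

/-- A set of plays is a well-bracketed strategy of `A* ⊗ B`. -/
structure IsStrat (A B : MBGame.{u}) (S : Set (List (A.Pos × B.Pos))) : Prop where
  isPlay : ∀ s ∈ S, (A.dual.tensor B).IsPlay s
  even : ∀ s ∈ S, Even s.length
  nil : [] ∈ S
  prefix_mem : ∀ s t, Even s.length → s ++ t ∈ S → s ∈ S
  coh : ∀ s ∈ S, ∀ t ∈ S, Coh 0 s t
  bracket : ∀ s t, s ++ t ∈ S → (A.dual.tensor B).Fresh (-1) (s.getLastD (A.root, B.root)) t →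
    (A.dual.tensor B).Fresh 1 (s.getLastD (A.root, B.root)) t

variable {A B C D : MBGame.{u}}

/-- The set of plays of a morphism. -/
def Hom.set (σ : Hom A B) : Set (List (A.Pos × B.Pos)) := σ.plays

theorem Hom.isStrat (σ : Hom A B) : IsStrat A B σ.set where
  isPlay := σ.isPlay
  even := σ.even_length
  nil := σ.nil_mem
  prefix_mem s t hs h := σ.toStrategy.prefix_mem (s := s) hs t h
  coh _ hs _ ht := σ.toStrategy.coh hs ht
  bracket := (wellBracketed_iff _).1 σ.wellBracketed

theorem Hom.ext_set {σ τ : Hom A B} (h : σ.set = τ.set) : σ = τ := Hom.ext h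

/-- The morphism with a given set of plays. -/
def IsStrat.hom {S : Set (List (A.Pos × B.Pos))} (h : IsStrat A B S) : Hom A B where
  plays := S
  isPlay := h.isPlay
  even_length := h.even
  nil_mem := h.nil
  prefix_closed s y z hs := h.prefix_mem s [y, z] (by
    have := h.even _ hs
    simpa [Nat.even_add] using this) hs
  deterministic s y z z' hs hs' := by
    have e : Even s.length := by
      have := h.even _ hs
      simpa [Nat.even_add] using this
    have := (h.coh _ hs _ hs').of_append
    rw [if_pos e] at this
    have := this.2 rfl
    exact this.1 (by simp)
  wellBracketed := (wellBracketed_iff _).2 h.bracket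

end MBGame

/-! ## Composition of sets of traces -/

section Traces

variable {A B C D : Type*}

/-- The composite of two sets of traces: restrictions of the interactions. -/
def compTr (a : A) (b : B) (c : C) (S : Set (List (A × B))) (T : Set (List (B × C))) :
    Set (List (A × C)) :=
  {s | ∃ u : List (A × B × C), project (fun x => (x.1, x.2.1)) (a, b, c) u ∈ S ∧
    project (fun x => (x.2.1, x.2.2)) (a, b, c) u ∈ T ∧
    project (fun x => (x.1, x.2.2)) (a, b, c) u = s}

/-- Interactions may be lists over any type `W` with maps to the three games. One list can then
serve for the interactions of several composites. -/
theorem mem_compTr_of_list {a : A} {b : B} {c : C} {S : Set (List (A × B))}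
    {T : Set (List (B × C))} {W : Type*} {x : W} {w : List W} {f : W → A} {g : W → B} {h : W → C}
    (ha : f x = a) (hb : g x = b) (hc : h x = c)
    (hS : project (fun p => (f p, g p)) x w ∈ S) (hT : project (fun p => (g p, h p)) x w ∈ T) :
    project (fun p => (f p, h p)) x w ∈ compTr a b c S T := by
  subst ha hb hc
  have e := project_map (fun p => (f p, g p, h p)) (fun x => (x.1, x.2.1)) x w
  have e' := project_map (fun p => (f p, g p, h p)) (fun x => (x.2.1, x.2.2)) x w
  have e'' := project_map (fun p => (f p, g p, h p)) (fun x => (x.1, x.2.2)) x w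
  dsimp only at e e' e''
  exact ⟨w.map fun p => (f p, g p, h p), e ▸ hS, e' ▸ hT, e''⟩

/-- Interactions of three sets of traces, composed from the left. -/
theorem exists_of_mem_compTr_left {a : A} {b : B} {c : C} {d : D} {S : Set (List (A × B))}
    {T : Set (List (B × C))} {U : Set (List (C × D))} {M : Set (List (A × C))}
    {s : List (A × D)} (hs : s ∈ compTr a c d (compTr a b c S T ∩ M) U) :
    ∃ w : List (A × B × C × D), project (fun x => (x.1, x.2.1)) (a, b, c, d) w ∈ S ∧
      project (fun x => (x.2.1, x.2.2.1)) (a, b, c, d) w ∈ T ∧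
      project (fun x => (x.2.2.1, x.2.2.2)) (a, b, c, d) w ∈ U ∧
      project (fun x => (x.1, x.2.2.1)) (a, b, c, d) w ∈ M ∧
      project (fun x => (x.1, x.2.2.2)) (a, b, c, d) w = s ∧
      Along (fun p q => q.2.1 = p.2.1 ∨ q.2.2.2 = p.2.2.2 ∨ (q.1, q.2.2.1) ≠ (p.1, p.2.2.1))
        (a, b, c, d) w := by
  obtain ⟨v, ⟨⟨u, hu₁, hu₂, hu₃⟩, hM⟩, hv, rfl⟩ := hs
  obtain ⟨w, h₁, h₂, h₃, h₄⟩ := exists_amalgam (fun x : A × B × C => (x.1, x.2.2))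
    (fun x : A × C × D => (x.1, x.2.1)) (a, b, c) (a, c, d) rfl u v hu₃
  let θ : (A × B × C) × (A × C × D) → A × B × C × D :=
    fun p => (p.1.1, p.1.2.1, p.1.2.2, p.2.2.2)
  have h₄' : ∀ p ∈ w, p.1.1 = p.2.1 ∧ p.1.2.2 = p.2.2.1 :=
    fun p hp => ⟨congrArg Prod.fst (h₄ p hp), congrArg Prod.snd (h₄ p hp)⟩
  refine ⟨w.map θ, ?_, ?_, ?_, ?_, ?_, ?_⟩
  · rw [project_map θ _ ((a, b, c), (a, c, d))]
    exact (project_comp_of_eq (x := ((a, b, c), (a, c, d))) h₁ fun x => (x.1, x.2.1)) ▸ hu₁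
  · rw [project_map θ _ ((a, b, c), (a, c, d))]
    exact (project_comp_of_eq (x := ((a, b, c), (a, c, d))) h₁ fun x => (x.2.1, x.2.2)) ▸ hu₂
  · rw [project_map θ _ ((a, b, c), (a, c, d))]
    rw [project_congr (π := fun p => (p.1.2.2, p.2.2.2))
      (π' := fun p => (p.2.2.1, p.2.2.2)) rfl
      fun p hp => Prod.ext (h₄' p hp).2 rfl]
    exact (project_comp_of_eq (x := ((a, b, c), (a, c, d))) h₂ fun x => (x.2.1, x.2.2)) ▸ hv
  · rw [project_map θ _ ((a, b, c), (a, c, d))]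
    rw [project_congr (π' := fun p => (p.2.1, p.2.2.1)) rfl h₄]
    exact (project_comp_of_eq (x := ((a, b, c), (a, c, d))) h₂ fun x => (x.1, x.2.1)) ▸ hM
  · rw [project_map θ _ ((a, b, c), (a, c, d))]
    rw [project_congr (π := fun p => (p.1.1, p.2.2.2))
      (π' := fun p => (p.2.1, p.2.2.2)) rfl
      fun p hp => Prod.ext (h₄' p hp).1 rfl]
    exact project_comp_of_eq (x := ((a, b, c), (a, c, d))) h₂ fun x => (x.1, x.2.2)
  · refine (along_map θ ((a, b, c), (a, c, d)) w).2 (h₃.mono fun p q h => ?_)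
    rcases h with h | h | h
    · exact Or.inl (by simp only [θ, h])
    · exact Or.inr (Or.inl (by simp only [θ, h]))
    · exact Or.inr (Or.inr h)

/-- Interactions of three sets of traces, composed from the right. -/
theorem exists_of_mem_compTr_right {a : A} {b : B} {c : C} {d : D} {S : Set (List (A × B))}
    {T : Set (List (B × C))} {U : Set (List (C × D))} {M : Set (List (B × D))}
    {s : List (A × D)} (hs : s ∈ compTr a b d S (compTr b c d T U ∩ M)) :
    ∃ w : List (A × B × C × D), project (fun x => (x.1, x.2.1)) (a, b, c, d) w ∈ S ∧
      project (fun x => (x.2.1, x.2.2.1)) (a, b, c, d) w ∈ T ∧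
      project (fun x => (x.2.2.1, x.2.2.2)) (a, b, c, d) w ∈ U ∧
      project (fun x => (x.2.1, x.2.2.2)) (a, b, c, d) w ∈ M ∧
      project (fun x => (x.1, x.2.2.2)) (a, b, c, d) w = s ∧
      Along (fun p q => q.2.2.1 = p.2.2.1 ∨ q.1 = p.1 ∨ (q.2.1, q.2.2.2) ≠ (p.2.1, p.2.2.2))
        (a, b, c, d) w := by
  obtain ⟨v, hv, ⟨⟨u, hu₁, hu₂, hu₃⟩, hM⟩, rfl⟩ := hs
  obtain ⟨w, h₁, h₂, h₃, h₄⟩ := exists_amalgam (fun x : B × C × D => (x.1, x.2.2))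
    (fun x : A × B × D => (x.2.1, x.2.2)) (b, c, d) (a, b, d) rfl u v hu₃
  let θ : (B × C × D) × (A × B × D) → A × B × C × D :=
    fun p => (p.2.1, p.1.1, p.1.2.1, p.1.2.2)
  have h₄' : ∀ p ∈ w, p.1.1 = p.2.2.1 ∧ p.1.2.2 = p.2.2.2 :=
    fun p hp => ⟨congrArg Prod.fst (h₄ p hp), congrArg Prod.snd (h₄ p hp)⟩
  refine ⟨w.map θ, ?_, ?_, ?_, ?_, ?_, ?_⟩
  · rw [project_map θ _ ((b, c, d), (a, b, d))]
    rw [project_congr (π := fun p => (p.2.1, p.1.1))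
      (π' := fun p => (p.2.1, p.2.2.1)) rfl
      fun p hp => Prod.ext rfl (h₄' p hp).1]
    exact (project_comp_of_eq (x := ((b, c, d), (a, b, d))) h₂ fun x => (x.1, x.2.1)) ▸ hv
  · rw [project_map θ _ ((b, c, d), (a, b, d))]
    exact (project_comp_of_eq (x := ((b, c, d), (a, b, d))) h₁ fun x => (x.1, x.2.1)) ▸ hu₁
  · rw [project_map θ _ ((b, c, d), (a, b, d))]
    exact (project_comp_of_eq (x := ((b, c, d), (a, b, d))) h₁ fun x => (x.2.1, x.2.2)) ▸ hu₂
  · rw [project_map θ _ ((b, c, d), (a, b, d))]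
    rw [project_congr (π' := fun p => (p.2.2.1, p.2.2.2)) rfl h₄]
    exact (project_comp_of_eq (x := ((b, c, d), (a, b, d))) h₂ fun x => (x.2.1, x.2.2)) ▸ hM
  · rw [project_map θ _ ((b, c, d), (a, b, d))]
    rw [project_congr (π := fun p => (p.2.1, p.1.2.2))
      (π' := fun p => (p.2.1, p.2.2.2)) rfl
      fun p hp => Prod.ext rfl (h₄' p hp).2]
    exact project_comp_of_eq (x := ((b, c, d), (a, b, d))) h₂ fun x => (x.1, x.2.2)
  · refine (along_map θ ((b, c, d), (a, b, d)) w).2 (h₃.mono fun p q h => ?_)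
    rcases h with h | h | h
    · exact Or.inl (by simp only [θ, h])
    · exact Or.inr (Or.inl (by simp only [θ, h]))
    · exact Or.inr (Or.inr h)

/-- Both sides consist of the external traces of interactions on all four types: such an interaction
is obtained by amalgamating the two nested ones over the projection that they share. No alternation
is involved. -/
theorem compTr_assoc (a : A) (b : B) (c : C) (d : D) (S : Set (List (A × B)))
    (T : Set (List (B × C))) (U : Set (List (C × D))) :
    compTr a c d (compTr a b c S T) U = compTr a b d S (compTr b c d T U) := by
  apply Set.Subset.antisymm
  · intro s hs
    rw [← Set.inter_univ (compTr a b c S T)] at hs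
    obtain ⟨w, h₁, h₂, h₃, -, rfl, -⟩ := exists_of_mem_compTr_left hs
    exact mem_compTr_of_list rfl rfl rfl h₁ (mem_compTr_of_list rfl rfl rfl h₂ h₃)
  · intro s hs
    rw [← Set.inter_univ (compTr b c d T U)] at hs
    obtain ⟨w, h₁, h₂, h₃, -, rfl, -⟩ := exists_of_mem_compTr_right hs
    exact mem_compTr_of_list rfl rfl rfl (mem_compTr_of_list rfl rfl rfl h₁ h₂) h₃

end Traces

namespace MBGame

open ConwayGame

variable {A B C D : MBGame.{u}}

/-- The alternating plays of `A* ⊗ B`. -/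
def Plays (A B : MBGame.{u}) : Set (List (A.Pos × B.Pos)) := {s | (A.dual.tensor B).IsPlay s}

theorem compPlays_eq (S : Set (List (A.Pos × B.Pos))) (T : Set (List (B.Pos × C.Pos))) :
    compPlays A B C S T = compTr A.root B.root C.root S T ∩ Plays A C := by
  ext s
  constructor
  · rintro ⟨u, h₁, h₂, h₃, h₄⟩
    exact ⟨⟨u, h₁, h₂, h₃⟩, h₄⟩
  · rintro ⟨⟨u, h₁, h₂, h₃⟩, h₄⟩
    exact ⟨u, h₁, h₂, h₃, h₄⟩

/-- Compared with `compTr_assoc`, the new intermediate trace must also be an alternating play. If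
the balances along the interaction satisfy `a ≤ b ≤ c ≤ d ≤ a + 1`, the bounds needed for the pair
`B`, `D` or the pair `A`, `C` are immediate. That the two games of this pair do not move together is
due to the clause of the amalgamation about simultaneous steps. -/
theorem compPlays_assoc {S : Set (List (A.Pos × B.Pos))} {T : Set (List (B.Pos × C.Pos))}
    {U : Set (List (C.Pos × D.Pos))} (hS : S ⊆ Plays A B) (hT : T ⊆ Plays B C)
    (hU : U ⊆ Plays C D) :
    compPlays A C D (compPlays A B C S T) U = compPlays A B D S (compPlays B C D T U) := by
  simp only [compPlays_eq]
  apply Set.Subset.antisymm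
  · rintro s ⟨hs, hs'⟩
    obtain ⟨w, h₁, h₂, h₃, h₄, rfl, h₅⟩ := exists_of_mem_compTr_left hs
    refine ⟨mem_compTr_of_list rfl rfl rfl h₁ ⟨mem_compTr_of_list rfl rfl rfl h₂ h₃, ?_⟩, hs'⟩
    obtain ⟨a₁, b₁⟩ := (isPlay_iff rfl rfl).1 (hS h₁)
    obtain ⟨a₂, b₂⟩ := (isPlay_iff rfl rfl).1 (hT h₂)
    obtain ⟨a₃, b₃⟩ := (isPlay_iff rfl rfl).1 (hU h₃)
    obtain ⟨a₄, b₄⟩ := (isPlay_iff rfl rfl).1 h₄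
    obtain ⟨a₅, b₅⟩ := (isPlay_iff rfl rfl).1 hs'
    refine (isPlay_iff rfl rfl).2 ⟨?_, fun t ht => ?_⟩
    · refine (((a₁.and a₂).and (a₃.and a₄)).and h₅).mono ?_
      rintro ⟨a, b, c, d⟩ ⟨a', b', c', d'⟩ h
      simp only [Step, Prod.mk.injEq, ne_eq] at h ⊢
      tauto
    · have := b₁ t ht; have := b₂ t ht; have := b₃ t ht; have := b₅ t ht
      omega
  · rintro s ⟨hs, hs'⟩
    obtain ⟨w, h₁, h₂, h₃, h₄, rfl, h₅⟩ := exists_of_mem_compTr_right hs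
    refine ⟨mem_compTr_of_list rfl rfl rfl ⟨mem_compTr_of_list rfl rfl rfl h₁ h₂, ?_⟩ h₃, hs'⟩
    obtain ⟨a₁, b₁⟩ := (isPlay_iff rfl rfl).1 (hS h₁)
    obtain ⟨a₂, b₂⟩ := (isPlay_iff rfl rfl).1 (hT h₂)
    obtain ⟨a₃, b₃⟩ := (isPlay_iff rfl rfl).1 (hU h₃)
    obtain ⟨a₄, b₄⟩ := (isPlay_iff rfl rfl).1 h₄
    obtain ⟨a₅, b₅⟩ := (isPlay_iff rfl rfl).1 hs'
    refine (isPlay_iff rfl rfl).2 ⟨?_, fun t ht => ?_⟩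
    · refine (((a₁.and a₂).and (a₃.and a₄)).and h₅).mono ?_
      rintro ⟨a, b, c, d⟩ ⟨a', b', c', d'⟩ h
      simp only [Step, Prod.mk.injEq, ne_eq] at h ⊢
      tauto
    · have := b₁ t ht; have := b₂ t ht; have := b₃ t ht; have := b₅ t ht
      omega

/-! ## Interactions of two strategies -/

/-- The steps of an interaction on `A`, `B`, `C`; the numbers say which of the two strategies has
to play. -/
inductive Trans (A B C : MBGame.{u}) : ℤ → ℤ → A.Pos × B.Pos × C.Pos → ℤ → ℤ →
    A.Pos × B.Pos × C.Pos → Prop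
  | askA {a a' b c} (h : A.Move 1 a a') : Trans A B C 0 0 (a, b, c) 1 0 (a', b, c)
  | askC {a b c c'} (h : C.Move (-1) c c') : Trans A B C 0 0 (a, b, c) 0 1 (a, b, c')
  | answerA {a a' b c} (h : A.Move (-1) a a') : Trans A B C 1 0 (a, b, c) 0 0 (a', b, c)
  | moveB {a b b' c} (h : B.Move 1 b b') : Trans A B C 1 0 (a, b, c) 0 1 (a, b', c)
  | moveB' {a b b' c} (h : B.Move (-1) b b') : Trans A B C 0 1 (a, b, c) 1 0 (a, b', c)
  | answerC {a b c c'} (h : C.Move 1 c c') : Trans A B C 0 1 (a, b, c) 0 0 (a, b, c')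

/-- Interactions. -/
def Inter (A B C : MBGame.{u}) : ℤ → ℤ → A.Pos × B.Pos × C.Pos →
    List (A.Pos × B.Pos × C.Pos) → Prop
  | _, _, _, [] => True
  | i, j, x, y :: u => ∃ i' j', Trans A B C i j x i' j' y ∧ Inter A B C i' j' y u

/-- The states `i` and `j` are the balances of `A* ⊗ B` and of `B* ⊗ C`. They are nonnegative, and
their sum, which is the balance of `A* ⊗ C`, is at most one. This leaves three states, and in each
of them the moves that keep the bounds are those of `Trans`. -/
theorem inter_of_bounds {i j : ℤ} {x : A.Pos × B.Pos × C.Pos} {u : List (A.Pos × B.Pos × C.Pos)}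
    (h₀ : NoStutter x u)
    (h₁ : Along (fun p q => Step A B (p.1, p.2.1) (q.1, q.2.1)) x u)
    (h₂ : Along (fun p q => Step B C (p.2.1, p.2.2) (q.2.1, q.2.2)) x u)
    (h₃ : Along (fun p q => Step A C (p.1, p.2.2) (q.1, q.2.2)) x u)
    (h₄ : ∀ t, t <+: u → 0 ≤ i + (B.bal (fun p => p.2.1) x t - A.bal (fun p => p.1) x t) ∧
      0 ≤ j + (C.bal (fun p => p.2.2) x t - B.bal (fun p => p.2.1) x t) ∧
      i + j + (C.bal (fun p => p.2.2) x t - A.bal (fun p => p.1) x t) ≤ 1) :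
    Inter A B C i j x u := by
  induction u generalizing x i j with
  | nil => trivial
  | cons y u ih =>
    obtain ⟨a, b, c⟩ := x
    obtain ⟨a', b', c'⟩ := y
    have e₀ := h₄ [] (by simp)
    have e₁ := h₄ [(a', b', c')] (by simp)
    simp only [bal_cons, bal_nil, add_zero, sub_zero] at e₀ e₁
    have key : ∀ i' j', i' = i + (B.inc b b' - A.inc a a') → j' = j + (C.inc c c' - B.inc b b') →
        Inter A B C i' j' (a', b', c') u := by
      rintro i' j' rfl rfl
      refine ih h₀.2 h₁.2 h₂.2 h₃.2 fun t ht => ?_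
      have := h₄ ((a', b', c') :: t) (by simpa using ht)
      simp only [bal_cons] at this
      omega
    have s₀ := h₀.1
    have s₁ := h₁.1
    have s₂ := h₂.1
    have s₃ := h₃.1
    simp only [Step, OK, ne_eq, Prod.mk.injEq] at s₀ s₁ s₂ s₃
    -- Each of the three projections forbids two of the games to move together, and the interaction
    -- does not stutter: exactly one game moves.
    have cases : (A.Edge a a' ∧ b' = b ∧ c' = c) ∨ (a' = a ∧ B.Edge b b' ∧ c' = c) ∨
        (a' = a ∧ b' = b ∧ C.Edge c c') := by tauto
    clear s₀ s₁ s₂ s₃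
    rcases cases with ⟨h, rfl, rfl⟩ | ⟨rfl, h, rfl⟩ | ⟨rfl, rfl, h⟩
    · rw [inc_self, inc_self] at e₁ key
      rcases h.cases with h | h
      · rw [inc_of_opp h] at e₁ key
        obtain rfl : i = 1 := by omega
        obtain rfl : j = 0 := by omega
        exact ⟨0, 0, .answerA h, key _ _ (by omega) (by omega)⟩
      · rw [inc_of_prop h] at e₁ key
        obtain rfl : i = 0 := by omega
        obtain rfl : j = 0 := by omega
        exact ⟨1, 0, .askA h, key _ _ (by omega) (by omega)⟩
    · rw [inc_self, inc_self] at e₁ key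
      rcases h.cases with h | h
      · rw [inc_of_opp h] at e₁ key
        obtain rfl : i = 0 := by omega
        obtain rfl : j = 1 := by omega
        exact ⟨1, 0, .moveB' h, key _ _ (by omega) (by omega)⟩
      · rw [inc_of_prop h] at e₁ key
        obtain rfl : i = 1 := by omega
        obtain rfl : j = 0 := by omega
        exact ⟨0, 1, .moveB h, key _ _ (by omega) (by omega)⟩
    · rw [inc_self, inc_self] at e₁ key
      rcases h.cases with h | h
      · rw [inc_of_opp h] at e₁ key
        obtain rfl : i = 0 := by omega
        obtain rfl : j = 0 := by omega
        exact ⟨0, 1, .askC h, key _ _ (by omega) (by omega)⟩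
      · rw [inc_of_prop h] at e₁ key
        obtain rfl : i = 0 := by omega
        obtain rfl : j = 1 := by omega
        exact ⟨0, 0, .answerC h, key _ _ (by omega) (by omega)⟩

/-- An interaction may be assumed not to stutter. -/
theorem exists_inter {S : Set (List (A.Pos × B.Pos))} {T : Set (List (B.Pos × C.Pos))}
    (hS : S ⊆ Plays A B) (hT : T ⊆ Plays B C) {s : List (A.Pos × C.Pos)}
    (hs : s ∈ compPlays A B C S T) :
    ∃ u : List (A.Pos × B.Pos × C.Pos), Inter A B C 0 0 (A.root, B.root, C.root) u ∧
      project (fun x => (x.1, x.2.1)) (A.root, B.root, C.root) u ∈ S ∧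
      project (fun x => (x.2.1, x.2.2)) (A.root, B.root, C.root) u ∈ T ∧
      project (fun x => (x.1, x.2.2)) (A.root, B.root, C.root) u = s := by
  obtain ⟨u, h₁, h₂, rfl, h₄⟩ := hs
  obtain ⟨v, hv, hvu⟩ : ∃ v, NoStutter (A.root, B.root, C.root) v ∧
      project (fun x => x) (A.root, B.root, C.root) v =
        project (fun x => x) (A.root, B.root, C.root) u :=
    ⟨_, noStutter_project (fun x => x) _ u, project_project (fun x => x) (fun x => x) _ u⟩
  have e : ∀ {Y : Type u} (f : A.Pos × B.Pos × C.Pos → Y),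
      project f (A.root, B.root, C.root) v = project f (A.root, B.root, C.root) u :=
    fun f => project_comp_of_eq hvu f
  rw [← e] at h₁ h₂ h₄
  refine ⟨v, ?_, h₁, h₂, e _⟩
  obtain ⟨a₁, b₁⟩ := (isPlay_iff (a := fun p : A.Pos × B.Pos × C.Pos => p.1) rfl rfl).1 (hS h₁)
  obtain ⟨a₂, b₂⟩ := (isPlay_iff rfl rfl).1 (hT h₂)
  obtain ⟨a₃, b₃⟩ := (isPlay_iff (a := fun p : A.Pos × B.Pos × C.Pos => p.1) rfl rfl).1 h₄
  refine inter_of_bounds hv a₁ a₂ a₃ fun t ht => ?_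
  have := b₁ t ht; have := b₂ t ht; have := b₃ t ht
  omega

/-- While one of the strategies is to move, its own coherence forces the same step on the two
interactions, be it hidden or visible. When neither is to move, the step is a visible Opponent move.
The first visible difference is therefore due to Opponent. -/
theorem Inter.coh {i j : ℤ} {x : A.Pos × B.Pos × C.Pos} {u u' : List (A.Pos × B.Pos × C.Pos)}
    (hu : Inter A B C i j x u) (hu' : Inter A B C i j x u')
    (h₁ : Coh i (project (fun x => (x.1, x.2.1)) x u) (project (fun x => (x.1, x.2.1)) x u'))
    (h₂ : Coh j (project (fun x => (x.2.1, x.2.2)) x u) (project (fun x => (x.2.1, x.2.2)) x u')) :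
    Coh (i + j) (project (fun x => (x.1, x.2.2)) x u) (project (fun x => (x.1, x.2.2)) x u') := by
  induction u generalizing x i j u' with
  | nil => simp [project_nil]
  | cons y u ih =>
    cases u' with
    | nil => simp [project_nil]
    | cons y' u' =>
      obtain ⟨i₁, j₁, t, hu⟩ := hu
      obtain ⟨i₂, j₂, t', hu'⟩ := hu'
      cases t with
      | askA h =>
        cases t' with
        | askA h' =>
          simp only [project, Prod.mk.injEq, h.ne, h'.ne, and_true, if_false, if_true,
            coh_cons_cons] at h₁ h₂ ⊢
          refine ⟨by simp, ?_⟩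
          rintro rfl
          exact ih hu hu' (h₁.2 rfl) h₂
        | askC h' => simp [project, h.ne, h'.ne]
      | askC h =>
        cases t' with
        | askA h' => simp [project, h.ne, h'.ne]
        | askC h' =>
          simp only [project, Prod.mk.injEq, h.ne, h'.ne, and_false, if_false, if_true,
            true_and, coh_cons_cons] at h₁ h₂ ⊢
          refine ⟨by simp, ?_⟩
          rintro rfl
          exact ih hu hu' h₁ (h₂.2 rfl)
      | answerA h =>
        cases t' with
        | answerA h' =>
          simp only [project, Prod.mk.injEq, h.ne, h'.ne, and_true, if_false, if_true,
            coh_cons_cons] at h₁ h₂ ⊢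
          obtain rfl := h₁.1 trivial
          exact ⟨fun _ => rfl, fun _ => ih hu hu' (h₁.2 rfl) h₂⟩
        | moveB h' =>
          simp [project, h.ne, h'.ne, h'.ne.symm] at h₁
      | moveB h =>
        cases t' with
        | answerA h' => simp [project, h.ne, h'.ne, h'.ne.symm] at h₁
        | moveB h' =>
          simp only [project, Prod.mk.injEq, h.ne, h'.ne, and_true, and_false, if_false, if_true,
            true_and, coh_cons_cons] at h₁ h₂ ⊢
          obtain rfl := h₁.1 trivial
          simpa using ih hu hu' (h₁.2 rfl) (h₂.2 rfl)
      | moveB' h =>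
        cases t' with
        | answerC h' => simp [project, h.ne, h'.ne, h'.ne.symm] at h₂
        | moveB' h' =>
          simp only [project, Prod.mk.injEq, h.ne, h'.ne, and_true, and_false, if_false, if_true,
            true_and, coh_cons_cons] at h₁ h₂ ⊢
          obtain rfl := h₂.1 trivial
          simpa using ih hu hu' (h₁.2 rfl) (h₂.2 rfl)
      | answerC h =>
        cases t' with
        | answerC h' =>
          simp only [project, Prod.mk.injEq, h.ne, h'.ne, and_false, if_false, if_true,
            true_and, coh_cons_cons] at h₁ h₂ ⊢
          obtain rfl := h₂.1 trivial
          exact ⟨fun _ => rfl, fun _ => ih hu hu' h₁ (h₂.2 rfl)⟩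
        | moveB' h' => simp [project, h.ne, h'.ne, h'.ne.symm] at h₂

/-- In an interaction of well-bracketed strategies, no query is pending that has been initiated by
one of the strategies if none is pending in the external games. -/
theorem fresh_inter {x : A.Pos × B.Pos × C.Pos} {u : List (A.Pos × B.Pos × C.Pos)}
    (h₁ : Along (fun p q => Step A B (p.1, p.2.1) (q.1, q.2.1)) x u)
    (h₂ : Along (fun p q => Step B C (p.2.1, p.2.2) (q.2.1, q.2.2)) x u)
    (h₃ : Along (fun p q => Step A C (p.1, p.2.2) (q.1, q.2.2)) x u)
    (hb : ∀ t v, t ++ v = u → ∀ y, y = t.getLastD x →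
      (A.Fresh 1 y.1 (project (fun p => p.1) y v) ∨
          B.Fresh (-1) y.2.1 (project (fun p => p.2.1) y v) →
        A.Fresh (-1) y.1 (project (fun p => p.1) y v) ∨
          B.Fresh 1 y.2.1 (project (fun p => p.2.1) y v)) ∧
      (B.Fresh 1 y.2.1 (project (fun p => p.2.1) y v) ∨
          C.Fresh (-1) y.2.2 (project (fun p => p.2.2) y v) →
        B.Fresh (-1) y.2.1 (project (fun p => p.2.1) y v) ∨
          C.Fresh 1 y.2.2 (project (fun p => p.2.2) y v)))
    (hA : ¬ A.Fresh (-1) x.1 (project (fun p => p.1) x u))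
    (hC : ¬ C.Fresh 1 x.2.2 (project (fun p => p.2.2) x u)) :
    ¬ A.Fresh 1 x.1 (project (fun p => p.1) x u) ∧
      (∀ q, ¬ B.Fresh q x.2.1 (project (fun p => p.2.1) x u)) ∧
      ¬ C.Fresh (-1) x.2.2 (project (fun p => p.2.2) x u) := by
  induction u generalizing x with
  | nil => exact ⟨not_fresh_nil, fun _ => not_fresh_nil, not_fresh_nil⟩
  | cons y u ih =>
    -- The induction runs from the end. Nothing is fresh for the tail, so a query that is fresh now
    -- was initiated by the first step, which moves a single game with a single polarity; the
    -- implications `hb'` would then require a second game or a second polarity in the same step.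
    obtain ⟨i₁, i₂, i₃⟩ := ih h₁.2 h₂.2 h₃.2
      (fun t v e z hz => hb (y :: t) v (by simp [e]) z (by rw [List.getLastD_cons, hz]))
      (fun h => hA h.project_of_tail) (fun h => hC h.project_of_tail)
    have hb' := hb [] (y :: u) rfl x rfl
    have s₁ := h₁.1
    have s₂ := h₂.1
    have s₃ := h₃.1
    have kA : A.Fresh 1 x.1 (project (fun p => p.1) x (y :: u)) → A.Move 1 x.1 y.1 := by
      intro h
      refine (Fresh.project_cons ?_ h).resolve_left i₁
      rcases s₁ with s₁ | s₁
      · exact s₁.1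
      · exact Or.inl s₁.1
    have kB : ∀ q, B.Fresh q x.2.1 (project (fun p => p.2.1) x (y :: u)) →
        B.Move q x.2.1 y.2.1 := by
      intro q h
      refine (Fresh.project_cons ?_ h).resolve_left (i₂ q)
      rcases s₂ with s₂ | s₂
      · exact s₂.1
      · exact Or.inl s₂.1
    have kC : C.Fresh (-1) x.2.2 (project (fun p => p.2.2) x (y :: u)) →
        C.Move (-1) x.2.2 y.2.2 := by
      intro h
      refine (Fresh.project_cons ?_ h).resolve_left i₃
      rcases s₂ with s₂ | s₂
      · exact Or.inl s₂.2
      · exact s₂.2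
    have kAB : ¬ (A.Edge x.1 y.1 ∧ B.Edge x.2.1 y.2.1) := by
      rintro ⟨e, e'⟩
      rcases s₁ with s | s
      · exact e'.ne s.2
      · exact e.ne s.1
    have kBC : ¬ (B.Edge x.2.1 y.2.1 ∧ C.Edge x.2.2 y.2.2) := by
      rintro ⟨e, e'⟩
      rcases s₂ with s | s
      · exact e'.ne s.2
      · exact e.ne s.1
    have kBB : ¬ (B.Move 1 x.2.1 y.2.1 ∧ B.Move (-1) x.2.1 y.2.1) := by
      rintro ⟨e, e'⟩
      exact absurd (B.pol_unique e e') (by decide)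
    have eA : A.Move 1 x.1 y.1 → A.Edge x.1 y.1 := fun h => ⟨_, h⟩
    have eB : ∀ q, B.Move q x.2.1 y.2.1 → B.Edge x.2.1 y.2.1 := fun _ h => ⟨_, h⟩
    have eC : C.Move (-1) x.2.2 y.2.2 → C.Edge x.2.2 y.2.2 := fun h => ⟨_, h⟩
    have nA : ¬ A.Fresh 1 x.1 (project (fun p => p.1) x (y :: u)) := fun h =>
      (hb'.1 (Or.inl h)).elim hA fun h' => kAB ⟨⟨_, kA h⟩, ⟨_, kB _ h'⟩⟩
    have nC : ¬ C.Fresh (-1) x.2.2 (project (fun p => p.2.2) x (y :: u)) := fun h =>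
      (hb'.2 (Or.inr h)).elim (fun h' => kBC ⟨⟨_, kB _ h'⟩, ⟨_, kC h⟩⟩) hC
    have nB : ¬ B.Fresh 1 x.2.1 (project (fun p => p.2.1) x (y :: u)) := fun h =>
      (hb'.2 (Or.inl h)).elim (fun h' => kBB ⟨kB _ h, kB _ h'⟩) hC
    have nB' : ¬ B.Fresh (-1) x.2.1 (project (fun p => p.2.1) x (y :: u)) := fun h =>
      (hb'.1 (Or.inr h)).elim hA nB
    refine ⟨nA, fun q => ?_, nC⟩
    rcases Int.units_eq_one_or q with rfl | rfl
    · exact nB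
    · exact nB'

theorem IsStrat.subset {S : Set (List (A.Pos × B.Pos))} (hS : IsStrat A B S) : S ⊆ Plays A B :=
  hS.isPlay

/-- Well-bracketing in terms of an interaction that projects to a play. -/
theorem IsStrat.bracket_project {S : Set (List (A.Pos × B.Pos))} (hS : IsStrat A B S)
    {W : Type*} {a : W → A.Pos} {b : W → B.Pos} {x : W} (ha : a x = A.root) (hb : b x = B.root)
    (t v : List W) (h : project (fun w => (a w, b w)) x (t ++ v) ∈ S) (y : W)
    (hy : y = t.getLastD x)
    (hf : A.Fresh 1 (a y) (project a y v) ∨ B.Fresh (-1) (b y) (project b y v)) :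
    A.Fresh (-1) (a y) (project a y v) ∨ B.Fresh 1 (b y) (project b y v) := by
  have hst := ((along_append _ _ _).1 ((isPlay_iff ha hb).1 (hS.isPlay _ h)).1).2
  rw [← hy] at hst
  rw [project_append] at h
  have hl : (project (fun w => (a w, b w)) x t).getLastD (A.root, B.root) = (a y, b y) := by
    rw [← ha, ← hb, hy]
    exact getLastD_project (fun w => (a w, b w)) x t
  have := hS.bracket _ _ h
  rw [hl, ← hy, fresh_arrow hst, fresh_arrow hst, neg_neg] at this
  exact this hf

theorem IsStrat.comp {S : Set (List (A.Pos × B.Pos))} {T : Set (List (B.Pos × C.Pos))}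
    (hS : IsStrat A B S) (hT : IsStrat B C T) : IsStrat A C (compPlays A B C S T) where
  isPlay := by
    rintro s ⟨u, -, -, -, h⟩
    exact h
  even := by
    rintro s ⟨u, h₁, h₂, rfl, h₄⟩
    have e₁ := (even_iff rfl rfl (hS.isPlay _ h₁)).1 (hS.even _ h₁)
    have e₂ := (even_iff rfl rfl (hT.isPlay _ h₂)).1 (hT.even _ h₂)
    exact (even_iff rfl rfl h₄).2 (e₂.trans e₁)
  nil := ⟨[], hS.nil, hT.nil, rfl, trivial⟩
  prefix_mem := by
    rintro s t hs ⟨u, h₁, h₂, h₃, h₄⟩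
    obtain ⟨v, ⟨v', rfl⟩, rfl⟩ := prefix_project (h₃.symm ▸ List.prefix_append s t :
      s <+: project (fun x => (x.1, x.2.2)) (A.root, B.root, C.root) u)
    have h₅ := h₄.prefix (List.prefix_append _ _)
    have b₁ := (isPlay_iff rfl rfl).1 (hS.isPlay _ h₁)
    have b₂ := (isPlay_iff rfl rfl).1 (hT.isPlay _ h₂)
    have b₁ := b₁.2 v (List.prefix_append _ _)
    have b₂ := b₂.2 v (List.prefix_append _ _)
    -- After an even prefix the external balance is 0. It is the sum of the balances of the two
    -- factors, which are nonnegative; so both vanish, and each factor is cut at an even prefix too.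
    rw [even_iff rfl rfl h₅] at hs
    rw [project_append] at h₁ h₂
    refine ⟨v, hS.prefix_mem _ _ ?_ h₁, hT.prefix_mem _ _ ?_ h₂, rfl, h₅⟩
    · rw [even_iff rfl rfl ((hS.isPlay _ h₁).prefix (List.prefix_append _ _))]
      omega
    · rw [even_iff rfl rfl ((hT.isPlay _ h₂).prefix (List.prefix_append _ _))]
      omega
  coh := by
    intro s hs t ht
    obtain ⟨u, hu, h₁, h₂, rfl⟩ := exists_inter hS.subset hT.subset hs
    obtain ⟨v, hv, k₁, k₂, rfl⟩ := exists_inter hS.subset hT.subset ht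
    exact hu.coh hv (hS.coh _ h₁ _ k₁) (hT.coh _ h₂ _ k₂)
  bracket := by
    rintro s t ⟨u, h₁, h₂, h₃, h₄⟩ hf
    obtain ⟨v, ⟨v', rfl⟩, rfl⟩ := prefix_project (h₃.symm ▸ List.prefix_append s t :
      s <+: project (fun x => (x.1, x.2.2)) (A.root, B.root, C.root) u)
    have a₁ := ((isPlay_iff rfl rfl).1 (hS.isPlay _ h₁)).1
    have a₂ := ((isPlay_iff rfl rfl).1 (hT.isPlay _ h₂)).1
    have a₃ := ((isPlay_iff rfl rfl).1 (h₃ ▸ h₄)).1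
    rw [project_append, List.append_cancel_left_eq] at h₃
    subst h₃
    have hl : (project (fun x => (x.1, x.2.2)) (A.root, B.root, C.root) v).getLastD
        (A.root, C.root) = _ := getLastD_project (fun x => (x.1, x.2.2)) (A.root, B.root, C.root) v
    rw [hl] at hf ⊢
    rw [along_append] at a₁ a₂ a₃
    rw [fresh_arrow a₃.2, neg_neg] at hf
    rw [fresh_arrow a₃.2]
    by_contra hc
    rw [not_or] at hc
    have := fresh_inter a₁.2 a₂.2 a₃.2 (fun t w e y hy => ⟨?_, ?_⟩) hc.1 hc.2
    · tauto
    · refine hS.bracket_project (x := (A.root, B.root, C.root)) rfl rfl (v ++ t) w ?_ y ?_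
      · rwa [List.append_assoc, e]
      · rw [getLastD_append, hy]
    · refine hT.bracket_project (x := (A.root, B.root, C.root)) rfl rfl (v ++ t) w ?_ y ?_
      · rwa [List.append_assoc, e]
      · rw [getLastD_append, hy]

end MBGame

/-! ## The copycat strategies -/

namespace MBGame

open ConwayGame

variable {A B C D : MBGame.{u}}

/-- The plays of the copycat strategy of `A* ⊗ A`, from the position `(x, x)`. -/
def IsCC (A : MBGame.{u}) : A.Pos → List (A.Pos × A.Pos) → Prop
  | _, [] => True
  | _, [_] => False
  | x, p :: q :: s => q.1 = q.2 ∧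
      ((A.Move 1 x q.1 ∧ p = (q.1, x)) ∨ (A.Move (-1) x q.1 ∧ p = (x, q.1))) ∧ IsCC A q.1 s

/-- Induction on a list, two elements at a time. -/
theorem two_step_induction {X : Type*} {P : List X → Prop} (nil : P []) (one : ∀ x, P [x])
    (cons : ∀ x y s, P s → P (x :: y :: s)) : ∀ s, P s
  | [] => nil
  | [x] => one x
  | x :: y :: s => cons x y s (two_step_induction nil one cons s)

/-- The recursive form reads a play as a sequence of exchanges, a move on one side followed by the
same move on the other, and is the one used in inductions; the right-hand side is the form in which
`copycat` is defined. -/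
theorem isCC_iff (x : A.Pos) (s : List (A.Pos × A.Pos)) : IsCC A x s ↔
    (A.dual.tensor A).IsAlternating (-1) (x, x) s ∧ Even s.length ∧
      ∀ t, t <+: s → Even t.length → project Prod.fst (x, x) t = project Prod.snd (x, x) t := by
  induction s using two_step_induction generalizing x with
  | nil =>
    refine ⟨fun _ => ⟨trivial, by simp, ?_⟩, fun _ => trivial⟩
    rintro t ht -
    rw [List.prefix_nil.1 ht]
    rfl
  | one p => simp [IsCC]
  | cons p q s ih =>
    constructor
    · rintro ⟨h, h', h''⟩
      obtain ⟨y, z⟩ := q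
      dsimp only at h; subst h
      obtain ⟨k₁, k₂, k₃⟩ := (ih y).1 h''
      refine ⟨⟨?_, ?_, ?_⟩, ?_, ?_⟩
      · rcases h' with ⟨h', rfl⟩ | ⟨h', rfl⟩
        · exact Or.inl ⟨h', rfl⟩
        · exact Or.inr ⟨rfl, h'⟩
      · rcases h' with ⟨h', rfl⟩ | ⟨h', rfl⟩
        · exact Or.inr ⟨rfl, h'⟩
        · exact Or.inl ⟨h', rfl⟩
      · exact k₁
      · simpa [Nat.even_add_one] using k₂
      · intro t ht hte
        match t, ht, hte with
        | [], _, _ => rfl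
        | [_], _, hte => simp at hte
        | p' :: q' :: t, ht, hte =>
          simp only [List.cons_prefix_cons] at ht
          obtain ⟨rfl, rfl, ht⟩ := ht
          have := k₃ t ht (by simpa [Nat.even_add_one] using hte)
          rcases h' with ⟨h', rfl⟩ | ⟨h', rfl⟩ <;> simp [project, h'.ne, this]
    · rintro ⟨⟨h₁, h₂, h₃⟩, h₄, h₅⟩
      have e := h₅ [p, q] (by simp) (by simp)
      obtain ⟨p₁, p₂⟩ := p
      obtain ⟨q₁, q₂⟩ := q
      rcases h₁ with ⟨h₁, e₁⟩ | ⟨e₁, h₁⟩ <;> rcases h₂ with ⟨h₂, e₂⟩ | ⟨e₂, h₂⟩ <;>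
        dsimp only at e₁ e₂ <;> subst e₁ <;> subst e₂
      · simp [project, h₁.ne, h₂.ne] at e
      · simp [project, h₁.ne, h₂.ne] at e
        subst e
        refine ⟨rfl, Or.inl ⟨h₁, rfl⟩, (ih _).2 ⟨h₃, by simpa [Nat.even_add_one] using h₄, ?_⟩⟩
        intro t ht hte
        have := h₅ (_ :: _ :: t)
          (List.cons_prefix_cons.2 ⟨rfl, List.cons_prefix_cons.2 ⟨rfl, ht⟩⟩)
          (by simpa [Nat.even_add_one] using hte)
        simpa [project, h₁.ne, h₂.ne] using this
      · simp [project, h₁.ne, h₂.ne] at e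
        subst e
        refine ⟨rfl, Or.inr ⟨h₁, rfl⟩, (ih _).2 ⟨h₃, by simpa [Nat.even_add_one] using h₄, ?_⟩⟩
        intro t ht hte
        have := h₅ (_ :: _ :: t)
          (List.cons_prefix_cons.2 ⟨rfl, List.cons_prefix_cons.2 ⟨rfl, ht⟩⟩)
          (by simpa [Nat.even_add_one] using hte)
        simpa [project, h₁.ne, h₂.ne] using this
      · simp [project, h₁.ne, h₂.ne] at e

/-- The plays of the identity. -/
def idPlays (A : MBGame.{u}) : Set (List (A.Pos × A.Pos)) := copycat A A (fun x => x)

theorem mem_idPlays {s : List (A.Pos × A.Pos)} : s ∈ idPlays A ↔ IsCC A A.root s := by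
  rw [isCC_iff]
  refine and_congr Iff.rfl (and_congr Iff.rfl (forall_congr' fun t => ?_))
  rw [List.map_id'']
  exact fun _ => rfl

theorem IsCC.coh {x : A.Pos} {s t : List (A.Pos × A.Pos)} (hs : IsCC A x s) (ht : IsCC A x t) :
    Coh 0 s t := by
  induction s using two_step_induction generalizing x t with
  | nil => simp
  | one p => exact hs.elim
  | cons p q s ih =>
    match t, ht with
    | [], _ => simp
    | p' :: q' :: t, ht =>
      obtain ⟨h₁, h₂, h₃⟩ := hs
      obtain ⟨k₁, k₂, k₃⟩ := ht
      refine ⟨by simp, ?_⟩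
      rintro rfl
      have e : q = q' := by
        obtain ⟨q₁, q₂⟩ := q
        obtain ⟨q₁', q₂'⟩ := q'
        dsimp only at h₁ k₁ h₂ k₂; subst h₁; subst k₁
        rcases h₂ with ⟨h, rfl⟩ | ⟨h, rfl⟩ <;> rcases k₂ with ⟨k, e⟩ | ⟨k, e⟩ <;>
          rw [Prod.mk.injEq] at e
        · rw [e.1]
        · exact (h.ne e.1).elim
        · exact (h.ne e.2).elim
        · rw [e.2]
      subst e
      refine ⟨fun _ => rfl, fun _ => ?_⟩
      have := ih h₃ k₃
      simpa using this

/-- It is enough to check well-bracketing on the suffixes that start at Opponent moves. -/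
theorem bracket_of_even {S : Set (List (A.Pos × B.Pos))} (hS : S ⊆ Plays A B)
    (h : ∀ s t, Even s.length → s ++ t ∈ S →
      (A.dual.tensor B).Fresh (-1) (s.getLastD (A.root, B.root)) t →
      (A.dual.tensor B).Fresh 1 (s.getLastD (A.root, B.root)) t)
    (s t : List (A.Pos × B.Pos)) (hst : s ++ t ∈ S)
    (hf : (A.dual.tensor B).Fresh (-1) (s.getLastD (A.root, B.root)) t) :
    (A.dual.tensor B).Fresh 1 (s.getLastD (A.root, B.root)) t := by
  by_cases e : Even s.length
  · exact h s t e hst hf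
  · rcases List.eq_nil_or_concat s with rfl | ⟨s, y, rfl⟩
    · simp at e
    · rw [List.concat_eq_append] at e hst hf ⊢
      have e' : Even s.length := by simpa [Nat.even_add_one] using e
      rw [List.append_assoc, List.singleton_append] at hst
      have hm := IsAlternating.move_of_append (hS hst)
      rw [if_pos e'] at hm
      rw [getLastD_append] at hf ⊢
      refine ((h s (y :: t) e' hst hf.of_tail).tail_or ⟨_, hm⟩).resolve_right fun h' => ?_
      exact absurd ((A.dual.tensor B).pol_unique hm h') (by decide)

theorem isStrat_id (A : MBGame.{u}) : IsStrat A A (idPlays A) where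
  isPlay _ hs := hs.1
  even _ hs := hs.2.1
  nil := mem_idPlays.2 trivial
  prefix_mem s t hs h := ⟨h.1.prefix (List.prefix_append _ _), hs,
    fun v hv => h.2.2 v (hv.trans (List.prefix_append _ _))⟩
  coh _ hs _ ht := (mem_idPlays.1 hs).coh (mem_idPlays.1 ht)
  bracket := by
    refine bracket_of_even (A := A) (B := A) (S := idPlays A) (fun s hs => hs.1)
      fun s t hs hst hf => ?_
    have key : ∀ v, v <+: s ++ t → Even v.length →
        project Prod.fst (A.root, A.root) v = project Prod.snd (A.root, A.root) v := by
      intro v hv hv'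
      simpa using hst.2.2 v hv hv'
    have e₁ := key _ (List.prefix_append _ _) hs
    have e₂ := key _ List.prefix_rfl hst.2.1
    rw [project_append, project_append, e₁, List.append_cancel_left_eq] at e₂
    have e₃ : (s.getLastD (A.root, A.root)).1 = (s.getLastD (A.root, A.root)).2 := by
      have h₁ := getLastD_project Prod.fst (A.root, A.root) s
      have h₂ := getLastD_project Prod.snd (A.root, A.root) s
      rw [← h₁, ← h₂, e₁]
    have hp : (A.dual.tensor A).IsPath (s.getLastD (A.root, A.root)) t := by
      rw [isPath_iff]
      exact ((along_append _ _ _).1 ((isAlternating_iff _).1 hst.1).1).2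
    -- The suffix begins and ends at complete exchanges, so it induces the same path of `A` on both
    -- sides. The left side being dualised, a fresh query of one polarity on one side is accompanied
    -- by one of the other polarity on the other side.
    rw [fresh_tensor hp, fresh_dual, e₂, e₃] at hf ⊢
    exact hf.symm

/-- Each move in `B` is doubled in the order in which copycat would produce it: an Opponent move is
made first in the outer copy, a Player move first in the hidden one. -/
theorem exists_interaction_id {x : A.Pos × B.Pos} {s : List (A.Pos × B.Pos)}
    (hs : Along (A.dual.tensor B).Edge x s) : ∃ u : List (A.Pos × B.Pos × B.Pos),
      project (fun p => (p.1, p.2.1)) (x.1, x.2, x.2) u = s ∧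
      project (fun p => (p.1, p.2.2)) (x.1, x.2, x.2) u = s ∧
      IsCC B x.2 (project (fun p => (p.2.1, p.2.2)) (x.1, x.2, x.2) u) := by
  induction s generalizing x with
  | nil => exact ⟨[], rfl, rfl, trivial⟩
  | cons y s ih =>
    obtain ⟨u, h₁, h₂, h₃⟩ := ih hs.2
    obtain ⟨a, b⟩ := x
    obtain ⟨a', b'⟩ := y
    rcases edge_tensor.1 hs.1 with ⟨h, e⟩ | ⟨e, h⟩ <;> dsimp only at e h h₁ h₂ h₃ ⊢ <;> subst e
    · have := h.ne
      exact ⟨(a', b, b) :: u, by simp [project, this, h₁], by simp [project, this, h₂],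
        by simpa [project, this] using h₃⟩
    · rcases h.cases with h | h
      · exact ⟨(a, b, b') :: (a, b', b') :: u, by simp [project, h.ne, h₁],
          by simp [project, h.ne, h₂], by simp [project, h.ne, h₃, IsCC, h]⟩
      · exact ⟨(a, b', b) :: (a, b', b') :: u, by simp [project, h.ne, h₁],
          by simp [project, h.ne, h₂], by simp [project, h.ne, h₃, IsCC, h]⟩

/-- Once a move is made in one copy of `B`, copycat has to answer before anything else may happen,
and it answers by the same move in the other copy. Moves of the two copies thus come in adjacent
pairs, which the induction removes two steps at a time. -/
theorem project_eq_of_inter_id {i : ℤ} {a : A.Pos} {b : B.Pos} {u : List (A.Pos × B.Pos × B.Pos)}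
    (hu : Inter A B B i 0 (a, b, b) u)
    (h : IsCC B b (project (fun p => (p.2.1, p.2.2)) (a, b, b) u)) :
    project (fun p => (p.1, p.2.1)) (a, b, b) u = project (fun p => (p.1, p.2.2)) (a, b, b) u := by
  induction hn : u.length using Nat.strong_induction_on generalizing i a b u with
  | _ n ih =>
    subst hn
    match u, hu with
    | [], _ => rfl
    | [y], ⟨_, _, t, _⟩ =>
      cases t with
      | askA k => simp [project]
      | answerA k => simp [project]
      | askC k => simp [project, k.ne, IsCC] at h
      | moveB k => simp [project, k.ne, IsCC] at h
    | y :: z :: u, ⟨_, _, t, i', j', t', hv⟩ =>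
      cases t with
      | askA k =>
        have := ih _ (by simp) (u := z :: u) ⟨_, _, t', hv⟩
          (by rwa [project_cons_of_eq (by rfl)] at h) rfl
        rw [project_cons_of_ne (y := (_, b, b)) (by simp [k.ne]),
          project_cons_of_ne (y := (_, b, b)) (by simp [k.ne]), this]
      | answerA k =>
        have := ih _ (by simp) (u := z :: u) ⟨_, _, t', hv⟩
          (by rwa [project_cons_of_eq (by rfl)] at h) rfl
        rw [project_cons_of_ne (y := (_, b, b)) (by simp [k.ne]),
          project_cons_of_ne (y := (_, b, b)) (by simp [k.ne]), this]
      | askC k =>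
        cases t' with
        | moveB' k' =>
          simp only [project, Prod.mk.injEq, k.ne, k'.ne, and_true, and_false, true_and,
            if_false, IsCC] at h
          obtain ⟨rfl, -, h⟩ := h
          have := ih _ (by simp) hv h rfl
          simp [project, k.ne, this]
        | answerC k' =>
          simp only [project, Prod.mk.injEq, k.ne, k'.ne, and_false,
            if_false, IsCC] at h
          obtain ⟨rfl, ⟨h, e⟩ | ⟨h, e⟩, -⟩ := h
      | moveB k =>
        cases t' with
        | moveB' k' =>
          simp only [project, Prod.mk.injEq, k.ne, k'.ne, and_true, and_false, false_and,
            if_false, IsCC] at h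
          obtain ⟨rfl, ⟨h, e⟩ | ⟨h, e⟩, -⟩ := h
          exact (h.ne rfl).elim
        | answerC k' =>
          simp only [project, Prod.mk.injEq, k.ne, k'.ne, and_true, and_false, false_and,
            if_false, IsCC] at h
          obtain ⟨rfl, -, h⟩ := h
          have := ih _ (by simp) hv h rfl
          simp [project, k.ne, this]

theorem compPlays_id {S : Set (List (A.Pos × B.Pos))} (hS : S ⊆ Plays A B) :
    compPlays A B B S (idPlays B) = S := by
  apply Set.Subset.antisymm
  · intro s hs
    obtain ⟨u, hu, h₁, h₂, rfl⟩ := exists_inter hS (fun s hs => hs.1) hs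
    rwa [← project_eq_of_inter_id hu (mem_idPlays.1 h₂)]
  · intro s hs
    obtain ⟨u, h₁, h₂, h₃⟩ := exists_interaction_id ((isAlternating_iff _).1 (hS hs)).1
    exact ⟨u, by rwa [h₁], mem_idPlays.2 h₃, h₂, hS hs⟩

/-! ### Exchange of the two sides -/

/-- The traces with the two components exchanged. -/
def swapTr {X Y : Type*} (S : Set (List (X × Y))) : Set (List (Y × X)) :=
  {s | s.map Prod.swap ∈ S}

theorem swapTr_swapTr {X Y : Type*} (S : Set (List (X × Y))) : swapTr (swapTr S) = S := by
  ext s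
  simp [swapTr]

theorem swapTr_plays : swapTr (Plays A B) = Plays B.dual A.dual := by
  ext s
  have key : ∀ (p : ℤˣ) (x : B.Pos × A.Pos),
      (A.dual.tensor B).IsAlternating p x.swap (s.map Prod.swap) ↔
        (B.dual.dual.tensor A.dual).IsAlternating p x s := by
    induction s with
    | nil => exact fun _ _ => Iff.rfl
    | cons y s ih =>
      intro p x
      refine and_congr ?_ (ih (-p) y)
      refine Or.comm.trans (or_congr ?_ ?_)
      · change _ ↔ B.Move (- -p) _ _ ∧ _
        rw [neg_neg]
        exact and_comm
      · exact and_comm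
  exact key (-1) (B.root, A.root)

theorem project_swap {W X Y : Type*} (f : W → X) (g : W → Y) (x : W) (u : List W) :
    (project (fun w => (f w, g w)) x u).map Prod.swap = project (fun w => (g w, f w)) x u :=
  map_project (fun w => (f w, g w)) Prod.swap Prod.swap_injective x u

theorem map_swap_mem_compTr {X Y Z : Type*} {x : X} {y : Y} {z : Z} {S : Set (List (X × Y))}
    {T : Set (List (Y × Z))} {s : List (X × Z)} (hs : s ∈ compTr x y z S T) :
    s.map Prod.swap ∈ compTr z y x (swapTr T) (swapTr S) := by
  obtain ⟨u, h₁, h₂, rfl⟩ := hs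
  rw [project_swap]
  refine mem_compTr_of_list (x := (x, y, z)) (g := fun p => p.2.1) rfl rfl rfl ?_ ?_
  · change _ ∈ T
    rwa [project_swap]
  · change _ ∈ S
    rwa [project_swap]

theorem swapTr_compTr {X Y Z : Type*} (x : X) (y : Y) (z : Z) (S : Set (List (X × Y)))
    (T : Set (List (Y × Z))) :
    swapTr (compTr x y z S T) = compTr z y x (swapTr T) (swapTr S) := by
  ext s
  constructor
  · intro h
    simpa using map_swap_mem_compTr h
  · intro h
    have := map_swap_mem_compTr h
    rwa [swapTr_swapTr, swapTr_swapTr] at this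

theorem swapTr_compPlays (S : Set (List (A.Pos × B.Pos))) (T : Set (List (B.Pos × C.Pos))) :
    swapTr (compPlays A B C S T) = compPlays C.dual B.dual A.dual (swapTr T) (swapTr S) := by
  rw [compPlays_eq, compPlays_eq, ← swapTr_plays]
  exact congrArg (· ∩ swapTr (Plays A C)) (swapTr_compTr A.root B.root C.root S T)

theorem swapTr_id : swapTr (idPlays A) = idPlays A.dual := by
  ext s
  rw [mem_idPlays]
  refine (mem_idPlays (A := A)).trans ?_
  have key : ∀ x : A.Pos, IsCC A x (s.map Prod.swap) ↔ IsCC A.dual x s := by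
    induction s using two_step_induction with
    | nil => exact fun _ => Iff.rfl
    | one p => exact fun _ => Iff.rfl
    | cons p q s ih =>
      intro x
      obtain ⟨p₁, p₂⟩ := p
      obtain ⟨q₁, q₂⟩ := q
      simp only [List.map_cons, IsCC, Prod.swap_prod_mk, Prod.mk.injEq]
      constructor
      · rintro ⟨rfl, h, h'⟩
        refine ⟨rfl, ?_, (ih _).1 h'⟩
        rcases h with ⟨h, rfl, rfl⟩ | ⟨h, rfl, rfl⟩
        · exact Or.inr ⟨by simpa using h, rfl, rfl⟩
        · exact Or.inl ⟨h, rfl, rfl⟩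
      · rintro ⟨rfl, h, h'⟩
        refine ⟨rfl, ?_, (ih _).2 h'⟩
        rcases h with ⟨h, rfl, rfl⟩ | ⟨h, rfl, rfl⟩
        · exact Or.inr ⟨h, rfl, rfl⟩
        · exact Or.inl ⟨by change A.Move (- -1) _ _ at h; simpa using h, rfl, rfl⟩
  exact key A.root

/-- Exchanging the two sides turns plays from `A` to `B` into plays from `B*` to `A*` and reverses
composition, so the left unit law is the right unit law for the dual games. -/
theorem id_compPlays {S : Set (List (A.Pos × B.Pos))} (hS : S ⊆ Plays A B) :
    compPlays A A B (idPlays A) S = S := by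
  rw [← swapTr_swapTr (compPlays A A B (idPlays A) S), swapTr_compPlays, swapTr_id,
    compPlays_id, swapTr_swapTr]
  rw [← swapTr_plays]
  exact fun s hs => hS hs

/-- A strategy that contains the copycat strategy is the copycat strategy. -/
theorem IsStrat.eq_of_subset {S T : Set (List (A.Pos × B.Pos))} (hS : IsStrat A B S)
    (hT : IsStrat A B T) (h : S ⊆ T)
    (total : ∀ s ∈ S, ∀ y z, s ++ [y, z] ∈ T → ∃ z', s ++ [y, z'] ∈ S) : S = T := by
  refine h.antisymm fun t ht => ?_
  suffices key : ∀ n (t : List (A.Pos × B.Pos)), t.length = n → t ∈ T → t ∈ S from key _ t rfl ht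
  intro n
  induction n using Nat.strong_induction_on with
  | _ n ih =>
    intro t hn ht
    rcases List.eq_nil_or_concat t with rfl | ⟨t, z, rfl⟩
    · exact hS.nil
    rcases List.eq_nil_or_concat t with rfl | ⟨t, y, rfl⟩
    · simpa using hT.even _ ht
    have e : (t.concat y).concat z = t ++ [y, z] := by simp
    rw [e] at ht hn ⊢
    have he : Even t.length := by
      have := hT.even _ ht
      simpa [Nat.even_add] using this
    have hs : t ∈ S := ih t.length (by simp at hn; omega) t rfl (hT.prefix_mem _ _ he ht)
    obtain ⟨z', hz'⟩ := total t hs y z ht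
    have := (hT.coh _ ht _ (h hz')).of_append
    rw [if_pos he] at this
    have := (this.2 rfl).1 (by simp)
    rwa [this]

theorem idPlays_total {s : List (A.Pos × A.Pos)} (hs : s ∈ idPlays A) {y : A.Pos × A.Pos}
    (hy : s ++ [y] ∈ Plays A A) : ∃ z, s ++ [y, z] ∈ idPlays A := by
  rw [mem_idPlays] at hs
  simp only [mem_idPlays]
  replace hy : (A.dual.tensor A).IsAlternating (-1) (A.root, A.root) (s ++ [y]) := hy
  revert hs hy
  generalize A.root = x
  induction s using two_step_induction generalizing x with
  | nil =>
    intro _ h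
    obtain ⟨y₁, y₂⟩ := y
    rcases h.1 with ⟨h', e⟩ | ⟨e, h'⟩ <;> dsimp only at e h' <;> subst e
    · exact ⟨(y₁, y₁), rfl, Or.inl ⟨h', rfl⟩, trivial⟩
    · exact ⟨(y₂, y₂), rfl, Or.inr ⟨h', rfl⟩, trivial⟩
  | one p => exact fun h => h.elim
  | cons p q s ih =>
    rintro ⟨h₁, h₂, h₃⟩ ⟨k₁, k₂, k₃⟩
    obtain ⟨q₁, q₂⟩ := q
    dsimp only at h₁; subst h₁
    obtain ⟨z, hz⟩ := ih q₁ h₃ k₃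
    exact ⟨z, rfl, h₂, hz⟩

/-- Copycat has an answer to every Opponent move, so determinism leaves no room for a larger
strategy. An equation with the identity is thus reduced to one inclusion. -/
theorem IsStrat.eq_id {S : Set (List (A.Pos × A.Pos))} (hS : IsStrat A A S)
    (h : idPlays A ⊆ S) : S = idPlays A := by
  refine ((isStrat_id A).eq_of_subset hS h fun s hs y z hz => idPlays_total hs ?_).symm
  exact (hS.isPlay _ hz).prefix ⟨[z], by simp⟩

end MBGame

open MBGame in
/-- The category of multi-bracketed games. -/
def gameCat : GameCat.{u} where
  id A := (isStrat_id A).hom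
  id_plays _ := rfl
  comp σ τ := (σ.isStrat.comp τ.isStrat).hom
  comp_plays _ _ := rfl
  id_comp σ := Hom.ext_set (id_compPlays σ.isStrat.subset)
  comp_id σ := Hom.ext_set (compPlays_id σ.isStrat.subset)
  assoc σ τ υ := Hom.ext_set
    (compPlays_assoc σ.isStrat.subset τ.isStrat.subset υ.isStrat.subset)

/-! ## The tensor product of strategies -/

/-- An erased step has the same image as the last recorded one, so a property of images that holds
at the start and along the projection holds at every step. -/
theorem forall_of_project {W X : Type*} {π : W → X} {R : X → Prop} {x : W} {u : List W}
    (hx : R (π x)) (h : ∀ p ∈ project π x u, R p) : ∀ w ∈ u, R (π w) := by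
  induction u generalizing x with
  | nil => simp
  | cons y u ih =>
    by_cases e : π y = π x
    · rw [project_cons_of_eq e] at h
      have := ih (by rwa [e]) h
      simpa [e, hx] using this
    · rw [project_cons_of_ne e] at h
      have hy := h _ (List.mem_cons_self ..)
      have := ih hy fun p hp => h p (List.mem_cons_of_mem _ hp)
      simpa [hy] using this

theorem mem_of_mem_project {X Y : Type*} {π : X → Y} {x : X} {s : List X} {y : Y}
    (h : y ∈ project π x s) : ∃ z ∈ s, π z = y := by
  induction s generalizing x with
  | nil => cases h
  | cons z s ih =>
    by_cases e : π z = π x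
    · rw [project_cons_of_eq e] at h
      obtain ⟨w, hw, hw'⟩ := ih h
      exact ⟨w, List.mem_cons_of_mem _ hw, hw'⟩
    · rw [project_cons_of_ne e] at h
      rcases List.mem_cons.1 h with rfl | h
      · exact ⟨z, List.mem_cons_self .., rfl⟩
      · obtain ⟨w, hw, hw'⟩ := ih h
        exact ⟨w, List.mem_cons_of_mem _ hw, hw'⟩

/-- A pair of interactions that extends a list of positions. -/
theorem exists_amalgam_pair {A A' A'' B B' B'' : Type u} {a : A} {a' : A'} {a'' : A''} {b : B}
    {b' : B'} {b'' : B''} {s : List ((A × B) × (A'' × B''))} {u : List (A × A' × A'')}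
    {v : List (B × B' × B'')} (hs : NoStutter ((a, b), (a'', b'')) s)
    (hu : project (fun x => (x.1, x.2.2)) (a, a', a'') u =
      project (fun x => (x.1.1, x.2.1)) ((a, b), (a'', b'')) s)
    (hv : project (fun x => (x.1, x.2.2)) (b, b', b'') v =
      project (fun x => (x.1.2, x.2.2)) ((a, b), (a'', b'')) s) :
    ∃ w : List ((A × A' × A'') × (B × B' × B'')),
      project (fun p => ((p.1.1, p.2.1), (p.1.2.2, p.2.2.2))) ((a, a', a''), (b, b', b'')) w = s ∧
      (∀ {Y : Type u} (f : A × A' × A'' → Y),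
        project (fun p => f p.1) ((a, a', a''), (b, b', b'')) w = project f (a, a', a'') u) ∧
      (∀ {Y : Type u} (f : B × B' × B'' → Y),
        project (fun p => f p.2) ((a, a', a''), (b, b', b'')) w = project f (b, b', b'') v) ∧
      Along (fun p q => (q.1.2.1 = p.1.2.1 ∨ (q.2.1 = p.2.1 ∧ q.2.2.2 = p.2.2.2) ∨
          ¬ (q.1.1 = p.1.1 ∧ q.1.2.2 = p.1.2.2)) ∧
        (q.2.2.1 = p.2.2.1 ∨ (q.1.1 = p.1.1 ∧ q.1.2.1 = p.1.2.1 ∧ q.1.2.2 = p.1.2.2) ∨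
          ¬ (q.2.1 = p.2.1 ∧ q.2.2.2 = p.2.2.2))) ((a, a', a''), (b, b', b'')) w := by
  -- The list `s` is amalgamated with `u` over `A` and `A''`, and the result with `v` over `B` and
  -- `B''`.
  obtain ⟨w₁, k₁, k₂, k₃, k₄⟩ := exists_amalgam
    (fun x : (A × B) × (A'' × B'') => (x.1.1, x.2.1))
    (fun x : A × A' × A'' => (x.1, x.2.2)) ((a, b), (a'', b'')) (a, a', a'') rfl s u hu.symm
  have e₃ := fun {Y : Type u} (f : _ → Y) => project_comp_of_eq
    (x := (((a, b), (a'', b'')), (a, a', a''))) k₁ f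
  have e₄ := fun {Y : Type u} (f : _ → Y) => project_comp_of_eq
    (x := (((a, b), (a'', b'')), (a, a', a''))) k₂ f
  obtain ⟨w, h₁, h₂, h₃, h₄⟩ := exists_amalgam
    (fun x : ((A × B) × (A'' × B'')) × (A × A' × A'') => (x.1.1.2, x.1.2.2))
    (fun x : B × B' × B'' => (x.1, x.2.2)) (((a, b), (a'', b'')), (a, a', a'')) (b, b', b'') rfl
    w₁ v (by rw [hv]; exact e₃ fun x => (x.1.2, x.2.2))
  have e₁ := fun {Y : Type u} (f : _ → Y) => project_comp_of_eq
    (x := ((((a, b), (a'', b'')), (a, a', a'')), (b, b', b''))) h₁ f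
  have e₂ := fun {Y : Type u} (f : _ → Y) => project_comp_of_eq
    (x := ((((a, b), (a'', b'')), (a, a', a'')), (b, b', b''))) h₂ f
  have k₃' := along_of_project_eq (x := ((((a, b), (a'', b'')), (a, a', a'')), (b, b', b''))) h₁
    (k₃.mono fun p q h => Or.inr h)
  have k₄' : ∀ p ∈ w, (p.1.1.1.1, p.1.1.2.1) = (p.1.2.1, p.1.2.2.2) := by
    refine forall_of_project (π := Prod.fst) (R := fun p : ((A × B) × (A'' × B'')) ×
      (A × A' × A'') => (p.1.1.1, p.1.2.1) = (p.2.1, p.2.2.2)) (x := ((((a, b), (a'', b'')),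
        (a, a', a'')), (b, b', b''))) rfl fun p hp => ?_
    rw [h₁] at hp
    obtain ⟨q, hq, rfl⟩ := mem_of_mem_project hp
    exact k₄ _ hq
  let θ : (((A × B) × (A'' × B'')) × (A × A' × A'')) × (B × B' × B'') →
    (A × A' × A'') × (B × B' × B'') := fun p => (p.1.2, p.2)
  have eθ := fun {Y : Type u} (f : _ → Y) => project_map θ f
    ((((a, b), (a'', b'')), (a, a', a'')), (b, b', b'')) w
  refine ⟨w.map θ, (eθ _).trans ?_, fun f => (eθ _).trans ((e₁ fun p => f p.2).trans (e₄ f)),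
    fun f => (eθ _).trans (e₂ f), ?_⟩
  · rw [project_congr (π := fun p => (((θ p).1.1, (θ p).2.1), ((θ p).1.2.2, (θ p).2.2.2)))
      (π' := fun p => p.1.1) rfl fun p hp => by
      obtain ⟨m₁, m₂⟩ := Prod.mk.inj (k₄' p hp)
      obtain ⟨m₃, m₄⟩ := Prod.mk.inj (h₄ p hp)
      exact Prod.ext (Prod.ext m₁.symm m₃.symm) (Prod.ext m₂.symm m₄.symm)]
    exact (e₁ fun p => p.1).trans ((e₃ fun p => p).trans (project_id_of_noStutter hs))
  · refine (along_map θ ((((a, b), (a'', b'')), (a, a', a'')), (b, b', b'')) w).2 ?_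
    have := k₃'.and h₃
    have hw : ∀ {W : Type u} {R : W → W → Prop} {Q : W → Prop} {x : W} {l : List W},
        Q x → (∀ y ∈ l, Q y) → Along R x l → Along (fun p q => Q p ∧ Q q ∧ R p q) x l := by
      intro W R Q x l hx hl h
      induction l generalizing x with
      | nil => trivial
      | cons y l ih =>
        have hy := hl y (List.mem_cons_self ..)
        exact ⟨⟨hx, hy, h.1⟩, ih hy (fun z hz => hl z (List.mem_cons_of_mem _ hz)) h.2⟩
    refine (hw (Q := fun p => (p.1.1.1.1, p.1.1.2.1) = (p.1.2.1, p.1.2.2.2) ∧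
      (p.1.1.1.2, p.1.1.2.2) = (p.2.1, p.2.2.2)) ⟨rfl, rfl⟩ (fun p hp => ⟨k₄' p hp, h₄ p hp⟩)
      this).mono fun p q h => ?_
    obtain ⟨⟨m₁, m₂⟩, ⟨m₃, m₄⟩, h, h'⟩ := h
    simp only [Prod.mk.injEq] at m₁ m₂ m₃ m₄
    simp only [θ, ← m₁.1, ← m₁.2, ← m₂.1, ← m₂.2, ← m₃.1, ← m₃.2, ← m₄.1, ← m₄.2]
    constructor
    · rcases h with h | h | h | h
      · exact Or.inl (by rw [h])
      · exact Or.inr (Or.inl (by rw [h]; exact ⟨rfl, rfl⟩))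
      · exact Or.inl (by rw [h])
      · exact Or.inr (Or.inr fun e => h (Prod.ext e.1 e.2))
    · rcases h' with h | h | h
      · exact Or.inr (Or.inl (by rw [h]; exact ⟨rfl, rfl, rfl⟩))
      · exact Or.inl (by rw [h])
      · exact Or.inr (Or.inr fun e => h (Prod.ext e.1 e.2))

/-- A list that is shared by two agents `π₁`, `π₂`; the agent that has opened an exchange
(`i = 1` or `j = 1`) has to close it. -/
def Shared {W X Y : Type*} (π₁ : W → X) (π₂ : W → Y) : ℤ → ℤ → W → List W → Prop
  | _, _, _, [] => True
  | i, j, x, y :: s => (j = 0 ∧ π₂ y = π₂ x ∧ π₁ y ≠ π₁ x ∧ Shared π₁ π₂ (1 - i) 0 y s) ∨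
      (i = 0 ∧ π₁ y = π₁ x ∧ π₂ y ≠ π₂ x ∧ Shared π₁ π₂ 0 (1 - j) y s)

/-- An agent with an open exchange is the one to move, and its own coherence determines the step. If
no exchange is open, Opponent moves, and equal steps concern the same agent, so the comparison can
go on. -/
theorem Shared.coh {W X Y : Type*} {π₁ : W → X} {π₂ : W → Y}
    (hπ : ∀ x y, π₁ x = π₁ y → π₂ x = π₂ y → x = y) {i j : ℤ} {x : W} {s s' : List W}
    (hs : Shared π₁ π₂ i j x s) (hs' : Shared π₁ π₂ i j x s')
    (h₁ : Coh i (project π₁ x s) (project π₁ x s'))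
    (h₂ : Coh j (project π₂ x s) (project π₂ x s')) : Coh (i + j) s s' := by
  induction s generalizing i j x s' with
  | nil => simp
  | cons y s ih =>
    cases s' with
    | nil => simp
    | cons y' s' =>
      rcases hs with ⟨rfl, e₂, e₁, hs⟩ | ⟨rfl, e₁, e₂, hs⟩ <;>
        rcases hs' with ⟨e, k₂, k₁, hs'⟩ | ⟨e, k₁, k₂, hs'⟩
      · rw [project_cons_of_ne e₁, project_cons_of_ne k₁] at h₁
        rw [project_cons_of_eq e₂, project_cons_of_eq k₂] at h₂
        refine ⟨fun hi => hπ _ _ (h₁.1 (by omega)) (e₂.trans k₂.symm), ?_⟩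
        rintro rfl
        have := ih hs hs' (h₁.2 rfl) h₂
        rwa [show 1 - (i + 0) = 1 - i + 0 by ring]
      · subst e
        refine ⟨by simp, ?_⟩
        rintro rfl
        exact (k₂ e₂).elim
      · subst e
        refine ⟨by simp, ?_⟩
        rintro rfl
        exact (e₂ k₂).elim
      · rw [project_cons_of_ne e₂, project_cons_of_ne k₂] at h₂
        rw [project_cons_of_eq e₁, project_cons_of_eq k₁] at h₁
        refine ⟨fun hi => hπ _ _ (e₁.trans k₁.symm) (h₂.1 (by omega)), ?_⟩
        rintro rfl
        have := ih hs hs' h₁ (h₂.2 rfl)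
        rwa [show 1 - (0 + j) = 0 + (1 - j) by ring]

namespace MBGame

open ConwayGame

variable {A A' A'' B B' B'' C D : MBGame.{u}}

theorem step_iff {x y : A.Pos × B.Pos} :
    Step A B x y ↔ A.OK x.1 y.1 ∧ B.OK x.2 y.2 ∧ (y.1 = x.1 ∨ y.2 = x.2) := by
  constructor
  · rintro (⟨h, e⟩ | ⟨e, h⟩)
    · exact ⟨h, Or.inl e, Or.inr e⟩
    · exact ⟨Or.inl e, h, Or.inl e⟩
  · rintro ⟨h, h', e | e⟩
    · exact Or.inr ⟨e, h'⟩
    · exact Or.inl ⟨h, e⟩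

/-- Plays of `(A ⊗ B)* ⊗ (A' ⊗ B')`, in terms of the balances of the components. -/
theorem isPlay_tensor_iff {W : Type*} {a : W → A.Pos} {b : W → B.Pos} {a' : W → A'.Pos}
    {b' : W → B'.Pos} {x : W} {u : List W} (ha : a x = A.root) (hb : b x = B.root)
    (ha' : a' x = A'.root) (hb' : b' x = B'.root) :
    ((A.tensor B).dual.tensor (A'.tensor B')).IsPlay
        (project (fun w => ((a w, b w), (a' w, b' w))) x u) ↔
      Along (fun p q => (Step A B (a p, b p) (a q, b q) ∧ a' q = a' p ∧ b' q = b' p) ∨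
        (a q = a p ∧ b q = b p ∧ Step A' B' (a' p, b' p) (a' q, b' q))) x u ∧
      ∀ t, t <+: u → 0 ≤ A'.bal a' x t + B'.bal b' x t - (A.bal a x t + B.bal b x t) ∧
        A'.bal a' x t + B'.bal b' x t - (A.bal a x t + B.bal b x t) ≤ 1 := by
  rw [isPlay_iff (A := A.tensor B) (B := A'.tensor B') (a := fun w => (a w, b w))
    (b := fun w => (a' w, b' w)) (Prod.ext ha hb) (Prod.ext ha' hb')]
  have e : ∀ p q : W, Step (A.tensor B) (A'.tensor B') ((a p, b p), (a' p, b' p))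
      ((a q, b q), (a' q, b' q)) ↔
      (Step A B (a p, b p) (a q, b q) ∧ a' q = a' p ∧ b' q = b' p) ∨
        (a q = a p ∧ b q = b p ∧ Step A' B' (a' p, b' p) (a' q, b' q)) := by
    intro p q
    rw [Step, ok_tensor, ok_tensor, Prod.mk.injEq, Prod.mk.injEq, and_assoc]
  simp only [e]
  refine and_congr_right fun h => forall₂_congr fun t ht => ?_
  have ht' := h.prefix ht
  have h₁ : Along (fun p q => Step A B (a p, b p) (a q, b q)) x t := ht'.mono fun p q h => by
    rcases h with h | ⟨h, h', -⟩
    · exact h.1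
    · exact Or.inl ⟨Or.inl h, h'⟩
  have h₂ : Along (fun p q => Step A' B' (a' p, b' p) (a' q, b' q)) x t := ht'.mono fun p q h => by
    rcases h with ⟨-, h, h'⟩ | h
    · exact Or.inl ⟨Or.inl h, h'⟩
    · exact h.2.2
  rw [bal_tensor h₁, bal_tensor h₂]

theorem isPlay_tensor_iff' {s : List ((A.Pos × B.Pos) × (A'.Pos × B'.Pos))} :
    ((A.tensor B).dual.tensor (A'.tensor B')).IsPlay s ↔
      NoStutter ((A.root, B.root), (A'.root, B'.root)) s ∧
      ((A.tensor B).dual.tensor (A'.tensor B')).IsPlay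
        (project (fun w => ((w.1.1, w.1.2), (w.2.1, w.2.2)))
          ((A.root, B.root), (A'.root, B'.root)) s) := by
  constructor
  · intro h
    have h' := h.noStutter
    refine ⟨h', ?_⟩
    have := project_id_of_noStutter h'
    exact this.symm ▸ h
  · rintro ⟨h, h'⟩
    have := project_id_of_noStutter h
    exact this ▸ h'

/-- The balances of the two factors are nonnegative and add up to at most one: at most one exchange
is open, and until it is closed any move in the other factor would violate one of the bounds. -/
theorem shared_of_bounds {i j : ℤ} {x : (A.Pos × B.Pos) × (A'.Pos × B'.Pos)}
    {s : List ((A.Pos × B.Pos) × (A'.Pos × B'.Pos))} (h₀ : NoStutter x s)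
    (h₁ : Along (fun p q => (Step A B (p.1.1, p.1.2) (q.1.1, q.1.2) ∧ q.2.1 = p.2.1 ∧
        q.2.2 = p.2.2) ∨ (q.1.1 = p.1.1 ∧ q.1.2 = p.1.2 ∧
        Step A' B' (p.2.1, p.2.2) (q.2.1, q.2.2))) x s)
    (h₂ : ∀ t, t <+: s → 0 ≤ i + (A'.bal (fun p => p.2.1) x t - A.bal (fun p => p.1.1) x t) ∧
      0 ≤ j + (B'.bal (fun p => p.2.2) x t - B.bal (fun p => p.1.2) x t) ∧
      i + j + (A'.bal (fun p => p.2.1) x t - A.bal (fun p => p.1.1) x t) +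
        (B'.bal (fun p => p.2.2) x t - B.bal (fun p => p.1.2) x t) ≤ 1) :
    Shared (fun p => (p.1.1, p.2.1)) (fun p => (p.1.2, p.2.2)) i j x s := by
  induction s generalizing x i j with
  | nil => trivial
  | cons y s ih =>
    obtain ⟨⟨a, b⟩, ⟨a', b'⟩⟩ := x
    obtain ⟨⟨c, d⟩, ⟨c', d'⟩⟩ := y
    have e₀ := h₂ [] (by simp)
    have e₁ := h₂ [((c, d), (c', d'))] (by simp)
    simp only [bal_cons, bal_nil, add_zero, sub_zero] at e₀ e₁
    have key : ∀ i₁ j₁, i₁ = i + (A'.inc a' c' - A.inc a c) →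
        j₁ = j + (B'.inc b' d' - B.inc b d) →
        Shared (fun p : (A.Pos × B.Pos) × (A'.Pos × B'.Pos) => (p.1.1, p.2.1))
          (fun p => (p.1.2, p.2.2)) i₁ j₁ ((c, d), (c', d')) s := by
      rintro i₁ j₁ rfl rfl
      refine ih h₀.2 h₁.2 fun t ht => ?_
      have := h₂ (((c, d), (c', d')) :: t) (by simpa using ht)
      simp only [bal_cons] at this
      omega
    have s₀ := h₀.1
    have s₁ := h₁.1
    clear h₀ h₁ h₂
    simp only [Step, OK, ne_eq, Prod.mk.injEq] at s₀ s₁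
    have inc_eq : ∀ {G : MBGame.{u}} {x y : G.Pos}, G.Edge x y →
        G.inc x y = 1 ∨ G.inc x y = -1 := fun h =>
      h.cases.imp inc_of_opp inc_of_prop
    have cases : (A.Edge a c ∧ d = b ∧ c' = a' ∧ d' = b') ∨
        (c = a ∧ B.Edge b d ∧ c' = a' ∧ d' = b') ∨ (c = a ∧ d = b ∧ A'.Edge a' c' ∧ d' = b') ∨
        (c = a ∧ d = b ∧ c' = a' ∧ B'.Edge b' d') := by tauto
    clear s₀ s₁
    rcases cases with ⟨h, rfl, rfl, rfl⟩ | ⟨rfl, h, rfl, rfl⟩ | ⟨rfl, rfl, h, rfl⟩ |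
      ⟨rfl, rfl, rfl, h⟩
    · simp only [inc_self] at e₁ key
      have := inc_eq h
      exact Or.inl ⟨by omega, rfl, by simp [h.ne], key _ _ (by omega) (by omega)⟩
    · simp only [inc_self] at e₁ key
      have := inc_eq h
      exact Or.inr ⟨by omega, rfl, by simp [h.ne], key _ _ (by omega) (by omega)⟩
    · simp only [inc_self] at e₁ key
      have := inc_eq h
      exact Or.inl ⟨by omega, rfl, by simp [h.ne], key _ _ (by omega) (by omega)⟩
    · simp only [inc_self] at e₁ key
      have := inc_eq h
      exact Or.inr ⟨by omega, rfl, by simp [h.ne], key _ _ (by omega) (by omega)⟩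

theorem IsStrat.tensor {S : Set (List (A.Pos × A'.Pos))} {T : Set (List (B.Pos × B'.Pos))}
    (hS : IsStrat A A' S) (hT : IsStrat B B' T) :
    IsStrat (A.tensor B) (A'.tensor B') (tensorPlays A A' B B' S T) where
  isPlay _ hs := hs.1
  even := by
    rintro s ⟨h, h₁, h₂⟩
    have e₁ := (even_iff rfl rfl (hS.isPlay _ h₁)).1 (hS.even _ h₁)
    have e₂ := (even_iff rfl rfl (hT.isPlay _ h₂)).1 (hT.even _ h₂)
    obtain ⟨hn, h'⟩ := isPlay_tensor_iff'.1 h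
    obtain ⟨k, -⟩ := (isPlay_tensor_iff rfl rfl rfl rfl).1 h'
    rw [← project_id_of_noStutter hn]
    refine (even_iff (A := A.tensor B) (B := A'.tensor B') (W := (A.Pos × B.Pos) × (A'.Pos × B'.Pos))
      (a := fun w => (w.1.1, w.1.2)) (b := fun w => (w.2.1, w.2.2)) rfl rfl h').2 ?_
    rw [bal_tensor, bal_tensor]
    · omega
    · refine k.mono fun p q h => ?_
      rcases h with h | ⟨h, h', -⟩
      · exact h.1
      · exact Or.inl ⟨Or.inl h, h'⟩
    · refine k.mono fun p q h => ?_
      rcases h with ⟨-, h, h'⟩ | h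
      · exact Or.inl ⟨Or.inl h, h'⟩
      · exact h.2.2
  nil := ⟨trivial, hS.nil, hT.nil⟩
  prefix_mem := by
    rintro s t hs ⟨h, h₁, h₂⟩
    have hp := h.prefix (List.prefix_append _ _)
    obtain ⟨hn, h'⟩ := isPlay_tensor_iff'.1 hp
    obtain ⟨k, -⟩ := (isPlay_tensor_iff rfl rfl rfl rfl).1 h'
    rw [← project_id_of_noStutter hn] at hs
    have e := (even_iff (A := A.tensor B) (B := A'.tensor B') (W := (A.Pos × B.Pos) × (A'.Pos × B'.Pos))
      (a := fun w => (w.1.1, w.1.2)) (b := fun w => (w.2.1, w.2.2)) rfl rfl h').1 hs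
    -- As for composites: the balances of the two factors are nonnegative with sum 0, hence both are
    -- 0 and the two projections of the prefix have even length.
    rw [bal_tensor, bal_tensor] at e
    · have b₁ := ((isPlay_iff rfl rfl).1 (hS.isPlay _ h₁)).2 s (List.prefix_append _ _)
      have b₂ := ((isPlay_iff rfl rfl).1 (hT.isPlay _ h₂)).2 s (List.prefix_append _ _)
      have p₁ := (hS.isPlay _ h₁).prefix (project_prefix _ _ (List.prefix_append s t))
      have p₂ := (hT.isPlay _ h₂).prefix (project_prefix _ _ (List.prefix_append s t))
      rw [project_append] at h₁ h₂
      refine ⟨hp, hS.prefix_mem _ _ ((even_iff rfl rfl p₁).2 ?_) h₁,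
        hT.prefix_mem _ _ ((even_iff rfl rfl p₂).2 ?_) h₂⟩
      · omega
      · omega
    · refine k.mono fun p q h => ?_
      rcases h with h | ⟨h, h', -⟩
      · exact h.1
      · exact Or.inl ⟨Or.inl h, h'⟩
    · refine k.mono fun p q h => ?_
      rcases h with ⟨-, h, h'⟩ | h
      · exact Or.inl ⟨Or.inl h, h'⟩
      · exact h.2.2
  coh := by
    have key : ∀ s ∈ tensorPlays A A' B B' S T,
        Shared (fun p => (p.1.1, p.2.1)) (fun p => (p.1.2, p.2.2)) 0 0
          ((A.root, B.root), (A'.root, B'.root)) s := by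
      rintro s ⟨h, h₁, h₂⟩
      obtain ⟨hn, h'⟩ := isPlay_tensor_iff'.1 h
      obtain ⟨k, k'⟩ := (isPlay_tensor_iff rfl rfl rfl rfl).1 h'
      refine shared_of_bounds hn k fun t ht => ?_
      have := k' t ht
      have := ((isPlay_iff rfl rfl).1 (hS.isPlay _ h₁)).2 t ht
      have := ((isPlay_iff rfl rfl).1 (hT.isPlay _ h₂)).2 t ht
      omega
    intro s hs t ht
    refine (key s hs).coh (fun x y h h' => ?_) (key t ht) (hS.coh _ hs.2.1 _ ht.2.1)
      (hT.coh _ hs.2.2 _ ht.2.2)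
    rw [Prod.mk.injEq] at h h'
    exact Prod.ext (Prod.ext h.1 h'.1) (Prod.ext h.2 h'.2)
  bracket := by
    rintro s t ⟨h, h₁, h₂⟩ hf
    have hs : ((A.tensor B).dual.tensor (A'.tensor B')).IsPath
        (s.getLastD ((A.root, B.root), (A'.root, B'.root))) t := by
      rw [isPath_iff]
      exact ((along_append _ _ _).1 ((isAlternating_iff _).1 h).1).2
    obtain ⟨hn, h'⟩ := isPlay_tensor_iff'.1 h
    obtain ⟨k, -⟩ := (isPlay_tensor_iff rfl rfl rfl rfl).1 h'
    have k' := ((along_append _ _ _).1 k).2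
    have q₁ := hS.bracket_project (a := fun w : (A.Pos × B.Pos) × (A'.Pos × B'.Pos) => w.1.1)
      rfl rfl s t h₁ _ rfl
    have q₂ := hT.bracket_project (a := fun w : (A.Pos × B.Pos) × (A'.Pos × B'.Pos) => w.1.2)
      rfl rfl s t h₂ _ rfl
    have hs' : ∀ p, ((A.tensor B).dual.tensor (A'.tensor B')).Fresh p
        (s.getLastD ((A.root, B.root), (A'.root, B'.root))) t ↔ _ := fun p => fresh_tensor hs
    have f₁ : ∀ p, (A.tensor B).Fresh p (s.getLastD ((A.root, B.root), (A'.root, B'.root))).1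
        (project Prod.fst (s.getLastD ((A.root, B.root), (A'.root, B'.root))) t) ↔ _ := fun p =>
      fresh_tensor_project (a := fun w : (A.Pos × B.Pos) × (A'.Pos × B'.Pos) => w.1.1)
        (b := fun w => w.1.2) (k'.mono fun p q h => by
          rcases h with h | ⟨h, h', -⟩
          · exact h.1
          · exact Or.inl ⟨Or.inl h, h'⟩) p
    have f₂ : ∀ p, (A'.tensor B').Fresh p (s.getLastD ((A.root, B.root), (A'.root, B'.root))).2
        (project Prod.snd (s.getLastD ((A.root, B.root), (A'.root, B'.root))) t) ↔ _ := fun p =>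
      fresh_tensor_project (a := fun w : (A.Pos × B.Pos) × (A'.Pos × B'.Pos) => w.2.1)
        (b := fun w => w.2.2) (k'.mono fun p q h => by
          rcases h with ⟨-, h, h'⟩ | h
          · exact Or.inl ⟨Or.inl h, h'⟩
          · exact h.2.2) p
    rw [hs', fresh_dual, f₁, f₂, neg_neg] at hf
    rw [hs', fresh_dual, f₁, f₂]
    -- A fresh Opponent query belongs to one of the two factors, and the strategy that is played
    -- there already provides a fresh Player query.
    rcases hf with (hf | hf) | (hf | hf)
    · exact (q₁ (Or.inl hf)).imp Or.inl Or.inl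
    · exact (q₂ (Or.inl hf)).imp Or.inr Or.inr
    · exact (q₁ (Or.inr hf)).imp Or.inl Or.inl
    · exact (q₂ (Or.inr hf)).imp Or.inr Or.inr

theorem IsCC.project {f : A.Pos → B.Pos}
    (hf : ∀ p x y, A.Move p x y → f y = f x ∨ B.Move p (f x) (f y)) {x : A.Pos}
    {s : List (A.Pos × A.Pos)} (h : IsCC A x s) :
    IsCC B (f x) (project (fun w => (f w.1, f w.2)) (x, x) s) := by
  induction s using two_step_induction generalizing x with
  | nil => trivial
  | one p => exact h.elim
  | cons p q s ih =>
    obtain ⟨q₁, q₂⟩ := q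
    obtain ⟨e, h₁, h₂⟩ := h
    dsimp only at e h₁ h₂; subst e
    have := ih h₂
    rcases h₁ with ⟨h₁, rfl⟩ | ⟨h₁, rfl⟩
    · rcases hf _ _ _ h₁ with e | h
      · rw [e] at this
        simpa [_root_.project, e] using this
      · have h' := h.ne
        simp [_root_.project, h', IsCC, h, this]
    · rcases hf _ _ _ h₁ with e | h
      · rw [e] at this
        simpa [_root_.project, e] using this
      · have h' := h.ne
        simp [_root_.project, h', IsCC, h, this]

theorem tensorPlays_id : tensorPlays A A B B (idPlays A) (idPlays B) = idPlays (A.tensor B) := by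
  refine ((isStrat_id A).tensor (isStrat_id B)).eq_id fun s hs => ?_
  have h := mem_idPlays.1 hs
  refine ⟨hs.1, mem_idPlays.2 ?_, mem_idPlays.2 ?_⟩
  · refine h.project (f := Prod.fst) fun p x y h => ?_
    rcases h with h | h
    · exact Or.inr h.1
    · exact Or.inl h.1.symm
  · refine h.project (f := Prod.snd) fun p x y h => ?_
    rcases h with h | h
    · exact Or.inl h.2.symm
    · exact Or.inr h.2

section

variable {W : Type*} {a : W → A.Pos} {b : W → B.Pos} {a' : W → A'.Pos} {b' : W → B'.Pos}
  {a'' : W → A''.Pos} {b'' : W → B''.Pos} {x : W} {u : List W}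

theorem mem_tensorPlays_iff {S : Set (List (A.Pos × A'.Pos))} {T : Set (List (B.Pos × B'.Pos))}
    (ha : a x = A.root) (hb : b x = B.root) (ha' : a' x = A'.root) (hb' : b' x = B'.root) :
    project (fun w => ((a w, b w), (a' w, b' w))) x u ∈ tensorPlays A A' B B' S T ↔
      ((A.tensor B).dual.tensor (A'.tensor B')).IsPlay
        (project (fun w => ((a w, b w), (a' w, b' w))) x u) ∧
      project (fun w => (a w, a' w)) x u ∈ S ∧ project (fun w => (b w, b' w)) x u ∈ T := by
  have e₁ := project_project (fun w => ((a w, b w), (a' w, b' w))) (fun p => (p.1.1, p.2.1)) x u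
  have e₂ := project_project (fun w => ((a w, b w), (a' w, b' w))) (fun p => (p.1.2, p.2.2)) x u
  dsimp only at e₁ e₂
  rw [ha, hb, ha', hb'] at e₁ e₂
  rw [← e₁, ← e₂]
  exact Iff.rfl

variable {S : Set (List (A.Pos × A'.Pos))} {S' : Set (List (A'.Pos × A''.Pos))}
  {T : Set (List (B.Pos × B'.Pos))} {T' : Set (List (B'.Pos × B''.Pos))}

theorem mem_tensorPlays_comp (hS : S ⊆ Plays A A') (hS' : S' ⊆ Plays A' A'')
    (hT : T ⊆ Plays B B') (hT' : T' ⊆ Plays B' B'') (ha : a x = A.root) (hb : b x = B.root)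
    (ha' : a' x = A'.root) (hb' : b' x = B'.root) (ha'' : a'' x = A''.root)
    (hb'' : b'' x = B''.root) (h₁ : project (fun w => (a w, a' w)) x u ∈ S)
    (h₂ : project (fun w => (a' w, a'' w)) x u ∈ S') (h₃ : project (fun w => (b w, b' w)) x u ∈ T)
    (h₄ : project (fun w => (b' w, b'' w)) x u ∈ T')
    (h : ((A.tensor B).dual.tensor (A''.tensor B'')).IsPlay
        (project (fun w => ((a w, b w), (a'' w, b'' w))) x u)) :
    project (fun w => ((a w, b w), (a'' w, b'' w))) x u ∈
      tensorPlays A A'' B B'' (compPlays A A' A'' S S') (compPlays B B' B'' T T') := by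
  obtain ⟨k, k'⟩ := (isPlay_tensor_iff ha hb ha'' hb'').1 h
  have b₁ := ((isPlay_iff ha ha').1 (hS h₁)).2
  have b₂ := ((isPlay_iff ha' ha'').1 (hS' h₂)).2
  have b₃ := ((isPlay_iff hb hb').1 (hT h₃)).2
  have b₄ := ((isPlay_iff hb' hb'').1 (hT' h₄)).2
  refine (mem_tensorPlays_iff ha hb ha'' hb'').2 ⟨h, ?_, ?_⟩
  · rw [compPlays_eq]
    refine ⟨mem_compTr_of_list ha ha' ha'' h₁ h₂, (isPlay_iff ha ha'').2
      ⟨k.mono fun p q h => ?_, fun t ht => ?_⟩⟩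
    · simp only [Step] at h ⊢
      rcases h with ⟨h | h, h', -⟩ | ⟨h, -, h' | h'⟩
      · exact Or.inl ⟨h.1, h'⟩
      · exact Or.inl ⟨Or.inl h.1, h'⟩
      · exact Or.inr ⟨h, h'.1⟩
      · exact Or.inr ⟨h, Or.inl h'.1⟩
    · have := k' t ht; have := b₁ t ht; have := b₂ t ht; have := b₃ t ht; have := b₄ t ht
      omega
  · rw [compPlays_eq]
    refine ⟨mem_compTr_of_list hb hb' hb'' h₃ h₄, (isPlay_iff hb hb'').2
      ⟨k.mono fun p q h => ?_, fun t ht => ?_⟩⟩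
    · simp only [Step] at h ⊢
      rcases h with ⟨h | h, -, h'⟩ | ⟨-, h, h' | h'⟩
      · exact Or.inl ⟨Or.inl h.2, h'⟩
      · exact Or.inl ⟨h.2, h'⟩
      · exact Or.inr ⟨h, Or.inl h'.2⟩
      · exact Or.inr ⟨h, h'.2⟩
    · have := k' t ht; have := b₁ t ht; have := b₂ t ht; have := b₃ t ht; have := b₄ t ht
      omega

/-- One list interacts in both factors, and the hidden games `A'` and `B'` have to move as a single
tensor product. The bounds are linear consequences of those for the factors and for the external
play; `hl` prevents a hidden move of one factor from coinciding with a move of the other. -/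
theorem mem_compPlays_tensor (hS : S ⊆ Plays A A') (hS' : S' ⊆ Plays A' A'')
    (hT : T ⊆ Plays B B') (hT' : T' ⊆ Plays B' B'') (ha : a x = A.root) (hb : b x = B.root)
    (ha' : a' x = A'.root) (hb' : b' x = B'.root) (ha'' : a'' x = A''.root)
    (hb'' : b'' x = B''.root) (h₁ : project (fun w => (a w, a' w)) x u ∈ S)
    (h₂ : project (fun w => (a' w, a'' w)) x u ∈ S') (h₃ : project (fun w => (b w, b' w)) x u ∈ T)
    (h₄ : project (fun w => (b' w, b'' w)) x u ∈ T')
    (h : ((A.tensor B).dual.tensor (A''.tensor B'')).IsPlay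
        (project (fun w => ((a w, b w), (a'' w, b'' w))) x u))
    (hl : Along (fun p q => (a' q = a' p ∨ (b q = b p ∧ b'' q = b'' p) ∨
        ¬ (a q = a p ∧ a'' q = a'' p)) ∧
      (b' q = b' p ∨ (a q = a p ∧ a' q = a' p ∧ a'' q = a'' p) ∨
        ¬ (b q = b p ∧ b'' q = b'' p))) x u) :
    project (fun w => ((a w, b w), (a'' w, b'' w))) x u ∈
      compPlays (A.tensor B) (A'.tensor B') (A''.tensor B'') (tensorPlays A A' B B' S T)
        (tensorPlays A' A'' B' B'' S' T') := by
  obtain ⟨k, k'⟩ := (isPlay_tensor_iff ha hb ha'' hb'').1 h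
  obtain ⟨c₁, b₁⟩ := (isPlay_iff ha ha').1 (hS h₁)
  obtain ⟨c₂, b₂⟩ := (isPlay_iff ha' ha'').1 (hS' h₂)
  obtain ⟨c₃, b₃⟩ := (isPlay_iff hb hb').1 (hT h₃)
  obtain ⟨c₄, b₄⟩ := (isPlay_iff hb' hb'').1 (hT' h₄)
  have hl := (((c₁.and c₂).and (c₃.and c₄)).and k).and hl
  rw [compPlays_eq]
  refine ⟨mem_compTr_of_list (f := fun w => (a w, b w)) (g := fun w => (a' w, b' w))
    (h := fun w => (a'' w, b'' w)) (Prod.ext ha hb) (Prod.ext ha' hb') (Prod.ext ha'' hb'')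
    ((mem_tensorPlays_iff ha hb ha' hb').2 ⟨?_, h₁, h₃⟩)
    ((mem_tensorPlays_iff ha' hb' ha'' hb'').2 ⟨?_, h₂, h₄⟩), h⟩
  · refine (isPlay_tensor_iff ha hb ha' hb').2 ⟨hl.mono fun p q h => ?_, fun t ht => ?_⟩
    · simp only [step_iff] at h ⊢
      obtain ⟨⟨⟨⟨⟨o₁, o₂, -⟩, -, o₃, -⟩, ⟨o₄, o₅, -⟩, -, o₆, -⟩, -⟩, -⟩ := id h
      simp only [o₁, o₂, o₃, o₄, o₅, o₆, true_and] at h ⊢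
      clear * - h
      grind
    · have := k' t ht; have := b₁ t ht; have := b₂ t ht; have := b₃ t ht; have := b₄ t ht
      omega
  · refine (isPlay_tensor_iff ha' hb' ha'' hb'').2 ⟨hl.mono fun p q h => ?_, fun t ht => ?_⟩
    · simp only [step_iff] at h ⊢
      obtain ⟨⟨⟨⟨⟨o₁, o₂, -⟩, -, o₃, -⟩, ⟨o₄, o₅, -⟩, -, o₆, -⟩, -⟩, -⟩ := id h
      simp only [o₁, o₂, o₃, o₄, o₅, o₆, true_and] at h ⊢
      clear * - h
      grind
    · have := k' t ht; have := b₁ t ht; have := b₂ t ht; have := b₃ t ht; have := b₄ t ht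
      omega

end

/-- An interaction of the two tensor products projects to interactions in the two factors.
Conversely, interactions of the factors over the same external play are amalgamated so that the
hidden moves of the two sides do not coincide. -/
theorem tensorPlays_compPlays {S : Set (List (A.Pos × A'.Pos))}
    {S' : Set (List (A'.Pos × A''.Pos))} {T : Set (List (B.Pos × B'.Pos))}
    {T' : Set (List (B'.Pos × B''.Pos))} (hS : S ⊆ Plays A A') (hS' : S' ⊆ Plays A' A'')
    (hT : T ⊆ Plays B B') (hT' : T' ⊆ Plays B' B'') :
    compPlays (A.tensor B) (A'.tensor B') (A''.tensor B'') (tensorPlays A A' B B' S T)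
      (tensorPlays A' A'' B' B'' S' T') =
    tensorPlays A A'' B B'' (compPlays A A' A'' S S') (compPlays B B' B'' T T') := by
  apply Set.Subset.antisymm
  · rintro s ⟨u, hu, hv, rfl, h⟩
    have hu := (mem_tensorPlays_iff (W := (A.Pos × B.Pos) × (A'.Pos × B'.Pos) ×
      (A''.Pos × B''.Pos)) (a := fun x => x.1.1) (b := fun x => x.1.2) (a' := fun x => x.2.1.1)
      (b' := fun x => x.2.1.2) rfl rfl rfl rfl).1 hu
    have hv := (mem_tensorPlays_iff (W := (A.Pos × B.Pos) × (A'.Pos × B'.Pos) ×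
      (A''.Pos × B''.Pos)) (a := fun x => x.2.1.1) (b := fun x => x.2.1.2)
      (a' := fun x => x.2.2.1) (b' := fun x => x.2.2.2) rfl rfl rfl rfl).1 hv
    exact mem_tensorPlays_comp hS hS' hT hT' rfl rfl rfl rfl rfl rfl hu.2.1 hv.2.1 hu.2.2 hv.2.2 h
  · rintro s ⟨hs, ⟨u, hu, hu', hus, hu''⟩, ⟨v, hv, hv', hvs, hv''⟩⟩
    obtain ⟨w, es, e₁, e₂, hl⟩ := exists_amalgam_pair (IsPlay.noStutter hs) hus hvs
    rw [← es] at hs ⊢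
    refine mem_compPlays_tensor (x := ((A.root, A'.root, A''.root), (B.root, B'.root, B''.root)))
      (a' := fun p => p.1.2.1) (b' := fun p => p.2.2.1) hS hS' hT hT' rfl rfl rfl rfl rfl rfl
      ?_ ?_ ?_ ?_ hs hl
    · exact (e₁ fun p => (p.1, p.2.1)) ▸ hu
    · exact (e₁ fun p => (p.2.1, p.2.2)) ▸ hu'
    · exact (e₂ fun p => (p.1, p.2.1)) ▸ hv
    · exact (e₂ fun p => (p.2.1, p.2.2)) ▸ hv'

end MBGame

/-! ## Synchronous relations between games -/

theorem exists_noStutter {W : Type*} (x : W) (u : List W) :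
    ∃ v, NoStutter x v ∧ ∀ {Y : Type u} (f : W → Y), project f x v = project f x u := by
  refine ⟨project (fun w => w) x u, noStutter_project (fun w => w) x u, fun f => ?_⟩
  exact project_project (fun w => w) f x u

namespace MBGame

open ConwayGame

variable {K X X' Y Y' Z : MBGame.{u}}

/-- A pair of simultaneous moves of the same polarity. -/
def SyncStep (Y X : MBGame.{u}) (p q : Y.Pos × X.Pos) : Prop :=
  ∃ m, Y.Move m p.1 q.1 ∧ X.Move m p.2 q.2

/-- A synchronous relation between two games: a set of paths of simultaneous moves. -/
def IsSync (Y X : MBGame.{u}) (P : Set (List (Y.Pos × X.Pos))) : Prop :=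
  ∀ s ∈ P, Along (SyncStep Y X) (Y.root, X.root) s

/-- Coherence of synchronous paths: the Opponent moves of `Y` are determined by those of `X`, and
the Proponent moves of `X` are determined by those of `Y`. -/
def SyncCoh (Y X : MBGame.{u}) : Y.Pos × X.Pos → List (Y.Pos × X.Pos) → List (Y.Pos × X.Pos) → Prop
  | x, y :: s, y' :: s' =>
      (Y.Move 1 x.1 y.1 → Y.Move 1 x.1 y'.1 → y.1 = y'.1 → y.2 = y'.2) ∧
      (Y.Move (-1) x.1 y.1 → Y.Move (-1) x.1 y'.1 → y.2 = y'.2 → y.1 = y'.1) ∧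
      (y = y' → SyncCoh Y X y s s')
  | _, _, _ => True

/-- Synchronous relations that turn strategies of `K* ⊗ Y` into strategies of `K* ⊗ X`. -/
structure IsTransl (Y X : MBGame.{u}) (P : Set (List (Y.Pos × X.Pos))) : Prop where
  sync : IsSync Y X P
  nil : [] ∈ P
  prefix_mem : ∀ s t, s ++ t ∈ P → s ∈ P
  coh : ∀ s ∈ P, ∀ t ∈ P, SyncCoh Y X (Y.root, X.root) s t
  fresh : ∀ s t, s ++ t ∈ P → ∀ q,
    Y.Fresh q (s.getLastD (Y.root, X.root)).1 (t.map Prod.fst) ↔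
      X.Fresh q (s.getLastD (Y.root, X.root)).2 (t.map Prod.snd)

section

variable {W : Type*} {k : W → K.Pos} {y : W → Y.Pos} {x : W → X.Pos} {w : W} {u : List W}
  {P : Set (List (Y.Pos × X.Pos))}

theorem IsSync.along (hP : IsSync Y X P) (hy : y w = Y.root) (hx : x w = X.root)
    (h : project (fun w => (y w, x w)) w u ∈ P) :
    Along (fun p q => (y q = y p ∧ x q = x p) ∨ SyncStep Y X (y p, x p) (y q, x q)) w u := by
  have := hP _ h
  rw [← hy, ← hx, along_project (fun w => (y w, x w))] at this
  exact this.mono fun p q h => h.imp_left Prod.mk.inj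

theorem bal_eq_of_along
    (h : Along (fun p q => (y q = y p ∧ x q = x p) ∨ SyncStep Y X (y p, x p) (y q, x q)) w u) :
    Y.bal y w u = X.bal x w u := by
  induction u generalizing w with
  | nil => rfl
  | cons v u ih =>
    rw [bal_cons, bal_cons, ih h.2]
    rcases h.1 with ⟨e, e'⟩ | ⟨m, h₁, h₂⟩
    · rw [e, e', inc_self, inc_self]
    · rw [inc_of_move h₁, inc_of_move h₂]

/-- Synchronous moves on the right do not affect alternation. -/
theorem IsSync.mem_plays_right (hP : IsSync Y X P) (hk : k w = K.root) (hy : y w = Y.root)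
    (hx : x w = X.root) (h : project (fun w => (y w, x w)) w u ∈ P) :
    project (fun w => (k w, y w)) w u ∈ Plays K Y ↔
      project (fun w => (k w, x w)) w u ∈ Plays K X := by
  have ha := hP.along hy hx h
  refine (isPlay_iff hk hy).trans (Iff.trans ?_ (isPlay_iff hk hx).symm)
  refine and_congr ⟨fun h => (ha.and h).mono fun p q h => ?_, fun h => (ha.and h).mono fun p q h =>
    ?_⟩ (forall₂_congr fun t ht => by rw [bal_eq_of_along (ha.prefix ht)])
  · simp only [step_iff] at h ⊢
    rcases h with ⟨⟨e, e'⟩ | ⟨m, h₁, h₂⟩, h₃, h₄, h₅⟩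
    · exact ⟨h₃, Or.inl e', Or.inr e'⟩
    · exact ⟨h₃, Or.inr ⟨m, h₂⟩, Or.inl (h₅.resolve_right h₁.ne)⟩
  · simp only [step_iff] at h ⊢
    rcases h with ⟨⟨e, e'⟩ | ⟨m, h₁, h₂⟩, h₃, h₄, h₅⟩
    · exact ⟨h₃, Or.inl e, Or.inr e⟩
    · exact ⟨h₃, Or.inr ⟨m, h₁⟩, Or.inl (h₅.resolve_right h₂.ne)⟩

/-- Synchronous moves on the left do not affect alternation. -/
theorem IsSync.mem_plays_left (hP : IsSync Y X P) (hk : k w = K.root) (hy : y w = Y.root)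
    (hx : x w = X.root) (h : project (fun w => (y w, x w)) w u ∈ P) :
    project (fun w => (y w, k w)) w u ∈ Plays Y K ↔
      project (fun w => (x w, k w)) w u ∈ Plays X K := by
  have ha := hP.along hy hx h
  refine (isPlay_iff hy hk).trans (Iff.trans ?_ (isPlay_iff hx hk).symm)
  refine and_congr ⟨fun h => (ha.and h).mono fun p q h => ?_, fun h => (ha.and h).mono fun p q h =>
    ?_⟩ (forall₂_congr fun t ht => by rw [bal_eq_of_along (ha.prefix ht)])
  · simp only [step_iff] at h ⊢
    rcases h with ⟨⟨e, e'⟩ | ⟨m, h₁, h₂⟩, h₃, h₄, h₅⟩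
    · exact ⟨Or.inl e', h₄, Or.inl e'⟩
    · exact ⟨Or.inr ⟨m, h₂⟩, h₄, Or.inr (h₅.resolve_left h₁.ne)⟩
  · simp only [step_iff] at h ⊢
    rcases h with ⟨⟨e, e'⟩ | ⟨m, h₁, h₂⟩, h₃, h₄, h₅⟩
    · exact ⟨Or.inl e, h₄, Or.inl e⟩
    · exact ⟨Or.inr ⟨m, h₁⟩, h₄, Or.inr (h₅.resolve_left h₂.ne)⟩

end

/-- The action of a relation on a set of plays. -/
abbrev act (K Y X : MBGame.{u}) (S : Set (List (K.Pos × Y.Pos))) (P : Set (List (Y.Pos × X.Pos))) :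
    Set (List (K.Pos × X.Pos)) :=
  compTr K.root Y.root X.root S P

theorem act_subset_plays {S : Set (List (K.Pos × Y.Pos))} {P : Set (List (Y.Pos × X.Pos))}
    (hS : S ⊆ Plays K Y) (hP : IsSync Y X P) : act K Y X S P ⊆ Plays K X := by
  rintro _ ⟨u, h₁, h₂, rfl⟩
  exact (hP.mem_plays_right rfl rfl rfl h₂).1 (hS h₁)

theorem act_subset_plays' {S : Set (List (X.Pos × K.Pos))} {P : Set (List (Y.Pos × X.Pos))}
    (hS : S ⊆ Plays X K) (hP : IsSync Y X P) : act Y X K P S ⊆ Plays Y K := by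
  rintro _ ⟨u, h₁, h₂, rfl⟩
  exact (hP.mem_plays_left rfl rfl rfl h₁).2 (hS h₂)

/-- Replacing `Y` by `X` along `P` changes neither the balance nor the side on which a step is made.
The alternation conditions before and after are therefore equivalent, and the relation may be
applied last. -/
theorem compPlays_act {S : Set (List (K.Pos × Z.Pos))} {T : Set (List (Z.Pos × Y.Pos))}
    {P : Set (List (Y.Pos × X.Pos))} (hP : IsSync Y X P) :
    compPlays K Z X S (act Z Y X T P) = act K Y X (compPlays K Z Y S T) P := by
  rw [compPlays_eq, compPlays_eq]
  apply Set.Subset.antisymm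
  · rintro s ⟨hs, hs'⟩
    rw [act, ← Set.inter_univ (compTr Z.root Y.root X.root T P)] at hs
    obtain ⟨w, h₁, h₂, h₃, -, rfl, -⟩ := exists_of_mem_compTr_right hs
    exact mem_compTr_of_list rfl rfl rfl ⟨mem_compTr_of_list rfl rfl rfl h₁ h₂,
      (hP.mem_plays_right rfl rfl rfl h₃).2 hs'⟩ h₃
  · intro s hs
    obtain ⟨w, h₁, h₂, h₃, h₄, rfl, -⟩ := exists_of_mem_compTr_left hs
    exact ⟨mem_compTr_of_list rfl rfl rfl h₁ (mem_compTr_of_list rfl rfl rfl h₂ h₃),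
      (hP.mem_plays_right rfl rfl rfl h₃).1 h₄⟩

/-- The plays of the morphism that translates the moves along `P`. -/
abbrev translPlays (Y X : MBGame.{u}) (P : Set (List (Y.Pos × X.Pos))) :
    Set (List (Y.Pos × X.Pos)) :=
  act Y Y X (idPlays Y) P

/-- Both the alternation filter of composition and the copycat part of the translation disappear:
composing with a translation is applying the relation. Equations between translations thereby reduce
to equations between relations. -/
theorem compPlays_transl {S : Set (List (K.Pos × Y.Pos))} {P : Set (List (Y.Pos × X.Pos))}
    (hS : S ⊆ Plays K Y) (hP : IsSync Y X P) :
    compPlays K Y X S (translPlays Y X P) = act K Y X S P := by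
  rw [compPlays_act hP, compPlays_id hS]

theorem transl_compPlays {S : Set (List (X.Pos × K.Pos))} {P : Set (List (Y.Pos × X.Pos))}
    (hS : S ⊆ Plays X K) (hP : IsSync Y X P) :
    compPlays Y X K (translPlays Y X P) S = act Y X K P S := by
  have h := id_compPlays (act_subset_plays' hS hP)
  rw [compPlays_eq] at h ⊢
  rwa [compTr_assoc]

theorem transl_compPlays_transl {P : Set (List (Y.Pos × X.Pos))} {Q : Set (List (X.Pos × Z.Pos))}
    (hP : IsSync Y X P) (hQ : IsSync X Z Q) :
    compPlays Y X Z (translPlays Y X P) (translPlays X Z Q) =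
      translPlays Y Z (compTr Y.root X.root Z.root P Q) := by
  rw [compPlays_transl (act_subset_plays (fun s hs => hs.1) hP) hQ]
  exact compTr_assoc _ _ _ _ _ _ _

theorem IsSync.comp {P : Set (List (Y.Pos × X.Pos))} {Q : Set (List (X.Pos × Z.Pos))}
    (hP : IsSync Y X P) (hQ : IsSync X Z Q) :
    IsSync Y Z (compTr Y.root X.root Z.root P Q) := by
  rintro _ ⟨u, h₁, h₂, rfl⟩
  have a₁ := hP.along rfl rfl h₁
  have a₂ := hQ.along rfl rfl h₂
  have := (along_project (R := SyncStep Y Z) (fun x : Y.Pos × X.Pos × Z.Pos => (x.1, x.2.2))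
    (Y.root, X.root, Z.root) u).2 ((a₁.and a₂).mono fun p q h => ?_)
  · exact this
  · rcases h with ⟨⟨e₁, e₂⟩ | ⟨m, h₁, h₂⟩, ⟨e₃, e₄⟩ | ⟨m', h₃, h₄⟩⟩
    · exact Or.inl (Prod.ext e₁ e₄)
    · exact (h₃.ne e₂).elim
    · exact (h₂.ne e₃).elim
    · obtain rfl := X.pol_unique h₂ h₃
      exact Or.inr ⟨m, h₁, h₄⟩

/-! ### Strategies are stable under the action of translations -/

/-- `i` is the balance. If `i = 1`, a move in `Y` is a Player move determined by the strategy, and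
the move in `X` is determined by it. If `i = 0`, Opponent moves, and equal moves in `X` come from
equal moves in `Y`, so the comparison of the two plays can continue. These are the two clauses of
`SyncCoh`. -/
theorem coh_act {i : ℤ} {w : K.Pos × Y.Pos × X.Pos}
    {u u' : List (K.Pos × Y.Pos × X.Pos)}
    (hu : Along (fun p q => (K.Edge p.1 q.1 ∧ q.2 = p.2) ∨
      (q.1 = p.1 ∧ SyncStep Y X (p.2.1, p.2.2) (q.2.1, q.2.2))) w u)
    (hu' : Along (fun p q => (K.Edge p.1 q.1 ∧ q.2 = p.2) ∨
      (q.1 = p.1 ∧ SyncStep Y X (p.2.1, p.2.2) (q.2.1, q.2.2))) w u')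
    (hi : ∀ t, t <+: u → 0 ≤ i + (Y.bal (fun p => p.2.1) w t - K.bal (fun p => p.1) w t) ∧
      i + (Y.bal (fun p => p.2.1) w t - K.bal (fun p => p.1) w t) ≤ 1)
    (hi' : ∀ t, t <+: u' → 0 ≤ i + (Y.bal (fun p => p.2.1) w t - K.bal (fun p => p.1) w t) ∧
      i + (Y.bal (fun p => p.2.1) w t - K.bal (fun p => p.1) w t) ≤ 1)
    (h : Coh i (project (fun p => (p.1, p.2.1)) w u) (project (fun p => (p.1, p.2.1)) w u'))
    (hP : SyncCoh Y X (w.2.1, w.2.2) (project (fun p => (p.2.1, p.2.2)) w u)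
      (project (fun p => (p.2.1, p.2.2)) w u')) :
    Coh i (project (fun p => (p.1, p.2.2)) w u) (project (fun p => (p.1, p.2.2)) w u') := by
  induction u generalizing w i u' with
  | nil => simp [project_nil]
  | cons v u ih =>
    cases u' with
    | nil => simp [project_nil]
    | cons v' u' =>
      obtain ⟨k, y, x⟩ := w
      obtain ⟨l, z, z₂⟩ := v
      obtain ⟨l', z', z₂'⟩ := v'
      have step : ∀ {l z} {z₂ : X.Pos} {u : List (K.Pos × Y.Pos × X.Pos)},
          (∀ t, t <+: (l, z, z₂) :: u → 0 ≤ i + (Y.bal (fun p => p.2.1) (k, y, x) t -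
            K.bal (fun p => p.1) (k, y, x) t) ∧
          i + (Y.bal (fun p => p.2.1) (k, y, x) t - K.bal (fun p => p.1) (k, y, x) t) ≤ 1) →
          (0 ≤ i ∧ i ≤ 1) ∧ ∀ t, t <+: u → 0 ≤ (i + (Y.inc y z - K.inc k l)) +
            (Y.bal (fun p => p.2.1) (l, z, z₂) t - K.bal (fun p => p.1) (l, z, z₂) t) ∧
          (i + (Y.inc y z - K.inc k l)) + (Y.bal (fun p => p.2.1) (l, z, z₂) t -
            K.bal (fun p => p.1) (l, z, z₂) t) ≤ 1 := by
        intro l z z₂ u h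
        refine ⟨by simpa using h [] (by simp), fun t ht => ?_⟩
        have := h ((l, z, z₂) :: t) (by simpa using ht)
        simp only [bal_cons] at this
        omega
      obtain ⟨i₀, hi⟩ := step hi
      obtain ⟨-, hi'⟩ := step hi'
      have i₁ := hi [] (by simp)
      have i₁' := hi' [] (by simp)
      simp only [bal_nil, sub_zero, add_zero] at i₁ i₁'
      have key : (l, z, z₂) = (l', z', z₂') → (i + (Y.inc y z - K.inc k l)) = 1 - i →
          Coh (1 - i) (project (fun p => (p.1, p.2.1)) (l, z, z₂) u)
            (project (fun p => (p.1, p.2.1)) (l, z, z₂) u') →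
          SyncCoh Y X (z, z₂) (project (fun p => (p.2.1, p.2.2)) (l, z, z₂) u)
            (project (fun p => (p.2.1, p.2.2)) (l, z, z₂) u') →
          Coh (1 - i) (project (fun p => (p.1, p.2.2)) (l, z, z₂) u)
            (project (fun p => (p.1, p.2.2)) (l, z, z₂) u') := by
        intro e e' h₁ h₂
        obtain ⟨rfl, rfl, rfl⟩ : l = l' ∧ z = z' ∧ z₂ = z₂' := by simpa using e
        rw [e'] at hi hi'
        exact ih hu.2 hu'.2 hi hi' h₁ h₂
      have s := hu.1
      have s' := hu'.1
      have flip : ∀ {j : ℤ}, 0 ≤ i + j ∧ i + j ≤ 1 → j = 1 ∨ j = -1 → i + j = 1 - i := by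
        intro j; omega
      have inc_eq : ∀ {G : MBGame.{u}} {x y : G.Pos}, G.Edge x y →
          G.inc x y = 1 ∨ G.inc x y = -1 := fun h =>
        h.cases.imp inc_of_opp inc_of_prop
      simp only [Prod.mk.injEq] at s s'
      rcases s with ⟨n, rfl, rfl⟩ | ⟨rfl, m, m₁, m₂⟩ <;>
        rcases s' with ⟨n', rfl, rfl⟩ | ⟨rfl, m', m₁', m₂'⟩
      · simp only [project, Prod.mk.injEq, n.ne, n'.ne, and_true, if_false, if_true,
          coh_cons_cons] at h hP ⊢
        refine ⟨h.1, ?_⟩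
        rintro rfl
        refine key rfl (flip i₁ ?_) (h.2 rfl) hP
        rcases inc_eq n with e | e <;> simp [inc_self, e]
      · simp only [project, Prod.mk.injEq, n.ne, m₁'.ne, m₂'.ne, and_true, and_false,
          false_and, if_false, if_true, coh_cons_cons, imp_false] at h hP ⊢
        exact ⟨h.1, False.elim⟩
      · simp only [project, Prod.mk.injEq, n'.ne, m₁.ne, m₂.ne, n'.ne.symm, and_true, and_false,
          if_false, if_true, coh_cons_cons, imp_false] at h hP ⊢
        exact ⟨h.1, False.elim⟩
      · simp only [project, Prod.mk.injEq, m₁.ne, m₂.ne, m₁'.ne, m₂'.ne, and_false,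
          true_and, if_false, coh_cons_cons, SyncCoh] at h hP ⊢
        have hz : z = z' → z₂ = z₂' → Coh (1 - i) (project (fun p => (p.1, p.2.2)) (l', z, z₂) u)
            (project (fun p => (p.1, p.2.2)) (l', z', z₂') u') := by
          rintro rfl rfl
          refine key rfl (flip i₁ ?_) (h.2 rfl) (hP.2.2 ⟨rfl, rfl⟩)
          rcases inc_eq ⟨m, m₁⟩ with e | e <;> simp [inc_self, e]
        rw [inc_of_move m₁, inc_self] at i₁
        rw [inc_of_move m₁', inc_self] at i₁'
        obtain rfl | rfl : i = 0 ∨ i = 1 := by omega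
        · obtain rfl : m = -1 := (Int.units_eq_one_or m).resolve_left fun e => by simp [e] at i₁
          obtain rfl : m' = -1 := (Int.units_eq_one_or m').resolve_left fun e => by simp [e] at i₁'
          exact ⟨by simp, fun e => hz (hP.2.1 m₁ m₁' e) e⟩
        · obtain rfl : m = 1 := (Int.units_eq_one_or m).resolve_right fun e => by simp [e] at i₁
          obtain rfl : m' = 1 := (Int.units_eq_one_or m').resolve_right fun e => by simp [e] at i₁'
          have e := h.1 rfl
          exact ⟨fun _ => hP.1 m₁ m₁' e, hz e⟩

theorem IsStrat.act {S : Set (List (K.Pos × Y.Pos))} {P : Set (List (Y.Pos × X.Pos))}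
    (hS : IsStrat K Y S) (hP : IsTransl Y X P) : IsStrat K X (act K Y X S P) where
  isPlay _ h := act_subset_plays hS.subset hP.sync h
  even := by
    rintro _ ⟨u, h₁, h₂, rfl⟩
    have e := (even_iff rfl rfl (hS.isPlay _ h₁)).1 (hS.even _ h₁)
    have := bal_eq_of_along (hP.sync.along rfl rfl h₂)
    exact (even_iff rfl rfl ((hP.sync.mem_plays_right rfl rfl rfl h₂).1 (hS.isPlay _ h₁))).2
      (this.symm.trans e)
  nil := ⟨[], hS.nil, hP.nil, rfl⟩
  prefix_mem := by
    rintro s t hs ⟨u, h₁, h₂, h₃⟩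
    obtain ⟨v, ⟨v', rfl⟩, rfl⟩ := prefix_project (h₃.symm ▸ List.prefix_append s t :
      s <+: project (fun x => (x.1, x.2.2)) (K.root, Y.root, X.root) u)
    have p₁ := (hS.isPlay _ h₁).prefix (project_prefix _ _ (List.prefix_append v v'))
    rw [project_append] at h₁ h₂
    have h₂ := hP.prefix_mem _ _ h₂
    have p₂ := (hP.sync.mem_plays_right rfl rfl rfl h₂).1 p₁
    have := bal_eq_of_along (hP.sync.along rfl rfl h₂)
    rw [even_iff rfl rfl p₂, ← this] at hs
    exact ⟨v, hS.prefix_mem _ _ ((even_iff rfl rfl p₁).2 hs) h₁, h₂, rfl⟩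
  coh := by
    have key : ∀ s ∈ MBGame.act K Y X S P, ∃ u : List (K.Pos × Y.Pos × X.Pos),
        Along (fun p q => (K.Edge p.1 q.1 ∧ q.2 = p.2) ∨
          (q.1 = p.1 ∧ SyncStep Y X (p.2.1, p.2.2) (q.2.1, q.2.2))) (K.root, Y.root, X.root) u ∧
        project (fun x => (x.1, x.2.1)) (K.root, Y.root, X.root) u ∈ S ∧
        project (fun x => (x.2.1, x.2.2)) (K.root, Y.root, X.root) u ∈ P ∧
        project (fun x => (x.1, x.2.2)) (K.root, Y.root, X.root) u = s := by
      rintro _ ⟨u, h₁, h₂, rfl⟩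
      obtain ⟨v, hv, e⟩ := exists_noStutter (K.root, Y.root, X.root) u
      rw [← e] at h₁ h₂
      refine ⟨v, ?_, h₁, h₂, e _⟩
      have a₁ := ((isPlay_iff rfl rfl).1 (hS.isPlay _ h₁)).1
      have a₂ := hP.sync.along rfl rfl h₂
      refine ((a₁.and a₂).and hv).mono fun p q h => ?_
      obtain ⟨⟨h, h' | ⟨m, k, k'⟩⟩, n⟩ := h
      · rcases h with ⟨h | h, -⟩ | ⟨h, -⟩
        · exact (n (Prod.ext h (Prod.ext h'.1 h'.2))).elim
        · exact Or.inl ⟨h, Prod.ext h'.1 h'.2⟩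
        · exact (n (Prod.ext h (Prod.ext h'.1 h'.2))).elim
      · rcases h with ⟨h, e⟩ | ⟨h, e⟩
        · exact (k.ne e).elim
        · exact Or.inr ⟨h, m, k, k'⟩
    intro s hs t ht
    obtain ⟨u, u₁, u₂, u₃, rfl⟩ := key s hs
    obtain ⟨v, v₁, v₂, v₃, rfl⟩ := key t ht
    refine coh_act u₁ v₁ (fun t ht => ?_) (fun t ht => ?_) (hS.coh _ u₂ _ v₂) (hP.coh _ u₃ _ v₃)
    · rw [zero_add]
      exact ((isPlay_iff (a := fun p : K.Pos × Y.Pos × X.Pos => p.1) rfl rfl).1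
        (hS.isPlay _ u₂)).2 t ht
    · rw [zero_add]
      exact ((isPlay_iff (a := fun p : K.Pos × Y.Pos × X.Pos => p.1) rfl rfl).1
        (hS.isPlay _ v₂)).2 t ht
  bracket := by
    rintro s t ⟨u, h₁, h₂, h₃⟩ hf
    obtain ⟨v, ⟨v', rfl⟩, rfl⟩ := prefix_project (h₃.symm ▸ List.prefix_append s t :
      s <+: project (fun x => (x.1, x.2.2)) (K.root, Y.root, X.root) u)
    have a := ((isPlay_iff rfl rfl).1 ((hP.sync.mem_plays_right rfl rfl rfl h₂).1
      (hS.isPlay _ h₁))).1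
    rw [project_append, List.append_cancel_left_eq] at h₃
    subst h₃
    have hl : (project (fun x => (x.1, x.2.2)) (K.root, Y.root, X.root) v).getLastD
        (K.root, X.root) = _ := getLastD_project (fun x => (x.1, x.2.2)) (K.root, Y.root, X.root) v
    have hl' : (project (fun x => (x.2.1, x.2.2)) (K.root, Y.root, X.root) v).getLastD
        (Y.root, X.root) = _ :=
      getLastD_project (fun x => (x.2.1, x.2.2)) (K.root, Y.root, X.root) v
    rw [hl] at hf ⊢
    rw [along_append] at a
    rw [fresh_arrow a.2, neg_neg] at hf
    rw [fresh_arrow a.2]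
    have hb := hS.bracket_project (a := fun p : K.Pos × Y.Pos × X.Pos => p.1) rfl rfl v v' h₁ _ rfl
    have hy := hP.sync _ h₂
    rw [project_append] at h₂ hy
    have hy := ((along_append _ _ _).1 hy).2
    have hF := hP.fresh _ _ h₂
    rw [hl'] at hF hy
    have e₁ := project_of_noStutter (π := Prod.fst) (hy.mono fun p q h => by
      obtain ⟨m, h, -⟩ := h
      exact h.ne)
    have e₂ := project_of_noStutter (π := Prod.snd) (hy.mono fun p q h => by
      obtain ⟨m, -, h⟩ := h
      exact h.ne)
    rw [← e₁, ← e₂] at hF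
    have f₁ := project_project (fun x : K.Pos × Y.Pos × X.Pos => (x.2.1, x.2.2)) Prod.fst
      (v.getLastD (K.root, Y.root, X.root)) v'
    have f₂ := project_project (fun x : K.Pos × Y.Pos × X.Pos => (x.2.1, x.2.2)) Prod.snd
      (v.getLastD (K.root, Y.root, X.root)) v'
    dsimp only at f₁ f₂
    rw [f₁, f₂] at hF
    dsimp only at hF
    rcases hf with hf | hf
    · exact (hb (Or.inl hf)).imp_right (hF 1).1
    · exact (hb (Or.inr ((hF _).2 hf))).imp_right (hF 1).1

/-- The morphism that translates the moves along `P`. -/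
def IsTransl.hom {P : Set (List (Y.Pos × X.Pos))} (hP : IsTransl Y X P) : Hom Y X :=
  ((isStrat_id Y).act hP).hom

/-! ### Tensor products of relations -/

/-- The product of two relations: in each step, one of the two pairs of games moves. -/
def prodRel (Y X Y' X' : MBGame.{u}) (P : Set (List (Y.Pos × X.Pos)))
    (Q : Set (List (Y'.Pos × X'.Pos))) : Set (List ((Y.Pos × Y'.Pos) × (X.Pos × X'.Pos))) :=
  {s | Along (SyncStep (Y.tensor Y') (X.tensor X')) ((Y.root, Y'.root), (X.root, X'.root)) s ∧
    project (fun p => (p.1.1, p.2.1)) ((Y.root, Y'.root), (X.root, X'.root)) s ∈ P ∧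
    project (fun p => (p.1.2, p.2.2)) ((Y.root, Y'.root), (X.root, X'.root)) s ∈ Q}

theorem isSync_prodRel {P : Set (List (Y.Pos × X.Pos))} {Q : Set (List (Y'.Pos × X'.Pos))} :
    IsSync (Y.tensor Y') (X.tensor X') (prodRel Y X Y' X' P Q) := fun _ h => h.1

section

variable {K' : MBGame.{u}} {W : Type*} {y : W → Y.Pos} {y' : W → Y'.Pos} {x : W → X.Pos}
  {x' : W → X'.Pos} {w : W} {u : List W} {P : Set (List (Y.Pos × X.Pos))}
  {Q : Set (List (Y'.Pos × X'.Pos))}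

theorem mem_prodRel_iff (hy : y w = Y.root) (hy' : y' w = Y'.root) (hx : x w = X.root)
    (hx' : x' w = X'.root) (hP : IsSync Y X P) (hQ : IsSync Y' X' Q) :
    project (fun w => ((y w, y' w), (x w, x' w))) w u ∈ prodRel Y X Y' X' P Q ↔
      project (fun w => (y w, x w)) w u ∈ P ∧ project (fun w => (y' w, x' w)) w u ∈ Q ∧
      Along (fun p q => x q = x p ∨ x' q = x' p) w u := by
  have e₁ := project_project (fun w => ((y w, y' w), (x w, x' w))) (fun p => (p.1.1, p.2.1)) w u
  have e₂ := project_project (fun w => ((y w, y' w), (x w, x' w))) (fun p => (p.1.2, p.2.2)) w u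
  have e₃ := along_project (R := SyncStep (Y.tensor Y') (X.tensor X'))
    (fun w => ((y w, y' w), (x w, x' w))) w u
  dsimp only at e₁ e₂ e₃
  rw [hy, hy', hx, hx'] at e₁ e₂ e₃
  rw [prodRel, Set.mem_ofPred_eq, e₁, e₂, e₃]
  constructor
  · rintro ⟨h, h₁, h₂⟩
    refine ⟨h₁, h₂, h.mono fun p q h => ?_⟩
    rcases h with h | ⟨m, -, h | h⟩
    · simp only [Prod.mk.injEq] at h
      exact Or.inl h.2.1
    · exact Or.inr h.2.symm
    · exact Or.inl h.1.symm
  · rintro ⟨h₁, h₂, h⟩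
    refine ⟨((h.and (hP.along hy hx h₁)).and (hQ.along hy' hx' h₂)).mono fun p q h => ?_, h₁, h₂⟩
    obtain ⟨⟨h, ⟨e₁, e₂⟩ | ⟨m, h₁, h₂⟩⟩, ⟨e₃, e₄⟩ | ⟨m', h₃, h₄⟩⟩ := h
    · exact Or.inl (Prod.ext (Prod.ext e₁ e₃) (Prod.ext e₂ e₄))
    · exact Or.inr ⟨m', Or.inr ⟨e₁.symm, h₃⟩, Or.inr ⟨e₂.symm, h₄⟩⟩
    · exact Or.inr ⟨m, Or.inl ⟨h₁, e₃.symm⟩, Or.inl ⟨h₂, e₄.symm⟩⟩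
    · exact (h.elim h₂.ne h₄.ne).elim

end

/-- Interactions of the two factors over the same play are amalgamated into one. Alternation in the
tensor products need be checked on one side of the relation only, since synchronous moves do not
affect it. -/
theorem tensorPlays_act {K' : MBGame.{u}} {S : Set (List (K.Pos × Y.Pos))}
    {T : Set (List (K'.Pos × Y'.Pos))} {P : Set (List (Y.Pos × X.Pos))}
    {Q : Set (List (Y'.Pos × X'.Pos))} (hP : IsSync Y X P) (hQ : IsSync Y' X' Q) :
    tensorPlays K X K' X' (act K Y X S P) (act K' Y' X' T Q) =
      act (K.tensor K') (Y.tensor Y') (X.tensor X') (tensorPlays K Y K' Y' S T)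
        (prodRel Y X Y' X' P Q) := by
  apply Set.Subset.antisymm
  · rintro s ⟨hs, ⟨u, hu, hu', hus⟩, ⟨v, hv, hv', hvs⟩⟩
    obtain ⟨w, es, e₁, e₂, -⟩ := exists_amalgam_pair (IsPlay.noStutter hs) hus hvs
    rw [← es] at hs ⊢
    have hp : project (fun p : (K.Pos × Y.Pos × X.Pos) × (K'.Pos × Y'.Pos × X'.Pos) =>
        ((p.1.2.1, p.2.2.1), (p.1.2.2, p.2.2.2)))
        ((K.root, Y.root, X.root), (K'.root, Y'.root, X'.root)) w ∈ prodRel Y X Y' X' P Q := by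
      refine (mem_prodRel_iff (w := ((K.root, Y.root, X.root), (K'.root, Y'.root, X'.root)))
        (x := fun p => p.1.2.2) (x' := fun p => p.2.2.2) rfl rfl rfl rfl hP hQ).2
        ⟨(e₁ fun p => (p.2.1, p.2.2)) ▸ hu', (e₂ fun p => (p.2.1, p.2.2)) ▸ hv', ?_⟩
      have := ((isPlay_tensor_iff (x := ((K.root, Y.root, X.root), (K'.root, Y'.root, X'.root)))
        (a := fun p => p.1.1) (b := fun p => p.2.1) (a' := fun p => p.1.2.2)
        (b' := fun p => p.2.2.2) rfl rfl rfl rfl).1 hs).1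
      refine this.mono fun p q h => ?_
      rcases h with ⟨-, h, -⟩ | ⟨-, -, h⟩
      · exact Or.inl h
      · exact (step_iff.1 h).2.2
    refine mem_compTr_of_list (x := ((K.root, Y.root, X.root), (K'.root, Y'.root, X'.root)))
      (f := fun p => (p.1.1, p.2.1)) (g := fun p => (p.1.2.1, p.2.2.1))
      (h := fun p => (p.1.2.2, p.2.2.2)) rfl rfl rfl ?_ hp
    refine (mem_tensorPlays_iff (x := ((K.root, Y.root, X.root), (K'.root, Y'.root, X'.root)))
      (a := fun p => p.1.1) (b := fun p => p.2.1) (a' := fun p => p.1.2.1)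
      (b' := fun p => p.2.2.1) rfl rfl rfl rfl).2 ⟨?_, (e₁ fun p => (p.1, p.2.1)) ▸ hu,
        (e₂ fun p => (p.1, p.2.1)) ▸ hv⟩
    exact (isSync_prodRel.mem_plays_right (K := K.tensor K') (Y := Y.tensor Y')
      (X := X.tensor X') (w := ((K.root, Y.root, X.root), (K'.root, Y'.root, X'.root)))
      (k := fun p : (K.Pos × Y.Pos × X.Pos) × (K'.Pos × Y'.Pos × X'.Pos) => (p.1.1, p.2.1))
      rfl rfl rfl hp).2 hs
  · rintro s ⟨u, hu, hp, rfl⟩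
    have hu' := (mem_tensorPlays_iff (W := (K.Pos × K'.Pos) × (Y.Pos × Y'.Pos) ×
      (X.Pos × X'.Pos)) (a := fun x => x.1.1) (b := fun x => x.1.2) (a' := fun x => x.2.1.1)
      (b' := fun x => x.2.1.2) rfl rfl rfl rfl).1 hu
    have hp' := (mem_prodRel_iff (W := (K.Pos × K'.Pos) × (Y.Pos × Y'.Pos) ×
      (X.Pos × X'.Pos)) (y := fun x => x.2.1.1) (y' := fun x => x.2.1.2) (x := fun x => x.2.2.1)
      (x' := fun x => x.2.2.2) rfl rfl rfl rfl hP hQ).1 hp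
    refine (mem_tensorPlays_iff (W := (K.Pos × K'.Pos) × (Y.Pos × Y'.Pos) ×
      (X.Pos × X'.Pos)) (a := fun x => x.1.1) (b := fun x => x.1.2) (a' := fun x => x.2.2.1)
      (b' := fun x => x.2.2.2) rfl rfl rfl rfl).2 ⟨?_, ?_, ?_⟩
    · exact (isSync_prodRel.mem_plays_right (K := K.tensor K') (Y := Y.tensor Y')
        (X := X.tensor X') (w := ((K.root, K'.root), (Y.root, Y'.root), (X.root, X'.root)))
        (k := fun p : (K.Pos × K'.Pos) × (Y.Pos × Y'.Pos) × (X.Pos × X'.Pos) => p.1)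
        rfl rfl rfl hp).1 hu.1
    · exact mem_compTr_of_list rfl rfl rfl hu'.2.1 hp'.1
    · exact mem_compTr_of_list rfl rfl rfl hu'.2.2 hp'.2.1

theorem tensorPlays_transl {P : Set (List (Y.Pos × X.Pos))} {Q : Set (List (Y'.Pos × X'.Pos))}
    (hP : IsSync Y X P) (hQ : IsSync Y' X' Q) :
    tensorPlays Y X Y' X' (translPlays Y X P) (translPlays Y' X' Q) =
      translPlays (Y.tensor Y') (X.tensor X') (prodRel Y X Y' X' P Q) := by
  rw [translPlays, translPlays, tensorPlays_act hP hQ, tensorPlays_id]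

end MBGame

/-! ## Isomorphisms of games -/

namespace MBGame

open ConwayGame

variable {A A' B B' C C' K X X' Y Y' Z : MBGame.{u}}

/-- An isomorphism of games: a renaming of the positions. -/
structure GameIso (Y X : MBGame.{u}) where
  e : Y.Pos ≃ X.Pos
  root : e Y.root = X.root
  move : ∀ p a b, X.Move p (e a) (e b) ↔ Y.Move p a b
  fresh : ∀ q a s, Along Y.Edge a s → (Y.Fresh q a s ↔ X.Fresh q (e a) (s.map e))

namespace GameIso

theorem edge (φ : GameIso Y X) (a b : Y.Pos) : X.Edge (φ.e a) (φ.e b) ↔ Y.Edge a b :=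
  exists_congr fun p => φ.move p a b

theorem root_symm (φ : GameIso Y X) : φ.e.symm X.root = Y.root := by
  rw [← φ.root, Equiv.symm_apply_apply]

/-- The identity isomorphism. -/
def refl (Y : MBGame.{u}) : GameIso Y Y where
  e := Equiv.refl _
  root := rfl
  move _ _ _ := Iff.rfl
  fresh _ _ _ _ := by simp

/-- The inverse isomorphism. -/
def symm (φ : GameIso Y X) : GameIso X Y where
  e := φ.e.symm
  root := φ.root_symm
  move p a b := by rw [← φ.move]; simp
  fresh q a s hs := by
    have h := φ.fresh q (φ.e.symm a) (s.map φ.e.symm) ((along_map _ _ _).2 (hs.mono fun p q h => by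
      rw [← φ.edge]; simpa using h))
    simpa using h.symm

/-- The composite of two isomorphisms. -/
def trans (φ : GameIso Y X) (ψ : GameIso X Z) : GameIso Y Z where
  e := φ.e.trans ψ.e
  root := by simp [φ.root, ψ.root]
  move p a b := by simp [φ.move, ψ.move]
  fresh q a s hs := by
    rw [φ.fresh q a s hs, ψ.fresh]
    · simp
    · exact (along_map _ _ _).2 (hs.mono fun p q h => (φ.edge p q).2 h)

theorem along_fst_of_edge {x : A.Pos × B.Pos} {s : List (A.Pos × B.Pos)}
    (h : Along (A.tensor B).Edge x s) : Along A.Edge x.1 (project Prod.fst x s) := by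
  rw [along_project]
  refine h.mono fun p q h => ?_
  rcases edge_tensor.1 h with h | h
  · exact Or.inr h.1
  · exact Or.inl h.1.symm

theorem along_snd_of_edge {x : A.Pos × B.Pos} {s : List (A.Pos × B.Pos)}
    (h : Along (A.tensor B).Edge x s) : Along B.Edge x.2 (project Prod.snd x s) := by
  rw [along_project]
  refine h.mono fun p q h => ?_
  rcases edge_tensor.1 h with h | h
  · exact Or.inl h.2.symm
  · exact Or.inr h.2

theorem fresh_tensor_of_along {p : ℤˣ} {x : A.Pos × B.Pos} {s : List (A.Pos × B.Pos)}
    (hs : Along (A.tensor B).Edge x s) : (A.tensor B).Fresh p x s ↔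
      A.Fresh p x.1 (project Prod.fst x s) ∨ B.Fresh p x.2 (project Prod.snd x s) :=
  fresh_tensor (isPath_iff.2 hs)

theorem not_fresh_one {p : ℤˣ} {x : one.{u}.Pos} {s : List one.{u}.Pos} : ¬ one.Fresh p x s :=
  fun ⟨r, _⟩ => r.elim

/-- The tensor product of two isomorphisms. -/
def prod (φ : GameIso Y X) (ψ : GameIso Y' X') : GameIso (Y.tensor Y') (X.tensor X') where
  e := φ.e.prodCongr ψ.e
  root := Prod.ext φ.root ψ.root
  move p a b := by
    refine or_congr (and_congr (φ.move p _ _) ?_) (and_congr ?_ (ψ.move p _ _))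
    · exact ψ.e.injective.eq_iff
    · exact φ.e.injective.eq_iff
  fresh q a s hs := by
    have hs' : Along (X.tensor X').Edge (φ.e a.1, ψ.e a.2) (s.map (φ.e.prodCongr ψ.e)) := by
      refine (along_map (φ.e.prodCongr ψ.e) a s).2 (hs.mono fun p q h => ?_)
      rw [edge_tensor] at h ⊢
      refine h.imp (And.imp (φ.edge _ _).2 fun e => ?_) (And.imp (fun e => ?_) (ψ.edge _ _).2)
      · exact congrArg ψ.e e
      · exact congrArg φ.e e
    rw [fresh_tensor_of_along hs, φ.fresh q _ _ (along_fst_of_edge hs),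
      ψ.fresh q _ _ (along_snd_of_edge hs), map_project _ _ φ.e.injective,
      map_project _ _ ψ.e.injective]
    refine Iff.trans ?_ (fresh_tensor_of_along hs').symm
    have e₁ := project_map (φ.e.prodCongr ψ.e) Prod.fst a s
    have e₂ := project_map (φ.e.prodCongr ψ.e) Prod.snd a s
    simp only [Equiv.prodCongr_apply, Prod.map] at e₁ e₂ ⊢
    rw [← e₁, ← e₂]

theorem move_assoc (p : ℤˣ) (x y : (A.Pos × B.Pos) × C.Pos) :
    (A.tensor (B.tensor C)).Move p (Equiv.prodAssoc _ _ _ x) (Equiv.prodAssoc _ _ _ y) ↔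
      ((A.tensor B).tensor C).Move p x y := by
  obtain ⟨⟨a, b⟩, c⟩ := x
  obtain ⟨⟨a', b'⟩, c'⟩ := y
  simp only [Equiv.prodAssoc_apply, Prod.mk.injEq]
  tauto

/-- The associativity isomorphism. -/
def assoc (A B C : MBGame.{u}) : GameIso ((A.tensor B).tensor C) (A.tensor (B.tensor C)) where
  e := Equiv.prodAssoc _ _ _
  root := rfl
  move := move_assoc
  fresh q x s hs := by
    have hs' : Along (A.tensor (B.tensor C)).Edge (x.1.1, x.1.2, x.2)
        (s.map (Equiv.prodAssoc _ _ _)) :=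
      (along_map (Equiv.prodAssoc _ _ _) x s).2 (hs.mono fun p q ⟨m, h⟩ =>
        ⟨m, (move_assoc m p q).2 h⟩)
    have h₁ := fresh_tensor_of_along (p := q) hs
    have h₂ := fresh_tensor_of_along (p := q) (along_fst_of_edge hs)
    have h₃ := fresh_tensor_of_along (p := q) hs'
    have h₄ := fresh_tensor_of_along (p := q) (along_snd_of_edge hs')
    have e₁ := project_map (Equiv.prodAssoc A.Pos B.Pos C.Pos) Prod.fst x s
    have e₂ := project_map (Equiv.prodAssoc A.Pos B.Pos C.Pos) Prod.snd x s
    have e₃ := project_project (Prod.fst : (A.Pos × B.Pos) × C.Pos → _) Prod.fst x s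
    have e₄ := project_project (Prod.fst : (A.Pos × B.Pos) × C.Pos → _) Prod.snd x s
    have e₅ := project_project (fun w => (Equiv.prodAssoc A.Pos B.Pos C.Pos w).2) Prod.fst x s
    have e₆ := project_project (fun w => (Equiv.prodAssoc A.Pos B.Pos C.Pos w).2) Prod.snd x s
    simp only [Equiv.prodAssoc_apply] at e₁ e₂ e₃ e₄ e₅ e₆ h₃ h₄ ⊢
    rw [e₂] at h₃ h₄
    rw [e₅, e₆] at h₄
    rw [e₃, e₄] at h₂
    rw [h₁, h₃, h₂, h₄, e₁, or_assoc]

/-- The unit isomorphism. -/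
def unitRight (A : MBGame.{u}) : GameIso (A.tensor one) A where
  e := Equiv.prodPUnit _
  root := rfl
  move p x y := ⟨fun h => Or.inl ⟨h, rfl⟩, fun h => h.elim And.left fun h => h.2.elim⟩
  fresh q x s hs := by
    have e := project_of_noStutter (π := Prod.fst) (hs.mono fun p q h => by
      rcases edge_tensor.1 h with h | ⟨-, m, h⟩
      · exact h.1.ne
      · exact h.elim)
    have h := fresh_tensor_of_along (p := q) hs
    rw [e, or_iff_left not_fresh_one] at h
    exact h

/-- The symmetry isomorphism. -/
def swap (A B : MBGame.{u}) : GameIso (A.tensor B) (B.tensor A) where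
  e := Equiv.prodComm _ _
  root := rfl
  move p x y := Or.comm.trans (or_congr and_comm and_comm)
  fresh q x s hs := by
    have hs' : Along (B.tensor A).Edge (x.2, x.1) (s.map (Equiv.prodComm _ _)) :=
      (along_map (Equiv.prodComm _ _) x s).2 (hs.mono fun p q ⟨m, h⟩ =>
        ⟨m, Or.comm.trans (or_congr and_comm and_comm) |>.1 h⟩)
    have h₁ := fresh_tensor_of_along (p := q) hs
    have h₂ := fresh_tensor_of_along (p := q) hs'
    have e₁ := project_map (Equiv.prodComm A.Pos B.Pos) Prod.fst x s
    have e₂ := project_map (Equiv.prodComm A.Pos B.Pos) Prod.snd x s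
    simp only [Equiv.prodComm_apply, Prod.swap] at e₁ e₂ h₂ ⊢
    rw [h₁, or_comm, ← e₁, ← e₂]
    exact h₂.symm

/-- The left unit isomorphism. -/
def unitLeft (A : MBGame.{u}) : GameIso (one.tensor A) A := (swap one A).trans (unitRight A)

/-- The graph of an isomorphism, as a synchronous relation. -/
def graph (φ : GameIso Y X) : Set (List (Y.Pos × X.Pos)) :=
  {s | Along (fun p q => Y.Edge p.1 q.1) (Y.root, X.root) s ∧ ∀ p ∈ s, p.2 = φ.e p.1}

theorem isTransl_graph (φ : GameIso Y X) : IsTransl Y X φ.graph where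
  sync := by
    rintro s ⟨h, h'⟩
    have hr : (Y.root, X.root).2 = φ.e (Y.root, X.root).1 := φ.root.symm
    revert h h' hr
    generalize (Y.root, X.root) = x
    intro h h' hx
    induction s generalizing x with
    | nil => trivial
    | cons y s ih =>
      have hy := h' y (List.mem_cons_self ..)
      refine ⟨?_, ih _ h.2 (fun p hp => h' p (List.mem_cons_of_mem _ hp)) hy⟩
      obtain ⟨m, hm⟩ := h.1
      refine ⟨m, hm, ?_⟩
      rw [hx, hy]
      exact (φ.move _ _ _).2 hm
  nil := ⟨trivial, by simp⟩
  prefix_mem s t h := ⟨h.1.prefix (List.prefix_append _ _), fun p hp =>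
    h.2 p (List.mem_append_left _ hp)⟩
  coh := by
    rintro s ⟨-, hs⟩ t ⟨-, ht⟩
    generalize (Y.root, X.root) = x
    induction s generalizing x t with
    | nil => trivial
    | cons y s ih =>
      cases t with
      | nil => trivial
      | cons z t =>
        have hy := hs y (List.mem_cons_self ..)
        have hz := ht z (List.mem_cons_self ..)
        refine ⟨fun _ _ e => by rw [hy, hz, e], fun _ _ e => ?_, fun _ => ?_⟩
        · rw [hy, hz] at e
          exact φ.e.injective e
        · apply ih
          · exact fun p hp => hs p (List.mem_cons_of_mem _ hp)
          · exact fun p hp => ht p (List.mem_cons_of_mem _ hp)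
  fresh := by
    rintro s t ⟨h, h'⟩ q
    have hx : (s.getLastD (Y.root, X.root)).2 = φ.e (s.getLastD (Y.root, X.root)).1 := by
      rcases List.eq_nil_or_concat s with rfl | ⟨s, p, rfl⟩
      · exact φ.root.symm
      · simpa using h' p (by simp)
    have ht : t.map Prod.snd = (t.map Prod.fst).map φ.e := by
      rw [List.map_map]
      exact List.map_congr_left fun p hp => h' p (List.mem_append_right _ hp)
    rw [φ.fresh, hx, ht]
    exact (along_map _ _ _).2 ((along_append _ _ _).1 h).2

theorem injective_right (φ : GameIso Y X) :
    Function.Injective fun p : K.Pos × X.Pos => (p.1, φ.e.symm p.2) := by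
  rintro ⟨a, b⟩ ⟨a', b'⟩ h
  simpa using h

/-- The action of the graph of an isomorphism on the right is a renaming. -/
theorem act_graph (φ : GameIso Y X) {S : Set (List (K.Pos × Y.Pos))} (hS : S ⊆ Plays K Y) :
    act K Y X S φ.graph = {s | s.map (fun p => (p.1, φ.e.symm p.2)) ∈ S} := by
  ext s
  constructor
  · rintro ⟨u, h₁, h₂, rfl⟩
    have hu := forall_of_project (R := fun p => p.2 = φ.e p.1) (π := fun x => (x.2.1, x.2.2))
      (x := (K.root, Y.root, X.root)) φ.root.symm h₂.2
    rw [Set.mem_ofPred_eq, map_project _ _ φ.injective_right]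
    refine (project_congr ?_ fun p hp => ?_) ▸ h₁
    · exact Prod.ext rfl φ.root_symm.symm
    · exact Prod.ext rfl (φ.e.eq_symm_apply.2 (hu p hp).symm)
  · intro hs
    have hn := IsPlay.noStutter (hS hs)
    have hr : (fun p : K.Pos × X.Pos => (p.1, φ.e.symm p.2)) (K.root, X.root) =
      (K.dual.tensor Y).root := Prod.ext rfl φ.root_symm
    have hn' : NoStutter (K.root, X.root) s := by
      rw [← hr] at hn
      exact ((along_map (fun p : K.Pos × X.Pos => (p.1, φ.e.symm p.2)) (K.root, X.root) s).1
        hn).mono fun p q h e => h (by rw [e])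
    have e := project_id_of_noStutter hn
    rw [← hr] at e
    replace e := (project_map (fun p : K.Pos × X.Pos => (p.1, φ.e.symm p.2)) (fun w => w)
      (K.root, X.root) s).symm.trans e
    have e' := fun {Z : Type u} (f : _ → Z) => project_map
      (fun p : K.Pos × X.Pos => (p.1, φ.e.symm p.2, p.2)) f (K.root, X.root) s
    simp only [φ.root_symm] at e'
    refine ⟨s.map fun p => (p.1, φ.e.symm p.2, p.2), ?_, ⟨?_, ?_⟩, ?_⟩
    · rw [e', e]
      exact hs
    · rw [e', ← φ.root_symm]
      refine (along_project (R := fun p q : Y.Pos × X.Pos => Y.Edge p.1 q.1)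
        (fun p : K.Pos × X.Pos => (φ.e.symm p.2, p.2)) (K.root, X.root) s).2 ?_
      have := ((isAlternating_iff _).1 (hS hs)).1
      rw [← hr] at this
      refine ((along_map (fun p : K.Pos × X.Pos => (p.1, φ.e.symm p.2)) (K.root, X.root) s).1
        this).mono fun p q h => ?_
      rcases edge_tensor.1 h with ⟨-, h⟩ | ⟨-, h⟩
      · have := φ.e.symm.injective h
        exact Or.inl (by rw [this])
      · exact Or.inr h
    · intro p hp
      obtain ⟨q, hq, rfl⟩ := mem_of_mem_project hp
      obtain ⟨q, hq, rfl⟩ := List.mem_map.1 hq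
      simp
    · rw [e']
      exact project_id_of_noStutter hn'

/-- The action of the graph of an isomorphism on the left is a renaming. -/
theorem graph_act (φ : GameIso Y X) {S : Set (List (X.Pos × K.Pos))} (hS : S ⊆ Plays X K) :
    act Y X K φ.graph S = {s | s.map (fun p => (φ.e p.1, p.2)) ∈ S} := by
  have hinj : Function.Injective fun p : Y.Pos × K.Pos => (φ.e p.1, p.2) := by
    rintro ⟨a, b⟩ ⟨a', b'⟩ h
    simpa using h
  ext s
  constructor
  · rintro ⟨u, h₂, h₁, rfl⟩
    have hu := forall_of_project (R := fun p => p.2 = φ.e p.1) (π := fun x => (x.1, x.2.1))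
      (x := (Y.root, X.root, K.root)) φ.root.symm h₂.2
    rw [Set.mem_ofPred_eq, map_project _ _ hinj]
    refine (project_congr ?_ fun p hp => ?_) ▸ h₁
    · exact Prod.ext φ.root.symm rfl
    · exact Prod.ext (hu p hp) rfl
  · intro hs
    have hn := IsPlay.noStutter (hS hs)
    have hr : (fun p : Y.Pos × K.Pos => (φ.e p.1, p.2)) (Y.root, K.root) =
      (X.dual.tensor K).root := Prod.ext φ.root rfl
    have hn' : NoStutter (Y.root, K.root) s := by
      rw [← hr] at hn
      exact ((along_map (fun p : Y.Pos × K.Pos => (φ.e p.1, p.2)) (Y.root, K.root) s).1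
        hn).mono fun p q h e => h (by rw [e])
    have e := project_id_of_noStutter hn
    rw [← hr] at e
    replace e := (project_map (fun p : Y.Pos × K.Pos => (φ.e p.1, p.2)) (fun w => w)
      (Y.root, K.root) s).symm.trans e
    have e' := fun {Z : Type u} (f : _ → Z) => project_map
      (fun p : Y.Pos × K.Pos => (p.1, φ.e p.1, p.2)) f (Y.root, K.root) s
    simp only [φ.root] at e'
    refine ⟨s.map fun p => (p.1, φ.e p.1, p.2), ⟨?_, ?_⟩, ?_, ?_⟩
    · rw [e', ← φ.root]
      refine (along_project (R := fun p q : Y.Pos × X.Pos => Y.Edge p.1 q.1)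
        (fun p : Y.Pos × K.Pos => (p.1, φ.e p.1)) (Y.root, K.root) s).2 ?_
      have := ((isAlternating_iff _).1 (hS hs)).1
      rw [← hr] at this
      refine ((along_map (fun p : Y.Pos × K.Pos => (φ.e p.1, p.2)) (Y.root, K.root) s).1
        this).mono fun p q h => ?_
      rcases edge_tensor.1 h with ⟨h, -⟩ | ⟨h, -⟩
      · exact Or.inr ((φ.edge _ _).1 (edge_dual.1 h))
      · have := φ.e.injective h
        exact Or.inl (by rw [this])
    · intro p hp
      obtain ⟨q, hq, rfl⟩ := mem_of_mem_project hp
      obtain ⟨q, hq, rfl⟩ := List.mem_map.1 hq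
      simp
    · rw [e', e]
      exact hs
    · rw [e']
      exact project_id_of_noStutter hn'

/-- The plays of the copycat strategy of an isomorphism. -/
def plays (φ : GameIso Y X) : Set (List (Y.Pos × X.Pos)) := translPlays Y X φ.graph

theorem isStrat_plays (φ : GameIso Y X) : IsStrat Y X φ.plays :=
  (isStrat_id Y).act φ.isTransl_graph

theorem mem_plays (φ : GameIso Y X) {s : List (Y.Pos × X.Pos)} :
    s ∈ φ.plays ↔ s.map (fun p => (p.1, φ.e.symm p.2)) ∈ idPlays Y :=
  Set.ext_iff.1 (φ.act_graph (isStrat_id Y).subset) s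

theorem compPlays_plays (φ : GameIso Y X) {S : Set (List (K.Pos × Y.Pos))} (hS : S ⊆ Plays K Y) :
    compPlays K Y X S φ.plays = {s | s.map (fun p => (p.1, φ.e.symm p.2)) ∈ S} := by
  rw [plays, compPlays_transl hS φ.isTransl_graph.sync, φ.act_graph hS]

theorem plays_compPlays (φ : GameIso Y X) {S : Set (List (X.Pos × K.Pos))} (hS : S ⊆ Plays X K) :
    compPlays Y X K φ.plays S = {s | s.map (fun p => (φ.e p.1, p.2)) ∈ S} := by
  rw [plays, transl_compPlays hS φ.isTransl_graph.sync, φ.graph_act hS]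

theorem plays_refl : (refl Y).plays = idPlays Y := by
  ext s
  rw [mem_plays]
  simp [refl]

theorem plays_trans (φ : GameIso Y X) (ψ : GameIso X Z) :
    compPlays Y X Z φ.plays ψ.plays = (φ.trans ψ).plays := by
  ext s
  rw [ψ.compPlays_plays φ.isStrat_plays.subset, Set.mem_ofPred_eq, mem_plays, mem_plays,
    List.map_map]
  rfl

theorem map_mem_plays_iff (φ : GameIso Y X) (s : List (K.Pos × X.Pos)) :
    s.map (fun p => (p.1, φ.e.symm p.2)) ∈ Plays K Y ↔ s ∈ Plays K X := by
  have key : ∀ (p : ℤˣ) (x : K.Pos × X.Pos),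
      (K.dual.tensor Y).IsAlternating p (x.1, φ.e.symm x.2)
        (s.map fun p => (p.1, φ.e.symm p.2)) ↔ (K.dual.tensor X).IsAlternating p x s := by
    induction s with
    | nil => exact fun _ _ => Iff.rfl
    | cons y s ih =>
      intro p x
      refine and_congr ?_ (ih (-p) y)
      refine or_congr (and_congr Iff.rfl ?_) (and_congr Iff.rfl ?_)
      · exact φ.e.symm.injective.eq_iff
      · exact φ.symm.move _ _ _
  have := key (-1) (K.root, X.root)
  rw [φ.root_symm] at this
  exact this

theorem map_left_mem_plays_iff (φ : GameIso Y X) (s : List (Y.Pos × K.Pos)) :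
    s.map (fun p => (φ.e p.1, p.2)) ∈ Plays X K ↔ s ∈ Plays Y K := by
  have key : ∀ (p : ℤˣ) (x : Y.Pos × K.Pos),
      (X.dual.tensor K).IsAlternating p (φ.e x.1, x.2)
        (s.map fun p => (φ.e p.1, p.2)) ↔ (Y.dual.tensor K).IsAlternating p x s := by
    induction s with
    | nil => exact fun _ _ => Iff.rfl
    | cons y s ih =>
      intro p x
      refine and_congr ?_ (ih (-p) y)
      refine or_congr (and_congr (φ.move _ _ _) Iff.rfl) (and_congr ?_ Iff.rfl)
      exact φ.e.injective.eq_iff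
  have := key (-1) (Y.root, K.root)
  rw [φ.root] at this
  exact this

/-- Applying the bijection carries the equality of the two projections from `Y` to `X`. This
identifies the translation along the graph with the copycat strategy that is prescribed for the
structural isomorphisms. -/
theorem plays_eq_copycat (φ : GameIso Y X) : φ.plays = copycat Y X φ.e := by
  ext s
  rw [mem_plays, idPlays, copycat, copycat, Set.mem_ofPred_eq, Set.mem_ofPred_eq]
  refine and_congr (φ.map_mem_plays_iff s) (and_congr (by rw [List.length_map]) ?_)
  have e₁ := fun t => project_map (fun p : Y.Pos × X.Pos => (p.1, φ.e.symm p.2)) Prod.fst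
    (Y.root, X.root) t
  have e₂ := fun t => project_map (fun p : Y.Pos × X.Pos => (p.1, φ.e.symm p.2)) Prod.snd
    (Y.root, X.root) t
  simp only [φ.root_symm] at e₁ e₂
  have e₃ := fun t => map_project (Prod.snd : Y.Pos × X.Pos → X.Pos) φ.e.symm
    φ.e.symm.injective (Y.root, X.root) t
  have key : ∀ t : List (Y.Pos × X.Pos),
      ((project Prod.fst (Y.root, Y.root) (t.map fun p => (p.1, φ.e.symm p.2))).map (fun x => x) =
        project Prod.snd (Y.root, Y.root) (t.map fun p => (p.1, φ.e.symm p.2))) ↔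
      (project Prod.fst (Y.root, X.root) t).map φ.e = project Prod.snd (Y.root, X.root) t := by
    intro t
    rw [e₁, e₂, ← e₃, List.map_id'']
    · constructor
      · intro h
        refine (congrArg (List.map φ.e) h).trans ?_
        simp
      · intro h
        rw [← h]
        simp
    · exact fun _ => rfl
  constructor
  · intro h t ht hte
    exact (key t).1 (h _ (ht.map _) (by rwa [List.length_map]))
  · intro h t ht hte
    obtain ⟨t, ht', rfl⟩ := List.prefix_map_iff.1 ht
    exact (key t).2 (h t ht' (by rwa [List.length_map] at hte))

/-- The tensor product of the copycat strategies of two isomorphisms. -/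
theorem plays_prod (φ : GameIso Y X) (ψ : GameIso Y' X') :
    tensorPlays Y X Y' X' φ.plays ψ.plays = (φ.prod ψ).plays := by
  ext s
  rw [mem_plays, ← tensorPlays_id]
  refine and_congr ((φ.prod ψ).map_mem_plays_iff (K := Y.tensor Y') s).symm ?_
  have e₁ := fun {Z : Type u} (f : _ → Z) => project_map
    (fun p : (Y.Pos × Y'.Pos) × (X.Pos × X'.Pos) => (p.1, (φ.prod ψ).e.symm p.2)) f
    ((Y.root, Y'.root), (X.root, X'.root)) s
  simp only [prod, Equiv.prodCongr_symm, Equiv.prodCongr_apply, Prod.map, root_symm] at e₁ ⊢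
  rw [mem_plays, mem_plays, map_project _ _ φ.injective_right, map_project _ _ ψ.injective_right]
  exact and_congr (by rw [e₁]) (by rw [e₁])

/-- Naturality of the associativity isomorphism. -/
theorem assoc_naturality {S : Set (List (A.Pos × A'.Pos))} {T : Set (List (B.Pos × B'.Pos))}
    {U : Set (List (C.Pos × C'.Pos))} (hS : IsStrat A A' S) (hT : IsStrat B B' T)
    (hU : IsStrat C C' U) :
    compPlays ((A.tensor B).tensor C) ((A'.tensor B').tensor C') (A'.tensor (B'.tensor C'))
      (tensorPlays (A.tensor B) (A'.tensor B') C C' (tensorPlays A A' B B' S T) U)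
      (assoc A' B' C').plays =
    compPlays ((A.tensor B).tensor C) (A.tensor (B.tensor C)) (A'.tensor (B'.tensor C'))
      (assoc A B C).plays (tensorPlays A A' (B.tensor C) (B'.tensor C') S
        (tensorPlays B B' C C' T U)) := by
  rw [compPlays_plays _ ((hS.tensor hT).tensor hU).subset,
    plays_compPlays _ (hS.tensor (hT.tensor hU)).subset]
  refine Set.ext fun (s : List (((A.Pos × B.Pos) × C.Pos) × (A'.Pos × B'.Pos × C'.Pos))) => ?_
  have e₁ := fun {Z : Type u} (f : _ → Z) => project_map
    (fun p : ((A.Pos × B.Pos) × C.Pos) × (A'.Pos × B'.Pos × C'.Pos) =>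
      (p.1, (assoc A' B' C').e.symm p.2)) f
    (((A.root, B.root), C.root), (A'.root, B'.root, C'.root)) s
  have e₂ := fun {Z : Type u} (f : _ → Z) => project_map
    (fun p : ((A.Pos × B.Pos) × C.Pos) × (A'.Pos × B'.Pos × C'.Pos) =>
      ((assoc A B C).e p.1, p.2)) f
    (((A.root, B.root), C.root), (A'.root, B'.root, C'.root)) s
  simp only [assoc, Equiv.prodAssoc_apply, Equiv.prodAssoc_symm_apply] at e₁ e₂
  have hl : s.map (fun p => (p.1, (assoc A' B' C').e.symm p.2)) ∈ tensorPlays (A.tensor B)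
      (A'.tensor B') C C' (tensorPlays A A' B B' S T) U ↔
      s ∈ Plays ((A.tensor B).tensor C) (A'.tensor (B'.tensor C')) ∧
      (((A.tensor B).dual.tensor (A'.tensor B')).IsPlay (project
        (fun p : ((A.Pos × B.Pos) × C.Pos) × (A'.Pos × B'.Pos × C'.Pos) =>
        ((p.1.1.1, p.1.1.2), (p.2.1, p.2.2.1)))
        (((A.root, B.root), C.root), (A'.root, B'.root, C'.root)) s) ∧
      project (fun p : ((A.Pos × B.Pos) × C.Pos) × (A'.Pos × B'.Pos × C'.Pos) =>
        (p.1.1.1, p.2.1)) (((A.root, B.root), C.root), (A'.root, B'.root, C'.root)) s ∈ S ∧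
      project (fun p : ((A.Pos × B.Pos) × C.Pos) × (A'.Pos × B'.Pos × C'.Pos) =>
        (p.1.1.2, p.2.2.1)) (((A.root, B.root), C.root), (A'.root, B'.root, C'.root)) s ∈ T) ∧
      project (fun p : ((A.Pos × B.Pos) × C.Pos) × (A'.Pos × B'.Pos × C'.Pos) =>
        (p.1.2, p.2.2.2)) (((A.root, B.root), C.root), (A'.root, B'.root, C'.root)) s ∈ U := by
    refine and_congr ((assoc A' B' C').map_mem_plays_iff (K := (A.tensor B).tensor C) s) ?_
    refine and_congr ((iff_of_eq (congrArg (· ∈ tensorPlays A A' B B' S T) (e₁ _))).trans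
      (mem_tensorPlays_iff rfl rfl rfl rfl)) (iff_of_eq (congrArg (· ∈ U) (e₁ _)))
  have hr : s.map (fun p => ((assoc A B C).e p.1, p.2)) ∈ tensorPlays A A' (B.tensor C)
      (B'.tensor C') S (tensorPlays B B' C C' T U) ↔
      s ∈ Plays ((A.tensor B).tensor C) (A'.tensor (B'.tensor C')) ∧
      project (fun p : ((A.Pos × B.Pos) × C.Pos) × (A'.Pos × B'.Pos × C'.Pos) =>
        (p.1.1.1, p.2.1)) (((A.root, B.root), C.root), (A'.root, B'.root, C'.root)) s ∈ S ∧
      ((B.tensor C).dual.tensor (B'.tensor C')).IsPlay (project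
        (fun p : ((A.Pos × B.Pos) × C.Pos) × (A'.Pos × B'.Pos × C'.Pos) =>
        ((p.1.1.2, p.1.2), (p.2.2.1, p.2.2.2)))
        (((A.root, B.root), C.root), (A'.root, B'.root, C'.root)) s) ∧
      project (fun p : ((A.Pos × B.Pos) × C.Pos) × (A'.Pos × B'.Pos × C'.Pos) =>
        (p.1.1.2, p.2.2.1)) (((A.root, B.root), C.root), (A'.root, B'.root, C'.root)) s ∈ T ∧
      project (fun p : ((A.Pos × B.Pos) × C.Pos) × (A'.Pos × B'.Pos × C'.Pos) =>
        (p.1.2, p.2.2.2)) (((A.root, B.root), C.root), (A'.root, B'.root, C'.root)) s ∈ U := by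
    refine and_congr ((assoc A B C).map_left_mem_plays_iff (K := A'.tensor (B'.tensor C')) s) ?_
    refine and_congr (iff_of_eq (congrArg (· ∈ S) (e₂ _))) ((iff_of_eq (congrArg
      (· ∈ tensorPlays B B' C C' T U) (e₂ _))).trans (mem_tensorPlays_iff rfl rfl rfl rfl))
  refine hl.trans (Iff.trans ?_ hr.symm)
  -- The two bracketings test alternation on different pairs of games, `A`, `B` on one side and `B`,
  -- `C` on the other. Both tests are redundant: they follow from the alternation of the whole play
  -- and the nonnegative balances of the three components.
  have key : s ∈ Plays ((A.tensor B).tensor C) (A'.tensor (B'.tensor C')) →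
      project (fun p : ((A.Pos × B.Pos) × C.Pos) × (A'.Pos × B'.Pos × C'.Pos) =>
        (p.1.1.1, p.2.1)) (((A.root, B.root), C.root), (A'.root, B'.root, C'.root)) s ∈ S →
      project (fun p : ((A.Pos × B.Pos) × C.Pos) × (A'.Pos × B'.Pos × C'.Pos) =>
        (p.1.1.2, p.2.2.1)) (((A.root, B.root), C.root), (A'.root, B'.root, C'.root)) s ∈ T →
      project (fun p : ((A.Pos × B.Pos) × C.Pos) × (A'.Pos × B'.Pos × C'.Pos) =>
        (p.1.2, p.2.2.2)) (((A.root, B.root), C.root), (A'.root, B'.root, C'.root)) s ∈ U →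
      ((A.tensor B).dual.tensor (A'.tensor B')).IsPlay (project
        (fun p : ((A.Pos × B.Pos) × C.Pos) × (A'.Pos × B'.Pos × C'.Pos) =>
        ((p.1.1.1, p.1.1.2), (p.2.1, p.2.2.1)))
        (((A.root, B.root), C.root), (A'.root, B'.root, C'.root)) s) ∧
      ((B.tensor C).dual.tensor (B'.tensor C')).IsPlay (project
        (fun p : ((A.Pos × B.Pos) × C.Pos) × (A'.Pos × B'.Pos × C'.Pos) =>
        ((p.1.1.2, p.1.2), (p.2.2.1, p.2.2.2)))
        (((A.root, B.root), C.root), (A'.root, B'.root, C'.root)) s) := by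
    intro h hs ht hu
    have hp : (((A.tensor B).tensor C).dual.tensor (A'.tensor (B'.tensor C'))).IsPlay
        (project (fun w => ((w.1.1, w.1.2), (w.2.1, w.2.2)))
          (((A.root, B.root), C.root), (A'.root, B'.root, C'.root)) s) :=
      (isPlay_tensor_iff'.1 h).2
    obtain ⟨k, k'⟩ := (isPlay_tensor_iff (A := A.tensor B) (A' := A') (B := C)
      (B' := B'.tensor C') (x := (((A.root, B.root), C.root), (A'.root, B'.root, C'.root)))
      (a := fun w : ((A.Pos × B.Pos) × C.Pos) × (A'.Pos × B'.Pos × C'.Pos) => w.1.1)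
      (b := fun w => w.1.2) (a' := fun w => w.2.1) (b' := fun w => w.2.2) rfl rfl rfl rfl).1 hp
    have b₁ := ((isPlay_iff rfl rfl).1 (hS.isPlay _ hs)).2
    have b₂ := ((isPlay_iff rfl rfl).1 (hT.isPlay _ ht)).2
    have b₃ := ((isPlay_iff rfl rfl).1 (hU.isPlay _ hu)).2
    have k'' := k.mono (R' := fun p q => (Step A B p.1.1 q.1.1 ∧ Step B' C' p.2.2 q.2.2) ∧
      ((Step A B p.1.1 q.1.1 ∧ q.2.1 = p.2.1 ∧ q.2.2.1 = p.2.2.1) ∨ (q.1.1.1 = p.1.1.1 ∧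
        q.1.1.2 = p.1.1.2 ∧ Step A' B' (p.2.1, p.2.2.1) (q.2.1, q.2.2.1))) ∧
      ((Step B C (p.1.1.2, p.1.2) (q.1.1.2, q.1.2) ∧ q.2.2.1 = p.2.2.1 ∧ q.2.2.2 = p.2.2.2) ∨
        (q.1.1.2 = p.1.1.2 ∧ q.1.2 = p.1.2 ∧ Step B' C' p.2.2 q.2.2)))
      fun p q h => by
        have o₁ : ∀ x y : A.Pos × B.Pos, (A.tensor B).OK x y ↔ _ := fun x y =>
          ok_tensor.trans step_iff
        have o₂ : ∀ x y : B'.Pos × C'.Pos, (B'.tensor C').OK x y ↔ _ := fun x y =>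
          ok_tensor.trans step_iff
        simp only [step_iff, o₁, o₂, Prod.ext_iff] at h ⊢
        clear o₁ o₂
        have o : ∀ (G : MBGame.{u}) (x y : G.Pos), y = x → G.OK x y := fun _ _ _ => Or.inl
        have o₁ := o A p.1.1.1 q.1.1.1
        have o₂ := o B p.1.1.2 q.1.1.2
        have o₃ := o C p.1.2 q.1.2
        have o₄ := o A' p.2.1 q.2.1
        have o₅ := o B' p.2.2.1 q.2.2.1
        have o₆ := o C' p.2.2.2 q.2.2.2
        clear * - h o₁ o₂ o₃ o₄ o₅ o₆
        rcases h with h | h <;> grind (splits := 30)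
    have bal : ∀ t, t <+: s →
        _ = A.bal (fun w : ((A.Pos × B.Pos) × C.Pos) × (A'.Pos × B'.Pos × C'.Pos) => w.1.1.1)
          (((A.root, B.root), C.root), (A'.root, B'.root, C'.root)) t + B.bal (fun w => w.1.1.2)
          (((A.root, B.root), C.root), (A'.root, B'.root, C'.root)) t ∧
        _ = B'.bal (fun w : ((A.Pos × B.Pos) × C.Pos) × (A'.Pos × B'.Pos × C'.Pos) => w.2.2.1)
          (((A.root, B.root), C.root), (A'.root, B'.root, C'.root)) t + C'.bal (fun w => w.2.2.2)
          (((A.root, B.root), C.root), (A'.root, B'.root, C'.root)) t := fun t ht =>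
      ⟨bal_tensor ((k''.prefix ht).mono fun p q h => h.1.1),
        bal_tensor ((k''.prefix ht).mono fun p q h => h.1.2)⟩
    refine ⟨(isPlay_tensor_iff rfl rfl rfl rfl).2 ⟨k''.mono fun p q h => h.2.1,
      fun t ht => ?_⟩, (isPlay_tensor_iff rfl rfl rfl rfl).2 ⟨k''.mono fun p q h => h.2.2,
      fun t ht => ?_⟩⟩
    all_goals
      obtain ⟨q₁, q₂⟩ := bal t ht
      have := k' t ht
      rw [q₁, q₂] at this
      have := b₁ t ht; have := b₂ t ht; have := b₃ t ht
      omega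
  clear * - key
  tauto

theorem unitRight_naturality {S : Set (List (A.Pos × A'.Pos))} (hS : IsStrat A A' S) :
    compPlays (A.tensor one) (A'.tensor one) A' (tensorPlays A A' one one S (idPlays one))
      (unitRight A').plays = compPlays (A.tensor one) A A' (unitRight A).plays S := by
  rw [compPlays_plays _ (hS.tensor (isStrat_id one)).subset, plays_compPlays _ hS.subset]
  ext s
  have e := fun {Z : Type u} (f : _ → Z) => project_map
    (fun p : (A.Pos × PUnit) × A'.Pos => (p.1, (unitRight A').e.symm p.2)) f
    ((A.root, PUnit.unit), A'.root) s
  have e' := map_project (fun p => p) (fun p : (A.Pos × PUnit) × A'.Pos =>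
    ((unitRight A).e p.1, p.2)) 
    (by rintro ⟨⟨a, _⟩, b⟩ ⟨⟨a', _⟩, b'⟩ h; simpa [unitRight] using h)
    ((A.root, PUnit.unit), A'.root) s
  have h₁ := (unitRight A').map_mem_plays_iff (K := A.tensor one) s
  have h₂ := (unitRight A).map_left_mem_plays_iff (K := A') s
  constructor
  · rintro ⟨h, h', -⟩
    have hn := IsPlay.noStutter (h₁.1 h)
    rw [project_id_of_noStutter hn] at e'
    rw [Set.mem_ofPred_eq, e']
    exact (iff_of_eq (congrArg (· ∈ S) (e _))).1 h'
  · intro h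
    have hp := h₂.1 (hS.subset h)
    have hn := IsPlay.noStutter hp
    rw [project_id_of_noStutter hn] at e'
    rw [Set.mem_ofPred_eq, e'] at h
    refine ⟨h₁.2 hp, (iff_of_eq (congrArg (· ∈ S) (e _))).2 h, ?_⟩
    have : project (fun x : (A.Pos × PUnit) × (A'.Pos × PUnit) => (x.1.2, x.2.2))
        ((A.root, PUnit.unit), (A'.root, PUnit.unit))
        (s.map (fun p => (p.1, (unitRight A').e.symm p.2))) = [] :=
      project_const (c := (PUnit.unit, PUnit.unit)) rfl fun _ _ => rfl
    exact this.symm ▸ (isStrat_id one).nil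

theorem swap_naturality {S : Set (List (A.Pos × A'.Pos))} {T : Set (List (B.Pos × B'.Pos))}
    (hS : IsStrat A A' S) (hT : IsStrat B B' T) :
    compPlays (A.tensor B) (A'.tensor B') (B'.tensor A') (tensorPlays A A' B B' S T)
      (swap A' B').plays =
    compPlays (A.tensor B) (B.tensor A) (B'.tensor A') (swap A B).plays
      (tensorPlays B B' A A' T S) := by
  rw [compPlays_plays _ (hS.tensor hT).subset, plays_compPlays _ (hT.tensor hS).subset]
  ext s
  have e := fun {Z : Type u} (f : _ → Z) => project_map
    (fun p : (A.Pos × B.Pos) × (B'.Pos × A'.Pos) => (p.1, (swap A' B').e.symm p.2)) f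
    ((A.root, B.root), (B'.root, A'.root)) s
  have e' := fun {Z : Type u} (f : _ → Z) => project_map
    (fun p : (A.Pos × B.Pos) × (B'.Pos × A'.Pos) => ((swap A B).e p.1, p.2)) f
    ((A.root, B.root), (B'.root, A'.root)) s
  have h₁ := (swap A' B').map_mem_plays_iff (K := A.tensor B) s
  have h₂ := (swap A B).map_left_mem_plays_iff (K := B'.tensor A') s
  refine Iff.trans (and_congr h₁ (and_congr (iff_of_eq (congrArg (· ∈ S) (e _)))
    (iff_of_eq (congrArg (· ∈ T) (e _))))) (Iff.trans ?_ (and_congr h₂ (and_congr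
    (iff_of_eq (congrArg (· ∈ T) (e' _))) (iff_of_eq (congrArg (· ∈ S) (e' _))))).symm)
  exact and_congr Iff.rfl and_comm

end GameIso

end MBGame

/-! ## The symmetric monoidal structure -/

namespace MBGame

variable {A A' B B' X X' Y Y' Z : MBGame.{u}}

/-- The tensor product of two strategies. -/
def tensorHom (f : Hom A A') (g : Hom B B') : Hom (A.tensor B) (A'.tensor B') :=
  (f.isStrat.tensor g.isStrat).hom

namespace GameIso

theorem plays_congr {φ ψ : GameIso Y X} (h : ∀ a, φ.e a = ψ.e a) : φ.plays = ψ.plays := by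
  rw [plays_eq_copycat, plays_eq_copycat, funext h]

/-- The copycat strategy of an isomorphism of games. -/
def hom (φ : GameIso Y X) : Hom Y X := φ.isStrat_plays.hom

/-- The copycat strategy of an isomorphism depends only on its map of positions. The pentagon, the
triangle and the hexagon hold because the bijections on their two sides agree definitionally. -/
theorem hom_congr {φ ψ : GameIso Y X} (h : ∀ a, φ.e a = ψ.e a) : φ.hom = ψ.hom :=
  Hom.ext_set (plays_congr h)

theorem hom_refl : (refl Y).hom = gameCat.id Y := Hom.ext_set (plays_refl (Y := Y))

theorem hom_trans (φ : GameIso Y X) (ψ : GameIso X Z) :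
    gameCat.comp φ.hom ψ.hom = (φ.trans ψ).hom := Hom.ext_set (plays_trans φ ψ)

theorem hom_prod (φ : GameIso Y X) (ψ : GameIso Y' X') :
    tensorHom φ.hom ψ.hom = (φ.prod ψ).hom := Hom.ext_set (plays_prod φ ψ)

/-- The isomorphism in the category of games given by an isomorphism of games. -/
def iso (φ : GameIso Y X) : Iso (C := gameCat.{u}.Obj) Y X where
  hom := φ.hom
  inv := φ.symm.hom
  hom_inv_id := (hom_trans φ φ.symm).trans
    ((hom_congr fun a => φ.e.symm_apply_apply a).trans hom_refl)
  inv_hom_id := (hom_trans φ.symm φ).trans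
    ((hom_congr fun a => φ.e.apply_symm_apply a).trans hom_refl)

end GameIso

theorem tensorHom_id : tensorHom (gameCat.id A) (gameCat.id B) = gameCat.id (A.tensor B) :=
  Hom.ext_set tensorPlays_id

theorem tensorHom_comp {A'' B'' : MBGame.{u}} (f : Hom A A') (g : Hom B B') (f' : Hom A' A'')
    (g' : Hom B' B'') : gameCat.comp (tensorHom f g) (tensorHom f' g') =
      tensorHom (gameCat.comp f f') (gameCat.comp g g') :=
  Hom.ext_set (tensorPlays_compPlays f.isStrat.subset f'.isStrat.subset g.isStrat.subset
    g'.isStrat.subset)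

theorem tensorHom_swap (f : Hom A A') (g : Hom B B') :
    gameCat.comp (tensorHom f g) (GameIso.swap A' B').hom =
      gameCat.comp (GameIso.swap A B).hom (tensorHom g f) :=
  Hom.ext_set (GameIso.swap_naturality f.isStrat g.isStrat)

theorem tensorHom_unitRight (f : Hom A A') :
    gameCat.comp (tensorHom f (gameCat.id one)) (GameIso.unitRight A').hom =
      gameCat.comp (GameIso.unitRight A).hom f :=
  Hom.ext_set (GameIso.unitRight_naturality f.isStrat)

theorem tensorHom_unitLeft (f : Hom A A') :
    gameCat.comp (tensorHom (gameCat.id one) f) (GameIso.unitLeft A').hom =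
      gameCat.comp (GameIso.unitLeft A).hom f := by
  rw [GameIso.unitLeft, GameIso.unitLeft, ← GameIso.hom_trans, ← GameIso.hom_trans,
    ← gameCat.assoc, tensorHom_swap, gameCat.assoc, tensorHom_unitRight, gameCat.assoc]

open GameIso in
theorem pentagon (A B C D : MBGame.{u}) :
    gameCat.comp (tensorHom (assoc A B C).hom (gameCat.id D))
      (gameCat.comp (assoc A (B.tensor C) D).hom (tensorHom (gameCat.id A) (assoc B C D).hom)) =
    gameCat.comp (assoc (A.tensor B) C D).hom (assoc A B (C.tensor D)).hom := by
  rw [← hom_refl, ← hom_refl, hom_prod, hom_prod, hom_trans, hom_trans, hom_trans]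
  exact hom_congr fun _ => rfl

open GameIso in
theorem triangle (A B : MBGame.{u}) :
    gameCat.comp (assoc A one B).hom (tensorHom (gameCat.id A) (unitLeft B).hom) =
      tensorHom (unitRight A).hom (gameCat.id B) := by
  rw [← hom_refl, ← hom_refl, hom_prod, hom_prod, hom_trans]
  exact hom_congr fun _ => rfl

open GameIso in
theorem hexagon (A B C : MBGame.{u}) :
    gameCat.comp (assoc A B C).hom (gameCat.comp (swap A (B.tensor C)).hom (assoc B C A).hom) =
      gameCat.comp (tensorHom (swap A B).hom (gameCat.id C))
        (gameCat.comp (assoc B A C).hom (tensorHom (gameCat.id B) (swap A C).hom)) := by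
  rw [← hom_refl, ← hom_refl, hom_prod, hom_prod, hom_trans, hom_trans, hom_trans, hom_trans]
  exact hom_congr fun _ => rfl

open GameIso in
theorem swap_hom_swap (A B : MBGame.{u}) :
    gameCat.comp (swap A B).hom (swap B A).hom = gameCat.id (A.tensor B) := by
  rw [← hom_refl, hom_trans]
  exact hom_congr fun _ => rfl

end MBGame

open MBGame GameIso in
/-- The symmetric monoidal structure of the category of multi-bracketed games. -/
def gameTensor : GameTensor gameCat.{u} where
  tensorHom f g := tensorHom f g
  tensorHom_plays _ _ := rfl
  associator A B C := (assoc A B C).iso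
  associator_plays A B C := plays_eq_copycat (assoc A B C)
  leftUnitor A := (unitLeft A).iso
  leftUnitor_plays A := plays_eq_copycat (unitLeft A)
  rightUnitor A := (unitRight A).iso
  rightUnitor_plays A := plays_eq_copycat (unitRight A)
  braiding A B := (swap A B).iso
  braiding_plays A B := plays_eq_copycat (swap A B)
  tensor_id A B := tensorHom_id
  tensor_comp f g f' g' := tensorHom_comp f g f' g'
  associator_naturality f g h := Hom.ext_set
    (assoc_naturality (Hom.isStrat f) (Hom.isStrat g) (Hom.isStrat h))
  leftUnitor_naturality f := tensorHom_unitLeft f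
  rightUnitor_naturality f := tensorHom_unitRight f
  pentagon A B C D := MBGame.pentagon A B C D
  triangle A B := MBGame.triangle A B
  braiding_naturality f g := tensorHom_swap f g
  hexagon A B C := MBGame.hexagon A B C
  symmetry A B := swap_hom_swap A B

/-! ## Duality -/

namespace MBGame

open ConwayGame

variable {A A' B B' X X' Y Y' Z : MBGame.{u}}

/-- For duals, equality of games is claimed and not merely isomorphism, so the fields that carry
data are compared; the axioms are propositions and take care of themselves. -/
theorem ext_heq (hP : A.Pos = B.Pos) (hr : HEq A.root B.root) (hM : HEq A.Move B.Move)
    (hQ : A.Query = B.Query) (hq : HEq A.IsQuery B.IsQuery) (hR : HEq A.Res B.Res) : A = B := by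
  obtain ⟨⟨_, _, _⟩, _, _⟩ := A
  obtain ⟨⟨_, _, _⟩, _, _⟩ := B
  dsimp only at hP hr hM hQ hq hR
  subst hP hr hM hQ hq hR
  rfl

theorem dual_dual (A : MBGame.{u}) : A.dual.dual = A := by
  refine ext_heq rfl HEq.rfl (heq_of_eq ?_) rfl (heq_of_eq ?_) HEq.rfl
  · funext p x y
    simp
  · funext p x r
    exact congrArg (fun p => A.IsQuery p x r) (neg_neg p)

/-- Positions and moves agree definitionally. The residuals need an argument, because the identity
on the queries of the idle component is guarded by the existence of a polarity, and dualising
permutes the polarities. -/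
theorem dual_tensor (A B : MBGame.{u}) : (A.tensor B).dual = A.dual.tensor B.dual := by
  refine ext_heq rfl HEq.rfl HEq.rfl rfl (heq_of_eq ?_) (heq_of_eq ?_)
  · funext p x r
    cases r <;> rfl
  · have he : ∀ x y, (tensorConway A.dual B.dual).Edge x y ↔ (tensorConway A B).Edge x y :=
      fun x y => edge_dual (A := A.tensor B)
    have hr : ∀ (C : MBGame.{u}) x y r r', C.dual.StepRes x y r r' ↔ C.StepRes x y r r' := by
      intro C x y r r'
      refine or_congr (and_congr_right fun _ => and_congr_right fun _ => ?_) Iff.rfl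
      exact ⟨fun ⟨p, hp⟩ => ⟨-p, hp⟩, fun ⟨p, hp⟩ => ⟨-p, by rwa [← neg_neg p] at hp⟩⟩
    funext x y r r'
    apply propext
    cases r <;> cases r'
    · exact and_congr (he x y).symm (hr _ _ _ _ _).symm
    · exact Iff.rfl
    · exact Iff.rfl
    · exact and_congr (he x y).symm (hr _ _ _ _ _).symm

/-- Strategies are transported along isomorphisms of games. -/
theorem IsStrat.transport (φ : GameIso (A.dual.tensor B) (A'.dual.tensor B'))
    {S : Set (List (A.Pos × B.Pos))} (hS : IsStrat A B S) :
    IsStrat A' B' {s | s.map φ.e.symm ∈ S} where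
  isPlay s hs := by
    have key : ∀ (p : ℤˣ) x, (A.dual.tensor B).IsAlternating p (φ.e.symm x) (s.map φ.e.symm) →
        (A'.dual.tensor B').IsAlternating p x s := by
      clear hs
      induction s with
      | nil => exact fun _ _ _ => trivial
      | cons y s ih => exact fun p x h => ⟨(φ.symm.move _ _ _).1 h.1, ih _ _ h.2⟩
    refine key _ _ ?_
    rw [φ.root_symm]
    exact hS.isPlay _ hs
  even s hs := by simpa using hS.even _ hs
  nil := hS.nil
  prefix_mem s t h hs := hS.prefix_mem _ (t.map φ.e.symm) (by simpa using h) (by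
    rw [← List.map_append]; exact hs)
  coh s hs t ht := by
    have key : ∀ k, Coh k (s.map φ.e.symm) (t.map φ.e.symm) → Coh k s t := by
      clear hs ht
      induction s generalizing t with
      | nil => simp
      | cons y s ih =>
        cases t with
        | nil => simp
        | cons z t =>
          exact fun k h => ⟨fun hk => φ.e.symm.injective (h.1 hk), fun e => ih _ _ (h.2 (by rw [e]))⟩
    exact key _ (hS.coh _ hs _ ht)
  bracket s t hs := by
    have hp : Along (A'.dual.tensor B').Edge (s.getLastD (A'.dual.tensor B').root) t := by
      have h := ((isAlternating_iff _).1 (hS.isPlay _ hs)).1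
      rw [← φ.root_symm, along_map, along_append] at h
      exact h.2.mono fun p q h => (φ.symm.edge _ _).1 h
    have h := hS.bracket (s.map φ.e.symm) (t.map φ.e.symm) (by rw [← List.map_append]; exact hs)
    have e : (s.map φ.e.symm).getLastD (A.root, B.root) =
      φ.e.symm (s.getLastD (A'.dual.tensor B').root) := by
      rw [← List.getLastD_map (f := φ.e.symm), φ.root_symm]
    rw [e] at h
    exact fun hf => (φ.symm.fresh _ _ _ hp).2 (h ((φ.symm.fresh _ _ _ hp).1 hf))

namespace GameIso

/-- A game is isomorphic to its bidual. -/
def dualDual (A : MBGame.{u}) : GameIso A A.dual.dual where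
  e := Equiv.refl _
  root := rfl
  move p a b := by simp
  fresh q a s _ := by
    rw [fresh_dual, fresh_dual]
    simp

/-- The dual of a tensor product. -/
def dualTensor (A B : MBGame.{u}) : GameIso (A.dual.tensor B.dual) (A.tensor B).dual where
  e := Equiv.refl _
  root := rfl
  move p a b := Iff.rfl
  fresh q a s hs := by
    have hs' : Along (A.tensor B).Edge a s := hs.mono fun p q h => edge_dual.1 h
    rw [fresh_dual]
    have h₁ := fresh_tensor_of_along (p := q) hs
    have h₂ := fresh_tensor_of_along (p := -q) hs'
    rw [fresh_dual, fresh_dual] at h₁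
    simp only [Equiv.refl_apply, Equiv.coe_refl, List.map_id]
    exact h₁.trans h₂.symm

/-- The unit is its own dual. -/
def dualOne : GameIso one.{u} one.dual where
  e := Equiv.refl _
  root := rfl
  move p a b := Iff.rfl
  fresh q a s _ := by
    rw [fresh_dual]
    exact iff_of_false not_fresh_one not_fresh_one

/-- The positions of the game of the unit of the duality. -/
def coev (A : MBGame.{u}) : GameIso (A.dual.tensor A) (one.dual.tensor (A.tensor A.dual)) :=
  (swap A.dual A).trans ((unitLeft _).symm.trans (dualOne.prod (refl _)))

/-- The positions of the game of the counit of the duality. -/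
def ev (A : MBGame.{u}) : GameIso (A.dual.tensor A) ((A.dual.tensor A).dual.tensor one) :=
  (swap A.dual A).trans ((((dualDual A).prod (refl A.dual)).trans (dualTensor A.dual A)).trans
    (unitRight _).symm)

/-- The maximality of copycat, transported along `φ`: after composition with the inverse
isomorphism, `IsStrat.eq_id` applies. -/
theorem eq_plays {S : Set (List (Y.Pos × X.Pos))} (hS : IsStrat Y X S) (φ : GameIso Y X)
    (h : φ.plays ⊆ S) : S = φ.plays := by
  have e := φ.symm.compPlays_plays hS.subset
  have h' := hS.comp φ.symm.isStrat_plays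
  rw [e] at h'
  have h'' := h'.eq_id fun s hs => h (φ.mem_plays.2 (by
    rw [List.map_map]
    convert hs
    exact List.map_id'' (fun p => by simp [symm]) s))
  ext s
  rw [mem_plays, ← h'', Set.mem_ofPred_eq, List.map_map, List.map_id'']
  exact fun p => by simp [symm]

end GameIso

/-- The plays of the unit `1 → A ⊗ A*` of the duality. -/
def coevPlays (A : MBGame.{u}) : Set (List (one.Pos × (A.Pos × A.Pos))) :=
  {s | s.map (fun p => (p.2.2, p.2.1)) ∈ idPlays A}

/-- The plays of the counit `A* ⊗ A → 1` of the duality. -/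
def evPlays (A : MBGame.{u}) : Set (List ((A.Pos × A.Pos) × one.Pos)) :=
  {s | s.map (fun p => (p.1.2, p.1.1)) ∈ idPlays A}

/-- The games `A* ⊗ A` and `1* ⊗ (A ⊗ A*)` differ by a renaming of positions, so the unit of the
duality is the identity strategy read in another game. -/
theorem isStrat_coev (A : MBGame.{u}) : IsStrat one (A.tensor A.dual) (coevPlays A) :=
  (isStrat_id A).transport (GameIso.coev A)

theorem isStrat_ev (A : MBGame.{u}) : IsStrat (A.dual.tensor A) one (evPlays A) :=
  (isStrat_id A).transport (GameIso.ev A)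

/-- The clauses for Player and Opponent moves are exchanged by passing to the dual game, and the
sides on which these moves begin are exchanged by the swap. -/
theorem isCC_swap {x : A.Pos} {s : List (A.Pos × A.Pos)} :
    IsCC A.dual x (s.map Prod.swap) ↔ IsCC A x s := by
  induction s using two_step_induction generalizing x with
  | nil => exact Iff.rfl
  | one p => exact Iff.rfl
  | cons p q s ih =>
    obtain ⟨y, y'⟩ := q
    by_cases e : y = y'
    · subst e
      refine and_congr Iff.rfl (and_congr ?_ ih)
      rw [or_comm]
      refine or_congr (and_congr Iff.rfl ?_) (and_congr (by simp) ?_)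
      · exact Prod.swap_injective.eq_iff' rfl
      · exact Prod.swap_injective.eq_iff' rfl
    · exact iff_of_false (fun h => e h.1.symm) fun h => e h.1

/-- A copycat play on `A* ⊗ A` expands to a copycat play on a chain of five copies of `A`. -/
theorem exists_chain {x : A.Pos} {s : List (A.Pos × A.Pos)} (h : IsCC A x s) :
    ∃ u : List (Fin 5 → A.Pos), project (fun w : Fin 5 → A.Pos => (w 0, w 4)) (fun _ => x) u = s ∧
      (IsCC A x (project (fun w : Fin 5 → A.Pos => (w 0, w 1)) (fun _ => x) u) ∧
      IsCC A x (project (fun w : Fin 5 → A.Pos => (w 1, w 2)) (fun _ => x) u) ∧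
      IsCC A x (project (fun w : Fin 5 → A.Pos => (w 2, w 3)) (fun _ => x) u) ∧
      IsCC A x (project (fun w : Fin 5 → A.Pos => (w 3, w 4)) (fun _ => x) u)) ∧
      Along (fun p q => ∃ i, A.OK (p i) (q i) ∧ ∀ j, j ≠ i → q j = p j) (fun _ => x) u := by
  induction s using two_step_induction generalizing x with
  | nil => exact ⟨[], rfl, ⟨trivial, trivial, trivial, trivial⟩, trivial⟩
  | one p => exact h.elim
  | cons p q s ih =>
    obtain ⟨y, y'⟩ := q
    obtain ⟨h₁, h₂, h₃⟩ := h
    dsimp only at h₁ h₂ h₃; subst h₁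
    obtain ⟨u, hu, ⟨k₁, k₂, k₃, k₄⟩, hl⟩ := ih h₃
    have ev : (fun _ : Fin 5 => y) = ![y, y, y, y, y] := by
      funext i; fin_cases i <;> rfl
    have ex : (fun _ : Fin 5 => x) = ![x, x, x, x, x] := by
      funext i; fin_cases i <;> rfl
    rw [ev] at hu k₁ k₂ k₃ k₄ hl
    rw [ex]
    -- The move enters the chain at the end where Opponent makes it and is passed on, copy by copy,
    -- to the other end.
    rcases h₂ with ⟨h, rfl⟩ | ⟨h, rfl⟩
    · have hn := h.ne
      refine ⟨![y, x, x, x, x] :: ![y, y, x, x, x] :: ![y, y, y, x, x] :: ![y, y, y, y, x] ::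
        ![y, y, y, y, y] :: u, ?_, ?_, ?_⟩
      · simp [project, hn, hu]
      · simp [project, hn, IsCC, h, k₁, k₂, k₃, k₄]
      · refine ⟨⟨0, Or.inr ⟨_, h⟩, ?_⟩, ⟨1, Or.inr ⟨_, h⟩, ?_⟩, ⟨2, Or.inr ⟨_, h⟩, ?_⟩,
          ⟨3, Or.inr ⟨_, h⟩, ?_⟩, ⟨4, Or.inr ⟨_, h⟩, ?_⟩, hl⟩
        all_goals intro j; fin_cases j <;> simp
    · have hn := h.ne
      refine ⟨![x, x, x, x, y] :: ![x, x, x, y, y] :: ![x, x, y, y, y] :: ![x, y, y, y, y] ::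
        ![y, y, y, y, y] :: u, ?_, ?_, ?_⟩
      · simp [project, hn, hu]
      · simp [project, hn, IsCC, h, k₁, k₂, k₃, k₄]
      · refine ⟨⟨4, Or.inr ⟨_, h⟩, ?_⟩, ⟨3, Or.inr ⟨_, h⟩, ?_⟩, ⟨2, Or.inr ⟨_, h⟩, ?_⟩,
          ⟨1, Or.inr ⟨_, h⟩, ?_⟩, ⟨0, Or.inr ⟨_, h⟩, ?_⟩, hl⟩
        all_goals intro j; fin_cases j <;> simp

end MBGame

/-! ## The category of games is compact closed -/

namespace MBGame

open ConwayGame GameIso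

variable {A : MBGame.{u}}

/-- Consecutive copies of the chain are related by copycat plays, and so are its two ends. Hence the
balances increase weakly along the chain and differ by at most one in all; every alternation bound
in the snake equations follows from these inequalities. -/
theorem exists_chain_plays {V : Type u} {θ : A.Pos × A.Pos → V} (hθ : Function.Injective θ)
    {s : List (A.Pos × A.Pos)} (hs : s ∈ idPlays A) :
    ∃ u : List (Fin 5 → A.Pos), project (fun w => θ (w 0, w 4)) (fun _ => A.root) u = s.map θ ∧
      (project (fun w => (w 0, w 1)) (fun _ => A.root) u ∈ idPlays A ∧
      project (fun w => (w 1, w 2)) (fun _ => A.root) u ∈ idPlays A ∧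
      project (fun w => (w 2, w 3)) (fun _ => A.root) u ∈ idPlays A ∧
      project (fun w => (w 3, w 4)) (fun _ => A.root) u ∈ idPlays A) ∧
      Along (fun p q => (∀ j, A.OK (p j) (q j)) ∧ ∃ i, ∀ j, j ≠ i → q j = p j)
        (fun _ => A.root) u ∧
      ∀ t, t <+: u → ∃ b : Fin 5 → ℤ, (∀ i, A.bal (fun w => w i) (fun _ => A.root) t = b i) ∧
        b 0 ≤ b 1 ∧ b 1 ≤ b 2 ∧ b 2 ≤ b 3 ∧ b 3 ≤ b 4 ∧ b 4 ≤ b 0 + 1 := by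
  obtain ⟨u, hu, ⟨h₁, h₂, h₃, h₄⟩, hl⟩ := exists_chain (mem_idPlays.1 hs)
  simp only [← mem_idPlays] at h₁ h₂ h₃ h₄
  refine ⟨u, ?_, ⟨h₁, h₂, h₃, h₄⟩, hl.mono ?_, fun t ht => ⟨_, fun _ => rfl, ?_⟩⟩
  · rw [← hu, map_project _ _ hθ]
  · rintro p q ⟨i, h, h'⟩
    refine ⟨fun j => ?_, i, h'⟩
    by_cases e : j = i
    · rwa [e]
    · exact Or.inl (h' j e)
  · rw [← hu] at hs
    have k := ((isPlay_iff (x := fun _ : Fin 5 => A.root) rfl rfl).1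
      ((isStrat_id A).isPlay _ hs)).2 t ht
    have k₁ := ((isPlay_iff (x := fun _ : Fin 5 => A.root) rfl rfl).1
      ((isStrat_id A).isPlay _ h₁)).2 t ht
    have k₂ := ((isPlay_iff (x := fun _ : Fin 5 => A.root) rfl rfl).1
      ((isStrat_id A).isPlay _ h₂)).2 t ht
    have k₃ := ((isPlay_iff (x := fun _ : Fin 5 => A.root) rfl rfl).1
      ((isStrat_id A).isPlay _ h₃)).2 t ht
    have k₄ := ((isPlay_iff (x := fun _ : Fin 5 => A.root) rfl rfl).1
      ((isStrat_id A).isPlay _ h₄)).2 t ht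
    omega

/-- The unit `1 → A ⊗ A*` of the duality. -/
def coevHom (A : MBGame.{u}) : Hom one (A.tensor A.dual) := (isStrat_coev A).hom

/-- The counit `A* ⊗ A → 1` of the duality. -/
def evHom (A : MBGame.{u}) : Hom (A.dual.tensor A) one := (isStrat_ev A).hom

theorem mem_coevPlays {W : Type*} {f g : W → A.Pos} {x : W} {u : List W} :
    project (fun w => ((PUnit.unit : one.{u}.Pos), (f w, g w))) x u ∈ coevPlays A ↔
      project (fun w => (g w, f w)) x u ∈ idPlays A := by
  rw [coevPlays, Set.mem_ofPred_eq, map_project]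
  rintro ⟨_, a, b⟩ ⟨_, a', b'⟩ h
  obtain ⟨rfl, rfl⟩ := Prod.mk.inj h
  rfl

theorem mem_evPlays {W : Type*} {f g : W → A.Pos} {x : W} {u : List W} :
    project (fun w => ((f w, g w), (PUnit.unit : one.{u}.Pos))) x u ∈ evPlays A ↔
      project (fun w => (g w, f w)) x u ∈ idPlays A := by
  rw [evPlays, Set.mem_ofPred_eq, map_project]
  rintro ⟨⟨a, b⟩, _⟩ ⟨⟨a', b'⟩, _⟩ h
  obtain ⟨rfl, rfl⟩ := Prod.mk.inj h
  rfl

theorem ok_tensor_mk {B : MBGame.{u}} {a a' : A.Pos} {b b' : B.Pos} :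
    (A.tensor B).OK (a, b) (a', b') ↔ A.OK a a' ∧ B.OK b b' ∧ (a' = a ∨ b' = b) :=
  ok_tensor.trans step_iff

theorem bal_one {W : Type*} (f : W → one.{u}.Pos) (x : W) (u : List W) : one.bal f x u = 0 := by
  induction u generalizing x with
  | nil => rfl
  | cons y u ih =>
    rw [bal_cons, ih, inc_of_not_edge fun ⟨_, h⟩ => h]
    rfl

/-- By `eq_plays` one inclusion is enough. Copies 0 and 4 of the chain are the source and the
target; in the middle game `(A ⊗ A*) ⊗ A` the factors are copies 3, 2 and 1 in this order. The
counit acts between copies 1 and 2, the unit between copies 2 and 3, and identities act between 0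
and 1 and between 3 and 4. -/
theorem coev_ev (A : MBGame.{u}) :
    gameCat.comp (tensorHom (coevHom A) (gameCat.id A)) (gameCat.comp (assoc A A.dual A).hom
      (tensorHom (gameCat.id A) (evHom A))) =
    gameCat.comp (unitLeft A).hom (unitRight A).symm.hom := by
  rw [hom_trans]
  refine Hom.ext_set (eq_plays (Hom.isStrat _) _ fun s hs => ?_)
  have hT := (isStrat_id A).tensor (isStrat_ev A)
  change s ∈ compPlays (one.tensor A) ((A.tensor A.dual).tensor A) (A.tensor one)
    (tensorPlays one (A.tensor A.dual) A A (coevPlays A) (idPlays A))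
    (compPlays ((A.tensor A.dual).tensor A) (A.tensor (A.dual.tensor A)) (A.tensor one)
      (assoc A A.dual A).plays (tensorPlays A A (A.dual.tensor A) one (idPlays A) (evPlays A)))
  rw [plays_compPlays _ hT.subset, compPlays_eq]
  refine ⟨?_, (isStrat_plays _).subset hs⟩
  have hs' := (mem_idPlays.1 ((mem_plays _).1 hs)).project (f := Prod.snd) fun p x y h => by
    rcases h with h | h
    · exact h.1.elim
    · exact Or.inr h.2
  rw [← mem_idPlays, project_of_noStutter, List.map_map] at hs'
  swap
  · have hn := IsPlay.noStutter ((isStrat_id _).subset ((mem_plays _).1 hs))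
    refine hn.mono fun ⟨⟨_, a⟩, _, b⟩ ⟨⟨_, a'⟩, _, b'⟩ h e => h ?_
    obtain ⟨rfl, rfl⟩ := Prod.mk.inj e
    rfl
  obtain ⟨u, hu, ⟨h₁, h₂, h₃, h₄⟩, hl, hb⟩ := exists_chain_plays (V := (one.{u}.Pos × A.Pos) × A.Pos × one.{u}.Pos)
    (θ := fun w => ((PUnit.unit, w.1), (w.2, PUnit.unit)))
    (fun w w' h => by simpa [Prod.ext_iff] using h) hs'
  rw [List.map_map, List.map_id''] at hu
  swap
  · exact fun _ => rfl
  rw [← hu]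
  refine mem_compTr_of_list (f := fun w : Fin 5 → A.Pos => ((PUnit.unit : one.{u}.Pos), w 0))
    (g := fun w => ((w 3, w 2), w 1)) (h := fun w => (w 4, (PUnit.unit : one.{u}.Pos))) rfl rfl rfl ?_ ?_
  · refine (mem_tensorPlays_iff (A := one) (B := A) (A' := A.tensor A.dual) (B' := A)
      (a := fun _ => PUnit.unit) (b := fun w : Fin 5 → A.Pos => w 0) (a' := fun w => (w 3, w 2))
      (b' := fun w => w 1) rfl rfl rfl rfl).2 ⟨?_, ?_, h₁⟩
    · refine (isPlay_tensor_iff (A := one) (B := A) (A' := A.tensor A.dual) (B' := A)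
        (a := fun _ => PUnit.unit) (b := fun w : Fin 5 → A.Pos => w 0) (a' := fun w => (w 3, w 2))
        (b' := fun w => w 1) rfl rfl rfl rfl).2 ⟨?_, fun t ht => ?_⟩
      · refine hl.mono fun p q ⟨o, i, h⟩ => ?_
        have hr : one.{u}.OK PUnit.unit PUnit.unit := Or.inl rfl
        rw [step_iff, step_iff, ok_tensor_mk, ok_dual, Prod.mk.injEq]
        have o₀ := o 0; have o₁ := o 1; have o₂ := o 2; have o₃ := o 3
        clear * - hr h o₀ o₁ o₂ o₃
        fin_cases i <;> simp_all
      · obtain ⟨b, hb, h'⟩ := hb t ht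
        rw [bal_tensor, bal_one, bal_dual, hb, hb, hb, hb]
        · omega
        · refine (hl.prefix ht).mono fun p q ⟨o, i, h⟩ => ?_
          rw [step_iff, ok_dual]
          refine ⟨o _, o _, ?_⟩
          clear * - h
          fin_cases i <;> simp [h]
    · exact mem_coevPlays.2 h₃
  · rw [Set.mem_ofPred_eq, map_project _ _ (fun w w' h => by simpa [Prod.ext_iff] using h)]
    refine (mem_tensorPlays_iff (A := A) (A' := A) (B := A.dual.tensor A) (B' := one)
      (b' := fun _ => PUnit.unit) (a := fun w : Fin 5 → A.Pos => w 3) (a' := fun w => w 4)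
      (b := fun w => (w 2, w 1)) rfl rfl rfl rfl).2 ⟨?_, h₄, mem_evPlays.2 h₂⟩
    refine (isPlay_tensor_iff (A := A) (A' := A) (B := A.dual.tensor A) (B' := one)
      (b' := fun _ => PUnit.unit) (a := fun w : Fin 5 → A.Pos => w 3) (a' := fun w => w 4)
      (b := fun w => (w 2, w 1)) rfl rfl rfl rfl).2 ⟨?_, fun t ht => ?_⟩
    · refine hl.mono fun p q ⟨o, i, h⟩ => ?_
      have hr : one.{u}.OK PUnit.unit PUnit.unit := Or.inl rfl
      rw [step_iff, step_iff, ok_tensor_mk, ok_dual, Prod.mk.injEq]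
      have o₁ := o 1; have o₂ := o 2; have o₃ := o 3; have o₄ := o 4
      clear * - hr h o₁ o₂ o₃ o₄
      fin_cases i <;> simp_all
    · obtain ⟨b, hb, h'⟩ := hb t ht
      rw [bal_tensor, bal_one, bal_dual, hb, hb, hb, hb]
      · omega
      · refine (hl.prefix ht).mono fun p q ⟨o, i, h⟩ => ?_
        rw [step_iff, ok_dual]
        refine ⟨o _, o _, ?_⟩
        clear * - h
        fin_cases i <;> simp [h]

/-- The same chain, now in `A*`, with copies 1, 2, 3 as the factors of `A* ⊗ (A ⊗ A*)`. Copy 2 is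
the one that occurs undualised, hence the change of sign of its balance and the reversal of the
copycat plays on both sides of it. -/
theorem ev_coev (A : MBGame.{u}) :
    gameCat.comp (tensorHom (gameCat.id A.dual) (coevHom A)) (gameCat.comp
      (assoc A.dual A A.dual).symm.hom (tensorHom (evHom A) (gameCat.id A.dual))) =
    gameCat.comp (unitRight A.dual).hom (unitLeft A.dual).symm.hom := by
  rw [hom_trans]
  refine Hom.ext_set (eq_plays (Hom.isStrat _) _ fun s hs => ?_)
  have hT := (isStrat_ev A).tensor (isStrat_id A.dual)
  change s ∈ compPlays (A.dual.tensor one) (A.dual.tensor (A.tensor A.dual)) (one.tensor A.dual)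
    (tensorPlays A.dual A.dual one (A.tensor A.dual) (idPlays A.dual) (coevPlays A))
    (compPlays (A.dual.tensor (A.tensor A.dual)) ((A.dual.tensor A).tensor A.dual)
      (one.tensor A.dual) (assoc A.dual A A.dual).symm.plays
      (tensorPlays (A.dual.tensor A) one A.dual A.dual (evPlays A) (idPlays A.dual)))
  rw [plays_compPlays _ hT.subset, compPlays_eq]
  refine ⟨?_, (isStrat_plays _).subset hs⟩
  have hs' := (mem_idPlays.1 ((mem_plays _).1 hs)).project (f := Prod.fst) fun p x y h => by
    rcases h with h | h
    · exact Or.inr h.1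
    · exact h.2.elim
  rw [← mem_idPlays, project_of_noStutter, List.map_map] at hs'
  swap
  · have hn := IsPlay.noStutter ((isStrat_id _).subset ((mem_plays _).1 hs))
    refine hn.mono fun ⟨⟨a, _⟩, b, _⟩ ⟨⟨a', _⟩, b', _⟩ h e => h ?_
    obtain ⟨rfl, rfl⟩ := Prod.mk.inj e
    rfl
  obtain ⟨u, hu, ⟨h₁, h₂, h₃, h₄⟩, hl, hb⟩ := exists_chain_plays (A := A.dual)
    (V := (A.Pos × one.{u}.Pos) × one.{u}.Pos × A.Pos)
    (θ := fun w => ((w.1, PUnit.unit), (PUnit.unit, w.2)))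
    (fun w w' h => by simpa [Prod.ext_iff] using h) hs'
  rw [List.map_map, List.map_id''] at hu
  swap
  · exact fun _ => rfl
  rw [← hu]
  have hsw : ∀ f g : (Fin 5 → A.Pos) → A.Pos,
      project (fun w => (f w, g w)) (fun _ => A.root) u ∈ idPlays A.dual →
      project (fun w => (g w, f w)) (fun _ => A.root) u ∈ idPlays A := by
    intro f g h
    rw [mem_idPlays] at h ⊢
    rw [← isCC_swap, project_swap]
    exact h
  refine mem_compTr_of_list (f := fun w : Fin 5 → A.Pos => (w 0, (PUnit.unit : one.{u}.Pos)))
    (g := fun w => (w 1, (w 2, w 3))) (h := fun w => ((PUnit.unit : one.{u}.Pos), w 4))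
    rfl rfl rfl ?_ ?_
  · refine (mem_tensorPlays_iff (A := A.dual) (B := one) (A' := A.dual) (B' := A.tensor A.dual)
      (b := fun _ => PUnit.unit) (a := fun w : Fin 5 → A.Pos => w 0) (a' := fun w => w 1)
      (b' := fun w => (w 2, w 3)) rfl rfl rfl rfl).2 ⟨?_, h₁, mem_coevPlays.2 (hsw _ _ h₃)⟩
    refine (isPlay_tensor_iff (A := A.dual) (B := one) (A' := A.dual) (B' := A.tensor A.dual)
      (b := fun _ => PUnit.unit) (a := fun w : Fin 5 → A.Pos => w 0) (a' := fun w => w 1)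
      (b' := fun w => (w 2, w 3)) rfl rfl rfl rfl).2 ⟨?_, fun t ht => ?_⟩
    · refine hl.mono fun p q ⟨o, i, h⟩ => ?_
      have hr : one.{u}.OK PUnit.unit PUnit.unit := Or.inl rfl
      rw [step_iff, step_iff, ok_tensor_mk, Prod.mk.injEq]
      have o₀ := o 0; have o₁ := o 1; have o₂ := ok_dual.1 (o 2); have o₃ := o 3
      clear * - hr h o₀ o₁ o₂ o₃
      fin_cases i <;> simp_all
    · obtain ⟨b, hb, h'⟩ := hb t ht
      have hb₂ : A.bal (fun w : Fin 5 → A.Pos => w 2) (fun _ => A.root) t = - b 2 := by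
        rw [← hb 2, bal_dual, neg_neg]
      rw [bal_tensor, bal_one, hb, hb, hb, hb₂]
      · omega
      · refine (hl.prefix ht).mono fun p q ⟨o, i, h⟩ => ?_
        rw [step_iff]
        refine ⟨ok_dual.1 (o _), o _, ?_⟩
        clear * - h
        fin_cases i <;> simp [h]
  · rw [Set.mem_ofPred_eq, map_project _ _ (fun w w' h => by simpa [Prod.ext_iff] using h)]
    refine (mem_tensorPlays_iff (A := A.dual.tensor A) (A' := one) (B := A.dual) (B' := A.dual)
      (a' := fun _ => PUnit.unit) (b := fun w : Fin 5 → A.Pos => w 3) (b' := fun w => w 4)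
      (a := fun w => (w 1, w 2)) rfl rfl rfl rfl).2 ⟨?_, (mem_evPlays (A := A)
        (f := fun w : Fin 5 → A.Pos => w 1) (g := fun w => w 2)).2 (hsw _ _ h₂), h₄⟩
    refine (isPlay_tensor_iff (A := A.dual.tensor A) (A' := one) (B := A.dual) (B' := A.dual)
      (x := fun _ => A.root) (a' := fun _ => PUnit.unit) (b := fun w : Fin 5 → A.Pos => w 3) (b' := fun w => w 4)
      (a := fun w => (w 1, w 2)) rfl rfl rfl rfl).2 ⟨?_, fun t ht => ?_⟩
    · refine hl.mono fun p q ⟨o, i, h⟩ => ?_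
      have hr : one.{u}.OK PUnit.unit PUnit.unit := Or.inl rfl
      rw [step_iff, step_iff, ok_tensor_mk, Prod.mk.injEq]
      have o₁ := o 1; have o₂ := ok_dual.1 (o 2); have o₃ := o 3; have o₄ := o 4
      clear * - hr h o₁ o₂ o₃ o₄
      fin_cases i <;> simp_all
    · obtain ⟨b, hb, h'⟩ := hb t ht
      have hb₂ : A.bal (fun w : Fin 5 → A.Pos => w 2) (fun _ => A.root) t = - b 2 := by
        rw [← hb 2, bal_dual, neg_neg]
      rw [bal_tensor, bal_one, hb, hb, hb, hb₂]
      · omega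
      · refine (hl.prefix ht).mono fun p q ⟨o, i, h⟩ => ?_
        rw [step_iff]
        refine ⟨o _, ok_dual.1 (o _), ?_⟩
        clear * - h
        fin_cases i <;> simp [h]

end MBGame

theorem gameTensor_dual_dual (A : gameTensor.{u}.Obj) :
    gameTensor.dual (gameTensor.dual A) = A := MBGame.dual_dual A

theorem gameTensor_dual_tensor (A B : gameTensor.{u}.Obj) :
    gameTensor.dual (A ⊗ B) = gameTensor.dual A ⊗ gameTensor.dual B := MBGame.dual_tensor A B

/-- The dual of a game is a monoidal dual. -/
def gamePairing (A : gameTensor.{u}.Obj) : ExactPairing A (gameTensor.dual A) where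
  coevaluation' := MBGame.coevHom A
  evaluation' := MBGame.evHom A
  coevaluation_evaluation' := MBGame.ev_coev A
  evaluation_coevaluation' := MBGame.coev_ev A

/-! ### Commutative comonoids in a symmetric monoidal category -/

section CommutativeComonoids

open Functor.LaxMonoidal Limits

universe v₁ u₁

variable {C : Type u₁} [Category.{v₁} C] [MonoidalCategory C] [SymmetricCategory C]

namespace CategoryTheory

open ComonObj

/-- This compatibility makes the braiding of two comonoids preserve the comultiplications of their
tensor products. -/
theorem tensorμ_braiding (X Y : C) : (β_ (X ⊗ X) (Y ⊗ Y)).hom ≫ tensorμ Y Y X X =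
    tensorμ X X Y Y ≫ ((β_ X Y).hom ⊗ₘ (β_ X Y).hom) := by
  simp [tensorμ, SymmetricCategory.braiding_swap_eq_inv_braiding Y X]
  rw [MonoidalCategory.tensorHom_def]
  monoidal

theorem tensorμ_unit (X Y : C) : tensorμ X (𝟙_ C) (𝟙_ C) Y ≫ ((ρ_ X).hom ⊗ₘ (λ_ Y).hom) =
    ((ρ_ X).hom ⊗ₘ (λ_ Y).hom) := by
  have h : (β_ (𝟙_ C) (𝟙_ C)).hom = 𝟙 _ := by
    rw [← cancel_mono (λ_ (𝟙_ C)).hom, braiding_leftUnitor, unitors_equal, Category.id_comp]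
  simp only [tensorμ, h]
  monoidal

theorem comul_tensor_comul (X : C) [ComonObj X] : Δ[X] ≫ (Δ[X] ⊗ₘ Δ[X]) ≫ (α_ X X (X ⊗ X)).hom =
    Δ[X] ≫ X ◁ (Δ[X] ≫ Δ[X] ▷ X ≫ (α_ X X X).hom) := by
  rw [← ComonObj.comul_assoc, whiskerLeft_comp, ComonObj.comul_assoc_assoc,
    MonoidalCategory.tensorHom_def]
  simp

/-- After coassociativity, the exchange that enters the comultiplication of `X ⊗ X` acts on two
middle factors that come from one comultiplication, and commutativity absorbs it. The
comultiplication is thus a morphism of comonoids and can serve as a diagonal. -/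
theorem comul_comul_comm (X : C) [ComonObj X] [IsCommComonObj X] :
    Δ[X] ≫ Δ[X ⊗ X] = Δ[X] ≫ (Δ[X] ⊗ₘ Δ[X]) := by
  have key := comul_tensor_comul X
  rw [Comon.tensorObj_comul, tensorμ, ← cancel_mono (α_ X X (X ⊗ X)).hom]
  simp only [Category.assoc, Iso.inv_hom_id, Category.comp_id]
  rw [key, reassoc_of% key, ← whiskerLeft_comp, ← whiskerLeft_comp, ← whiskerLeft_comp]
  simp only [Category.assoc, Iso.hom_inv_id_assoc, ← comp_whiskerRight_assoc,
    IsCommComonObj.comul_comm]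

theorem comul_projections (X Y : C) [ComonObj X] [ComonObj Y] :
    Δ[X ⊗ Y] ≫ (X ◁ ε[Y] ≫ (ρ_ X).hom ⊗ₘ ε[X] ▷ Y ≫ (λ_ Y).hom) = 𝟙 _ := by
  rw [Comon.tensorObj_comul, ← tensorHom_comp_tensorHom, ← id_tensorHom, ← tensorHom_id,
    Category.assoc, ← tensorμ_natural_assoc, tensorμ_unit]
  simp [tensorHom_comp_tensorHom]

theorem comul_fst {K A B : C} [ComonObj K] [ComonObj B] (f : K ⟶ A) (g : K ⟶ B)
    (hg : g ≫ ε[B] = ε[K]) : (Δ[K] ≫ (f ⊗ₘ g)) ≫ A ◁ ε[B] ≫ (ρ_ A).hom = f := by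
  rw [← id_tensorHom, Category.assoc, tensorHom_comp_tensorHom_assoc, hg]
  simp

theorem comul_snd {K A B : C} [ComonObj K] [ComonObj A] (f : K ⟶ A) (g : K ⟶ B)
    (hf : f ≫ ε[A] = ε[K]) : (Δ[K] ≫ (f ⊗ₘ g)) ≫ ε[A] ▷ B ≫ (λ_ B).hom = g := by
  rw [← tensorHom_id, Category.assoc, tensorHom_comp_tensorHom_assoc, hf]
  simp

/-- Comultiplying `A ⊗ B` and then discarding one factor in each of the two copies is the identity,
so a map that preserves the comultiplications is recovered from its two components. This gives
uniqueness of pairings. -/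
theorem eq_comul_projections {K A B : C} [ComonObj K] [ComonObj A] [ComonObj B] (m : K ⟶ A ⊗ B)
    (hm : m ≫ Δ[A ⊗ B] = Δ[K] ≫ (m ⊗ₘ m)) :
    m = Δ[K] ≫ (m ≫ A ◁ ε[B] ≫ (ρ_ A).hom ⊗ₘ m ≫ ε[A] ▷ B ≫ (λ_ B).hom) := by
  rw [← tensorHom_comp_tensorHom, ← reassoc_of% hm, comul_projections, Category.comp_id]

end CategoryTheory

namespace CategoryTheory.CommComon

attribute [local instance] ComonObj.instTensorUnit

open ComonObj

/-- The tensor product of commutative comonoids. -/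
def prod (A B : CommComon C) : CommComon C := mk (A.X ⊗ B.X)

/-- A morphism of the underlying objects that preserves the comonoid structures. -/
def homMk {A B : CommComon C} (f : A.X ⟶ B.X) (h : IsComonHom f) : A ⟶ B :=
  ⟨@Comon.Hom.mk _ _ _ A.toComon B.toComon f h⟩

instance monoidalStruct : MonoidalCategoryStruct (CommComon C) where
  tensorObj := prod
  tensorUnit := trivial C
  tensorHom f g := ⟨f.hom ⊗ₘ g.hom⟩
  whiskerLeft A _ _ f := ⟨A.toComon ◁ f.hom⟩
  whiskerRight f B := ⟨f.hom ▷ B.toComon⟩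
  associator A B D := InducedCategory.isoMk (α_ A.toComon B.toComon D.toComon)
  leftUnitor A := InducedCategory.isoMk (λ_ A.toComon)
  rightUnitor A := InducedCategory.isoMk (ρ_ A.toComon)

theorem associator_hom (A B D : CommComon C) : (α_ A B D).hom.hom.hom = (α_ A.X B.X D.X).hom :=
  (Comon.monoidal_associator_hom_hom C A.toComon B.toComon D.toComon).trans (by
    exact (show 𝟙 (A.X ⊗ B.X) ▷ D.X ≫ (α_ A.X B.X D.X).hom ≫ A.X ◁ 𝟙 (B.X ⊗ D.X) =
      (α_ A.X B.X D.X).hom by simp))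

theorem leftUnitor_hom (A : CommComon C) : (λ_ A).hom.hom.hom = (λ_ A.X).hom :=
  (Comon.monoidal_leftUnitor_hom_hom C A.toComon).trans
    (show 𝟙 (𝟙_ C) ▷ A.X ≫ (λ_ A.X).hom = (λ_ A.X).hom by simp)

theorem rightUnitor_hom (A : CommComon C) : (ρ_ A).hom.hom.hom = (ρ_ A.X).hom :=
  (Comon.monoidal_rightUnitor_hom_hom C A.toComon).trans
    (show A.X ◁ 𝟙 (𝟙_ C) ≫ (ρ_ A.X).hom = (ρ_ A.X).hom by simp)

instance : (forget₂Comon C).Faithful := inferInstanceAs (inducedFunctor _).Faithful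

instance : (forgetCommComon C).Faithful :=
  inferInstanceAs (forget₂Comon C ⋙ Comon.forget C).Faithful

/-- The forgetful functor preserves the monoidal structure strictly. -/
def inducing : Monoidal.InducingFunctorData (forgetCommComon C) where
  μIso _ _ := Iso.refl _
  εIso := Iso.refl _
  whiskerLeft_eq A _ _ f := (show A.X ◁ f.hom.hom = 𝟙 _ ≫ A.X ◁ f.hom.hom ≫ 𝟙 _ by simp)
  whiskerRight_eq f B := (show f.hom.hom ▷ B.X = 𝟙 _ ≫ f.hom.hom ▷ B.X ≫ 𝟙 _ by simp)
  tensorHom_eq f g := (show (f.hom.hom ⊗ₘ g.hom.hom) = 𝟙 _ ≫ (f.hom.hom ⊗ₘ g.hom.hom) ≫ 𝟙 _ by simp)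
  associator_eq A B D := by
    refine (associator_hom A B D).trans ?_
    exact (show (α_ A.X B.X D.X).hom = (𝟙 _ ≫ (𝟙 _ ⊗ₘ 𝟙 _)) ≫
      (α_ A.X B.X D.X).hom ≫ (𝟙 _ ⊗ₘ 𝟙 _) ≫ 𝟙 _ by simp)
  leftUnitor_eq A := (leftUnitor_hom A).trans
    (show (λ_ A.X).hom = (𝟙 _ ≫ (𝟙 _ ⊗ₘ 𝟙 _)) ≫ (λ_ A.X).hom by simp)
  rightUnitor_eq A := (rightUnitor_hom A).trans
    (show (ρ_ A.X).hom = (𝟙 _ ≫ (𝟙 _ ⊗ₘ 𝟙 _)) ≫ (ρ_ A.X).hom by simp)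

/-- The axioms are reflected by the faithful forgetful functor to `C`, which carries the structural
morphisms to those of `C`. -/
instance monoidal : MonoidalCategory (CommComon C) :=
  Monoidal.induced (forgetCommComon C) inducing

instance forgetMonoidal : (forgetCommComon C).Monoidal :=
  Monoidal.fromInducedMonoidal (forgetCommComon C) inducing

theorem isComonHom_braiding (A B : CommComon C) :
    IsComonHom (M := (A.prod B).X) (N := (B.prod A).X) (β_ A.X B.X).hom where
  hom_counit := show (β_ A.X B.X).hom ≫ ((ε[B.X] ⊗ₘ ε[A.X]) ≫ (λ_ _).hom) =
      (ε[A.X] ⊗ₘ ε[B.X]) ≫ (λ_ _).hom by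
    rw [← BraidedCategory.braiding_naturality_assoc, braiding_leftUnitor, unitors_equal]
  hom_comul := show (β_ A.X B.X).hom ≫ Δ[B.X ⊗ A.X] =
      Δ[A.X ⊗ B.X] ≫ ((β_ A.X B.X).hom ⊗ₘ (β_ A.X B.X).hom) by
    rw [Comon.tensorObj_comul, Comon.tensorObj_comul, Category.assoc, ← tensorμ_braiding,
      BraidedCategory.braiding_naturality_assoc]

/-- The braiding of commutative comonoids. -/
def braidingIso (A B : CommComon C) : A ⊗ B ≅ B ⊗ A where
  hom := homMk (A := A.prod B) (B := B.prod A) (β_ A.X B.X).hom (isComonHom_braiding A B)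
  inv := homMk (A := B.prod A) (B := A.prod B) (β_ B.X A.X).hom (isComonHom_braiding B A)
  hom_inv_id := hom_ext _ _ (SymmetricCategory.symmetry _ _)
  inv_hom_id := hom_ext _ _ (SymmetricCategory.symmetry _ _)

instance braided : BraidedCategory (CommComon C) :=
  BraidedCategory.ofFaithful (forgetCommComon C) braidingIso fun A B => show 𝟙 (A.X ⊗ B.X) ≫ (β_ A.X B.X).hom = (β_ A.X B.X).hom ≫ 𝟙 _ by simp

instance forgetBraided : (forgetCommComon C).Braided where
  braided A B := show 𝟙 (A.X ⊗ B.X) ≫ (β_ A.X B.X).hom = (β_ A.X B.X).hom ≫ 𝟙 _ by simp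

theorem isComonHom_counit (A : CommComon C) :
    IsComonHom (M := A.X) (N := (trivial C).X) ε[A.X] where
  hom_counit := show ε[A.X] ≫ 𝟙 _ = ε[A.X] by simp
  hom_comul := show ε[A.X] ≫ (λ_ _).inv = Δ[A.X] ≫ (ε[A.X] ⊗ₘ ε[A.X]) by
    rw [ComonObj.counit_comul_hom]

theorem isComonHom_comul (A : CommComon C) :
    IsComonHom (M := A.X) (N := (A.prod A).X) Δ[A.X] where
  hom_counit := show Δ[A.X] ≫ (ε[A.X] ⊗ₘ ε[A.X]) ≫ (λ_ _).hom = ε[A.X] by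
    rw [ComonObj.counit_comul_hom_assoc, Iso.inv_hom_id, Category.comp_id]
  hom_comul := show Δ[A.X] ≫ Δ[A.X ⊗ A.X] = Δ[A.X] ≫ (Δ[A.X] ⊗ₘ Δ[A.X]) from
    comul_comul_comm A.X

/-- The counit, as the morphism to the terminal comonoid. -/
def toUnit (A : CommComon C) : A ⟶ trivial C := homMk (B := trivial C) ε[A.X] (isComonHom_counit A)

theorem eq_toUnit {A : CommComon C} (f : A ⟶ trivial C) : f = toUnit A := by
  refine hom_ext _ _ ?_
  exact (Category.comp_id _).symm.trans f.hom.isComonHom_hom.hom_counit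

/-- The pairing of two morphisms of commutative comonoids. -/
def pair {K A B : CommComon C} (f : K ⟶ A) (g : K ⟶ B) : K ⟶ A ⊗ B :=
  homMk (A := K) (B := K.prod K) Δ[K.X] (isComonHom_comul K) ≫ (f ⊗ₘ g)

theorem pair_fst {K A B : CommComon C} (f : K ⟶ A) (g : K ⟶ B) :
    pair f g ≫ A ◁ toUnit B ≫ (ρ_ A).hom = f := by
  refine hom_ext _ _ ?_
  have hg : g.hom.hom ≫ ε[B.X] = ε[K.X] := g.hom.isComonHom_hom.hom_counit
  change (Δ[K.X] ≫ (f.hom.hom ⊗ₘ g.hom.hom)) ≫ A.X ◁ ε[B.X] ≫ (ρ_ A).hom.hom.hom = f.hom.hom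
  rw [rightUnitor_hom]
  exact comul_fst _ _ hg

theorem pair_snd {K A B : CommComon C} (f : K ⟶ A) (g : K ⟶ B) :
    pair f g ≫ toUnit A ▷ B ≫ (λ_ B).hom = g := by
  refine hom_ext _ _ ?_
  have hf : f.hom.hom ≫ ε[A.X] = ε[K.X] := f.hom.isComonHom_hom.hom_counit
  change (Δ[K.X] ≫ (f.hom.hom ⊗ₘ g.hom.hom)) ≫ ε[A.X] ▷ B.X ≫ (λ_ B).hom.hom.hom = g.hom.hom
  rw [leftUnitor_hom]
  exact comul_snd _ _ hf

theorem eq_pair {K A B : CommComon C} (m : K ⟶ A ⊗ B) :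
    m = pair (m ≫ A ◁ toUnit B ≫ (ρ_ A).hom) (m ≫ toUnit A ▷ B ≫ (λ_ B).hom) := by
  refine hom_ext _ _ ?_
  have hm : m.hom.hom ≫ Δ[A.X ⊗ B.X] = Δ[K.X] ≫ (m.hom.hom ⊗ₘ m.hom.hom) :=
    m.hom.isComonHom_hom.hom_comul
  change m.hom.hom = Δ[K.X] ≫ (m.hom.hom ≫ A.X ◁ ε[B.X] ≫ (ρ_ A).hom.hom.hom ⊗ₘ
    m.hom.hom ≫ ε[A.X] ▷ B.X ≫ (λ_ B).hom.hom.hom)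
  rw [rightUnitor_hom, leftUnitor_hom]
  exact eq_comul_projections _ hm

/-- The category of commutative comonoids is cartesian. -/
def cartesian : CartesianMonoidalCategory (CommComon C) where
  toMonoidalCategory := monoidal
  isTerminalTensorUnit := IsTerminal.ofUniqueHom toUnit fun _ f => eq_toUnit f
  fst A B := A ◁ toUnit B ≫ (ρ_ A).hom
  snd A B := toUnit A ▷ B ≫ (λ_ B).hom
  fst_def _ _ := rfl
  snd_def _ _ := rfl
  tensorProductIsBinaryProduct A B := BinaryFan.isLimitMk
    (fun s => pair (B := B) s.fst s.snd)
    (fun s => pair_fst (A := A) (B := B) _ _)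
    (fun s => pair_snd (A := A) (B := B) _ _)
    (fun s m h₁ h₂ => (eq_pair (A := A) (B := B) m).trans (by rw [← h₁, ← h₂]))

/-- A choice of free commutative comonoids is a right adjoint of the forgetful functor. -/
noncomputable def freeAdjunction (F : C → CommComon C) (e : ∀ A, (F A).X ⟶ A)
    (h : ∀ A, IsFreeCommComonoid (F A) (e A)) :
    Σ' (G : C ⥤ CommComon C) (adj : forgetCommComon C ⊣ G), ∀ A, ∃ i : G.obj A ≅ F A,
      (forgetCommComon C).map i.hom ≫ e A = adj.counit.app A :=
  let eq (K : CommComon C) (A : C) : (K.X ⟶ A) ≃ (K ⟶ F A) :=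
    (Equiv.ofBijective (fun g : K ⟶ F A => g.hom.hom ≫ e A)
      ⟨fun g g' h' => (h A K _).unique h' rfl, fun f => (h A K f).exists⟩).symm
  have nat (K' K : CommComon C) (A : C) (f : K' ⟶ K) (g : K.X ⟶ A) :
      eq K' A (f.hom.hom ≫ g) = f ≫ eq K A g := by
    refine (Equiv.symm_apply_eq _).2 ?_
    have : (eq K A g).hom.hom ≫ e A = g := (eq K A).symm_apply_apply g
    conv_lhs => rw [← this]
    exact (Category.assoc _ _ _).symm
  ⟨_, Adjunction.adjunctionOfEquivRight (F := forgetCommComon C) (G_obj := F) eq nat, fun A =>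
    ⟨Iso.refl _, rfl⟩⟩

end CategoryTheory.CommComon

/-! ### Compact closed categories with involutive duality are *-autonomous -/

namespace CategoryTheory

variable [RightRigidCategory C]

/-- Morphisms to a dual are pairings. -/
def dualEquiv (X D : C) : (X ⟶ Dᘁ) ≃ (X ⊗ D ⟶ 𝟙_ C) :=
  (λ_ Dᘁ).symm.homToEquiv.trans (tensorRightHomEquiv X D Dᘁ (𝟙_ C)).symm

theorem dualEquiv_apply {X D : C} (g : X ⟶ Dᘁ) : dualEquiv X D g = g ▷ D ≫ ε_ D Dᘁ := by
  rw [dualEquiv, Equiv.trans_apply, Equiv.symm_apply_eq,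
    tensorRightHomEquiv_whiskerRight_comp_evaluation]
  rfl

theorem dualEquiv_natural {X X' D D' : C} (f : X' ⟶ X) (h : D' ⟶ D) (g : X ⟶ Dᘁ) :
    dualEquiv X' D' (f ≫ g ≫ hᘁ) = (f ⊗ₘ h) ≫ dualEquiv X D g := by
  rw [dualEquiv_apply, dualEquiv_apply, comp_whiskerRight_assoc, comp_whiskerRight_assoc,
    rightAdjointMate_comp_evaluation, MonoidalCategory.tensorHom_def, Category.assoc,
    whisker_exchange_assoc]

/-- Duality as a contravariant functor. -/
def dualFunctor : Cᵒᵖ ⥤ C where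
  obj A := A.unopᘁ
  map f := f.unopᘁ
  map_id _ := rightAdjointMate_id
  map_comp f g := comp_rightAdjointMate

/-- Currying of morphisms to a dual. -/
def dualCurry (A B D : C) : (A ⊗ B ⟶ Dᘁ) ≃ (A ⟶ (B ⊗ D)ᘁ) :=
  (dualEquiv (A ⊗ B) D).trans
    ((α_ A B D).homFromEquiv.trans (dualEquiv A (B ⊗ D)).symm)

/-- Both sides are compared as pairings with values in the unit, where currying is reassociation and
its naturality that of the associator. -/
theorem dualCurry_natural {A A' B B' D D' : C} (f : A' ⟶ A) (g : B' ⟶ B) (h : D' ⟶ D)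
    (k : A ⊗ B ⟶ Dᘁ) :
    dualCurry A' B' D' ((f ⊗ₘ g) ≫ k ≫ hᘁ) = f ≫ dualCurry A B D k ≫ (g ⊗ₘ h)ᘁ := by
  have e : dualEquiv A (B ⊗ D) (dualCurry A B D k) = (α_ A B D).inv ≫ dualEquiv (A ⊗ B) D k :=
    Equiv.apply_symm_apply _ _
  change (dualEquiv A' (B' ⊗ D')).symm _ = _
  rw [Equiv.symm_apply_eq, dualEquiv_natural, dualEquiv_natural, e]
  change (α_ A' B' D').inv ≫ _ = _
  rw [associator_inv_naturality_assoc]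

/-- Morphisms as pairings with the dual of their target. -/
def dualMateEquiv (X Y : C) : (X ⟶ Y) ≃ (Yᘁ ⊗ X ⟶ 𝟙_ C) :=
  (ρ_ Y).symm.homToEquiv.trans (tensorLeftHomEquiv X Y Yᘁ (𝟙_ C)).symm

/-- Seen as pairings, `f` and its mate coincide. Passing to the mate is thus a composite of two
bijections, which makes the duality functor full and faithful. -/
theorem dualEquiv_mate {X Y : C} (f : X ⟶ Y) : dualEquiv Yᘁ X (fᘁ) = dualMateEquiv X Y f := by
  rw [dualEquiv_apply, rightAdjointMate_comp_evaluation, dualMateEquiv, Equiv.trans_apply,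
    Equiv.eq_symm_apply]
  exact tensorLeftHomEquiv_whiskerLeft_comp_evaluation (Z := Yᘁ) f

instance : (dualFunctor (C := C)).Faithful where
  map_injective {A B} f g h := Quiver.Hom.unop_inj <| (dualMateEquiv _ _).injective <| by
    rw [← dualEquiv_mate, ← dualEquiv_mate]
    exact congrArg _ h

instance : (dualFunctor (C := C)).Full where
  map_surjective {A B} k := ⟨((dualMateEquiv _ _).symm (dualEquiv _ _ k)).op,
    (dualEquiv _ _).injective <| (dualEquiv_mate _).trans <| Equiv.apply_symm_apply _ _⟩

/-- A compact closed category in which duality is involutive on objects is *-autonomous. -/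
def starAutonomous (h : ∀ A : C, ∃ B : C, Nonempty (Bᘁ ≅ A)) : StarAutonomous C where
  star := dualFunctor
  isEquivalence := { essSurj := ⟨fun A => ⟨.op (h A).choose, (h A).choose_spec⟩⟩ }
  curry := dualCurry
  curry_natural := dualCurry_natural

end CategoryTheory

end CommutativeComonoids

/-- Free commutative comonoids in a compact closed category whose duality is involutive on objects
make it a model of linear logic. -/
theorem exists_mellModel {C : Type*} [Category* C] [MonoidalCategory C] [SymmetricCategory C]
    (d : C → C) (p : ∀ A, ExactPairing A (d A)) (hd : ∀ A, d (d A) = A) (F : C → CommComon C)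
    (e : ∀ A, (F A).X ⟶ A) (h : ∀ A, IsFreeCommComonoid (F A) (e A)) :
    ∃ L : MELLModel (forgetCommComon C), (∀ A : C, L.star.obj (.op A) = d A) ∧
      ∀ A : C, ∃ i : L.F.obj A ≅ F A,
        (forgetCommComon C).map i.hom ≫ e A = L.adj.counit.app A := by
  let _ : RightRigidCategory C := { rightDual := fun A => { rightDual := d A, exact := p A } }
  obtain ⟨G, adj, hG⟩ := CommComon.freeAdjunction F e h
  -- Every object is equal to its double dual, hence is the dual of its dual: this gives essential
  -- surjectivity of the duality.
  exact ⟨{  toStarAutonomous := starAutonomous fun A => ⟨d A, ⟨show d (d A) ≅ A from eqToIso (hd A)⟩⟩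
            cartesian := CommComon.cartesian
            braided := CommComon.braided
            symmetricMonoidal := CommComon.forgetBraided
            F := G
            adj := adj }, fun A => rfl, hG⟩

/-! ## Families of copies of a game -/

namespace MBGame

open ConwayGame

/-- A presentation of the positions of a game as families of positions of `A`, where every move is
a move of `A` in one member of the family, together with a set of admissible moves, in which the
members of the family are opened by Opponent. -/
structure Family (A : MBGame.{u}) where
  game : MBGame.{u}
  I : Type
  lt : I → game.Pos → A.Pos
  root : ∀ i, lt i game.root = A.root
  ext : ∀ {x y}, (∀ i, lt i x = lt i y) → x = y
  move : ∀ {p x y}, game.Move p x y →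
    ∃ i, A.Move p (lt i x) (lt i y) ∧ ∀ j, j ≠ i → lt j y = lt j x
  fresh : ∀ {p x s}, Along game.Edge x s →
    (game.Fresh p x s ↔ ∃ i, A.Fresh p (lt i x) (project (lt i) x s))
  step : game.Pos → game.Pos → Prop
  step_edge : ∀ {x y}, step x y → game.Edge x y
  opp : ∀ {x y i}, step x y → lt i x = A.root → lt i y ≠ A.root → A.Move (-1) A.root (lt i y)

namespace Family

variable {A : MBGame.{u}}

/-- The admissible paths from the root. -/
def adm (Y : Family A) (s : List Y.game.Pos) : Prop := Along Y.step Y.game.root s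

/-- The game `A` as a family with one member. -/
abbrev self (A : MBGame.{u}) : Family A where
  game := A
  I := Unit
  lt _ x := x
  root _ := rfl
  ext h := h ()
  move h := ⟨(), h, fun _ h => (h rfl).elim⟩
  fresh {p x s} h := by
    rw [project_id_of_noStutter (h.mono fun _ _ => Edge.ne)]
    exact ⟨fun h => ⟨(), h⟩, fun ⟨_, h⟩ => h⟩
  step x y := A.Edge x y ∧ (x = A.root → A.Move (-1) x y)
  step_edge h := h.1
  opp h h₁ _ := h₁ ▸ h.2 h₁

/-- The unit game as the empty family. -/
abbrev unit (A : MBGame.{u}) : Family A where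
  game := one
  I := Empty
  lt i := i.elim
  root i := i.elim
  ext _ := rfl
  move h := h.elim
  fresh _ := ⟨fun h => (GameIso.not_fresh_one h).elim, fun ⟨i, _⟩ => i.elim⟩
  step _ _ := False
  step_edge h := h.elim
  opp h := h.elim

/-- The disjoint union of two families. -/
abbrev tensor (Y X : Family A) : Family A where
  game := Y.game.tensor X.game
  I := Y.I ⊕ X.I
  lt i x := i.elim (fun i => Y.lt i x.1) (fun j => X.lt j x.2)
  root i := by
    cases i
    exacts [Y.root _, X.root _]
  ext h := Prod.ext (Y.ext fun i => h (.inl i)) (X.ext fun j => h (.inr j))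
  move := by
    rintro p x y (⟨h, e⟩ | ⟨e, h⟩)
    · obtain ⟨i, h, h'⟩ := Y.move h
      refine ⟨.inl i, h, ?_⟩
      rintro (j | j) hj
      · exact h' j fun e => hj (congrArg _ e)
      · exact congrArg (X.lt j) e.symm
    · obtain ⟨i, h, h'⟩ := X.move h
      refine ⟨.inr i, h, ?_⟩
      rintro (j | j) hj
      · exact congrArg (Y.lt j) e.symm
      · exact h' j fun e => hj (congrArg _ e)
  fresh {p x s} h := by
    rw [GameIso.fresh_tensor_of_along h, Y.fresh (GameIso.along_fst_of_edge h), X.fresh (GameIso.along_snd_of_edge h)]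
    have e₁ := fun i => project_project Prod.fst (Y.lt i) x s
    have e₂ := fun i => project_project Prod.snd (X.lt i) x s
    simp only [e₁, e₂]
    constructor
    · rintro (⟨i, h⟩ | ⟨i, h⟩)
      exacts [⟨.inl i, h⟩, ⟨.inr i, h⟩]
    · rintro ⟨i | i, h⟩
      exacts [.inl ⟨i, h⟩, .inr ⟨i, h⟩]
  step x y := (Y.step x.1 y.1 ∧ y.2 = x.2) ∨ (X.step x.2 y.2 ∧ y.1 = x.1)
  step_edge h := edge_tensor.2 (h.imp (fun h => ⟨Y.step_edge h.1, h.2.symm⟩)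
    fun h => ⟨h.2.symm, X.step_edge h.1⟩)
  opp {x y i} h h₁ h₂ := by
    cases i with
    | inl i =>
      rcases h with h | h
      · exact Y.opp h.1 h₁ h₂
      · exact (h₂ ((congrArg (Y.lt i) h.2).trans h₁)).elim
    | inr i =>
      rcases h with h | h
      · exact (h₂ ((congrArg (X.lt i) h.2).trans h₁)).elim
      · exact X.opp h.1 h₁ h₂

theorem bang_fresh {A : MBGame.{u}} {p : ℤˣ} {x : A.bang.Pos} {s : List A.bang.Pos}
    (h : Along A.bang.Edge x s) :
    A.bang.Fresh p x s ↔ ∃ i, A.Fresh p (A.letter i x) (project (A.letter i) x s) := by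
  have key : ∀ i r r', A.bang.pathRes x s (i, r) r' ↔ ∃ r₁, r' = (i, r₁) ∧
      A.pathRes (A.letter i x) (project (A.letter i) x s) r r₁ := fun i r r' =>
    pathResidual_project A A.bangConway _ _ (A.letter i) (Prod.mk i)
      (fun _ _ _ => bangIsQuery_iff) (fun x y h r r' => by
        constructor
        · obtain ⟨j, r'⟩ := r'
          rintro ⟨-, e, h'⟩
          dsimp only at e
          subst e
          exact ⟨r', rfl, h'⟩
        · rintro ⟨r₁, rfl, h'⟩
          exact ⟨h, rfl, h'⟩) x s (isPath_iff.2 h) r r'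
  constructor
  · rintro ⟨⟨i, r⟩, h₁, h₂⟩
    refine ⟨i, r, ?_, fun ⟨r₀, h₀⟩ => h₂ ⟨(i, r₀), (key _ _ _).2 ⟨r, rfl, h₀⟩⟩⟩
    rw [getLastD_project]
    exact h₁.2
  · rintro ⟨i, r, h₁, h₂⟩
    rw [getLastD_project] at h₁
    refine ⟨(i, r), bangIsQuery_iff.2 h₁, fun ⟨⟨j, r₀⟩, h₀⟩ => ?_⟩
    obtain ⟨r₁, e, h₀⟩ := (key _ _ _).1 h₀
    cases e
    exact h₂ ⟨r₀, h₀⟩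

theorem letter_of_getElem {A : MBGame.{u}} {i : ℕ} {w : A.BangPos} (h : i < w.length) :
    A.letter i w = (w[i]).1 := by
  simp [letter, h]

theorem letter_ne_root_iff {A : MBGame.{u}} {i : ℕ} {w : A.BangPos} :
    A.letter i w ≠ A.root ↔ i < w.length := by
  refine ⟨fun h => ?_, fun h => ?_⟩
  · by_contra h'
    exact h (letter_of_le (not_lt.1 h'))
  · rw [letter_of_getElem h]
    exact (w[i]).2

/-- The length of a word can be read off its letters, as the indices below it are exactly those at
which the letter is not the root. -/
theorem letter_ext {A : MBGame.{u}} {w v : A.BangPos} (h : ∀ i, A.letter i w = A.letter i v) :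
    w = v := by
  have hl : ∀ i, i < w.length ↔ i < v.length := fun i => by
    rw [← letter_ne_root_iff, ← letter_ne_root_iff, h]
  have hl' : w.length = v.length := le_antisymm
    (not_lt.1 fun h => (lt_irrefl _ ((hl _).1 h))) (not_lt.1 fun h => (lt_irrefl _ ((hl _).2 h)))
  refine List.ext_getElem hl' fun i h₁ h₂ => Subtype.ext ?_
  rw [← letter_of_getElem h₁, ← letter_of_getElem h₂, h]

/-- A move inside an open copy neither leaves nor reaches the root, so a letter leaves the root only
when Opponent opens a copy, at the end of the word. The index of the new copy is determined by the
current position; the uniqueness of canonical relations from `!A` rests on this. -/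
theorem bang_open {A : MBGame.{u}} {p : ℤˣ} {x y : A.BangPos} (h : A.bang.Move p x y) {i : ℕ}
    (hx : A.letter i x = A.root) (hy : A.letter i y ≠ A.root) :
    i = x.length ∧ p = -1 ∧ A.Move (-1) A.root (A.letter i y) := by
  cases h with
  | play w₁ w₂ a b h =>
    have h₁ := letter_ne_root_iff.1 hy
    exact (letter_ne_root_iff.2 (by simpa using h₁) hx).elim
  | openCopy _ a h =>
    have h₁ := letter_ne_root_iff.1 hy
    have h₂ : ¬ i < x.length := fun h => letter_ne_root_iff.2 h hx
    obtain rfl : i = x.length := by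
      simp at h₁
      omega
    refine ⟨rfl, rfl, ?_⟩
    rwa [letter_middle]

/-- The exponential game as a family; all its paths are admissible. -/
abbrev bang (A : MBGame.{u}) : Family A where
  game := A.bang
  I := ℕ
  lt := A.letter
  root i := letter_of_le (by simp)
  ext := letter_ext
  move h := by
    obtain ⟨i, -, -, h, h'⟩ := BangMove.exists_copy h
    exact ⟨i, h, fun j hj => (h' j hj).symm⟩
  fresh := bang_fresh
  step := A.bang.Edge
  step_edge h := h
  opp {x y i} h h₁ h₂ := by
    obtain ⟨p, hp⟩ := h
    exact (bang_open hp h₁ h₂).2.2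

/-! ### Matchings -/

variable {Y X Z : Family A}

/-- The members of two families are matched by a relation of their indices. -/
def Matched (Y X : Family A) (b : Y.I → X.I → Prop) (p : Y.game.Pos × X.game.Pos) : Prop :=
  (∀ i j, b i j → Y.lt i p.1 = X.lt j p.2) ∧ (∀ i, Y.lt i p.1 ≠ A.root → ∃ j, b i j) ∧
    ∀ j, X.lt j p.2 ≠ A.root → ∃ i, b i j

/-- All positions of a path are matched by the same partial bijection. -/
structure MatchedBy (Y X : Family A) (b : Y.I → X.I → Prop) (s : List (Y.game.Pos × X.game.Pos)) :
    Prop where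
  inj : ∀ {i i' j}, b i j → b i' j → i = i'
  func : ∀ {i j j'}, b i j → b i j' → j = j'
  matched : ∀ p ∈ s, Matched Y X b p

theorem matched_root (b : Y.I → X.I → Prop) : Matched Y X b (Y.game.root, X.game.root) :=
  ⟨fun i j _ => (Y.root i).trans (X.root j).symm, fun i h => (h (Y.root i)).elim,
    fun j h => (h (X.root j)).elim⟩

theorem MatchedBy.last {b : Y.I → X.I → Prop} {s t : List (Y.game.Pos × X.game.Pos)}
    (h : MatchedBy Y X b (s ++ t)) :
    Matched Y X b (s.getLastD (Y.game.root, X.game.root)) := by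
  rcases List.eq_nil_or_concat s with rfl | ⟨s, z, rfl⟩
  · exact matched_root b
  · simpa using h.matched z (by simp)

theorem MatchedBy.left {b : Y.I → X.I → Prop} {s t : List (Y.game.Pos × X.game.Pos)}
    (h : MatchedBy Y X b (s ++ t)) : MatchedBy Y X b s :=
  ⟨h.inj, h.func, fun p hp => h.matched p (List.mem_append_left _ hp)⟩

theorem Matched.symm {b : Y.I → X.I → Prop} {p : Y.game.Pos × X.game.Pos} (h : Matched Y X b p) :
    Matched X Y (fun j i => b i j) (p.2, p.1) :=
  ⟨fun j i h' => (h.1 i j h').symm, h.2.2, h.2.1⟩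

/-- A fresh query lives in one member. If that member were unmatched it would stay at the root, and
an empty path initiates nothing; so it has a partner, and the two members follow the same path of
`A`. -/
theorem fresh_of_matched {b : Y.I → X.I → Prop} {p : Y.game.Pos × X.game.Pos}
    {t : List (Y.game.Pos × X.game.Pos)} (hp : Matched Y X b p) (ht : ∀ q ∈ t, Matched Y X b q)
    (ha : Along (SyncStep Y.game X.game) p t) {q : ℤˣ}
    (h : Y.game.Fresh q p.1 (t.map Prod.fst)) : X.game.Fresh q p.2 (t.map Prod.snd) := by
  have a₁ : Along Y.game.Edge p.1 (t.map Prod.fst) :=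
    (along_map Prod.fst p t).2 (ha.mono fun p q h => h.imp fun _ h => h.1)
  have a₂ : Along X.game.Edge p.2 (t.map Prod.snd) :=
    (along_map Prod.snd p t).2 (ha.mono fun p q h => h.imp fun _ h => h.2)
  obtain ⟨i, hi⟩ := (Y.fresh a₁).1 h
  rw [project_map Prod.fst (Y.lt i)] at hi
  have : ∃ j, b i j := by
    by_contra hb
    have hr : ∀ q, Matched Y X b q → Y.lt i q.1 = A.root := fun q hq => by
      by_contra h
      exact hb (hq.2.1 i h)
    have e : project (fun q => Y.lt i q.1) p t = [] :=
      project_const (hr p hp) fun q hq => hr q (ht q hq)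
    rw [e] at hi
    exact not_fresh_nil hi
  obtain ⟨j, hj⟩ := this
  refine (X.fresh a₂).2 ⟨j, ?_⟩
  have e : project (fun q => Y.lt i q.1) p t = project (fun q => X.lt j q.2) p t :=
    project_congr (hp.1 i j hj) fun q hq => (ht q hq).1 i j hj
  rwa [project_map Prod.snd (X.lt j), ← hp.1 i j hj, ← e]

theorem fresh_iff_of_matched {b : Y.I → X.I → Prop} {p : Y.game.Pos × X.game.Pos}
    {t : List (Y.game.Pos × X.game.Pos)} (hp : Matched Y X b p) (ht : ∀ q ∈ t, Matched Y X b q)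
    (ha : Along (SyncStep Y.game X.game) p t) (q : ℤˣ) :
    Y.game.Fresh q p.1 (t.map Prod.fst) ↔ X.game.Fresh q p.2 (t.map Prod.snd) := by
  refine ⟨fresh_of_matched hp ht ha, fun h => ?_⟩
  have ha' : Along (SyncStep X.game Y.game) (p.2, p.1) (t.map Prod.swap) :=
    (along_map Prod.swap p t).2 (ha.mono fun p q h => h.imp fun _ h => h.symm)
  have := fresh_of_matched (t := t.map Prod.swap) (q := q) hp.symm (by
    intro q hq
    obtain ⟨r, hr, rfl⟩ := List.mem_map.1 hq
    exact (ht r hr).symm) ha' (by rw [List.map_map]; exact h)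
  rw [List.map_map] at this
  exact this

/-- In a step, the index of the member that moves on the left is matched with the index of the
member that moves on the right. -/
theorem Matched.step {b : Y.I → X.I → Prop} {p q : Y.game.Pos × X.game.Pos}
    (hp : Matched Y X b p) (hq : Matched Y X b q) (h : SyncStep Y.game X.game p q) :
    ∃ i j, b i j ∧ Y.lt i q.1 ≠ A.root ∧ X.lt j p.2 = Y.lt i p.1 ∧ X.lt j q.2 = Y.lt i q.1 ∧
      Y.lt i q.1 ≠ Y.lt i p.1 ∧
      (∀ i', i' ≠ i → Y.lt i' q.1 = Y.lt i' p.1) ∧ (∀ j', j' ≠ j → X.lt j' q.2 = X.lt j' p.2) ∧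
      ∀ m, Y.game.Move m p.1 q.1 → A.Move m (Y.lt i p.1) (Y.lt i q.1) := by
  obtain ⟨m, hm, hm'⟩ := h
  obtain ⟨i, hi, hi'⟩ := Y.move hm
  obtain ⟨j, hj, hj'⟩ := X.move hm'
  have hr : Y.lt i q.1 ≠ A.root := fun e => A.no_return (e ▸ hi)
  obtain ⟨j₀, hb⟩ := hq.2.1 i hr
  obtain rfl : j₀ = j := by
    by_contra e
    have := hj' j₀ e
    rw [← hp.1 i j₀ hb, ← hq.1 i j₀ hb] at this
    exact hi.ne this
  exact ⟨i, j₀, hb, hr, (hp.1 _ _ hb).symm, (hq.1 _ _ hb).symm, hi.ne, hi', hj', fun m' h => by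
    rwa [Y.game.pol_unique h hm]⟩

/-- Two matchings of the same path agree on the members that have been opened. -/
theorem MatchedBy.agree {b b' : Y.I → X.I → Prop} {s : List (Y.game.Pos × X.game.Pos)}
    (h : MatchedBy Y X b s) (h' : MatchedBy Y X b' s)
    (ha : Along (SyncStep Y.game X.game) (Y.game.root, X.game.root) s) {i : Y.I} {j : X.I}
    (hi : Y.lt i (s.getLastD (Y.game.root, X.game.root)).1 ≠ A.root) (hb : b i j) : b' i j := by
  induction s using List.reverseRecOn with
  | nil => exact (hi (Y.root i)).elim
  | append_singleton s q ih =>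
    have hs := ((along_append _ _ _).1 ha).2.1
    by_cases hi' : Y.lt i (s.getLastD (Y.game.root, X.game.root)).1 = A.root
    · rw [getLastD_append] at hi
      change Y.lt i q.1 ≠ A.root at hi
      obtain ⟨i₁, j₁, b₁, -, -, -, -, h₁, h₂, -⟩ := Matched.step h.last (h.matched q (by simp)) hs
      obtain ⟨i₂, j₂, b₂, -, -, -, -, h₁', h₂', -⟩ :=
        Matched.step h'.last (h'.matched q (by simp)) hs
      obtain rfl : i = i₁ := by
        by_contra e
        exact hi ((h₁ i e).trans hi')
      obtain rfl : i = i₂ := by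
        by_contra e
        exact hi ((h₁' i e).trans hi')
      obtain rfl := h.func hb b₁
      have : j = j₂ := by
        by_contra e
        have := h₂' j e
        rw [← h.last.1 i j hb, ← (h.matched q (by simp)).1 i j hb, hi'] at this
        exact hi this
      exact this ▸ b₂
    · exact ih h.left h'.left ((along_append _ _ _).1 ha).1 hi'

/-- On the paths in `R`, the index of the member that is opened is determined by the past. -/
def Rigid (Y : Family A) (R : List Y.game.Pos → Prop) : Prop :=
  ∀ t y y' i i', R (t ++ [y]) → R (t ++ [y']) →
    Y.lt i (t.getLastD Y.game.root) = A.root → Y.lt i y ≠ A.root →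
    Y.lt i' (t.getLastD Y.game.root) = A.root → Y.lt i' y' ≠ A.root → i = i'

theorem rigid_bang : Rigid (bang A) (bang A).adm := by
  intro t y y' i i' h h' h₁ h₂ h₃ h₄
  obtain ⟨p, hp⟩ := ((along_append _ _ _).1 h).2.1
  obtain ⟨p', hp'⟩ := ((along_append _ _ _).1 h').2.1
  exact (bang_open hp h₁ h₂).1.trans (bang_open hp' h₃ h₄).1.symm

theorem fst_getLastD {V W : Type*} (s : List (V × W)) (v : V) (w : W) :
    (s.map Prod.fst).getLastD v = (s.getLastD (v, w)).1 := by
  induction s generalizing v w with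
  | nil => rfl
  | cons p s ih =>
    rw [List.map_cons, List.getLastD_cons, List.getLastD_cons]
    exact ih p.1 p.2

/-- The right-hand move determines the member `j` that moves. If its partner on the left is already
open, any two matchings agree on it; if it is being opened, rigidity determines it. Its new position
is then that of `j`, and the other members do not move. -/
theorem eq_fst_of_rigid {R : List Y.game.Pos → Prop} (hR : Rigid Y R) {b b' : Y.I → X.I → Prop}
    {s : List (Y.game.Pos × X.game.Pos)} {q q' : Y.game.Pos × X.game.Pos}
    (h : MatchedBy Y X b (s ++ [q])) (h' : MatchedBy Y X b' (s ++ [q']))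
    (ha : Along (SyncStep Y.game X.game) (Y.game.root, X.game.root) (s ++ [q]))
    (ha' : Along (SyncStep Y.game X.game) (Y.game.root, X.game.root) (s ++ [q']))
    (hr : R ((s ++ [q]).map Prod.fst)) (hr' : R ((s ++ [q']).map Prod.fst)) (e : q.2 = q'.2) :
    q.1 = q'.1 := by
  obtain ⟨ha₀, ha, -⟩ := (along_append _ _ _).1 ha
  obtain ⟨-, ha', -⟩ := (along_append _ _ _).1 ha'
  obtain ⟨i, j, hb, hi, e₁, e₂, n, h₁, h₂, -⟩ := Matched.step h.last (h.matched q (by simp)) ha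
  obtain ⟨i', j', hb', hi', e₁', e₂', n', h₁', h₂', -⟩ :=
    Matched.step h'.last (h'.matched q' (by simp)) ha'
  obtain rfl : j = j' := by
    by_contra hj
    have := h₂' j hj
    rw [← e, e₁, e₂] at this
    exact n this
  have : i = i' := by
    by_cases hn : Y.lt i (s.getLastD (Y.game.root, X.game.root)).1 = A.root
    · rw [List.map_append] at hr hr'
      rw [← fst_getLastD] at hn
      refine hR _ _ _ i i' hr hr' hn hi ?_ hi'
      rw [fst_getLastD _ _ X.game.root] at hn ⊢
      rw [← e₁', e₁, hn]
    · exact h'.inj (h.left.agree h'.left ha₀ hn hb) hb'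
  subst this
  refine Y.ext fun k => ?_
  by_cases hk : k = i
  · rw [hk, ← e₂, ← e₂', e]
  · rw [h₁ k hk, h₁' k hk]

/-- In an admissible path Player opens no member, so the member that moves on the left has been
opened before, and the partner of an open member is the same for any two matchings of the past. -/
theorem eq_snd_of_matched {b b' : Y.I → X.I → Prop}
    {s : List (Y.game.Pos × X.game.Pos)} {q q' : Y.game.Pos × X.game.Pos}
    (h : MatchedBy Y X b (s ++ [q])) (h' : MatchedBy Y X b' (s ++ [q']))
    (ha : Along (SyncStep Y.game X.game) (Y.game.root, X.game.root) (s ++ [q]))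
    (ha' : Along (SyncStep Y.game X.game) (Y.game.root, X.game.root) (s ++ [q']))
    (hr : Y.adm ((s ++ [q]).map Prod.fst))
    (hm : Y.game.Move 1 (s.getLastD (Y.game.root, X.game.root)).1 q.1) (e : q.1 = q'.1) :
    q.2 = q'.2 := by
  obtain ⟨ha₀, ha, -⟩ := (along_append _ _ _).1 ha
  obtain ⟨-, ha', -⟩ := (along_append _ _ _).1 ha'
  obtain ⟨i, j, hb, hi, e₁, e₂, n, h₁, h₂, hp⟩ := Matched.step h.last (h.matched q (by simp)) ha
  obtain ⟨i', j', hb', hi', e₁', e₂', n', h₁', h₂', -⟩ :=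
    Matched.step h'.last (h'.matched q' (by simp)) ha'
  obtain rfl : i = i' := by
    by_contra hj
    exact n (e ▸ h₁' i hj)
  have hn : Y.lt i (s.getLastD (Y.game.root, X.game.root)).1 ≠ A.root := by
    intro hn
    rw [List.map_append, adm, along_append, fst_getLastD _ _ X.game.root] at hr
    have h₁ := Y.opp hr.2.1 hn hi
    have h₂ := hp 1 hm
    rw [hn] at h₂
    exact absurd (A.pol_unique h₁ h₂) (by decide)
  obtain rfl := h'.func (h.left.agree h'.left ha₀ hn hb) hb'
  refine X.ext fun k => ?_
  by_cases hk : k = j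
  · rw [hk, e₂, e₂', e]
  · rw [h₂ k hk, h₂' k hk]

/-- Matched paths from a family in which the opened members are determined by the past are
determined by their right components. -/
theorem eq_of_map_snd_eq {R : List Y.game.Pos → Prop} (hR : Rigid Y R)
    (hp : ∀ s t, R (s ++ t) → R s) {b b' : Y.I → X.I → Prop}
    {s s' : List (Y.game.Pos × X.game.Pos)} (h : MatchedBy Y X b s) (h' : MatchedBy Y X b' s')
    (ha : Along (SyncStep Y.game X.game) (Y.game.root, X.game.root) s)
    (ha' : Along (SyncStep Y.game X.game) (Y.game.root, X.game.root) s')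
    (hr : R (s.map Prod.fst)) (hr' : R (s'.map Prod.fst)) (e : s.map Prod.snd = s'.map Prod.snd) :
    s = s' := by
  induction s using List.reverseRecOn generalizing s' with
  | nil => exact (List.map_eq_nil_iff.1 e.symm).symm
  | append_singleton s q ih =>
    rcases List.eq_nil_or_concat s' with rfl | ⟨s', q', rfl⟩
    · simp at e
    rw [List.concat_eq_append] at *
    rw [List.map_append, List.map_append] at e
    obtain ⟨e, e'⟩ := List.append_inj' e rfl
    have hr₁ := hr
    have hr₁' := hr'
    rw [List.map_append] at hr₁ hr₁'
    obtain rfl := ih h.left h'.left ((along_append _ _ _).1 ha).1 ((along_append _ _ _).1 ha').1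
      (hp _ _ hr₁) (hp _ _ hr₁') e
    have e' : q.2 = q'.2 := by simpa using e'
    rw [Prod.ext (eq_fst_of_rigid hR h h' ha ha' hr hr' e') e']

end Family

end MBGame

/-! ## Canonical relations between families -/

theorem exists_zip {X Y Z : Type*} {s : List (X × Y)} {t : List (Y × Z)}
    (h : s.map Prod.snd = t.map Prod.fst) :
    ∃ u : List (X × Y × Z), u.map (fun x => (x.1, x.2.1)) = s ∧ u.map Prod.snd = t := by
  induction s generalizing t with
  | nil =>
    obtain rfl := List.map_eq_nil_iff.1 h.symm
    exact ⟨[], rfl, rfl⟩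
  | cons p s ih =>
    cases t with
    | nil => cases h
    | cons q t =>
      rw [List.map_cons, List.map_cons, List.cons.injEq] at h
      obtain ⟨u, rfl, rfl⟩ := ih h.2
      refine ⟨(p.1, q) :: u, ?_, rfl⟩
      rw [List.map_cons]
      exact congrArg (· :: _) (Prod.ext rfl h.1.symm)

namespace MBGame

open ConwayGame

theorem SyncStep.ne_left {Y X : MBGame.{u}} {p q : Y.Pos × X.Pos} (h : SyncStep Y X p q) :
    q.1 ≠ p.1 := h.elim fun _ h => h.1.ne

theorem SyncStep.ne_right {Y X : MBGame.{u}} {p q : Y.Pos × X.Pos} (h : SyncStep Y X p q) :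
    q.2 ≠ p.2 := h.elim fun _ h => h.2.ne

/-- The elements of the composite of two synchronous relations are simultaneous in the three
games. -/
theorem mem_compTr_iff {Y X Z : MBGame.{u}} {P : Set (List (Y.Pos × X.Pos))}
    {Q : Set (List (X.Pos × Z.Pos))} (hP : IsSync Y X P) (hQ : IsSync X Z Q)
    {s : List (Y.Pos × Z.Pos)} : s ∈ compTr Y.root X.root Z.root P Q ↔
      ∃ u : List (Y.Pos × X.Pos × Z.Pos), u.map (fun x => (x.1, x.2.1)) ∈ P ∧
        u.map Prod.snd ∈ Q ∧ u.map (fun x => (x.1, x.2.2)) = s := by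
  constructor
  · rintro ⟨u, h₁, h₂, rfl⟩
    obtain ⟨v, hv, e⟩ := exists_noStutter (Y.root, X.root, Z.root) u
    rw [← e] at h₁ h₂
    have a : Along (fun p q => q.1 ≠ p.1 ∧ q.2.1 ≠ p.2.1 ∧ q.2.2 ≠ p.2.2)
        (Y.root, X.root, Z.root) v := by
      refine (((hP.along rfl rfl h₁).and (hQ.along rfl rfl h₂)).and hv).mono fun p q h => ?_
      obtain ⟨⟨⟨e₁, e₂⟩ | h₁, ⟨e₃, e₄⟩ | h₂⟩, h⟩ := h
      · exact (h (Prod.ext e₁ (Prod.ext e₂ e₄))).elim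
      · exact (h₂.ne_left e₂).elim
      · exact (h₁.ne_right e₃).elim
      · exact ⟨h₁.ne_left, h₁.ne_right, h₂.ne_right⟩
    rw [project_of_noStutter (π := fun x => (x.1, x.2.1))
      (a.mono fun p q h e => h.1 (Prod.mk.inj e).1)] at h₁
    rw [project_of_noStutter (π := fun x => (x.2.1, x.2.2))
      (a.mono fun p q h e => h.2.2 (congrArg Prod.snd e))] at h₂
    refine ⟨v, h₁, h₂, ?_⟩
    rw [← e, project_of_noStutter (π := fun x => (x.1, x.2.2))
      (a.mono fun p q h e => h.1 (Prod.mk.inj e).1)]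
  · rintro ⟨u, h₁, h₂, rfl⟩
    have a := (along_map (fun x : Y.Pos × X.Pos × Z.Pos => (x.1, x.2.1)) (Y.root, X.root, Z.root)
      u).1 (hP _ h₁)
    have a' := (along_map (Prod.snd : Y.Pos × X.Pos × Z.Pos → _) (Y.root, X.root, Z.root)
      u).1 (hQ _ h₂)
    refine ⟨u, ?_, ?_, ?_⟩
    · rwa [project_of_noStutter (π := fun x => (x.1, x.2.1))
        (a.mono fun p q h e => h.ne_left (Prod.mk.inj e).1)]
    · rwa [project_of_noStutter (π := fun x => (x.2.1, x.2.2))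
        (a'.mono fun p q h e => h.ne_left (congrArg Prod.fst e))]
    · rw [project_of_noStutter (π := fun x => (x.1, x.2.2))
        (a.mono fun p q h e => h.ne_left (Prod.mk.inj e).1)]

/-- Simultaneous paths in the components of a tensor product are the projections of a simultaneous
path. -/
theorem exists_sync_tensor {Y Y' X X' : MBGame.{u}} {y : Y.Pos} {y' : Y'.Pos} {x : X.Pos}
    {x' : X'.Pos} {t : List (X.Pos × X'.Pos)} (ht : Along (X.tensor X').Edge (x, x') t)
    {s : List (Y.Pos × X.Pos)} {s' : List (Y'.Pos × X'.Pos)}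
    (hs : Along (SyncStep Y X) (y, x) s) (hs' : Along (SyncStep Y' X') (y', x') s')
    (e : s.map Prod.snd = project Prod.fst (x, x') t)
    (e' : s'.map Prod.snd = project Prod.snd (x, x') t) :
    ∃ w : List ((Y.Pos × Y'.Pos) × (X.Pos × X'.Pos)),
      Along (SyncStep (Y.tensor Y') (X.tensor X')) ((y, y'), (x, x')) w ∧
      project (fun p => (p.1.1, p.2.1)) ((y, y'), (x, x')) w = s ∧
      project (fun p => (p.1.2, p.2.2)) ((y, y'), (x, x')) w = s' ∧ w.map Prod.snd = t := by
  induction t generalizing y y' x x' s s' with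
  | nil =>
    obtain rfl := List.map_eq_nil_iff.1 e
    obtain rfl := List.map_eq_nil_iff.1 e'
    exact ⟨[], trivial, rfl, rfl, rfl⟩
  | cons z t ih =>
    obtain ⟨z, z'⟩ := z
    obtain ⟨h, ht⟩ := ht
    rcases edge_tensor.1 h with ⟨k, e₁⟩ | ⟨e₁, k⟩
    · dsimp only at e₁ k
      subst e₁
      rw [project_cons_of_ne (π := Prod.fst) (y := (z, x')) (x := (x, x')) (Edge.ne (G := X.toConwayGame) k)] at e
      rw [project_cons_of_eq (π := Prod.snd) (by rfl)] at e'
      cases s with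
      | nil => cases e
      | cons p s =>
        obtain ⟨p, q⟩ := p
        rw [List.map_cons, List.cons.injEq] at e
        obtain ⟨e₂, e⟩ := e
        dsimp only at e₂
        subst e₂
        obtain ⟨w, h₁, rfl, rfl, rfl⟩ := ih ht hs.2 hs' e e'
        obtain ⟨m, m₁, m₂⟩ := hs.1
        refine ⟨((p, y'), (q, x')) :: w, ⟨⟨m, Or.inl ⟨m₁, rfl⟩, Or.inl ⟨m₂, rfl⟩⟩, h₁⟩, ?_, ?_, rfl⟩
        · exact project_cons_of_ne (fun e => m₁.ne (congrArg Prod.fst e)) _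
        · exact project_cons_of_eq (by rfl) _
    · dsimp only at e₁ k
      subst e₁
      rw [project_cons_of_eq (π := Prod.fst) (by rfl)] at e
      rw [project_cons_of_ne (π := Prod.snd) (y := (x, z')) (x := (x, x')) (Edge.ne (G := X'.toConwayGame) k)] at e'
      cases s' with
      | nil => cases e'
      | cons p s' =>
        obtain ⟨p, q⟩ := p
        rw [List.map_cons, List.cons.injEq] at e'
        obtain ⟨e₂, e'⟩ := e'
        dsimp only at e₂
        subst e₂
        obtain ⟨w, h₁, rfl, rfl, rfl⟩ := ih ht hs hs'.2 e e'
        obtain ⟨m, m₁, m₂⟩ := hs'.1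
        refine ⟨((y, p), (x, q)) :: w, ⟨⟨m, Or.inr ⟨rfl, m₁⟩, Or.inr ⟨rfl, m₂⟩⟩, h₁⟩, ?_, ?_, rfl⟩
        · exact project_cons_of_eq (by rfl) _
        · exact project_cons_of_ne (fun e => m₁.ne (congrArg Prod.fst e)) _

namespace Family

variable {A : MBGame.{u}} {Y Y' X X' Z : Family A}

/-- A synchronous relation that matches the members of two families and lifts the admissible paths
of the second family. -/
structure Canonical (Y X : Family A) (P : Set (List (Y.game.Pos × X.game.Pos))) : Prop where
  sync : IsSync Y.game X.game P
  matched : ∀ s ∈ P, ∃ b, MatchedBy Y X b s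
  adm : ∀ s ∈ P, Y.adm (s.map Prod.fst) ↔ X.adm (s.map Prod.snd)
  lift : ∀ t, X.adm t → ∃ s ∈ P, s.map Prod.snd = t

theorem MatchedBy.comp {b : Y.I → X.I → Prop} {b' : X.I → Z.I → Prop}
    {u : List (Y.game.Pos × X.game.Pos × Z.game.Pos)}
    (h : MatchedBy Y X b (u.map fun x => (x.1, x.2.1))) (h' : MatchedBy X Z b' (u.map Prod.snd)) :
    MatchedBy Y Z (Relation.Comp b b') (u.map fun x => (x.1, x.2.2)) where
  inj := by
    rintro i i' k ⟨j, h₁, h₂⟩ ⟨j', h₁', h₂'⟩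
    obtain rfl := h'.inj h₂ h₂'
    exact h.inj h₁ h₁'
  func := by
    rintro i k k' ⟨j, h₁, h₂⟩ ⟨j', h₁', h₂'⟩
    obtain rfl := h.func h₁ h₁'
    exact h'.func h₂ h₂'
  matched := by
    intro p hp
    obtain ⟨x, hx, rfl⟩ := List.mem_map.1 hp
    have m := h.matched _ (List.mem_map_of_mem hx)
    have m' := h'.matched _ (List.mem_map_of_mem hx)
    refine ⟨?_, fun i hi => ?_, fun k hk => ?_⟩
    · rintro i k ⟨j, h₁, h₂⟩
      exact (m.1 i j h₁).trans (m'.1 j k h₂)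
    · obtain ⟨j, hj⟩ := m.2.1 i hi
      obtain ⟨k, hk⟩ := m'.2.1 j (m.1 i j hj ▸ hi)
      exact ⟨k, j, hj, hk⟩
    · obtain ⟨j, hj⟩ := m'.2.2 k hk
      obtain ⟨i, hi⟩ := m.2.2 j ((m'.1 j k hj).symm ▸ hk)
      exact ⟨i, j, hi, hj⟩

theorem Canonical.comp {P : Set (List (Y.game.Pos × X.game.Pos))}
    {Q : Set (List (X.game.Pos × Z.game.Pos))} (hP : Canonical Y X P) (hQ : Canonical X Z Q) :
    Canonical Y Z (compTr Y.game.root X.game.root Z.game.root P Q) where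
  sync := hP.sync.comp hQ.sync
  matched s hs := by
    obtain ⟨u, h₁, h₂, rfl⟩ := (mem_compTr_iff hP.sync hQ.sync).1 hs
    obtain ⟨b, hb⟩ := hP.matched _ h₁
    obtain ⟨b', hb'⟩ := hQ.matched _ h₂
    exact ⟨_, hb.comp hb'⟩
  adm s hs := by
    obtain ⟨u, h₁, h₂, rfl⟩ := (mem_compTr_iff hP.sync hQ.sync).1 hs
    have e₁ := hP.adm _ h₁
    have e₂ := hQ.adm _ h₂
    rw [List.map_map, List.map_map] at *
    exact e₁.trans e₂
  lift t ht := by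
    obtain ⟨s, hs, rfl⟩ := hQ.lift t ht
    obtain ⟨r, hr, e⟩ := hP.lift _ ((hQ.adm s hs).2 ht)
    obtain ⟨u, rfl, rfl⟩ := exists_zip e
    exact ⟨_, (mem_compTr_iff hP.sync hQ.sync).2 ⟨u, hr, hs, rfl⟩, by simp⟩

theorem adm_tensor_iff {t : List (Y.game.Pos × X.game.Pos)} :
    (Y.tensor X).adm t ↔ Along (Y.game.tensor X.game).Edge (Y.game.root, X.game.root) t ∧
      Y.adm (project Prod.fst (Y.game.root, X.game.root) t) ∧
      X.adm (project Prod.snd (Y.game.root, X.game.root) t) := by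
  have e₁ := along_project (R := Y.step) Prod.fst (Y.game.root, X.game.root) t
  have e₂ := along_project (R := X.step) Prod.snd (Y.game.root, X.game.root) t
  refine Iff.trans ?_ (and_congr Iff.rfl (and_congr e₁ e₂)).symm
  constructor
  · intro h
    refine ⟨h.mono fun p q h => (Y.tensor X).step_edge h, h.mono fun p q h => ?_,
      h.mono fun p q h => ?_⟩
    · exact h.elim (fun h => Or.inr h.1) fun h => Or.inl h.2
    · exact h.elim (fun h => Or.inl h.2) fun h => Or.inr h.1
  · rintro ⟨h, h₁, h₂⟩
    refine ((h.and h₁).and h₂).mono fun p q h => ?_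
    obtain ⟨⟨h, h₁⟩, h₂⟩ := h
    rcases edge_tensor.1 h with ⟨h, e⟩ | ⟨e, h⟩
    · exact Or.inl ⟨h₁.resolve_left h.ne, e.symm⟩
    · exact Or.inr ⟨h₂.resolve_left h.ne, e.symm⟩

theorem MatchedBy.tensor {b : Y.I → X.I → Prop} {b' : Y'.I → X'.I → Prop}
    {s : List ((Y.game.Pos × Y'.game.Pos) × (X.game.Pos × X'.game.Pos))}
    (h : MatchedBy Y X b (project (fun p => (p.1.1, p.2.1))
      ((Y.game.root, Y'.game.root), (X.game.root, X'.game.root)) s))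
    (h' : MatchedBy Y' X' b' (project (fun p => (p.1.2, p.2.2))
      ((Y.game.root, Y'.game.root), (X.game.root, X'.game.root)) s)) :
    MatchedBy (Y.tensor Y') (X.tensor X') (Sum.LiftRel b b') s where
  inj := by
    rintro (i | i) (i' | i') (j | j) h₁ h₂ <;> cases h₁ <;> cases h₂
    · exact congrArg _ (h.inj ‹_› ‹_›)
    · exact congrArg _ (h'.inj ‹_› ‹_›)
  func := by
    rintro (i | i) (j | j) (j' | j') h₁ h₂ <;> cases h₁ <;> cases h₂
    · exact congrArg _ (h.func ‹_› ‹_›)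
    · exact congrArg _ (h'.func ‹_› ‹_›)
  matched p hp := by
    have m := forall_of_project (π := fun p => (p.1.1, p.2.1)) (R := Matched Y X b)
      (x := ((Y.game.root, Y'.game.root), (X.game.root, X'.game.root))) (matched_root b)
      h.matched p hp
    have m' := forall_of_project (π := fun p => (p.1.2, p.2.2)) (R := Matched Y' X' b')
      (x := ((Y.game.root, Y'.game.root), (X.game.root, X'.game.root))) (matched_root b')
      h'.matched p hp
    refine ⟨?_, ?_, ?_⟩
    · rintro (i | i) (j | j) (h | h)
      · exact m.1 i j h
      · exact m'.1 i j h
    · rintro (i | i) hi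
      · exact (m.2.1 i hi).imp' Sum.inl fun _ h => .inl h
      · exact (m'.2.1 i hi).imp' Sum.inr fun _ h => .inr h
    · rintro (i | i) hi
      · exact (m.2.2 i hi).imp' Sum.inl fun _ h => .inl h
      · exact (m'.2.2 i hi).imp' Sum.inr fun _ h => .inr h

theorem Canonical.tensor {P : Set (List (Y.game.Pos × X.game.Pos))}
    {Q : Set (List (Y'.game.Pos × X'.game.Pos))} (hP : Canonical Y X P) (hQ : Canonical Y' X' Q) :
    Canonical (Y.tensor Y') (X.tensor X') (prodRel Y.game X.game Y'.game X'.game P Q) where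
  sync := isSync_prodRel
  matched s hs := by
    obtain ⟨b, hb⟩ := hP.matched _ hs.2.1
    obtain ⟨b', hb'⟩ := hQ.matched _ hs.2.2
    exact ⟨_, hb.tensor hb'⟩
  adm s hs := by
    let r := ((Y.game.root, Y'.game.root), (X.game.root, X'.game.root))
    have a₁ := hP.adm _ hs.2.1
    have a₂ := hQ.adm _ hs.2.2
    have s₁ := hP.sync _ hs.2.1
    have s₂ := hQ.sync _ hs.2.2
    rw [← project_of_noStutter (s₁.mono fun p q h => h.ne_left),
      ← project_of_noStutter (s₁.mono fun p q h => h.ne_right)] at a₁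
    rw [← project_of_noStutter (s₂.mono fun p q h => h.ne_left),
      ← project_of_noStutter (s₂.mono fun p q h => h.ne_right)] at a₂
    have f₁ := project_project (fun p : (Y.game.Pos × Y'.game.Pos) × (X.game.Pos × X'.game.Pos) =>
      (p.1.1, p.2.1)) Prod.fst r s
    have f₂ := project_project (fun p : (Y.game.Pos × Y'.game.Pos) × (X.game.Pos × X'.game.Pos) =>
      (p.1.1, p.2.1)) Prod.snd r s
    have f₃ := project_project (fun p : (Y.game.Pos × Y'.game.Pos) × (X.game.Pos × X'.game.Pos) =>
      (p.1.2, p.2.2)) Prod.fst r s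
    have f₄ := project_project (fun p : (Y.game.Pos × Y'.game.Pos) × (X.game.Pos × X'.game.Pos) =>
      (p.1.2, p.2.2)) Prod.snd r s
    have g₁ := project_map (Prod.fst : (Y.game.Pos × Y'.game.Pos) × (X.game.Pos × X'.game.Pos) → _)
      Prod.fst r s
    have g₂ := project_map (Prod.snd : (Y.game.Pos × Y'.game.Pos) × (X.game.Pos × X'.game.Pos) → _)
      Prod.fst r s
    have g₃ := project_map (Prod.fst : (Y.game.Pos × Y'.game.Pos) × (X.game.Pos × X'.game.Pos) → _)
      Prod.snd r s
    have g₄ := project_map (Prod.snd : (Y.game.Pos × Y'.game.Pos) × (X.game.Pos × X'.game.Pos) → _)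
      Prod.snd r s
    have e₁ : Along (Y.game.tensor Y'.game).Edge r.1 (s.map Prod.fst) :=
      (along_map Prod.fst r s).2 (hs.1.mono fun p q h => h.imp fun _ h => h.1)
    have e₂ : Along (X.game.tensor X'.game).Edge r.2 (s.map Prod.snd) :=
      (along_map Prod.snd r s).2 (hs.1.mono fun p q h => h.imp fun _ h => h.2)
    refine adm_tensor_iff.trans (Iff.trans ?_ adm_tensor_iff.symm)
    refine and_congr (iff_of_true e₁ e₂) (and_congr ?_ ?_)
    · exact (iff_of_eq (congrArg Y.adm (g₁.trans f₁.symm))).trans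
        (a₁.trans (iff_of_eq (congrArg X.adm (f₂.trans g₂.symm))))
    · exact (iff_of_eq (congrArg Y'.adm (g₃.trans f₃.symm))).trans
        (a₂.trans (iff_of_eq (congrArg X'.adm (f₄.trans g₄.symm))))
  lift t ht := by
    obtain ⟨h, h₁, h₂⟩ := adm_tensor_iff.1 ht
    obtain ⟨s, hs, e⟩ := hP.lift _ h₁
    obtain ⟨s', hs', e'⟩ := hQ.lift _ h₂
    obtain ⟨w, hw, rfl, rfl, rfl⟩ := exists_sync_tensor h (hP.sync _ hs) (hQ.sync _ hs') e e'
    exact ⟨w, ⟨hw, hs, hs'⟩, rfl⟩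

/-- Canonical relations between the same families are equal if their elements have admissible right
components and are determined by them. -/
theorem Canonical.eq {P Q : Set (List (Y.game.Pos × X.game.Pos))} (hP : Canonical Y X P)
    (hQ : Canonical Y X Q) (aP : ∀ s ∈ P, X.adm (s.map Prod.snd))
    (aQ : ∀ s ∈ Q, X.adm (s.map Prod.snd))
    (h : ∀ s ∈ P, ∀ s' ∈ Q, s.map Prod.snd = s'.map Prod.snd → s = s') : P = Q := by
  ext s
  constructor
  · intro hs
    obtain ⟨s', hs', e⟩ := hQ.lift _ (aP s hs)
    rwa [h s hs s' hs' e.symm]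
  · intro hs
    obtain ⟨s', hs', e⟩ := hP.lift _ (aQ s hs)
    rwa [← h s' hs' s hs e]

/-! ### The canonical relations from the exponential -/

/-- The relation that matches the copies of the exponential with the members of a family. -/
def canRel (X : Family A) : Set (List (A.bang.Pos × X.game.Pos)) :=
  {s | Along (SyncStep A.bang X.game) (A.bang.root, X.game.root) s ∧
    (∃ b, MatchedBy (bang A) X b s) ∧ X.adm (s.map Prod.snd)}

theorem bang_adm_of_sync {s : List (A.bang.Pos × X.game.Pos)}
    (h : Along (SyncStep A.bang X.game) (A.bang.root, X.game.root) s) :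
    (bang A).adm (s.map Prod.fst) :=
  (along_map Prod.fst (A.bang.root, X.game.root) s).2 (h.mono fun p q h => h.imp fun _ h => h.1)

theorem exists_bang_move {w : A.BangPos} {i : ℕ} (hi : i < w.length) {m : ℤˣ} {y : A.Pos}
    (h : A.Move m (A.letter i w) y) : ∃ v : A.BangPos, A.bang.Move m w v ∧ v.length = w.length ∧
      A.letter i v = y ∧ ∀ j, j ≠ i → A.letter j v = A.letter j w := by
  obtain ⟨w₁, w₂, e, rfl⟩ : ∃ w₁ w₂, w = w₁ ++ w[i] :: w₂ ∧ w₁.length = i :=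
    ⟨w.take i, w.drop (i + 1), by simp, by simp; omega⟩
  generalize w[w₁.length] = x at e
  subst e
  rw [letter_middle] at h
  have hy : y ≠ A.root := fun e => A.no_return (e ▸ h)
  refine ⟨w₁ ++ ⟨y, hy⟩ :: w₂, BangMove.play w₁ w₂ x ⟨y, hy⟩ h, by simp, letter_middle _ _ _,
    fun j hj => letter_middle_ne hj⟩

/-- The lift is built move by move. A move that opens a member opens a new copy at the end of the
word, and the two are added to the matching; admissibility is needed here, as only Opponent may open
copies of `!A`. Any other move is played in the matched copy. The bound on the matched indices keeps
the index of the next copy free. -/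
theorem exists_lift {t : List X.game.Pos} (ht : X.adm t) :
    ∃ s : List (A.bang.Pos × X.game.Pos),
      Along (SyncStep A.bang X.game) (A.bang.root, X.game.root) s ∧
      (∃ b : ℕ → X.I → Prop, MatchedBy (bang A) X b s ∧
        ∀ i j, b i j → i < (s.getLastD (A.bang.root, X.game.root)).1.length) ∧
      s.map Prod.snd = t := by
  induction t using List.reverseRecOn with
  | nil =>
    refine ⟨[], trivial, ⟨fun _ _ => False, ⟨fun h => h.elim, fun h => h.elim, fun p hp => by cases hp⟩,
      fun _ _ h => h.elim⟩, rfl⟩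
  | append_singleton t x ih =>
    obtain ⟨ht₀, ht, -⟩ := (along_append _ _ _).1 ht
    obtain ⟨s, hs, ⟨b, hb, hl⟩, rfl⟩ := ih ht₀
    have eX : (s.map Prod.snd).getLastD X.game.root =
        (s.getLastD (A.bang.root, X.game.root)).2 := by
      have := fst_getLastD (s.map Prod.swap) X.game.root A.bang.root
      rw [List.map_map] at this
      refine this.trans ?_
      clear * -
      generalize A.bang.root = a
      generalize X.game.root = x
      induction s generalizing a x with
      | nil => rfl
      | cons p s ih =>
        rw [List.map_cons, List.getLastD_cons, List.getLastD_cons]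
        exact ih p.1 p.2
    rw [eX] at ht
    have hm : Matched (bang A) X b (s.getLastD (A.bang.root, X.game.root)) :=
      MatchedBy.last (t := []) ((List.append_nil s).symm ▸ hb)
    obtain ⟨m, hmv⟩ := X.step_edge ht
    obtain ⟨j, hj, hj'⟩ := X.move hmv
    have hx : X.lt j x ≠ A.root := fun e => A.no_return (e ▸ hj)
    set p := s.getLastD (A.bang.root, X.game.root) with hp
    by_cases hr : X.lt j p.2 = A.root
    · have ho := X.opp ht hr hx
      obtain rfl : m = -1 := by
        rw [hr] at hj
        exact A.pol_unique hj ho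
      -- The index `p.1.length` has not been used so far. It can be matched with `j` without
      -- spoiling the earlier positions, at which both members are unopened.
      have hlen : ∀ q ∈ s, ∀ k, ¬ b p.1.length k ∧ A.letter p.1.length q.1 = A.root := by
        intro q hq k
        refine ⟨fun h => lt_irrefl _ (hl _ _ h), ?_⟩
        by_contra h
        obtain ⟨k, hk⟩ := (hb.matched q hq).2.1 _ h
        exact lt_irrefl _ (hl _ _ hk)
      have hnb : ∀ i, ¬ b i j := fun i h =>
        letter_ne_root_iff.2 (hl i j h) ((hm.1 i j h).trans hr)
      have hnp : ∀ k, ¬ b p.1.length k := fun k h => lt_irrefl _ (hl _ _ h)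
      refine ⟨s ++ [(p.1 ++ [⟨X.lt j x, hx⟩], x)], (along_append _ _ _).2 ⟨hs, ⟨-1, ?_, hmv⟩,
        trivial⟩, ⟨fun i k => b i k ∨ (i = p.1.length ∧ k = j), ⟨?_, ?_, ?_⟩, ?_⟩, by simp⟩
      · exact BangMove.openCopy p.1 ⟨X.lt j x, hx⟩ ho
      · rintro i i' k (h | ⟨rfl, rfl⟩) (h' | ⟨rfl, h'⟩)
        · exact hb.inj h h'
        · exact (hnb _ (h' ▸ h)).elim
        · exact (hnb _ h').elim
        · rfl
      · rintro i k k' (h | ⟨rfl, rfl⟩) (h' | ⟨h', rfl⟩)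
        · exact hb.func h h'
        · exact (hnp _ (h' ▸ h)).elim
        · exact (hnp _ h').elim
        · rfl
      · intro q hq
        rcases List.mem_append.1 hq with hqs | hq
        · have mq := hb.matched q hqs
          refine ⟨?_, fun i hi => (mq.2.1 i hi).imp fun _ => Or.inl,
            fun i hi => (mq.2.2 i hi).imp fun _ => Or.inl⟩
          rintro i k (h | ⟨rfl, rfl⟩)
          · exact mq.1 i k h
          · refine (hlen q hqs k).2.trans ?_
            by_contra h
            obtain ⟨i, hi⟩ := mq.2.2 k (Ne.symm h)
            exact hnb i hi
        · rw [List.mem_singleton] at hq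
          subst hq
          have hlast : A.letter p.1.length (p.1 ++ [⟨X.lt j x, hx⟩]) = X.lt j x :=
            letter_middle _ _ _
          refine ⟨?_, ?_, ?_⟩
          · rintro i k (h | ⟨rfl, rfl⟩)
            · have hk : k ≠ j := fun e => hnb i (e ▸ h)
              refine (letter_append_left (hl i k h)).trans ((hm.1 i k h).trans (hj' k hk).symm)
            · exact hlast
          · intro i hi
            have hi' := letter_ne_root_iff.1 hi
            rw [List.length_append, List.length_singleton] at hi'
            by_cases e : i = p.1.length
            · exact ⟨j, Or.inr ⟨e, rfl⟩⟩
            · have hi'' : i < p.1.length := lt_of_le_of_ne (Nat.lt_succ_iff.1 hi') e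
              exact (hm.2.1 i (letter_ne_root_iff.2 hi'')).imp fun _ => Or.inl
          · intro k hk
            by_cases e : k = j
            · exact ⟨p.1.length, Or.inr ⟨rfl, e⟩⟩
            · exact (hm.2.2 k (by rwa [← hj' k e])).imp fun _ => Or.inl
      · intro i k h
        rw [getLastD_append]
        change i < (p.1 ++ [_]).length
        rw [List.length_append, List.length_singleton]
        rcases h with h | ⟨rfl, -⟩
        · exact (hl i k h).trans (Nat.lt_succ_self _)
        · exact Nat.lt_succ_self _
    · obtain ⟨i, hi⟩ := hm.2.2 j hr
      have hi' : A.Move m (A.letter i p.1) (X.lt j x) := by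
        have := hm.1 i j hi
        change A.letter i p.1 = _ at this
        rwa [this]
      obtain ⟨v, hv, hvl, hvi, hvn⟩ := exists_bang_move (hl i j hi) hi'
      refine ⟨s ++ [(v, x)], (along_append _ _ _).2 ⟨hs, ⟨m, hv, hmv⟩, trivial⟩,
        ⟨b, ⟨hb.inj, hb.func, ?_⟩, ?_⟩, by simp⟩
      · intro q hq
        rcases List.mem_append.1 hq with hq | hq
        · exact hb.matched q hq
        · rw [List.mem_singleton] at hq
          subst hq
          refine ⟨fun i' k h => ?_, fun i' h => ?_, fun k h => ?_⟩
          · by_cases e : i' = i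
            · subst e
              obtain rfl := hb.func h hi
              exact hvi
            · have e' : k ≠ j := by
                rintro rfl
                exact e (hb.inj h hi)
              exact (hvn i' e).trans ((hm.1 i' k h).trans (hj' k e').symm)
          · by_cases e : i' = i
            · exact ⟨j, e ▸ hi⟩
            · exact hm.2.1 i' fun h' => h ((hvn i' e).trans h')
          · by_cases e : k = j
            · exact ⟨i, e ▸ hi⟩
            · exact hm.2.2 k (by rwa [← hj' k e])
      · intro i' k h
        rw [getLastD_append]
        change i' < v.length
        rw [hvl]
        exact hl i' k h

theorem canonical_canRel (X : Family A) : Canonical (bang A) X (canRel X) where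
  sync _ h := h.1
  matched _ h := h.2.1
  adm _ h := iff_of_true (bang_adm_of_sync h.1) h.2.2
  lift t ht := by
    obtain ⟨s, hs, ⟨b, hb, -⟩, rfl⟩ := exists_lift ht
    exact ⟨s, ⟨hs, ⟨b, hb⟩, ht⟩, rfl⟩

/-- There is only one canonical relation from the exponential to a family. -/
theorem Canonical.eq_canRel {P : Set (List (A.bang.Pos × X.game.Pos))}
    (hP : Canonical (bang A) X P) : P = canRel X := by
  refine hP.eq (canonical_canRel X) (fun s hs => (hP.adm s hs).1 (bang_adm_of_sync (hP.sync s hs)))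
    (fun s hs => hs.2.2) fun s hs s' hs' e => ?_
  obtain ⟨b, hb⟩ := hP.matched s hs
  obtain ⟨b', hb'⟩ := hs'.2.1
  exact eq_of_map_snd_eq rigid_bang (fun s t h => ((along_append _ _ _).1 h).1) hb hb'
    (hP.sync s hs) hs'.1 (bang_adm_of_sync (hP.sync s hs)) (bang_adm_of_sync hs'.1) e

end Family

/-- Coherence of a relation that is closed under prefixes need only be checked at the last step. -/
theorem syncCoh_of_prefix {Y X : MBGame.{u}} {P : Set (List (Y.Pos × X.Pos))}
    (hp : ∀ s t, s ++ t ∈ P → s ∈ P)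
    (h : ∀ c q q', c ++ [q] ∈ P → c ++ [q'] ∈ P →
      (Y.Move 1 (c.getLastD (Y.root, X.root)).1 q.1 → q.1 = q'.1 → q.2 = q'.2) ∧
      (q.2 = q'.2 → q.1 = q'.1)) {c s t : List (Y.Pos × X.Pos)} (hs : c ++ s ∈ P)
    (ht : c ++ t ∈ P) : SyncCoh Y X (c.getLastD (Y.root, X.root)) s t := by
  induction s generalizing c t with
  | nil => trivial
  | cons q s ih =>
    cases t with
    | nil => trivial
    | cons q' t =>
      rw [List.append_cons] at hs ht
      obtain ⟨h₁, h₂⟩ := h c q q' (hp _ _ hs) (hp _ _ ht)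
      refine ⟨fun hm _ e => h₁ hm e, fun _ _ e => h₂ e, ?_⟩
      rintro rfl
      have := ih hs ht
      rwa [getLastD_append] at this

namespace Family

variable {A : MBGame.{u}}

/-- Rigidity of `!A` lets the moves of the family determine those of `!A`; Player moves of `!A` open
no copy and so determine those of the family. Fresh queries are compared copy by copy along the
matching. -/
theorem isTransl_canRel (X : Family A) : IsTransl A.bang X.game (canRel X) := by
  have hp : ∀ s t, s ++ t ∈ canRel X → s ∈ canRel X := by
    rintro s t ⟨h, ⟨b, hb⟩, ha⟩
    rw [List.map_append] at ha
    exact ⟨((along_append _ _ _).1 h).1, ⟨b, hb.left⟩, ((along_append _ _ _).1 ha).1⟩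
  refine ⟨fun s h => h.1, ⟨trivial, ⟨fun _ _ => False, fun h => h.elim, fun h => h.elim, fun p hp => by cases hp⟩,
    trivial⟩, hp, fun s hs t ht => syncCoh_of_prefix hp ?_ (c := []) hs ht, ?_⟩
  · rintro c q q' ⟨h, ⟨b, hb⟩, -⟩ ⟨h', ⟨b', hb'⟩, -⟩
    exact ⟨fun hm => eq_snd_of_matched hb hb' h h' (bang_adm_of_sync h) hm,
      eq_fst_of_rigid rigid_bang hb hb' h h' (bang_adm_of_sync h) (bang_adm_of_sync h')⟩
  · rintro s t ⟨h, ⟨b, hb⟩, -⟩ q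
    exact fresh_iff_of_matched hb.last (fun p hp => hb.matched p (List.mem_append_right _ hp))
      ((along_append _ _ _).1 h).2 q

/-- The canonical morphism from the exponential to a family. -/
def can (X : Family A) : Hom A.bang X.game := (isTransl_canRel X).hom

/-- Morphisms that translate the moves along a canonical relation. -/
def IsCan (Y X : Family A) (f : Hom Y.game X.game) : Prop :=
  ∃ P, Canonical Y X P ∧ f.set = translPlays Y.game X.game P

theorem isCan_can (X : Family A) : IsCan (bang A) X (can X) := ⟨_, canonical_canRel X, rfl⟩

/-- The source of all equations between structure morphisms of `!A`: two composites of canonical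
morphisms that start at `!A` are equal as soon as they end at the same family. -/
theorem IsCan.eq {X : Family A} {f g : Hom A.bang X.game} (hf : IsCan (bang A) X f)
    (hg : IsCan (bang A) X g) : f = g := by
  obtain ⟨P, hP, hf⟩ := hf
  obtain ⟨Q, hQ, hg⟩ := hg
  apply Hom.ext_set
  rw [hf, hg, hP.eq_canRel, hQ.eq_canRel]

theorem IsCan.comp {Y X Z : Family A} {f : Hom Y.game X.game} {g : Hom X.game Z.game}
    (hf : IsCan Y X f) (hg : IsCan X Z g) : IsCan Y Z (gameCat.comp f g) := by
  obtain ⟨P, hP, hf⟩ := hf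
  obtain ⟨Q, hQ, hg⟩ := hg
  refine ⟨_, hP.comp hQ, ?_⟩
  refine Eq.trans ?_ (transl_compPlays_transl hP.sync hQ.sync)
  rw [← hf, ← hg]
  rfl

theorem IsCan.tensor {Y X Y' X' : Family A} {f : Hom Y.game X.game} {g : Hom Y'.game X'.game}
    (hf : IsCan Y X f) (hg : IsCan Y' X' g) :
    IsCan (Y.tensor Y') (X.tensor X') (tensorHom f g) := by
  obtain ⟨P, hP, hf⟩ := hf
  obtain ⟨Q, hQ, hg⟩ := hg
  refine ⟨_, hP.tensor hQ, ?_⟩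
  refine Eq.trans ?_ (tensorPlays_transl hP.sync hQ.sync)
  rw [← hf, ← hg]
  rfl

end Family

end MBGame

/-! ## Changes of presentation of a family -/

theorem along_of_forall {X : Type*} {C : X → Prop} {x : X} {s : List X} (hx : C x)
    (h : ∀ p ∈ s, C p) : Along (fun p q => C p ∧ C q) x s := by
  induction s generalizing x with
  | nil => trivial
  | cons y s ih =>
    have hy := h y (List.mem_cons_self ..)
    exact ⟨⟨hx, hy⟩, ih hy fun p hp => h p (List.mem_cons_of_mem _ hp)⟩

namespace MBGame

open ConwayGame

namespace Family

variable {A : MBGame.{u}} {Y Y' X X' Z : Family A}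

/-- The left components of the elements of a relation are the images of the right components. -/
def Along₂ {V W : Type u} (θ : W → V) (P : Set (List (V × W))) : Prop :=
  ∀ s ∈ P, ∀ p ∈ s, p.1 = θ p.2

/-- An embedding of the positions of `X` in those of `Y` which reindexes the members of the
families; the admissible steps of `X` stay in the domain `D`. -/
structure Reindexing (Y X : Family A) where
  e : Y.I ≃ X.I
  θ : X.game.Pos → Y.game.Pos
  D : X.game.Pos → Prop
  lt : ∀ i x, X.lt (e i) x = Y.lt i (θ x)
  move : ∀ {m x x'}, X.game.Move m x x' → Y.game.Move m (θ x) (θ x')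
  dom : ∀ {x x'}, X.step x x' → D x'
  step : ∀ {x x'}, X.game.Edge x x' → D x' → (Y.step (θ x) (θ x') ↔ X.step x x')

namespace Reindexing

variable (φ : Reindexing Y X)

theorem root : φ.θ X.game.root = Y.game.root :=
  Y.ext fun i => (φ.lt i _).symm.trans ((X.root _).trans (Y.root _).symm)

theorem injective : Function.Injective φ.θ := fun x x' h => X.ext fun j => by
  obtain ⟨i, rfl⟩ := φ.e.surjective j
  rw [φ.lt, φ.lt, h]

/-- The relation given by a reindexing. -/
def rel : Set (List (Y.game.Pos × X.game.Pos)) :=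
  {s | Along (SyncStep Y.game X.game) (Y.game.root, X.game.root) s ∧
    ∀ p ∈ s, p.1 = φ.θ p.2 ∧ φ.D p.2}

theorem along₂ : Along₂ φ.θ φ.rel := fun _ h p hp => (h.2 p hp).1

theorem matchedBy {s : List (Y.game.Pos × X.game.Pos)} (h : s ∈ φ.rel) :
    MatchedBy Y X (fun i j => φ.e i = j) s where
  inj h h' := φ.e.injective (h.trans h'.symm)
  func h h' := h.symm.trans h'
  matched p hp := by
    refine ⟨?_, fun i _ => ⟨_, rfl⟩, fun j _ => ⟨_, φ.e.apply_symm_apply j⟩⟩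
    rintro i j rfl
    rw [φ.lt, (h.2 p hp).1]

theorem isTransl_rel : IsTransl Y.game X.game φ.rel := by
  have hp : ∀ s t, s ++ t ∈ φ.rel → s ∈ φ.rel := fun s t h =>
    ⟨((along_append _ _ _).1 h.1).1, fun p hp => h.2 p (List.mem_append_left _ hp)⟩
  refine ⟨fun s h => h.1, ⟨trivial, fun p hp => by cases hp⟩, hp,
    fun s hs t ht => syncCoh_of_prefix hp ?_ (c := []) hs ht, ?_⟩
  · intro c q q' h h'
    have e := (h.2 q (by simp)).1
    have e' := (h'.2 q' (by simp)).1
    exact ⟨fun _ h => φ.injective (e.symm.trans (h.trans e')), fun h => by rw [e, e', h]⟩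
  · intro s t h q
    have hb := φ.matchedBy h
    exact fresh_iff_of_matched hb.last (fun p hp => hb.matched p (List.mem_append_right _ hp))
      ((along_append _ _ _).1 h.1).2 q

/-- The matching is the bijection of indices. The paths of the relation stay in the domain `D`,
where a step of `X` and its image in `Y` are admissible at the same time. -/
theorem canonical_rel : Canonical Y X φ.rel where
  sync _ h := h.1
  matched s h := ⟨_, φ.matchedBy h⟩
  adm s h := by
    have hr : (Y.game.root, X.game.root).1 = φ.θ (Y.game.root, X.game.root).2 := φ.root.symm
    have a := h.1.and (along_of_forall (C := fun p => p.1 = φ.θ p.2) hr fun p hp => (h.2 p hp).1)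
    have d : Along (fun _ q => φ.D q.2) (Y.game.root, X.game.root) s := by
      have h := fun p hp => (h.2 p hp).2
      clear * - h
      generalize (Y.game.root, X.game.root) = r
      induction s generalizing r with
      | nil => trivial
      | cons q s ih =>
        exact ⟨h q (List.mem_cons_self ..), ih (fun p hp => h p (List.mem_cons_of_mem _ hp)) q⟩
    have key : ∀ p q : Y.game.Pos × X.game.Pos,
        (SyncStep Y.game X.game p q ∧ p.1 = φ.θ p.2 ∧ q.1 = φ.θ q.2) ∧ φ.D q.2 →
        (Y.step p.1 q.1 ↔ X.step p.2 q.2) := by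
      rintro p q ⟨⟨⟨m, -, h⟩, e, e'⟩, h'⟩
      rw [e, e']
      exact φ.step ⟨m, h⟩ h'
    refine (along_map Prod.fst (Y.game.root, X.game.root) s).trans (Iff.trans ⟨fun h => ?_,
      fun h => ?_⟩ (along_map Prod.snd (Y.game.root, X.game.root) s).symm)
    · exact (h.and (a.and d)).mono fun p q h => (key p q h.2).1 h.1
    · exact (h.and (a.and d)).mono fun p q h => (key p q h.2).2 h.1
  lift t ht := by
    refine ⟨t.map fun x => (φ.θ x, x), ⟨?_, fun p hp => ?_⟩,
      by simp [Function.comp_def]⟩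
    · have := (along_map (R := SyncStep Y.game X.game) (fun x => (φ.θ x, x)) X.game.root t).2
        (ht.mono fun x x' h => (X.step_edge h).imp fun m h => ⟨φ.move h, h⟩)
      rwa [φ.root] at this
    · obtain ⟨x, hx, rfl⟩ := List.mem_map.1 hp
      refine ⟨rfl, ?_⟩
      have : ∀ (r : X.game.Pos), Along X.step r t → ∀ x ∈ t, φ.D x := by
        clear * -
        induction t with
        | nil => exact fun _ _ _ h => by cases h
        | cons y t ih =>
          rintro r ⟨h, h'⟩ x (_ | ⟨_, hx⟩)
          · exact φ.dom h
          · exact ih y h' x hx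
      exact this _ ht x hx

/-- The morphism given by a reindexing. -/
def hom : Hom Y.game X.game := φ.isTransl_rel.hom

theorem isCan : IsCan Y X φ.hom := ⟨_, φ.canonical_rel, rfl⟩

end Reindexing

theorem _root_.MBGame.GameIso.canonical (φ : GameIso Y.game X.game) (e : Y.I ≃ X.I)
    (hl : ∀ i y, X.lt (e i) (φ.e y) = Y.lt i y)
    (hs : ∀ x y, X.step (φ.e x) (φ.e y) ↔ Y.step x y) : Canonical Y X φ.graph := by
  let ψ : Reindexing Y X :=
    { e := e
      θ := φ.e.symm
      D := fun _ => True
      lt := fun i x => by rw [← hl, Equiv.apply_symm_apply]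
      move := fun h => (φ.symm.move _ _ _).2 h
      dom := fun _ => trivial
      step := fun _ _ => by rw [← hs, Equiv.apply_symm_apply, Equiv.apply_symm_apply] }
  have : φ.graph = ψ.rel := by
    ext s
    constructor
    · intro h
      exact ⟨φ.isTransl_graph.sync s h, fun p hp => ⟨(φ.e.symm_apply_eq.2 (h.2 p hp)).symm, trivial⟩⟩
    · rintro ⟨h, h'⟩
      exact ⟨h.mono fun p q h => h.imp fun _ h => h.1,
        fun p hp => (φ.e.symm_apply_eq.1 (h' p hp).1.symm)⟩
  rw [this]
  exact ψ.canonical_rel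

theorem _root_.MBGame.GameIso.isCan (φ : GameIso Y.game X.game) (e : Y.I ≃ X.I)
    (hl : ∀ i y, X.lt (e i) (φ.e y) = Y.lt i y)
    (hs : ∀ x y, X.step (φ.e x) (φ.e y) ↔ Y.step x y) : IsCan Y X φ.hom :=
  ⟨_, φ.canonical e hl hs, rfl⟩

theorem canonical_refl (Y : Family A) : Canonical Y Y (GameIso.refl Y.game).graph :=
  (GameIso.refl Y.game).canonical (Equiv.refl _) (fun _ _ => rfl) fun _ _ => Iff.rfl

theorem isCan_id (Y : Family A) : IsCan Y Y (gameCat.id Y.game) := by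
  rw [← GameIso.hom_refl]
  exact ⟨_, canonical_refl Y, rfl⟩

theorem canonical_assoc_symm (X Y Z : Family A) :
    Canonical (X.tensor (Y.tensor Z)) ((X.tensor Y).tensor Z)
      (GameIso.assoc X.game Y.game Z.game).symm.graph := by
  refine GameIso.canonical (Y := X.tensor (Y.tensor Z)) (X := (X.tensor Y).tensor Z)
    (GameIso.assoc X.game Y.game Z.game).symm (Equiv.sumAssoc _ _ _).symm ?_ ?_
  · rintro (i | i | i) y <;> rfl
  · rintro ⟨x, y, z⟩ ⟨x', y', z'⟩
    simp only [GameIso.symm, GameIso.assoc, Equiv.prodAssoc_symm_apply, Prod.mk.injEq]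
    tauto

theorem isCan_assoc (X Y Z : Family A) :
    IsCan ((X.tensor Y).tensor Z) (X.tensor (Y.tensor Z))
      (GameIso.assoc X.game Y.game Z.game).hom := by
  refine GameIso.isCan (X := X.tensor (Y.tensor Z)) (Y := (X.tensor Y).tensor Z)
    (GameIso.assoc X.game Y.game Z.game) (Equiv.sumAssoc _ _ _) ?_ ?_
  · rintro ((i | i) | i) y <;> rfl
  · rintro ⟨⟨x, y⟩, z⟩ ⟨⟨x', y'⟩, z'⟩
    simp only [GameIso.assoc, Equiv.prodAssoc_apply, Prod.mk.injEq]
    tauto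

theorem isCan_swap (X Y : Family A) :
    IsCan (X.tensor Y) (Y.tensor X) (GameIso.swap X.game Y.game).hom := by
  refine GameIso.isCan (Y := X.tensor Y) (X := Y.tensor X)
    (GameIso.swap X.game Y.game) (Equiv.sumComm _ _) ?_ ?_
  · rintro (i | i) y <;> rfl
  · rintro ⟨x, y⟩ ⟨x', y'⟩
    exact Or.comm

theorem isCan_unitRight_symm (X : Family A) :
    IsCan X (X.tensor (unit A)) (GameIso.unitRight X.game).symm.hom := by
  refine GameIso.isCan (Y := X) (X := X.tensor (unit A))
    (GameIso.unitRight X.game).symm (Equiv.sumEmpty _ _).symm ?_ ?_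
  · intro i y
    rfl
  · intro x y
    exact ⟨fun h => h.elim And.left fun h => h.1.elim, fun h => Or.inl ⟨h, rfl⟩⟩

theorem isCan_unitLeft_symm (X : Family A) :
    IsCan X ((unit A).tensor X) (GameIso.unitLeft X.game).symm.hom := by
  refine GameIso.isCan (Y := X) (X := (unit A).tensor X)
    (GameIso.unitLeft X.game).symm (Equiv.emptySum _ _).symm ?_ ?_
  · intro i y
    rfl
  · intro x y
    exact ⟨fun h => h.elim (fun h => h.1.elim) And.left, fun h => Or.inr ⟨h, rfl⟩⟩

end Family

theorem comp_set {X Y Z : MBGame.{u}} (f : Hom X Y) (g : Hom Y Z) :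
    (gameCat.comp f g).set = compPlays X Y Z f.set g.set := rfl

theorem tensorHom_set {X X' Y Y' : MBGame.{u}} (f : Hom X X') (g : Hom Y Y') :
    (tensorHom f g).set = tensorPlays X X' Y Y' f.set g.set := rfl

/-! ## The comonoid structure of the exponential -/

open Family

/-- The comultiplication of `!A`. -/
def bangComul (A : MBGame.{u}) : Hom A.bang (A.bang.tensor A.bang) :=
  can ((Family.bang A).tensor (Family.bang A))

/-- The counit of `!A`. -/
def bangCounit (A : MBGame.{u}) : Hom A.bang one := can (Family.unit A)

/-- The dereliction `!A → A`. -/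
def bangCoer (A : MBGame.{u}) : Hom A.bang A := can (Family.self A)

variable (A : MBGame.{u})

theorem isCan_comul : IsCan (Family.bang A) ((Family.bang A).tensor (Family.bang A))
    (bangComul A) := isCan_can _

theorem isCan_counit : IsCan (Family.bang A) (Family.unit A) (bangCounit A) := isCan_can _

theorem isCan_coer : IsCan (Family.bang A) (Family.self A) (bangCoer A) := isCan_can _

theorem isCan_id_bang : IsCan (Family.bang A) (Family.bang A) (gameCat.id A.bang) := isCan_id _

/-- This law and the next three hold because both sides are canonical morphisms from `!A` to the
same family. -/
theorem bang_counit_comul : gameCat.comp (bangComul A)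
    (tensorHom (bangCounit A) (gameCat.id A.bang)) = (GameIso.unitLeft A.bang).symm.hom :=
  ((isCan_comul A).comp ((isCan_counit A).tensor (isCan_id_bang A))).eq
    (isCan_unitLeft_symm (Family.bang A))

theorem bang_comul_counit : gameCat.comp (bangComul A)
    (tensorHom (gameCat.id A.bang) (bangCounit A)) = (GameIso.unitRight A.bang).symm.hom :=
  ((isCan_comul A).comp ((isCan_id_bang A).tensor (isCan_counit A))).eq
    (isCan_unitRight_symm (Family.bang A))

theorem bang_comul_assoc : gameCat.comp (bangComul A)
    (tensorHom (gameCat.id A.bang) (bangComul A)) = gameCat.comp (bangComul A)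
      (gameCat.comp (tensorHom (bangComul A) (gameCat.id A.bang))
        (GameIso.assoc A.bang A.bang A.bang).hom) :=
  ((isCan_comul A).comp ((isCan_id_bang A).tensor (isCan_comul A))).eq
    ((isCan_comul A).comp (((isCan_comul A).tensor (isCan_id_bang A)).comp
      (isCan_assoc (Family.bang A) (Family.bang A) (Family.bang A))))

theorem bang_comul_comm : gameCat.comp (bangComul A) (GameIso.swap A.bang A.bang).hom =
    bangComul A :=
  ((isCan_comul A).comp (isCan_swap (Family.bang A) (Family.bang A))).eq (isCan_comul A)

end MBGame

open MBGame

/-- The comonoid structure of `!A`. -/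
instance bangComonObj (A : gameTensor.{u}.Obj) : ComonObj (gameTensor.bang A) where
  counit := bangCounit A
  comul := bangComul A
  counit_comul := bang_counit_comul A
  comul_counit := bang_comul_counit A
  comul_assoc := bang_comul_assoc A

instance isCommComonObj_bang (A : gameTensor.{u}.Obj) : IsCommComonObj (gameTensor.bang A) where
  comul_comm := bang_comul_comm A

/-! ## Opening the first copy -/

namespace MBGame

open ConwayGame

variable (A : MBGame.{u})

namespace Family

theorem letter_zero_eq_root_iff {A : MBGame.{u}} {w : A.BangPos} :
    A.letter 0 w = A.root ↔ w = [] := by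
  rw [← not_iff_not, ← ne_eq, letter_ne_root_iff, List.length_pos_iff]

theorem move_uncons {A : MBGame.{u}} {m : ℤˣ} {w w' : A.BangPos} (h : A.bang.Move m w w') :
    (A.tensor A.bang).Move m (A.letter 0 w, w.tail) (A.letter 0 w', w'.tail) := by
  cases h with
  | play w₁ w₂ x y h =>
    cases w₁ with
    | nil => exact Or.inl ⟨h, rfl⟩
    | cons z w₁ => exact Or.inr ⟨rfl, BangMove.play w₁ w₂ x y h⟩
  | openCopy _ x h =>
    cases w with
    | nil => exact Or.inl ⟨h, rfl⟩
    | cons z w => exact Or.inr ⟨rfl, BangMove.openCopy w x h⟩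

/-- A word of positions is a first letter, which is not opened if the word is empty, followed by
a word. -/
def uncons : Reindexing ((self A).tensor (bang A)) (bang A) where
  e := 
    { toFun := fun i => i.elim (fun _ => 0) (· + 1)
      invFun := fun i => i.casesOn (.inl ()) .inr
      left_inv := by rintro (_ | i) <;> rfl
      right_inv := by rintro (_ | i) <;> rfl }
  θ w := (A.letter 0 w, w.tail)
  D _ := True
  lt i w := by
    rcases i with _ | i
    · rfl
    · cases w <;> rfl
  move := move_uncons
  dom _ := trivial
  step := by
    rintro w w' ⟨m, h⟩ -
    refine iff_of_true ?_ ⟨m, h⟩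
    rcases move_uncons h with ⟨k, e⟩ | ⟨e, k⟩
    · refine Or.inl ⟨⟨⟨m, k⟩, fun e' => ?_⟩, e.symm⟩
      rw [e']
      exact (bang_open h e' fun e => A.no_return (e ▸ k)).2.2
    · exact Or.inr ⟨⟨m, k⟩, e.symm⟩

/-- Two copies of the exponential, where the first one is opened first. -/
abbrev leftFirst : Family A :=
  { (bang A).tensor (bang A) with
    step := fun x y => (A.bang.tensor A.bang).Edge x y ∧ (y.1 = [] → y.2 = [])
    step_edge := fun h => h.1
    opp := fun {x y i} h h₁ h₂ => by
      refine ((bang A).tensor (bang A)).opp (x := x) (y := y) (i := i) ?_ h₁ h₂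
      exact (edge_tensor.1 h.1).imp (fun h => ⟨h.1, h.2.symm⟩) fun h => ⟨h.2, h.1.symm⟩ }

/-- The restriction to the paths in which the first exponential is opened first. -/
def restrictLeft : Reindexing ((bang A).tensor (bang A)) (leftFirst A) where
  e := Equiv.refl _
  θ x := x
  D x := x.1 = [] → x.2 = []
  lt _ _ := rfl
  move h := h
  dom h := h.2
  step h h' := iff_of_true
    ((edge_tensor.1 h).imp (fun h => ⟨h.1, h.2.symm⟩) fun h => ⟨h.2, h.1.symm⟩) ⟨h, h'⟩

theorem Along₂.comp {Y X Z : MBGame.{u}} {P : Set (List (Y.Pos × X.Pos))}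
    {Q : Set (List (X.Pos × Z.Pos))} {θ : X.Pos → Y.Pos} {θ' : Z.Pos → X.Pos} (hP : IsSync Y X P)
    (hQ : IsSync X Z Q) (h : Along₂ θ P) (h' : Along₂ θ' Q) :
    Along₂ (fun z => θ (θ' z)) (compTr Y.root X.root Z.root P Q) := by
  intro s hs p hp
  obtain ⟨u, h₁, h₂, rfl⟩ := (mem_compTr_iff hP hQ).1 hs
  obtain ⟨x, hx, rfl⟩ := List.mem_map.1 hp
  have e := h _ h₁ _ (List.mem_map_of_mem hx)
  have e' := h' _ h₂ _ (List.mem_map_of_mem hx)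
  exact e.trans (congrArg θ e')

theorem Along₂.prod {Y X Y' X' : MBGame.{u}} {P : Set (List (Y.Pos × X.Pos))}
    {Q : Set (List (Y'.Pos × X'.Pos))} {θ : X.Pos → Y.Pos} {θ' : X'.Pos → Y'.Pos}
    (hr : Y.root = θ X.root) (hr' : Y'.root = θ' X'.root) (h : Along₂ θ P) (h' : Along₂ θ' Q) :
    Along₂ (fun z => (θ z.1, θ' z.2)) (prodRel Y X Y' X' P Q) := by
  intro s hs p hp
  refine Prod.ext ?_ ?_
  · exact forall_of_project (π := fun p => (p.1.1, p.2.1)) (R := fun p => p.1 = θ p.2)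
      (x := ((Y.root, Y'.root), (X.root, X'.root))) hr (h _ hs.2.1) p hp
  · exact forall_of_project (π := fun p => (p.1.2, p.2.2)) (R := fun p => p.1 = θ' p.2)
      (x := ((Y.root, Y'.root), (X.root, X'.root))) hr' (h' _ hs.2.2) p hp

theorem along₂_graph {Y X : MBGame.{u}} (φ : GameIso Y X) : Along₂ φ.e.symm φ.graph :=
  fun _ h p hp => (φ.e.symm_apply_eq.2 (h.2 p hp)).symm

end Family

open Family

/-- The relation that opens the first copy of the first exponential, before anything else happens. -/
def openLeftRel : Set (List ((A.Pos × A.BangPos × A.BangPos) × (A.BangPos × A.BangPos))) :=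
  compTr (A.tensor (A.bang.tensor A.bang)).root ((A.tensor A.bang).tensor A.bang).root
    (A.bang.tensor A.bang).root (GameIso.assoc A A.bang A.bang).symm.graph
    (compTr ((A.tensor A.bang).tensor A.bang).root (A.bang.tensor A.bang).root
      (A.bang.tensor A.bang).root
      (prodRel (A.tensor A.bang) A.bang A.bang A.bang (uncons A).rel (GameIso.refl A.bang).graph)
      (restrictLeft A).rel)

/-- The morphism given by the relation `openLeftRel`. -/
def openLeft : Hom (A.tensor (A.bang.tensor A.bang)) (A.bang.tensor A.bang) :=
  gameCat.comp (GameIso.assoc A A.bang A.bang).symm.hom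
    (gameCat.comp (tensorHom (uncons A).hom (gameCat.id A.bang)) (restrictLeft A).hom)

theorem isSync_uncons_prod : IsSync ((A.tensor A.bang).tensor A.bang) (A.bang.tensor A.bang)
    (prodRel (A.tensor A.bang) A.bang A.bang A.bang (uncons A).rel (GameIso.refl A.bang).graph) :=
  isSync_prodRel

theorem isSync_restrictLeft : IsSync (A.bang.tensor A.bang) (A.bang.tensor A.bang)
    (restrictLeft A).rel := (restrictLeft A).isTransl_rel.sync

theorem isSync_openLeftRel :
    IsSync (A.tensor (A.bang.tensor A.bang)) (A.bang.tensor A.bang) (openLeftRel A) :=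
  (GameIso.assoc A A.bang A.bang).symm.isTransl_graph.sync.comp
    ((isSync_uncons_prod A).comp (isSync_restrictLeft A))

theorem openLeft_set : (openLeft A).set = translPlays (A.tensor (A.bang.tensor A.bang))
    (A.bang.tensor A.bang) (openLeftRel A) := by
  refine Eq.trans ?_ (transl_compPlays_transl
    (GameIso.assoc A A.bang A.bang).symm.isTransl_graph.sync
    ((isSync_uncons_prod A).comp (isSync_restrictLeft A)))
  rw [openLeft, comp_set, comp_set, tensorHom_set]
  refine congrArg (compPlays (A.tensor (A.bang.tensor A.bang)) ((A.tensor A.bang).tensor A.bang)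
    (A.bang.tensor A.bang) (GameIso.assoc A A.bang A.bang).symm.hom.set) ?_
  refine Eq.trans ?_ (transl_compPlays_transl (isSync_uncons_prod A) (isSync_restrictLeft A))
  refine congrArg (fun S => compPlays ((A.tensor A.bang).tensor A.bang) (A.bang.tensor A.bang)
    (A.bang.tensor A.bang) S (restrictLeft A).hom.set) ?_
  refine Eq.trans ?_ (tensorPlays_transl (uncons A).isTransl_rel.sync
    (GameIso.refl A.bang).isTransl_graph.sync)
  exact congrArg (tensorPlays (A.tensor A.bang) A.bang A.bang A.bang (uncons A).hom.set)
    (GameIso.plays_refl (Y := A.bang)).symm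

theorem canonical_openLeftRel : Canonical ((self A).tensor ((Family.bang A).tensor (Family.bang A)))
    (leftFirst A) (openLeftRel A) :=
  (canonical_assoc_symm (self A) (Family.bang A) (Family.bang A)).comp
    (((uncons A).canonical_rel.tensor (canonical_refl (Family.bang A))).comp
      (restrictLeft A).canonical_rel)

variable {A}

theorem restrictLeft_adm {s : List ((A.BangPos × A.BangPos) × (A.BangPos × A.BangPos))}
    (h : s ∈ (restrictLeft A).rel) : (leftFirst A).adm (s.map Prod.snd) := by
  refine ((restrictLeft A).canonical_rel.adm s h).1 ?_
  refine (along_map Prod.fst ((A.bang.tensor A.bang).root, (A.bang.tensor A.bang).root) s).2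
    (h.1.mono fun p q h => ?_)
  obtain ⟨m, h, -⟩ := h
  exact (edge_tensor.1 ⟨m, h⟩).imp (fun h => ⟨h.1, h.2.symm⟩) fun h => ⟨h.2, h.1.symm⟩

theorem adm_of_mem_compTr {Y X : MBGame.{u}} {Z : Family A} {P : Set (List (Y.Pos × X.Pos))}
    {Q : Set (List (X.Pos × Z.game.Pos))} (hP : IsSync Y X P) (hQ : IsSync X Z.game Q)
    (h : ∀ s ∈ Q, Z.adm (s.map Prod.snd)) {s : List (Y.Pos × Z.game.Pos)}
    (hs : s ∈ compTr Y.root X.root Z.game.root P Q) : Z.adm (s.map Prod.snd) := by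
  obtain ⟨u, h₁, h₂, rfl⟩ := (mem_compTr_iff hP hQ).1 hs
  have := h _ h₂
  rwa [List.map_map] at this ⊢

theorem openLeftRel_adm {s : List ((A.Pos × A.BangPos × A.BangPos) × (A.BangPos × A.BangPos))}
    (h : s ∈ openLeftRel A) : (leftFirst A).adm (s.map Prod.snd) :=
  adm_of_mem_compTr (Z := leftFirst A) (GameIso.assoc A A.bang A.bang).symm.isTransl_graph.sync
    ((isSync_uncons_prod A).comp (isSync_restrictLeft A)) (fun s hs =>
      adm_of_mem_compTr (Z := leftFirst A) (isSync_uncons_prod A) (isSync_restrictLeft A)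
        (fun s hs => restrictLeft_adm hs) hs) h

theorem mem_openLeftRel {s : List ((A.Pos × A.BangPos × A.BangPos) × (A.BangPos × A.BangPos))}
    (h : s ∈ openLeftRel A) {p : (A.Pos × A.BangPos × A.BangPos) × (A.BangPos × A.BangPos)}
    (hp : p ∈ s) : p.1 = (A.letter 0 p.2.1, p.2.1.tail, p.2.2) ∧ (p.2.1 = [] → p.2.2 = []) := by
  refine ⟨?_, ?_⟩
  · exact Along₂.comp (GameIso.assoc A A.bang A.bang).symm.isTransl_graph.sync
      ((isSync_uncons_prod A).comp (isSync_restrictLeft A)) (along₂_graph _)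
      (Along₂.comp (isSync_uncons_prod A) (isSync_restrictLeft A)
        (Along₂.prod (θ := (uncons A).θ) rfl rfl (uncons A).along₂ (along₂_graph _)) (restrictLeft A).along₂) s h p hp
  · have h := openLeftRel_adm h
    have key : ∀ (t : List (A.BangPos × A.BangPos)) r, Along (leftFirst A).step r t → ∀ x ∈ t,
        x.1 = [] → x.2 = [] := by
      intro t
      induction t with
      | nil => exact fun _ _ _ h => by cases h
      | cons y t ih =>
        rintro r ⟨h, h'⟩ x (_ | ⟨_, hx⟩)
        · exact h.2
        · exact ih y h' x hx
    exact key _ _ h _ (List.mem_map_of_mem hp)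

variable (A)

/-- Separating one copy from the others and putting it back in front is canonical from `!A` to
itself, hence equal to the identity. This identity forces every comonoid morphism into `!A` to
satisfy the unfolding equation. -/
theorem comul_coer_uncons : gameCat.comp (bangComul A)
    (gameCat.comp (tensorHom (bangCoer A) (gameCat.id A.bang)) (uncons A).hom) =
      gameCat.id A.bang :=
  ((isCan_comul A).comp (((isCan_coer A).tensor (isCan_id_bang A)).comp (uncons A).isCan)).eq
    (isCan_id_bang A)

/-- Without a guard, Opponent could open either `A` or the first copy of `!A`. If `!A` stays empty
as long as `A` is unopened, the choice disappears: what is opened next is `A` at first, and then the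
copy at the end of the word. -/
theorem rigid_uncons : Rigid ((self A).tensor (Family.bang A)) fun t =>
    Along (A.tensor A.bang).Edge (A.root, []) t ∧ ∀ y ∈ t, y.1 = A.root → y.2 = [] := by
  rintro t y y' i i' ⟨h, k⟩ ⟨h', k'⟩ h₁ h₂ h₁' h₂'
  have hr : (t.getLastD (A.root, ([] : A.BangPos))).1 = A.root →
      (t.getLastD (A.root, ([] : A.BangPos))).2 = [] := by
    rcases List.eq_nil_or_concat t with rfl | ⟨t, z, rfl⟩
    · exact fun _ => rfl
    · rw [List.concat_eq_append] at k ⊢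
      rw [getLastD_append]
      exact k z (by simp)
  have ky := k y (by simp)
  have ky' := k' y' (by simp)
  have h := ((along_append _ _ _).1 h).2.1
  have h' := ((along_append _ _ _).1 h').2.1
  change Sum Unit ℕ at i i'
  change i.elim (fun _ => (t.getLastD (A.root, ([] : A.BangPos))).1)
    (fun j => A.letter j (t.getLastD (A.root, ([] : A.BangPos))).2) = A.root at h₁
  change i'.elim (fun _ => (t.getLastD (A.root, ([] : A.BangPos))).1)
    (fun j => A.letter j (t.getLastD (A.root, ([] : A.BangPos))).2) = A.root at h₁'
  change i.elim (fun _ => y.1) (fun j => A.letter j y.2) ≠ A.root at h₂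
  change i'.elim (fun _ => y'.1) (fun j => A.letter j y'.2) ≠ A.root at h₂'
  generalize t.getLastD (A.root, ([] : A.BangPos)) = z at *
  have key : ∀ (w : A.Pos × A.BangPos) (j : ℕ), (A.tensor A.bang).Edge z w →
      (w.1 = A.root → w.2 = []) → A.letter j z.2 = A.root → A.letter j w.2 ≠ A.root →
      z.1 ≠ A.root ∧ j = z.2.length := by
    intro w j hw hw' h₁ h₂
    rcases edge_tensor.1 hw with ⟨-, e⟩ | ⟨e, m, hm⟩
    · exact (h₂ (e ▸ h₁)).elim
    · refine ⟨fun e' => h₂ ?_, (bang_open hm h₁ h₂).1⟩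
      rw [hw' (e ▸ e')]
      rfl
  rcases i with ⟨⟩ | i <;> rcases i' with ⟨⟩ | i'
  · rfl
  · exact ((key y' i' h' ky' h₁' h₂').1 h₁).elim
  · exact ((key y i h ky h₁ h₂).1 h₁').elim
  · rw [(key y' i' h' ky' h₁' h₂').2, (key y i h ky h₁ h₂).2]

/-- On the left-hand side the member `A` may end up in either exponential, whereas `openLeft` always
puts it in the left one; the restriction to plays that open the left exponential first removes the
difference. The source is `A ⊗ !A` and not `!A`, so uniqueness of the canonical relation is derived
from `rigid_uncons`, whose guard has to be checked on both sides. -/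
theorem uncons_comul_restrictLeft :
    gameCat.comp (uncons A).hom (gameCat.comp (bangComul A) (restrictLeft A).hom) =
      gameCat.comp (tensorHom (gameCat.id A) (bangComul A)) (openLeft A) := by
  let Q := canRel ((Family.bang A).tensor (Family.bang A))
  have hQ : IsSync A.bang (A.bang.tensor A.bang) Q :=
    (isTransl_canRel ((Family.bang A).tensor (Family.bang A))).sync
  have c₁ := (uncons A).canonical_rel.comp ((canonical_canRel
    ((Family.bang A).tensor (Family.bang A))).comp (restrictLeft A).canonical_rel)
  have c₂ := ((canonical_refl (self A)).tensor (canonical_canRel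
    ((Family.bang A).tensor (Family.bang A)))).comp (canonical_openLeftRel A)
  have s₁ : IsSync A.bang (A.bang.tensor A.bang) (compTr A.bang.root (A.bang.tensor A.bang).root
    (A.bang.tensor A.bang).root Q (restrictLeft A).rel) := hQ.comp (isSync_restrictLeft A)
  have s₂ : IsSync (A.tensor A.bang) (A.tensor (A.bang.tensor A.bang)) (prodRel A A A.bang
    (A.bang.tensor A.bang) (GameIso.refl A).graph Q) := isSync_prodRel
  have e : _ = _ := Canonical.eq c₁ c₂
    (fun s hs => adm_of_mem_compTr (Z := leftFirst A) (uncons A).isTransl_rel.sync s₁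
      (fun s hs => adm_of_mem_compTr (Z := leftFirst A) hQ (isSync_restrictLeft A)
        (fun s hs => restrictLeft_adm hs) hs) hs)
    (fun s hs => adm_of_mem_compTr (Z := leftFirst A) s₂ (isSync_openLeftRel A)
      (fun s hs => openLeftRel_adm hs) hs)
    (fun s hs s' hs' e => by
      obtain ⟨b, hb⟩ := c₁.matched s hs
      obtain ⟨b', hb'⟩ := c₂.matched s' hs'
      have edge : ∀ {s : List ((A.Pos × A.BangPos) × (A.BangPos × A.BangPos))},
          Along (SyncStep (A.tensor A.bang) (A.bang.tensor A.bang))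
            ((A.root, []), ([], [])) s →
          Along (A.tensor A.bang).Edge (A.root, []) (s.map Prod.fst) := fun {s} h =>
        (along_map Prod.fst (((A.root, []), ([], [])) : (A.Pos × A.BangPos) ×
          (A.BangPos × A.BangPos)) s).2 (h.mono fun p q h => h.imp fun _ h => h.1)
      refine eq_of_map_snd_eq (rigid_uncons A) (fun s t h => ⟨((along_append _ _ _).1 h.1).1,
        fun y hy => h.2 y (List.mem_append_left _ hy)⟩) hb hb' (c₁.sync s hs) (c₂.sync s' hs')
        ⟨edge (c₁.sync s hs), ?_⟩ ⟨edge (c₂.sync s' hs'), ?_⟩ e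
      · intro y hy
        obtain ⟨u, h₁, -, rfl⟩ := (mem_compTr_iff (uncons A).isTransl_rel.sync s₁).1 hs
        rw [List.map_map] at hy
        obtain ⟨x, hx, rfl⟩ := List.mem_map.1 hy
        have := (uncons A).along₂ _ h₁ _ (List.mem_map_of_mem hx)
        dsimp only [Function.comp] at this ⊢
        rw [this]
        intro h
        rw [letter_zero_eq_root_iff.1 h]
        rfl
      · intro y hy
        obtain ⟨u, h₁, h₂, rfl⟩ := (mem_compTr_iff s₂ (isSync_openLeftRel A)).1 hs'
        rw [List.map_map] at hy
        obtain ⟨x, hx, rfl⟩ := List.mem_map.1 hy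
        obtain ⟨e₁, e₂⟩ := mem_openLeftRel h₂ (List.mem_map_of_mem hx)
        obtain ⟨b, hb⟩ := (canonical_canRel _).matched _ h₁.2.2
        have e₃ := forall_of_project (π := fun p => (p.1.1, p.2.1)) (R := fun p => p.2 = p.1)
          (x := ((A.root, A.bang.root), (A.root, (A.bang.tensor A.bang).root))) rfl h₁.2.1.2 _
          (List.mem_map_of_mem hx)
        have e₄ := forall_of_project (π := fun p => (p.1.2, p.2.2))
          (R := Matched (Family.bang A) ((Family.bang A).tensor (Family.bang A)) b)
          (x := ((A.root, A.bang.root), (A.root, (A.bang.tensor A.bang).root))) (matched_root b)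
          hb.matched _ (List.mem_map_of_mem hx)
        dsimp only [Function.comp] at e₁ e₂ e₃ e₄ ⊢
        -- If `A` is unopened, the left exponential of the target is empty, hence the right one is
        -- empty too by the restriction. The word in the source is matched with these two, so it is
        -- empty.
        intro hr
        rw [← e₃, e₁] at hr
        have hn := letter_zero_eq_root_iff.1 hr
        rw [e₁, hn, e₂ hn] at e₄
        by_contra hne
        obtain ⟨j, hj⟩ := e₄.2.1 0 fun h => hne (letter_zero_eq_root_iff.1 h)
        refine hne (letter_zero_eq_root_iff.1 ((e₄.1 0 j hj).trans ?_))
        rcases j with j | j <;> rfl)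
  apply Hom.ext_set
  have t₁ : (gameCat.comp (uncons A).hom (gameCat.comp (bangComul A) (restrictLeft A).hom)).set =
      translPlays (A.tensor A.bang) (A.bang.tensor A.bang) (compTr (A.tensor A.bang).root
        A.bang.root (A.bang.tensor A.bang).root (uncons A).rel (compTr A.bang.root
        (A.bang.tensor A.bang).root (A.bang.tensor A.bang).root Q (restrictLeft A).rel)) := by
    rw [comp_set, comp_set]
    refine Eq.trans ?_ (transl_compPlays_transl (uncons A).isTransl_rel.sync s₁)
    exact congrArg (compPlays (A.tensor A.bang) A.bang (A.bang.tensor A.bang) (uncons A).hom.set)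
      (transl_compPlays_transl hQ (isSync_restrictLeft A))
  have t₂ : (gameCat.comp (tensorHom (gameCat.id A) (bangComul A)) (openLeft A)).set =
      translPlays (A.tensor A.bang) (A.bang.tensor A.bang) (compTr (A.tensor A.bang).root
        (A.tensor (A.bang.tensor A.bang)).root (A.bang.tensor A.bang).root (prodRel A A A.bang
        (A.bang.tensor A.bang) (GameIso.refl A).graph Q) (openLeftRel A)) := by
    rw [comp_set, tensorHom_set, openLeft_set]
    refine Eq.trans ?_ (transl_compPlays_transl s₂ (isSync_openLeftRel A))
    refine congrArg (fun S => compPlays (A.tensor A.bang) (A.tensor (A.bang.tensor A.bang))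
      (A.bang.tensor A.bang) S _) ?_
    refine Eq.trans ?_ (tensorPlays_transl (GameIso.refl A).isTransl_graph.sync hQ)
    exact congrArg (fun S => tensorPlays A A A.bang (A.bang.tensor A.bang) S (bangComul A).set)
      (GameIso.plays_refl (Y := A)).symm
  exact t₁.trans ((congrArg (translPlays (A.tensor A.bang) (A.bang.tensor A.bang)) e).trans
    t₂.symm)

end MBGame

/-! ## Games in which Opponent starts -/

theorem Along.forall {X : Type*} {R : X → X → Prop} {C : X → Prop} (hC : ∀ p q, R p q → C p → C q)
    {x : X} {s : List X} (h : Along R x s) (hx : C x) : ∀ q ∈ s, C q := by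
  induction s generalizing x with
  | nil => exact fun _ h => by cases h
  | cons y s ih =>
    have hy := hC _ _ h.1 hx
    rintro q (_ | ⟨_, hq⟩)
    · exact hy
    · exact ih h.2 hy q hq

theorem getLastD_mem_or {X : Type*} (x : X) (s : List X) : s.getLastD x = x ∨ s.getLastD x ∈ s := by
  rcases List.eq_nil_or_concat s with rfl | ⟨s, y, rfl⟩
  · exact Or.inl rfl
  · right
    simp

namespace MBGame

open ConwayGame

variable {K X Y Z : MBGame.{u}}

/-- Player has no initial move. -/
def Negative (K : MBGame.{u}) : Prop := ∀ y, ¬ K.Move 1 K.root y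

theorem along_of_mem_plays {s : List (K.Pos × X.Pos)} (h : s ∈ Plays K X) :
    Along (K.dual.tensor X).Edge (K.root, X.root) s := ((isAlternating_iff _).1 h).1

theorem Negative.first (hK : K.Negative) {p : K.Pos × X.Pos} {s : List (K.Pos × X.Pos)}
    (h : p :: s ∈ Plays K X) : p.1 = K.root ∧ X.Move (-1) X.root p.2 := by
  rcases h.1 with h | h
  · refine (hK p.1 ?_).elim
    have := h.1
    rwa [move_dual, neg_neg] at this
  · exact ⟨h.1.symm, h.2⟩

theorem edge_snd {p q : K.Pos × X.Pos} (h : (K.dual.tensor X).Edge p q) :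
    q.2 = p.2 ∨ X.Edge p.2 q.2 :=
  (edge_tensor.1 h).imp (fun h => h.2.symm) And.right

/-- The first move of a nonempty play is made in `X`, and no move returns to the root of `X`. This
is the base case of the inductions on the length of final words. -/
theorem Negative.eq_nil (hK : K.Negative) {s : List (K.Pos × X.Pos)} (h : s ∈ Plays K X)
    (hl : (s.getLastD (K.root, X.root)).2 = X.root) : s = [] := by
  cases s with
  | nil => rfl
  | cons p s =>
    have hp := (hK.first h).2
    have := (along_of_mem_plays h).2.forall (C := fun q => q.2 ≠ X.root) (fun p q h hp => by
      rcases edge_snd h with e | ⟨m, e⟩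
      · rwa [e]
      · exact fun e' => X.no_return (e' ▸ e)) fun e => X.no_return (e ▸ hp)
    rw [List.getLastD_cons] at hl
    rcases getLastD_mem_or p s with e | e
    · exact (X.no_return ((e ▸ hl) ▸ hp)).elim
    · exact (this _ e hl).elim

/-- The morphisms from a game in which Opponent starts to the unit game are equal. -/
theorem Negative.hom_one_ext (hK : K.Negative) (f g : Hom K one) : f = g := by
  have key : ∀ f : Hom K one, f.set = {[]} := fun f => by
    ext s
    constructor
    · exact fun h => hK.eq_nil (f.isStrat.subset h) rfl
    · rintro rfl
      exact f.isStrat.nil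
  exact Hom.ext_set ((key f).trans (key g).symm)

/-- The game of a commutative comonoid has no initial Player move. -/
theorem negative_of_comul (d : Hom K (K.tensor K)) (e : Hom K one)
    (h₁ : gameCat.comp d (tensorHom e (gameCat.id K)) = (GameIso.unitLeft K).symm.hom)
    (h₂ : gameCat.comp d (GameIso.swap K K).hom = d) : K.Negative := by
  intro k hk
  have hcc : [(k, (PUnit.unit, K.root)), (k, (PUnit.unit, k))] ∈
      (gameCat.comp d (tensorHom e (gameCat.id K))).set := by
    rw [h₁]
    refine (GameIso.mem_plays (GameIso.unitLeft K).symm).2 (mem_idPlays.2 ?_)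
    exact ⟨rfl, Or.inl ⟨hk, rfl⟩, trivial⟩
  obtain ⟨u, hu₁, hu₂, hu₃, -⟩ := hcc
  obtain ⟨v, hv, ev⟩ := exists_noStutter (K.root, (K.tensor K).root, (one.tensor K).root) u
  rw [← ev] at hu₁ hu₂ hu₃
  have hs : ∀ z z', [(k, K.root, K.root), (k, z, z')] ∈ d.set →
      [(k, K.root, K.root), (k, z', z)] ∈ d.set := by
    intro z z' h
    rw [← h₂] at h
    exact (Set.ext_iff.1 ((GameIso.swap K K).compPlays_plays d.isStrat.subset) _).1 h
  cases v with
  | nil => cases hu₃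
  | cons p v =>
    obtain ⟨a, b, c⟩ := p
    -- A first step in the hidden game `K ⊗ K` would have to be an Opponent move there, as the
    -- beginning of a play of `d`, and a Player move there, as the beginning of a play of `e ⊗ id`.
    have hb : b = (K.tensor K).root := by
      by_contra hb
      rw [project_cons_of_ne (π := fun x : K.Pos × (K.tensor K).Pos × (one.tensor K).Pos =>
        (x.1, x.2.1)) (fun e => hb (Prod.mk.inj e).2)] at hu₁
      rw [project_cons_of_ne (π := fun x : K.Pos × (K.tensor K).Pos × (one.tensor K).Pos =>
        (x.2.1, x.2.2)) (fun e => hb (Prod.mk.inj e).1)] at hu₂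
      have m₁ := (d.isStrat.subset hu₁).1
      have m₂ := ((tensorHom e (gameCat.id K)).isStrat.subset hu₂).1
      rcases m₁ with m₁ | m₁
      · exact hb m₁.2.symm
      rcases m₂ with m₂ | m₂
      · exact absurd ((K.tensor K).pol_unique m₁.2 m₂.1) (by decide)
      · exact hb m₂.1.symm
    subst hb
    have hac : a = k ∧ c = (PUnit.unit, K.root) ∧ project (fun x => (x.1, x.2.2))
        (a, (K.tensor K).root, c) v = [(k, (PUnit.unit, k))] := by
      rw [project_cons_of_ne (π := fun x : K.Pos × (K.tensor K).Pos × (one.tensor K).Pos =>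
        (x.1, x.2.2)) (fun e => hv.1 (Prod.ext (Prod.mk.inj e).1
          (Prod.ext rfl (Prod.mk.inj e).2)))] at hu₃
      obtain ⟨e, e'⟩ := List.cons.inj hu₃
      exact ⟨(Prod.mk.inj e).1, (Prod.mk.inj e).2, e'⟩
    obtain ⟨rfl, rfl, hu₃⟩ := hac
    have hka : a ≠ K.root := hk.ne
    rw [project_cons_of_ne (π := fun x : K.Pos × (K.tensor K).Pos × (one.tensor K).Pos =>
        (x.1, x.2.1)) (fun e => hka (Prod.mk.inj e).1)] at hu₁
    -- In the external play the copy of `K` on the left makes no move after `k`, so the reply of `d`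
    -- lies in `K ⊗ K`.
    have hfst : project Prod.fst (a, (K.tensor K).root) (project (fun x => (x.1, x.2.1))
        (a, (K.tensor K).root, ((PUnit.unit, K.root) : (one.tensor K).Pos)) v) = [] := by
      have e₁ := project_project (fun x : K.Pos × (K.tensor K).Pos × (one.tensor K).Pos =>
        (x.1, x.2.1)) Prod.fst (a, (K.tensor K).root, (PUnit.unit, K.root)) v
      have e₂ := project_project (fun x : K.Pos × (K.tensor K).Pos × (one.tensor K).Pos =>
        (x.1, x.2.2)) Prod.fst (a, (K.tensor K).root, (PUnit.unit, K.root)) v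
      refine e₁.trans (e₂.symm.trans ?_)
      rw [hu₃]
      exact project_cons_of_eq (by rfl) _
    generalize project (fun x : K.Pos × (K.tensor K).Pos × (one.tensor K).Pos => (x.1, x.2.1))
      (a, (K.tensor K).root, (PUnit.unit, K.root)) v = w at hu₁ hfst
    cases w with
    | nil => exact absurd (d.isStrat.even _ hu₁) (by simp)
    | cons z w =>
      have hz : [(a, (K.tensor K).root), z] ∈ d.set :=
        d.isStrat.prefix_mem [(a, (K.tensor K).root), z] w (by simp) hu₁
      obtain ⟨b, z, z'⟩ := z
      have hm := (d.isStrat.subset hz).2.1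
      obtain rfl : b = a := by
        by_contra hb
        rw [project_cons_of_ne (π := Prod.fst) (by exact hb)] at hfst
        cases hfst
      -- By commutativity the reply with the two factors exchanged is also a reply of `d`, and
      -- determinism makes the two equal. But a single move in `K ⊗ K` from the root cannot reach a
      -- position with equal components.
      have hz' := hs z z' hz
      have e : z = z' := by
        have := (d.isStrat.coh _ hz _ hz').2 rfl
        have := this.1 (by norm_num)
        exact (Prod.mk.inj (Prod.mk.inj this).2).1
      subst e
      rcases hm with hm | ⟨-, hm | hm⟩
      · exact K.no_loop hm.1
      · have e : K.root = z := hm.2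
        exact hm.1.ne e.symm
      · have e : K.root = z := hm.1
        exact hm.2.ne e.symm

/-! ### The first copy and the dereliction -/

variable {A : MBGame.{u}}

open Family

theorem adm_self_of_first {t : List A.Pos} (h : Along A.Edge A.root t)
    (h' : ∀ x t', t = x :: t' → A.Move (-1) A.root x) : (self A).adm t := by
  cases t with
  | nil => trivial
  | cons x t =>
    have hx := h' x t rfl
    refine ⟨⟨⟨_, hx⟩, fun _ => hx⟩, ?_⟩
    clear h'
    obtain ⟨-, h⟩ := h
    have hne := fun e : x = A.root => A.no_return (e ▸ hx)
    clear hx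
    induction t generalizing x with
    | nil => trivial
    | cons y t ih =>
      exact ⟨⟨h.1, fun e => (hne e).elim⟩, ih y h.2 fun e => h.1.elim fun _ h => A.no_return (e ▸ h)⟩

/-- Since Player does not start in `K`, the first move of the play is an Opponent move in `Y`, and
the synchronous relation makes it an Opponent move in `A`. The family `self A` asks for no more. -/
theorem Negative.adm_self (hK : K.Negative) {Y : MBGame.{u}} {P : Set (List (Y.Pos × A.Pos))}
    (hP : IsSync Y A P) {u : List (K.Pos × Y.Pos × A.Pos)}
    (h₁ : project (fun x => (x.1, x.2.1)) (K.root, Y.root, A.root) u ∈ Plays K Y)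
    (h₂ : project (fun x => (x.2.1, x.2.2)) (K.root, Y.root, A.root) u ∈ P) :
    (self A).adm ((project (fun x => (x.2.1, x.2.2)) (K.root, Y.root, A.root) u).map
      Prod.snd) := by
  have hs := hP _ h₂
  have e₁ := project_project (fun x : K.Pos × Y.Pos × A.Pos => (x.1, x.2.1)) Prod.snd
    (K.root, Y.root, A.root) u
  have e₂ := project_project (fun x : K.Pos × Y.Pos × A.Pos => (x.2.1, x.2.2)) Prod.fst
    (K.root, Y.root, A.root) u
  have e := e₂.trans e₁.symm
  generalize project (fun x : K.Pos × Y.Pos × A.Pos => (x.2.1, x.2.2))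
    (K.root, Y.root, A.root) u = t at hs e
  generalize project (fun x : K.Pos × Y.Pos × A.Pos => (x.1, x.2.1))
    (K.root, Y.root, A.root) u = s at h₁ e
  refine adm_self_of_first ((along_map Prod.snd (Y.root, A.root) t).2
    (hs.mono fun p q h => h.imp fun _ h => h.2)) fun x t' ht => ?_
  cases t with
  | nil => cases ht
  | cons q t =>
    obtain ⟨rfl, -⟩ := List.cons.inj ht
    obtain ⟨m, m₁, m₂⟩ := hs.1
    rw [project_cons_of_ne (π := Prod.fst) (by exact m₁.ne)] at e
    cases s with
    | nil => cases e
    | cons p s =>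
      have hp := (hK.first h₁).2
      rw [project_cons_of_ne (π := Prod.snd) (by exact hp.ne)] at e
      have e := (List.cons.inj e).1
      change q.1 = p.2 at e
      rw [← e] at hp
      obtain rfl := Y.pol_unique m₁ hp
      exact m₂

/-- Only admissible paths of `A` occur in plays from `K`, and `Q` lifts them all. As the left
components are functions of the right ones, the lift in `Q` is the given element of `P`. Without the
condition on `K` the two relations could differ on paths that Player opens. -/
theorem Canonical.act_eq_of_determined {Y : Family A} {θ : A.Pos → Y.game.Pos}
    (hK : K.Negative) {P Q : Set (List (Y.game.Pos × A.Pos))} (hP : Canonical Y (self A) P)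
    (hQ : Canonical Y (self A) Q) (dP : Along₂ θ P) (dQ : Along₂ θ Q)
    {S : Set (List (K.Pos × Y.game.Pos))} (hS : S ⊆ Plays K Y.game) :
    act K Y.game A S P ⊆ act K Y.game A S Q := by
  rintro _ ⟨u, h₁, h₂, rfl⟩
  refine ⟨u, h₁, ?_, rfl⟩
  obtain ⟨s, hs, e⟩ := hQ.lift _ (hK.adm_self hP.sync (hS h₁) h₂)
  have key : ∀ {t : List (Y.game.Pos × A.Pos)}, (∀ p ∈ t, p.1 = θ p.2) →
      t = (t.map Prod.snd).map fun x => (θ x, x) := fun {t} ht => by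
    rw [List.map_map]
    conv_lhs => rw [← List.map_id t]
    exact List.map_congr_left fun p hp => Prod.ext (ht p hp) rfl
  rw [key (dP _ h₂), ← e, ← key (dQ _ hs)]
  exact hs

/-- In a play that is matched with `A`, only one copy of `A` is opened. -/
theorem along₂_uncons_coer : Along₂ (fun x : A.Pos => (x, ([] : A.BangPos)))
    (compTr (A.tensor A.bang).root A.bang.root A.root (uncons A).rel (canRel (self A))) := by
  intro s hs p hp
  obtain ⟨u, h₁, h₂, rfl⟩ := (mem_compTr_iff (X := A.bang) (Z := A)
    (uncons A).isTransl_rel.sync (isTransl_canRel (self A)).sync).1 hs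
  obtain ⟨x, hx, rfl⟩ := List.mem_map.1 hp
  have e₁ := (uncons A).along₂ _ h₁ _ (List.mem_map_of_mem hx)
  obtain ⟨b, hb⟩ := h₂.2.1
  have m := hb.matched _ (List.mem_map_of_mem hx)
  obtain ⟨y, w, a⟩ := x
  change y = (A.letter 0 w, w.tail) at e₁
  subst e₁
  obtain ⟨m₁, m₂, m₃⟩ := m
  change ∀ (i : ℕ) (j : Unit), b i j → A.letter i w = a at m₁
  change ∀ i : ℕ, A.letter i w ≠ A.root → ∃ j, b i j at m₂
  change ∀ _ : Unit, a ≠ A.root → ∃ i : ℕ, b i () at m₃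
  refine Prod.ext ?_ ?_
  · change A.letter 0 w = a
    by_cases h : A.letter 0 w = A.root
    · by_contra ha
      obtain ⟨i, hi⟩ := m₃ () fun e => ha (h.trans e.symm)
      have := m₁ i () hi
      rw [letter_zero_eq_root_iff.1 h] at this ha
      exact ha this
    · obtain ⟨j, hj⟩ := m₂ 0 h
      exact m₁ 0 j hj
  · change w.tail = []
    rcases w with _ | ⟨x, _ | ⟨y, w⟩⟩
    · rfl
    · rfl
    · obtain ⟨j, hj⟩ := m₂ 0 (letter_ne_root_iff.2 (by simp))
      obtain ⟨j', hj'⟩ := m₂ 1 (letter_ne_root_iff.2 (by simp))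
      exact absurd (hb.inj hj hj' : (0 : ℕ) = 1) zero_ne_one

/-- The game `1` has no move, so the relation for the counit contains only the empty path and `!A`
is never opened. -/
theorem along₂_counit : Along₂ (fun x : A.Pos => (x, ([] : A.BangPos)))
    (compTr (A.tensor A.bang).root (A.tensor one).root A.root
      (prodRel A A A.bang one (GameIso.refl A).graph (canRel (unit A)))
      (GameIso.unitRight A).graph) := by
  have s₁ : IsSync (A.tensor A.bang) (A.tensor one) (prodRel A A A.bang one
    (GameIso.refl A).graph (canRel (unit A))) := isSync_prodRel
  have a : Along₂ (fun x : A.Pos × one.{u}.Pos => (x.1, ([] : A.BangPos))) (prodRel A A A.bang one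
      (GameIso.refl A).graph (canRel (unit A))) := by
    refine Along₂.prod (Y := A) (X := A) (Y' := A.bang) (X' := one) (θ := fun x : A.Pos => x)
      (θ' := fun _ => ([] : A.BangPos)) rfl rfl (fun s h p hp => ?_) ?_
    · exact (h.2 p hp).symm
    · intro s h p hp
      have := h.1
      cases s with
      | nil => cases hp
      | cons q s => exact this.1.elim fun _ h => h.2.elim
  exact Along₂.comp s₁ (GameIso.unitRight A).isTransl_graph.sync a
    (along₂_graph (GameIso.unitRight A))

theorem canonical_unitRight (X : Family A) :
    Canonical (X.tensor (unit A)) X (GameIso.unitRight X.game).graph := by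
  refine GameIso.canonical (Y := X.tensor (unit A)) (X := X)
    (GameIso.unitRight X.game) (Equiv.sumEmpty _ _) ?_ ?_
  · rintro (i | i) y
    · rfl
    · exact i.elim
  · intro x y
    exact ⟨fun h => Or.inl ⟨h, rfl⟩, fun h => h.elim And.left fun h => h.1.elim⟩

/-- Opening a copy and playing in it is playing in it and in no other copy. -/
theorem Negative.comp_uncons_coer (hK : K.Negative) (X : Hom K (A.tensor A.bang)) :
    gameCat.comp X (gameCat.comp (uncons A).hom (bangCoer A)) =
      gameCat.comp X (gameCat.comp (tensorHom (gameCat.id A) (bangCounit A))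
        (GameIso.unitRight A).hom) := by
  have s₁ : IsSync (A.tensor A.bang) (A.tensor one) (prodRel A A A.bang one
    (GameIso.refl A).graph (canRel (unit A))) := isSync_prodRel
  have s₂ := (GameIso.unitRight A).isTransl_graph.sync
  have s₃ : IsSync A.bang A (canRel (self A)) := (isTransl_canRel (self A)).sync
  have c₁ : Canonical ((self A).tensor (Family.bang A)) (self A) _ :=
    (uncons A).canonical_rel.comp (canonical_canRel (self A))
  have c₂ : Canonical ((self A).tensor (Family.bang A)) (self A) _ :=
    ((canonical_refl (self A)).tensor (canonical_canRel (unit A))).comp (canonical_unitRight (self A))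
  have e₁ : (gameCat.comp (uncons A).hom (bangCoer A)).set = translPlays (A.tensor A.bang) A _ :=
    transl_compPlays_transl (uncons A).isTransl_rel.sync s₃
  have e₂ : (gameCat.comp (tensorHom (gameCat.id A) (bangCounit A))
      (GameIso.unitRight A).hom).set = translPlays (A.tensor A.bang) A (compTr
        (A.tensor A.bang).root (A.tensor one).root A.root
      (prodRel A A A.bang one (GameIso.refl A).graph (canRel (unit A)))
      (GameIso.unitRight A).graph) := by
    refine Eq.trans ?_ (transl_compPlays_transl s₁ s₂)
    refine congrArg (fun S => compPlays (A.tensor A.bang) (A.tensor one) A S _) ?_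
    refine Eq.trans ?_ (tensorPlays_transl (GameIso.refl A).isTransl_graph.sync
      (isTransl_canRel (unit A)).sync)
    exact congrArg (fun S => tensorPlays A A A.bang one S (bangCounit A).set)
      (GameIso.plays_refl (Y := A)).symm
  apply Hom.ext_set
  rw [comp_set, comp_set X, e₁, e₂, compPlays_transl X.isStrat.subset c₁.sync,
    compPlays_transl X.isStrat.subset c₂.sync]
  exact Set.Subset.antisymm
    (Canonical.act_eq_of_determined hK c₁ c₂ along₂_uncons_coer along₂_counit X.isStrat.subset)
    (Canonical.act_eq_of_determined hK c₂ c₁ along₂_counit along₂_uncons_coer X.isStrat.subset)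

end MBGame

/-! ## The morphisms into the exponential -/

namespace MBGame

open ConwayGame Family

variable {K A B X : MBGame.{u}}

/-- In a composite with `d`, `f ⊗ S` and `P`, the final position of the play in `S` is determined
by the final position of the composite. -/
theorem mem_act_comp_tensor {D : Set (List (K.Pos × K.Pos × K.Pos))}
    {F : Set (List (K.Pos × A.Pos))} {S S' : Set (List (K.Pos × B.Pos))}
    {P : Set (List ((A.Pos × B.Pos) × X.Pos))} {θ : X.Pos → A.Pos × B.Pos}
    (hr : (A.root, B.root) = θ X.root) (hP : Along₂ θ P) {s : List (K.Pos × X.Pos)}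
    (hs : s ∈ act K (A.tensor B) X
      (compPlays K (K.tensor K) (A.tensor B) D (tensorPlays K A K B F S)) P)
    (h : ∀ t ∈ S, (t.getLastD (K.root, B.root)).2 = (θ (s.getLastD (K.root, X.root)).2).2 →
      t ∈ S') :
    s ∈ act K (A.tensor B) X
      (compPlays K (K.tensor K) (A.tensor B) D (tensorPlays K A K B F S')) P := by
  obtain ⟨u, ⟨v, h₁, ⟨k₁, k₂, k₃⟩, h₃, h₄⟩, h₂, rfl⟩ := hs
  refine ⟨u, ⟨v, h₁, ⟨k₁, k₂, h _ k₃ ?_⟩, h₃, h₄⟩, h₂, rfl⟩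
  have e₁ := getLastD_project (fun x : (K.Pos × K.Pos) × (A.Pos × B.Pos) => (x.1.2, x.2.2))
    ((K.root, K.root), (A.root, B.root)) (project (fun x : K.Pos × (K.Pos × K.Pos) ×
      (A.Pos × B.Pos) => (x.2.1, x.2.2)) (K.root, (K.root, K.root), (A.root, B.root)) v)
  have e₂ := getLastD_project (fun x : K.Pos × (K.Pos × K.Pos) × (A.Pos × B.Pos) =>
    (x.2.1, x.2.2)) (K.root, (K.root, K.root), (A.root, B.root)) v
  have e₃ := getLastD_project (fun x : K.Pos × (K.Pos × K.Pos) × (A.Pos × B.Pos) =>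
    (x.1, x.2.2)) (K.root, (K.root, K.root), (A.root, B.root)) v
  have e₄ := getLastD_project (fun x : K.Pos × (A.Pos × B.Pos) × X.Pos => (x.1, x.2.1))
    (K.root, (A.root, B.root), X.root) u
  have e₅ := getLastD_project (fun x : K.Pos × (A.Pos × B.Pos) × X.Pos => (x.1, x.2.2))
    (K.root, (A.root, B.root), X.root) u
  have e₆ : (u.getLastD (K.root, (A.root, B.root), X.root)).2.1 =
      θ (u.getLastD (K.root, (A.root, B.root), X.root)).2.2 := by
    rcases getLastD_mem_or (K.root, (A.root, B.root), X.root) u with e | e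
    · rw [e]
      exact hr
    · exact forall_of_project (π := fun x : K.Pos × (A.Pos × B.Pos) × X.Pos => (x.2.1, x.2.2))
        (R := fun p => p.1 = θ p.2) (x := (K.root, (A.root, B.root), X.root)) hr (hP _ h₂) _ e
  have f₁ : _ = (v.getLastD (K.root, (K.root, K.root), (A.root, B.root))).2.2.2 :=
    (congrArg Prod.snd e₁).trans (congrArg (fun p => p.2.2) e₂)
  have f₂ : (v.getLastD (K.root, (K.root, K.root), (A.root, B.root))).2.2 =
      (u.getLastD (K.root, (A.root, B.root), X.root)).2.1 :=
    (congrArg Prod.snd e₃).symm.trans ((congrArg (fun l : List (K.Pos × A.Pos × B.Pos) =>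
      (l.getLastD (K.root, (A.root, B.root))).2) h₃).trans (congrArg Prod.snd e₄))
  exact f₁.trans ((congrArg Prod.snd f₂).trans ((congrArg Prod.snd e₆).trans
    (congrArg (fun p => (θ p.2).2) e₅.symm)))

/-- The composite with the comultiplication `d`, the tensor product with `F` and a relation. -/
abbrev unfold (d : Hom K (K.tensor K)) (f : Hom K A) (S : Set (List (K.Pos × B.Pos)))
    (P : Set (List ((A.Pos × B.Pos) × X.Pos))) : Set (List (K.Pos × X.Pos)) :=
  act K (A.tensor B) X (compPlays K (K.tensor K) (A.tensor B) d.set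
    (tensorPlays K A K B f.set S)) P

theorem unfold_mono {d : Hom K (K.tensor K)} {f : Hom K A} {S S' : Set (List (K.Pos × B.Pos))}
    {P : Set (List ((A.Pos × B.Pos) × X.Pos))} (h : S ⊆ S') : unfold d f S P ⊆ unfold d f S' P := by
  rintro s ⟨u, ⟨v, h₁, ⟨k₁, k₂, k₃⟩, h₃, h₄⟩, h₂, rfl⟩
  exact ⟨u, ⟨v, h₁, ⟨k₁, k₂, h k₃⟩, h₃, h₄⟩, h₂, rfl⟩

theorem comp_comp_tensor_set (d : Hom K (K.tensor K)) (f : Hom K A) (g : Hom K B)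
    {P : Set (List ((A.Pos × B.Pos) × X.Pos))} {r : Hom (A.tensor B) X}
    (hr : r.set = translPlays (A.tensor B) X P) (hP : IsSync (A.tensor B) X P) :
    (gameCat.comp d (gameCat.comp (tensorHom f g) r)).set = unfold d f g.set P := by
  rw [← gameCat.assoc, comp_set, hr]
  exact compPlays_transl (gameCat.comp d (tensorHom f g)).isStrat.subset hP

/-! ### Existence -/

/-- Finite approximations of the morphism `g` such that `g = d ≫ (f ⊗ g) ≫ r`. -/
def approx (d : Hom K (K.tensor K)) (f : Hom K A) : ℕ → Set (List (K.Pos × A.bang.Pos))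
  | 0 => {[]}
  | n + 1 => unfold d f (approx d f n) (uncons A).rel

theorem isStrat_nil (K X : MBGame.{u}) : IsStrat K X {[]} where
  isPlay := by rintro _ rfl; trivial
  even := by rintro _ rfl; simp
  nil := rfl
  prefix_mem s t _ h := (List.append_eq_nil_iff.1 h).1
  coh := by rintro _ rfl t ht; simp
  bracket s t h hf := by
    obtain ⟨rfl, rfl⟩ := List.append_eq_nil_iff.1 h
    exact (not_fresh_nil hf).elim

theorem isStrat_approx (d : Hom K (K.tensor K)) (f : Hom K A) (n : ℕ) :
    IsStrat K A.bang (approx d f n) := by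
  induction n with
  | zero => exact isStrat_nil K A.bang
  | succ n ih => exact (d.isStrat.comp (f.isStrat.tensor ih)).act (uncons A).isTransl_rel

theorem approx_mono (d : Hom K (K.tensor K)) (f : Hom K A) : Monotone (approx d f) := by
  refine monotone_nat_of_le_succ fun n => ?_
  induction n with
  | zero =>
    rintro _ rfl
    exact (isStrat_approx d f 1).nil
  | succ n ih => exact unfold_mono ih

theorem isStrat_iUnion {S : ℕ → Set (List (K.Pos × X.Pos))} (hS : ∀ n, IsStrat K X (S n))
    (hm : Monotone S) : IsStrat K X (⋃ n, S n) where
  isPlay s h := by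
    obtain ⟨n, h⟩ := Set.mem_iUnion.1 h
    exact (hS n).isPlay s h
  even s h := by
    obtain ⟨n, h⟩ := Set.mem_iUnion.1 h
    exact (hS n).even s h
  nil := Set.mem_iUnion.2 ⟨0, (hS 0).nil⟩
  prefix_mem s t hs h := by
    obtain ⟨n, h⟩ := Set.mem_iUnion.1 h
    exact Set.mem_iUnion.2 ⟨n, (hS n).prefix_mem s t hs h⟩
  coh s h t h' := by
    obtain ⟨n, h⟩ := Set.mem_iUnion.1 h
    obtain ⟨m, h'⟩ := Set.mem_iUnion.1 h'
    exact (hS (max n m)).coh s (hm (le_max_left n m) h) t (hm (le_max_right n m) h')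
  bracket s t h := by
    obtain ⟨n, h⟩ := Set.mem_iUnion.1 h
    exact (hS n).bracket s t h

/-- The morphism `g` such that `g = d ≫ (f ⊗ g) ≫ r`. -/
def lift (d : Hom K (K.tensor K)) (f : Hom K A) : Hom K A.bang :=
  (isStrat_iUnion (isStrat_approx d f) (approx_mono d f)).hom

/-- Unfolding is continuous: a play of the composite uses one play of the recursive argument, which
already belongs to some finite approximation. -/
theorem lift_eq (d : Hom K (K.tensor K)) (f : Hom K A) :
    lift d f = gameCat.comp d (gameCat.comp (tensorHom f (lift d f)) (uncons A).hom) := by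
  apply Hom.ext_set
  refine Eq.trans ?_ (comp_comp_tensor_set d f (lift d f) rfl (uncons A).isTransl_rel.sync).symm
  apply Set.Subset.antisymm
  · intro s h
    obtain ⟨n, h⟩ := Set.mem_iUnion.1 h
    exact unfold_mono (Set.subset_iUnion (approx d f) n) (approx_mono d f (Nat.le_succ n) h)
  · rintro s ⟨u, ⟨v, h₁, ⟨k₁, k₂, k₃⟩, h₃, h₄⟩, h₂, rfl⟩
    obtain ⟨n, k₃⟩ := Set.mem_iUnion.1 k₃
    exact Set.mem_iUnion.2 ⟨n + 1, u, ⟨v, h₁, ⟨k₁, k₂, k₃⟩, h₃, h₄⟩, h₂, rfl⟩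

/-! ### Uniqueness -/

/-- Induction on the length of the final word in `!A`. The inner play of an unfolding ends at the
tail of that word, so it belongs to both solutions by induction; a play that ends at the empty word
is empty because Player does not start in `K`. -/
theorem Negative.subset_of_unfold (hK : K.Negative) (d : Hom K (K.tensor K)) (f : Hom K A)
    {g g' : Hom K A.bang} (h : g.set = unfold d f g.set (uncons A).rel)
    (h' : g'.set = unfold d f g'.set (uncons A).rel) : g.set ⊆ g'.set := by
  have key : ∀ n, ∀ s ∈ g.set, (s.getLastD (K.root, A.bang.root)).2.length = n → s ∈ g'.set := by
    intro n
    induction n with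
    | zero =>
      intro s hs hn
      rw [hK.eq_nil (g.isStrat.subset hs) (List.length_eq_zero_iff.1 hn)]
      exact g'.isStrat.nil
    | succ n ih =>
      intro s hs hn
      rw [h] at hs
      rw [h']
      refine mem_act_comp_tensor (B := A.bang) (X := A.bang) (θ := (uncons A).θ) rfl
        (uncons A).along₂ hs fun t ht e => ih t ht ?_
      rw [e]
      change (List.tail _).length = n
      rw [List.length_tail, hn]
      rfl
  exact fun s hs => key _ s hs rfl

theorem Negative.unfold_ext (hK : K.Negative) (d : Hom K (K.tensor K)) (f : Hom K A)
    {g g' : Hom K A.bang}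
    (h : g = gameCat.comp d (gameCat.comp (tensorHom f g) (uncons A).hom))
    (h' : g' = gameCat.comp d (gameCat.comp (tensorHom f g') (uncons A).hom)) : g = g' := by
  have e := fun g => comp_comp_tensor_set d f g (r := (uncons A).hom) rfl
    (uncons A).isTransl_rel.sync
  have h := (congrArg Hom.set h).trans (e g)
  have h' := (congrArg Hom.set h').trans (e g')
  exact Hom.ext_set (Set.Subset.antisymm (hK.subset_of_unfold d f h h')
    (hK.subset_of_unfold d f h' h))

/-- The relation is an identity with a guard, so its action merely selects plays. -/
theorem mem_act_restrictLeft {S : Set (List (K.Pos × A.BangPos × A.BangPos))}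
    (hS : S ⊆ Plays K (A.bang.tensor A.bang)) {s : List (K.Pos × A.BangPos × A.BangPos)} :
    s ∈ act K (A.bang.tensor A.bang) (A.bang.tensor A.bang) S (restrictLeft A).rel ↔
      s ∈ S ∧ ∀ p ∈ s, p.2.1 = [] → p.2.2 = [] := by
  constructor
  · rintro ⟨u, h₁, h₂, rfl⟩
    have hu := forall_of_project (R := fun p : (A.BangPos × A.BangPos) × (A.BangPos × A.BangPos) =>
      p.1 = p.2 ∧ (p.2.1 = [] → p.2.2 = [])) (π := fun x : K.Pos × (A.BangPos × A.BangPos) ×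
      (A.BangPos × A.BangPos) => (x.2.1, x.2.2)) (x := (K.root, ([], []), ([], [])))
      ⟨rfl, fun _ => rfl⟩ h₂.2
    refine ⟨?_, fun p hp => ?_⟩
    · rwa [project_congr (π := fun x => (x.1, x.2.2)) (π' := fun x => (x.1, x.2.1)) rfl
        fun x hx => Prod.ext rfl (hu x hx).1.symm]
    · obtain ⟨x, hx, rfl⟩ := mem_of_mem_project hp
      exact (hu x hx).2
  · rintro ⟨hs, h⟩
    have e : project (fun p : K.Pos × A.BangPos × A.BangPos => (p.1, p.2)) (K.root, [], []) s = s :=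
      project_id_of_noStutter (IsPlay.noStutter (hS hs))
    have := mem_compTr_of_list (a := K.root) (b := (A.bang.tensor A.bang).root)
      (c := (A.bang.tensor A.bang).root) (S := S) (T := (restrictLeft A).rel)
      (x := (K.root, [], [])) (w := s) (f := fun p => p.1) (g := fun p => p.2) (h := fun p => p.2)
      rfl rfl rfl (by rwa [e]) ⟨?_, fun p hp => ?_⟩
    · rwa [e] at this
    · refine (along_project (R := SyncStep (A.bang.tensor A.bang) (A.bang.tensor A.bang))
        (fun p : K.Pos × A.BangPos × A.BangPos => (p.2, p.2)) (K.root, [], []) s).2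
        ((along_of_mem_plays (hS hs)).mono fun p q h => ?_)
      rcases edge_snd h with e | ⟨m, h⟩
      · exact Or.inl (Prod.ext e e)
      · exact Or.inr ⟨m, h, h⟩
    · obtain ⟨x, hx, rfl⟩ := mem_of_mem_project hp
      exact ⟨rfl, h x hx⟩

/-- Induction on the total length of the two final words. The unfolding equations speak only of
plays that open the left exponential first; symmetry of the two morphisms gives the other plays. -/
theorem Negative.subset_of_openLeft (hK : K.Negative) (d : Hom K (K.tensor K)) (f : Hom K A)
    {g g' : Hom K (A.bang.tensor A.bang)}
    (s₁ : gameCat.comp g (GameIso.swap A.bang A.bang).hom = g)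
    (s₂ : gameCat.comp g' (GameIso.swap A.bang A.bang).hom = g')
    (h : act K (A.bang.tensor A.bang) (A.bang.tensor A.bang) g.set (restrictLeft A).rel =
      unfold d f g.set (openLeftRel A))
    (h' : act K (A.bang.tensor A.bang) (A.bang.tensor A.bang) g'.set (restrictLeft A).rel =
      unfold d f g'.set (openLeftRel A)) : g.set ⊆ g'.set := by
  have sw : ∀ {g : Hom K (A.bang.tensor A.bang)},
      gameCat.comp g (GameIso.swap A.bang A.bang).hom = g → ∀ s : List (K.Pos × A.BangPos ×
      A.BangPos), s ∈ g.set ↔ s.map (fun p => (p.1, (p.2.2, p.2.1))) ∈ g.set := by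
    intro g hg s
    conv_lhs => rw [← hg]
    exact Set.ext_iff.1 ((GameIso.swap A.bang A.bang).compPlays_plays g.isStrat.subset) s
  have key : ∀ n, ∀ s ∈ g.set, (s.getLastD (K.root, [], [])).2.1.length +
      (s.getLastD (K.root, [], [])).2.2.length = n → s ∈ g'.set := by
    intro n
    induction n with
    | zero =>
      intro s hs hn
      have e : s = [] := hK.eq_nil (g.isStrat.subset hs) (Prod.ext
        (List.length_eq_zero_iff.1 (Nat.eq_zero_of_add_eq_zero_right hn))
        (List.length_eq_zero_iff.1 (Nat.eq_zero_of_add_eq_zero_left hn)))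
      rw [e]
      exact g'.isStrat.nil
    | succ n ih =>
      -- After a first move that opens the left exponential the left word stays nonempty, so the
      -- play passes the restriction. Unfolding then removes one letter of the left word, and the
      -- induction hypothesis applies to the inner play.
      have left : ∀ (p : K.Pos × A.BangPos × A.BangPos) (s : List (K.Pos × A.BangPos × A.BangPos)),
          p :: s ∈ g.set → p.2.1 ≠ [] →
          ((p :: s).getLastD (K.root, [], [])).2.1.length +
            ((p :: s).getLastD (K.root, [], [])).2.2.length = n + 1 → p :: s ∈ g'.set := by
        intro p s hs hp hn
        have hne : ∀ q ∈ s, q.2.1 ≠ [] := by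
          refine (along_of_mem_plays (g.isStrat.subset hs)).2.forall (fun p q h hp => ?_) hp
          rcases edge_snd h with e | e
          · rwa [e]
          · rcases edge_tensor.1 e with ⟨⟨m, e⟩, -⟩ | ⟨e, -⟩
            · exact fun e' => A.bang.no_return (e' ▸ e)
            · rwa [← e]
        have hne' : ∀ q ∈ p :: s, q.2.1 ≠ [] := by
          rintro q (_ | ⟨_, hq⟩)
          exacts [hp, hne q hq]
        have hs' := (mem_act_restrictLeft g.isStrat.subset).2
          ⟨hs, fun q hq e => (hne' q hq e).elim⟩
        rw [h] at hs'
        refine ((mem_act_restrictLeft g'.isStrat.subset).1 ?_).1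
        rw [h']
        refine mem_act_comp_tensor (B := A.bang.tensor A.bang) (X := A.bang.tensor A.bang)
          (θ := fun v : A.BangPos × A.BangPos => (A.letter 0 v.1, (v.1.tail, v.2))) rfl
          (fun s hs p hp => (mem_openLeftRel hs hp).1) hs' fun t ht e => ih t ht ?_
        have hl : ((p :: s).getLastD (K.root, ([] : A.BangPos), ([] : A.BangPos))).2.1 ≠ [] := by
          refine hne' _ ?_
          rw [List.getLastD_cons]
          rcases getLastD_mem_or p s with e | e
          · rw [e]
            exact List.mem_cons_self ..
          · exact List.mem_cons_of_mem _ e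
        have hl := List.length_pos_iff.2 hl
        have e₁ := congrArg (fun v : A.BangPos × A.BangPos => v.1.length) e
        have e₂ := congrArg (fun v : A.BangPos × A.BangPos => v.2.length) e
        dsimp only at e₁ e₂
        rw [List.length_tail] at e₁
        change ((t.getLastD (K.root, [], [])).2.1 : A.BangPos).length = ((p :: s).getLastD
          (K.root, ([] : A.BangPos), ([] : A.BangPos))).2.1.length - 1 at e₁
        change ((t.getLastD (K.root, [], [])).2.2 : A.BangPos).length = ((p :: s).getLastD
          (K.root, ([] : A.BangPos), ([] : A.BangPos))).2.2.length at e₂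
        omega
      intro s hs hn
      cases s with
      | nil => exact g'.isStrat.nil
      | cons p s =>
        -- If the left word is empty after the first move, that move has opened the right
        -- exponential, and the exchanged play opens the left one.
        by_cases hp : p.2.1 = []
        · rw [sw s₂]
          refine left _ _ ((sw s₁ _).1 hs) (fun e => ?_) ?_
          · have hm := (hK.first (g.isStrat.subset hs)).2
            have e' : p.2 = (A.bang.tensor A.bang).root := Prod.ext hp e
            exact (A.bang.tensor A.bang).no_return (e' ▸ hm)
          · have el : ((p :: s).map fun p => (p.1, (p.2.2, p.2.1))).getLastD
                (K.root, ([] : A.BangPos), ([] : A.BangPos)) = (fun p => (p.1, (p.2.2, p.2.1)))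
                ((p :: s).getLastD (K.root, ([] : A.BangPos), ([] : A.BangPos))) := by
              rcases List.eq_nil_or_concat (p :: s) with e | ⟨t, z, e⟩
              · cases e
              · rw [e, List.concat_eq_append, List.map_append, getLastD_append, getLastD_append]
                rfl
            rw [List.map_cons] at el
            rw [el, add_comm]
            exact hn
        · exact left p s hs hp hn
  exact fun s hs => key _ s hs rfl

theorem Negative.openLeft_ext (hK : K.Negative) (d : Hom K (K.tensor K)) (f : Hom K A)
    {g g' : Hom K (A.bang.tensor A.bang)}
    (s₁ : gameCat.comp g (GameIso.swap A.bang A.bang).hom = g)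
    (s₂ : gameCat.comp g' (GameIso.swap A.bang A.bang).hom = g')
    (h : gameCat.comp g (restrictLeft A).hom =
      gameCat.comp d (gameCat.comp (tensorHom f g) (openLeft A)))
    (h' : gameCat.comp g' (restrictLeft A).hom =
      gameCat.comp d (gameCat.comp (tensorHom f g') (openLeft A))) : g = g' := by
  have e := fun g => comp_comp_tensor_set d f g (openLeft_set A) (isSync_openLeftRel A)
  have e' := fun g : Hom K (A.bang.tensor A.bang) =>
    compPlays_transl g.isStrat.subset (isSync_restrictLeft A)
  have h := (e' g).symm.trans ((congrArg Hom.set h).trans (e g))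
  have h' := (e' g').symm.trans ((congrArg Hom.set h').trans (e g'))
  exact Hom.ext_set (Set.Subset.antisymm (hK.subset_of_openLeft d f s₁ s₂ h h')
    (hK.subset_of_openLeft d f s₂ s₁ h' h))

end MBGame

/-! ### A criterion for a commutative comonoid to be free -/

section FreeComonoid

universe v₁ u₁

variable {C : Type u₁} [Category.{v₁} C] [MonoidalCategory C] [SymmetricCategory C]

namespace CategoryTheory

open ComonObj

variable {K W A : C} [ComonObj K] [ComonObj W] (r : A ⊗ W ⟶ W)

theorem comul_braiding_tensor [IsCommComonObj K] (g : K ⟶ W) :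
    (Δ[K] ≫ (g ⊗ₘ g)) ≫ (β_ W W).hom = Δ[K] ≫ (g ⊗ₘ g) := by
  rw [Category.assoc, BraidedCategory.braiding_naturality, ← Category.assoc,
    IsCommComonObj.comul_comm]

/-- After one unfolding of `g`, the hypothesis `h` moves the comultiplication past `r`, up to `L`,
so that `g ≫ Δ` satisfies an unfolding equation of its own. -/
theorem unfold_comul {f : K ⟶ A} {g : K ⟶ W} {L : W ⊗ W ⟶ W ⊗ W}
    (h : r ≫ Δ[W] ≫ L = A ◁ Δ[W] ≫ (α_ A W W).inv ≫ r ▷ W ≫ L)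
    (hg : g = Δ[K] ≫ (f ⊗ₘ g) ≫ r) :
    (g ≫ Δ[W]) ≫ L = Δ[K] ≫ (f ⊗ₘ (g ≫ Δ[W])) ≫ (α_ A W W).inv ≫ r ▷ W ≫ L := by
  conv_lhs => rw [hg]
  have e : (f ⊗ₘ (g ≫ Δ[W])) = (f ⊗ₘ g) ≫ A ◁ Δ[W] := by
    rw [← MonoidalCategory.id_tensorHom, tensorHom_comp_tensorHom, Category.comp_id]
  simp only [Category.assoc, h, e]

/-- Only the left factor `g` is unfolded. Coassociativity regroups the resulting three copies of `K`
so that the last two carry `Δ ≫ (g ⊗ g)` again. -/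
theorem unfold_tensor {f : K ⟶ A} {g : K ⟶ W} {L : W ⊗ W ⟶ W ⊗ W}
    (hg : g = Δ[K] ≫ (f ⊗ₘ g) ≫ r) :
    (Δ[K] ≫ (g ⊗ₘ g)) ≫ L =
      Δ[K] ≫ (f ⊗ₘ (Δ[K] ≫ (g ⊗ₘ g))) ≫ (α_ A W W).inv ≫ r ▷ W ≫ L := by
  have e₁ : (f ⊗ₘ (Δ[K] ≫ (g ⊗ₘ g))) = K ◁ Δ[K] ≫ (f ⊗ₘ (g ⊗ₘ g)) := by
    rw [← MonoidalCategory.id_tensorHom, tensorHom_comp_tensorHom, Category.id_comp]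
  have e₂ : (g ⊗ₘ g) = Δ[K] ▷ K ≫ ((f ⊗ₘ g) ⊗ₘ g) ≫ r ▷ W := by
    rw [← MonoidalCategory.tensorHom_id, ← MonoidalCategory.tensorHom_id, tensorHom_comp_tensorHom, tensorHom_comp_tensorHom,
      Category.id_comp, Category.comp_id, ← hg]
  rw [e₁, Category.assoc, Category.assoc, associator_inv_naturality_assoc, ComonObj.comul_assoc_assoc,
    Iso.hom_inv_id_assoc]
  conv_lhs => rw [e₂]
  simp only [Category.assoc]

/-- Splitting off one copy of `A` and putting it back does nothing on `W`; for a map that preserves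
the comultiplications the splitting can be done in `K` instead. This is the uniqueness half of the
universal property. -/
theorem unfold_of_comul {ε' : W ⟶ A} (h : Δ[W] ≫ ε' ▷ W ≫ r = 𝟙 W) {f : K ⟶ A} {g : K ⟶ W}
    (hg : g ≫ Δ[W] = Δ[K] ≫ (g ⊗ₘ g)) (hf : g ≫ ε' = f) : g = Δ[K] ≫ (f ⊗ₘ g) ≫ r := by
  have e : (f ⊗ₘ g) = (g ⊗ₘ g) ≫ ε' ▷ W := by
    rw [← MonoidalCategory.tensorHom_id, tensorHom_comp_tensorHom, Category.comp_id, hf]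
  rw [e, Category.assoc, ← reassoc_of% hg, h, Category.comp_id]

/-- By `h`, the part of `X` that lies in `W` is discarded by `r ≫ ε'`; what remains of the unfolding
is `f`, since `g` preserves the counits. -/
theorem unfold_comp {ε' : W ⟶ A} {f : K ⟶ A} {g : K ⟶ W}
    (h : ∀ X : K ⟶ A ⊗ W, X ≫ r ≫ ε' = X ≫ A ◁ ε[W] ≫ (ρ_ A).hom) (he : g ≫ ε[W] = ε[K])
    (hg : g = Δ[K] ≫ (f ⊗ₘ g) ≫ r) : g ≫ ε' = f := by
  rw [hg, Category.assoc, Category.assoc, ← Category.assoc, h, comul_fst f g he]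

/-- Both `g ≫ Δ` and `Δ ≫ (g ⊗ g)` are symmetric solutions of the same unfolding equation under `L`,
and `ext` leaves room for one only. Symmetry enters `ext` because `L`, in the intended case, forgets
the plays that begin on the right. -/
theorem isComonHom_of_unfold [IsCommComonObj K] [IsCommComonObj W] {f : K ⟶ A} {g : K ⟶ W}
    {L : W ⊗ W ⟶ W ⊗ W}
    (h : r ≫ Δ[W] ≫ L = A ◁ Δ[W] ≫ (α_ A W W).inv ≫ r ▷ W ≫ L)
    (he : g ≫ ε[W] = ε[K]) (hg : g = Δ[K] ≫ (f ⊗ₘ g) ≫ r)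
    (ext : ∀ k k' : K ⟶ W ⊗ W, k ≫ (β_ W W).hom = k → k' ≫ (β_ W W).hom = k' →
      k ≫ L = Δ[K] ≫ (f ⊗ₘ k) ≫ (α_ A W W).inv ≫ r ▷ W ≫ L →
      k' ≫ L = Δ[K] ≫ (f ⊗ₘ k') ≫ (α_ A W W).inv ≫ r ▷ W ≫ L → k = k') : IsComonHom g where
  hom_counit := he
  hom_comul := ext _ _ (by rw [Category.assoc, IsCommComonObj.comul_comm])
    (comul_braiding_tensor g) (unfold_comul r h hg) (unfold_tensor r hg)

/-- A commutative comonoid `W` is free on `A` when it is unfolded by a morphism `r : A ⊗ W ⟶ W`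
that has, for each commutative comonoid `K`, the properties below. -/
theorem isFreeCommComonoid_of_unfold (W : CommComon C) {A : C} (e : W.X ⟶ A) (r : A ⊗ W.X ⟶ W.X)
    (L : W.X ⊗ W.X ⟶ W.X ⊗ W.X) (h₁ : Δ[W.X] ≫ e ▷ W.X ≫ r = 𝟙 W.X)
    (h₂ : r ≫ Δ[W.X] ≫ L = A ◁ Δ[W.X] ≫ (α_ A W.X W.X).inv ≫ r ▷ W.X ≫ L)
    (unit : ∀ (K : CommComon C) (f g : K.X ⟶ 𝟙_ C), f = g)
    (comp : ∀ (K : CommComon C) (X : K.X ⟶ A ⊗ W.X),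
      X ≫ r ≫ e = X ≫ A ◁ ε[W.X] ≫ (ρ_ A).hom)
    (lift : ∀ (K : CommComon C) (f : K.X ⟶ A), ∃! g : K.X ⟶ W.X, g = Δ[K.X] ≫ (f ⊗ₘ g) ≫ r)
    (ext : ∀ (K : CommComon C) (f : K.X ⟶ A) (k k' : K.X ⟶ W.X ⊗ W.X),
      k ≫ (β_ W.X W.X).hom = k → k' ≫ (β_ W.X W.X).hom = k' →
      k ≫ L = Δ[K.X] ≫ (f ⊗ₘ k) ≫ (α_ A W.X W.X).inv ≫ r ▷ W.X ≫ L →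
      k' ≫ L = Δ[K.X] ≫ (f ⊗ₘ k') ≫ (α_ A W.X W.X).inv ≫ r ▷ W.X ≫ L → k = k') :
    IsFreeCommComonoid W e := by
  intro K f
  obtain ⟨g, hg, u⟩ := lift K f
  have he : g ≫ ε[W.X] = ε[K.X] := unit K _ _
  refine ⟨CommComon.homMk g (isComonHom_of_unfold r h₂ he hg (ext K f)),
    unfold_comp r (comp K) he hg, fun k hk => ?_⟩
  exact CommComon.hom_ext _ _ (u k.hom.hom
    (unfold_of_comul r h₁ (IsComonHom.hom_comul (f := k.hom.hom)) hk))

end CategoryTheory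

end FreeComonoid

/-! ### The exponential game is the free commutative comonoid, and the model of linear logic -/

open MBGame

theorem negative_of_commComon (K : CommComon gameTensor.{u}.Obj) :
    Negative (GameCat.game (S := gameCat.{u}) K.X) :=
  negative_of_comul (ComonObj.comul (X := K.X)) (ComonObj.counit (X := K.X))
    (ComonObj.counit_comul K.X) (IsCommComonObj.comul_comm K.X)

theorem isFreeCommComonoid_bang (A : gameTensor.{u}.Obj) :
    IsFreeCommComonoid (gameTensor.bangComonoid A (bangComonObj A) (isCommComonObj_bang A))
      (bangCoer A : gameTensor.bang A ⟶ A) := by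
  let W := gameTensor.bangComonoid A (bangComonObj A) (isCommComonObj_bang A)
  let e : W.X ⟶ A := bangCoer A
  let r : A ⊗ W.X ⟶ W.X := (Family.uncons A).hom
  let L : W.X ⊗ W.X ⟶ W.X ⊗ W.X := (Family.restrictLeft A).hom
  refine isFreeCommComonoid_of_unfold W e r L (comul_coer_uncons A)
    (uncons_comul_restrictLeft A) ?_ ?_ ?_ ?_
  · exact fun K f g => (negative_of_commComon K).hom_one_ext f g
  · exact fun K X => (negative_of_commComon K).comp_uncons_coer X
  · intro K f
    exact ⟨lift (ComonObj.comul (X := K.X)) f, lift_eq (ComonObj.comul (X := K.X)) f, fun g h =>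
      (negative_of_commComon K).unfold_ext (ComonObj.comul (X := K.X)) f h
        (lift_eq (ComonObj.comul (X := K.X)) f)⟩
  · intro K f k k' s₁ s₂ h h'
    exact (negative_of_commComon K).openLeft_ext (ComonObj.comul (X := K.X)) f s₁ s₂ h h'

theorem mainTheorem4 :
    -- The category of multi-bracketed games, with its symmetric monoidal structure.
    ∃ (S : GameCat.{u}) (T : GameTensor S)
      -- Commutative comonoid structures on the games `!A`, and morphisms `!A ⟶ A`.
      (c : ∀ A : T.Obj, ComonObj (T.bang A)) (hc : ∀ A : T.Obj, IsCommComonObj (T.bang A))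
      (ε : ∀ A : T.Obj, T.bang A ⟶ A),
      -- `!A` is the free commutative comonoid on `A`.
      (∀ A : T.Obj, IsFreeCommComonoid (T.bangComonoid A (c A) (hc A)) (ε A)) ∧
      -- A model of multiplicative exponential linear logic, whose negation is the dual of games
      -- and whose exponential modality is `!`.
      (∃ L : MELLModel (forgetCommComon T.Obj),
        (∀ A : T.Obj, L.star.obj (.op A) = T.dual A) ∧
        ∀ A : T.Obj, ∃ i : L.F.obj A ≅ T.bangComonoid A (c A) (hc A),
          (forgetCommComon T.Obj).map i.hom ≫ ε A = L.adj.counit.app A) ∧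
      -- The model is degenerate: the category is compact closed, and the tensor product is equal
      -- to its dual.
      (∀ A : T.Obj, Nonempty (ExactPairing A (T.dual A))) ∧
      (∀ A : T.Obj, T.dual (T.dual A) = A) ∧
      ∀ A B : T.Obj, T.dual (A ⊗ B) = T.dual A ⊗ T.dual B := by
  exact ⟨gameCat, gameTensor, bangComonObj, isCommComonObj_bang,
    fun A => (bangCoer A : gameTensor.bang A ⟶ A), isFreeCommComonoid_bang,
    exists_mellModel gameTensor.dual gamePairing gameTensor_dual_dual
      (fun A => gameTensor.bangComonoid A (bangComonObj A) (isCommComonObj_bang A))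
      (fun A => (bangCoer A : gameTensor.bang A ⟶ A)) isFreeCommComonoid_bang,
    fun A => ⟨gamePairing A⟩, gameTensor_dual_dual, gameTensor_dual_tensor⟩
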